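/- **Setting.** Let $G_{\mathbb C}\subset \mathrm{GL}(m,\mathbb C)$ be a connected reductive linear algebraic group defined over $\mathbb R$, and let $\rho:G_{\mathbb C}\to \mathrm{GL}(n,\mathbb C)$, $n\ge 1$, be an $\mathbb R$-rational representation with a Zariski-dense orbit in $V_{\mathbb C}=\mathbb C^n$. Let $S_{\mathbb C}$ be the complement of the dense orbit, $V_{\mathbb R}=\mathbb R^n$, $S_{\mathbb R}=S_{\mathbb C}\cap V_{\mathbb R}$, and let $S_{\mathbb R}^{\rm sing}$ be the set of non-regular points of $S_{\mathbb R}$. Assume that $S_{\mathbb C}$ is an irreducible hypersurface, and let $p$ be a polynomial with real coefficients, irreducible over $\mathbb C$, with $S_{\mathbb C}=\{p=0\}$. Let $G_{\mathbb R}$ be the group of real points of $G_{\mathbb C}$, $G$ its identity component, $d_G$ a left Haar measure on $G$, and $\mathfrak g$ its Lie algebra; write $gv=\rho(g)v$, and $\tilde X(v)=\frac{d}{dh}\rho(e^{hX})v|_{h=0}$ for $X\in\mathfrak g$. Then $p(gv)=\chi(g)p(v)$ for $g\in G_{\mathbb R}$, $v\in V_{\mathbb R}$, with a character $\chi$; put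 $\mathfrak g(p)=\{X\in\mathfrak g: d\chi(X)=0\}$. Let $|g|$ be the distance of $g\in G$ to the identity for a left invariant Riemannian metric, and let $\mathcal S(G)$ be the space of all $f\in C^\infty(G)$ such that, for every $\kappa\ge 0$ and every $X$ in the universal enveloping algebra of $\mathfrak g_{\mathbb C}$, $e^{\kappa|g|}dL(X)f$ is bounded and integrable, $L$ being the left regular representation. Put $(\pi(f)\varphi)(v)=\int_G f(g)\varphi(g^{-1}v)\,d_G(g)$. **Assumptions.** 1. $S_{\mathbb R}$ is an irreducible hypersurface (its vanishing ideal in $\mathbb R[v_1,\dots,v_n]$ is generated by an irreducible polynomial). 2. Every point of $V_{\mathbb R}-S_{\mathbb R}^{\rm sing}$ has an open neighbourhood $Z\subset V_{\mathbb R}-S_{\mathbb R}^{\rm sing}$ for which there are $X_1,\dots,X_{n-1}\in\mathfrak g(p)$ such that $\tilde X_1(v),\dots,\tilde X_{n-1}(v)$ form a basis of $\ker dp(v)$, the tangent space of the level set of $p$ through $v$, for all $v\in Z$ (local transitivity of $G_{\mathbb R}(p)=\{\chi=1\}$ on the level sets of $p$ in $V_{\mathbb R}-S_{\mathbb R}^{\rm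 sing}$). **Charts.** An adapted chart $\gamma$ consists of open sets $U\subset U_1\subset V_{\mathbb R}-S_{\mathbb R}^{\rm sing}$, of indices $j,l_1,\dots,l_{n-1}$ with $\{j,l_1,\dots,l_{n-1}\}=\{1,\dots,n\}$ such that $\kappa(v)=(p(v),v_{l_1},\dots,v_{l_{n-1}})$ is injective on $U_1$ and $\partial p/\partial v_j\ne 0$ on $U_1$, of elements of $\mathfrak g(p)$ as in Assumption 2 with $Z=U_1$, and of a function $c\in C_c^\infty(U_1)$ with $c=1$ on $U$. Put $\tilde U=\kappa(U)$, $\tilde U_\pm=\{x\in\tilde U:\pm x_1\ge 0\}$, and for a function $u$ on $\tilde U$ let $A_f u=[\pi(f)(u\circ\kappa)]\circ\kappa^{-1}$, where $u\circ\kappa$ is extended by zero outside $U$. For $x\in\tilde U$, $\xi=(\xi_1,\xi')\in\mathbb R^n$ and $v=\kappa^{-1}(x)$ define $$a_f(x,\xi)=e^{-ix\cdot\xi}\int_G f(g)\,e^{i\kappa(g^{-1}v)\cdot\xi}\,c(g^{-1}v)\,d_G(g),$$ $$\tilde a_f(x,\xi)=e^{-i(1,x_2,\dots,x_n)\cdot\xi}\int_G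 f(g)\,e^{i(\chi(g^{-1}),(g^{-1}v)_{l_1},\dots,(g^{-1}v)_{l_{n-1}})\cdot\xi}\,c(g^{-1}v)\,d_G(g).$$ **Symbols and operators.** Let $W$ be open in $\mathbb R^n$, or relatively open in a closed half space $\{\pm x_1\ge 0\}$ (functions are then smooth up to the boundary). $S^{-\infty}_{la}(W\times\mathbb R^n)$ consists of the smooth $a$ on $W\times\mathbb R^n$ such that $|\partial_\xi^\alpha\partial_x^\beta a(x,\xi)|\le C_{\alpha,\beta,K,r}(1+|\xi|^2)^{(r-|\alpha|)/2}$ for all $\alpha,\beta$, all $r\in\mathbb R$, all compact $K\subset W$ and all $x\in K$, and which are lacunary: $\int e^{i(1-t)\xi_1}a(x,\xi_1,\xi')\,d\xi_1=0$ for all $t<0$. For $W$ relatively open in $Z_\pm=\{\pm x_1\ge 0\}$, $L_b^{-\infty}(W)$ is the class of continuous linear operators $A:C_c^\infty(W)\to C^\infty(W)$ such that for all $v,w\in C_c^\infty(W)$ the operator $vAw$ is of the form $$u\mapsto (2\pi)^{-n}\int\!\!\int e^{i(x-y)\cdot\xi}\,a(x,x_1\xi_1,\xi')\,u(y)\,dy\,d\xi,\qquad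 u\in C_c^\infty(Z_\pm),$$ with some $a\in S^{-\infty}_{la}(Z_\pm\times\mathbb R^n)$. Here the integral is understood as the adjoint, for the $L^2$ pairing on $Z_\pm$, of $$A^*\varphi(y)=(2\pi)^{-n}\int\!\!\int e^{i(1/s-1,\,y'-x')\cdot(\lambda,\xi')}\,\overline{a(y_1s,x',\lambda,\xi')}\,\varphi(y_1s,x')\,d\lambda\,d\xi'\,\frac{ds}{s}\,dx'\qquad (s>0).$$ **Theorem.** The adapted chart domains $U$ cover $V_{\mathbb R}-S_{\mathbb R}^{\rm sing}$. For every $f\in\mathcal S(G)$ and every adapted chart: * $a_f(x,\xi)=\tilde a_f(x,x_1\xi_1,\xi')$ on $\tilde U\times\mathbb R^n$, and $\tilde a_f\in S^{-\infty}_{la}(\tilde U\times\mathbb R^n)$. * $\pi(f)$ is given in the chart by the amplitude $a_f$: for all $u\in C_c^\infty(\tilde U)$ and $x\in\tilde U$, $$A_fu(x)=(2\pi)^{-n}\int\!\!\int e^{i(x-y)\cdot\xi}\,a_f(x,\xi)\,u(y)\,dy\,d\xi ,$$ where the integral over $\xi$ converges absolutely after the integration over $y$. * On each of $\tilde U_\pm$,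 $A_fu$ depends only on the restriction of $u$ to $\tilde U_\pm$, and the resulting operator is a totally characteristic pseudodifferential operator of class $L_b^{-\infty}(\tilde U_\pm)$. Thus $\pi(f)$ is totally characteristic of order $-\infty$ on $\overline V_i-S_{\mathbb R}^{\rm sing}$ for each connected component $V_i$ of $V_{\mathbb R}-S_{\mathbb R}$. -/

import Mathlib

open MeasureTheory Set
open scoped ContDiff Matrix

noncomputable section

namespace PHV

/-! ### Algebraic groups, prehomogeneous vector spaces, hypersurfaces -/

/-- `H ⊆ GL(m, ℂ)` is an algebraic subgroup defined over `k ⊆ ℂ`: it is cut out in `GL(m, ℂ)` by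
polynomials in the matrix entries with coefficients in `k`. -/
def IsAlgebraicSubgroup (k : Type) [Field k] [Algebra k ℂ] {m : ℕ}
    (H : Subgroup (GL (Fin m) ℂ)) : Prop :=
  ∃ P : Set (MvPolynomial (Fin m × Fin m) k), ∀ g : GL (Fin m) ℂ,
    g ∈ H ↔ ∀ q ∈ P, MvPolynomial.aeval (fun ij : Fin m × Fin m => g.1 ij.1 ij.2) q = 0

/-- The closed subset of `GL(m, ℂ)` given by a set of polynomials in the matrix entries. -/
def zeroSetGL {m : ℕ} (P : Set (MvPolynomial (Fin m × Fin m) ℂ)) : Set (GL (Fin m) ℂ) :=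
  {g | ∀ q ∈ P, MvPolynomial.eval (fun ij : Fin m × Fin m => g.1 ij.1 ij.2) q = 0}

/-- Connectedness in the Zariski topology. -/
def IsZariskiConnected {m : ℕ} (H : Subgroup (GL (Fin m) ℂ)) : Prop :=
  ∀ P Q : Set (MvPolynomial (Fin m × Fin m) ℂ),
    (H : Set (GL (Fin m) ℂ)) ⊆ zeroSetGL P ∪ zeroSetGL Q →
    (H : Set (GL (Fin m) ℂ)) ∩ (zeroSetGL P ∩ zeroSetGL Q) = ∅ →
    (H : Set (GL (Fin m) ℂ)) ⊆ zeroSetGL P ∨ (H : Set (GL (Fin m) ℂ)) ⊆ zeroSetGL Q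

/-- A linear algebraic group is reductive if its unipotent radical is trivial, i.e. if it has no
nontrivial connected normal unipotent algebraic subgroup. -/
def IsReductive {m : ℕ} (H : Subgroup (GL (Fin m) ℂ)) : Prop :=
  ∀ N : Subgroup (GL (Fin m) ℂ), N ≤ H → IsAlgebraicSubgroup ℂ N → IsZariskiConnected N →
    (∀ g ∈ H, ∀ u ∈ N, g * u * g⁻¹ ∈ N) →
    (∀ u ∈ N, IsNilpotent ((u : Matrix (Fin m) (Fin m) ℂ) - 1)) → N = ⊥

variable {m n d : ℕ}

/-- A representation is `ℝ`-rational if its matrix coefficients are polynomials with real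
coefficients in the entries of `g` and in `1 / det g`. -/
def IsRealRational {GC : Subgroup (GL (Fin m) ℂ)} (ρ : GC →* GL (Fin n) ℂ) : Prop :=
  ∃ R : Fin n → Fin n → MvPolynomial (Option (Fin m × Fin m)) ℝ, ∀ (g : GC) (i j : Fin n),
    (ρ g).1 i j = MvPolynomial.aeval (fun o : Option (Fin m × Fin m) =>
      o.elim (g.1.1.det)⁻¹ (fun ij => g.1.1 ij.1 ij.2)) (R i j)

/-- The `G_ℂ`-orbit of a vector. -/
def orbit {GC : Subgroup (GL (Fin m) ℂ)} (ρ : GC →* GL (Fin n) ℂ) (v : Fin n → ℂ) :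
    Set (Fin n → ℂ) :=
  Set.range fun g : GC => (ρ g).1 *ᵥ v

/-- A subset of `ℂⁿ` is Zariski dense if only the zero polynomial vanishes on it. -/
def IsZariskiDense (A : Set (Fin n → ℂ)) : Prop := MvPolynomial.vanishingIdeal ℂ A = ⊥

/-- The singular set `S_ℂ`: the complement of the (unique) dense orbit. -/
def singularSet {GC : Subgroup (GL (Fin m) ℂ)} (ρ : GC →* GL (Fin n) ℂ) : Set (Fin n → ℂ) :=
  {v | ¬ IsZariskiDense (orbit ρ v)}

/-- `(G_ℂ, ρ, ℂⁿ)` is a reductive prehomogeneous vector space over `ℝ`. -/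
structure IsReductivePHV (GC : Subgroup (GL (Fin m) ℂ)) (ρ : GC →* GL (Fin n) ℂ) : Prop where
  algebraic : IsAlgebraicSubgroup ℝ GC
  connected : IsZariskiConnected GC
  reductive : IsReductive GC
  rational : IsRealRational ρ
  prehomogeneous : ∃ v, IsZariskiDense (orbit ρ v)

/-- `A ⊆ Kⁿ` is an irreducible hypersurface: an irreducible algebraic subset of codimension one.
As polynomial rings are factorial, this says that its vanishing ideal (prime of height one) is
generated by an irreducible polynomial. -/
def IsIrreducibleHypersurface (K : Type) [Field K] (A : Set (Fin n → K)) : Prop :=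
  ∃ q : MvPolynomial (Fin n) K, Irreducible q ∧ A = {v | MvPolynomial.eval v q = 0} ∧
    MvPolynomial.vanishingIdeal K A = Ideal.span {q}

/-- The set of real points `S_ℝ = S_ℂ ∩ ℝⁿ`. -/
def realSingularSet {GC : Subgroup (GL (Fin m) ℂ)} (ρ : GC →* GL (Fin n) ℂ) : Set (Fin n → ℝ) :=
  {v | (fun i => (v i : ℂ)) ∈ singularSet ρ}

/-- The non-regular points of a real hypersurface: the points where the differentials of all
polynomials vanishing on it are zero (the Jacobian rank is less than the codimension one). -/
def nonRegularPoints (A : Set (Fin n → ℝ)) : Set (Fin n → ℝ) :=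
  {v ∈ A | ∀ q ∈ MvPolynomial.vanishingIdeal ℝ A, ∀ i : Fin n,
    MvPolynomial.eval v (MvPolynomial.pderiv i q) = 0}

/-- `V_ℝ = ℝⁿ` with its Euclidean structure. -/
abbrev VR (n : ℕ) : Type := EuclideanSpace ℝ (Fin n)

/-- The open set `V_ℝ - S_ℝ^sing`. -/
def regularDomain {GC : Subgroup (GL (Fin m) ℂ)} (ρ : GC →* GL (Fin n) ℂ) : Set (VR n) :=
  {v | v.ofLp ∉ nonRegularPoints (realSingularSet ρ)}

/-! ### Real points, identity component, Lie algebra, real action -/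

/-- The group `G_ℝ` of real points. -/
def realPoints (GC : Subgroup (GL (Fin m) ℂ)) : Subgroup (GL (Fin m) ℝ) :=
  GC.comap (Matrix.GeneralLinearGroup.map (algebraMap ℝ ℂ))

/-- The connected component `G` of the identity of `G_ℝ`. -/
abbrev G0 (GC : Subgroup (GL (Fin m) ℂ)) : Type :=
  ↥(Subgroup.connectedComponentOfOne ↥(realPoints GC))

/-- The inclusion `G_ℝ → G_ℂ`. -/
def toComplex {GC : Subgroup (GL (Fin m) ℂ)} (g : realPoints GC) : GC :=
  ⟨Matrix.GeneralLinearGroup.map (algebraMap ℝ ℂ) g.1, g.2⟩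

/-- The action of `G_ℝ` on `V_ℝ`, through the (real) matrix `ρ(g)`. -/
def act {GC : Subgroup (GL (Fin m) ℂ)} (ρ : GC →* GL (Fin n) ℂ) (g : realPoints GC)
    (v : VR n) : VR n :=
  WithLp.toLp 2 (((ρ (toComplex g)).1.map Complex.re) *ᵥ v.ofLp)

/-- The matrix exponential with values in `GL(m, ℝ)`. -/
def expGL (X : Matrix (Fin m) (Fin m) ℝ) : GL (Fin m) ℝ where
  val := NormedSpace.exp X
  inv := NormedSpace.exp (-X)
  val_inv := by
    rw [← Matrix.exp_add_of_commute _ _ (Commute.neg_right (Commute.refl X)), add_neg_cancel,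
      NormedSpace.exp_zero]
  inv_val := by
    rw [← Matrix.exp_add_of_commute _ _ (Commute.neg_left (Commute.refl X)), neg_add_cancel,
      NormedSpace.exp_zero]

/-- The Lie algebra `𝔤` of `G_ℝ`, as a set of matrices. -/
def lieAlg (GC : Subgroup (GL (Fin m) ℂ)) : Set (Matrix (Fin m) (Fin m) ℝ) :=
  {X | ∀ t : ℝ, expGL (t • X) ∈ realPoints GC}

/-- The one-parameter subgroup `t ↦ exp (tX)` in `G_ℝ`. -/
def expR {GC : Subgroup (GL (Fin m) ℂ)} (X : lieAlg GC) (t : ℝ) : realPoints GC :=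
  ⟨expGL (t • X.1), X.2 t⟩

theorem continuous_expGL (X : Matrix (Fin m) (Fin m) ℝ) :
    Continuous fun t : ℝ => expGL (t • X) := by
  have hexp : Continuous (NormedSpace.exp : Matrix (Fin m) (Fin m) ℝ → _) := by
    open scoped Matrix.Norms.Operator in exact NormedSpace.exp_continuous
  rw [Units.continuous_iff]
  exact ⟨hexp.comp (continuous_id.smul continuous_const),
    hexp.comp (continuous_id.smul continuous_const).neg⟩

theorem expR_mem {GC : Subgroup (GL (Fin m) ℂ)} (X : lieAlg GC) (t : ℝ) :
    expR X t ∈ Subgroup.connectedComponentOfOne ↥(realPoints GC) := by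
  have hc : Continuous (expR X) := (continuous_expGL X.1).subtype_mk _
  have h0 : expR X 0 = 1 := by
    apply Subtype.ext
    apply Units.ext
    simp [expR, expGL]
  have hpre : IsPreconnected (Set.range (expR X)) := isPreconnected_range hc
  exact hpre.subset_connectedComponent ⟨0, h0⟩ ⟨t, rfl⟩

/-- The one-parameter subgroup `t ↦ exp (tX)`, which lies in the identity component `G`. -/
def expG {GC : Subgroup (GL (Fin m) ℂ)} (X : lieAlg GC) (t : ℝ) : G0 GC :=
  ⟨expR X t, expR_mem X t⟩

/-- The matrix of an element of `G`. -/
def mat {GC : Subgroup (GL (Fin m) ℂ)} (g : G0 GC) : Matrix (Fin m) (Fin m) ℝ := g.1.1.1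

/-- The fundamental vector field `X̃(v) = d/dh ρ(exp (hX)) v` at `h = 0`. -/
def fundField {GC : Subgroup (GL (Fin m) ℂ)} (ρ : GC →* GL (Fin n) ℂ) (X : lieAlg GC)
    (v : VR n) : VR n :=
  deriv (fun h : ℝ => act ρ (expR X h) v) 0

/-! ### The space of rapidly decreasing functions on `G` -/

/-- The length of the curve `c : [0, 1] → G` for the left invariant Riemannian metric that is
given on the Lie algebra by the inner product `tr (X Yᵀ)`. -/
def curveLength (c : ℝ → Matrix (Fin m) (Fin m) ℝ) : ℝ :=
  ∫ t in (0 : ℝ)..1, Real.sqrt (∑ i, ∑ j,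
    (((c t)⁻¹ * Matrix.of fun k l => deriv (fun s => c s k l) t) i j) ^ 2)

/-- `|g| = d(g, e)`, the Riemannian distance of `g` to the identity. -/
def gnorm {GC : Subgroup (GL (Fin m) ℂ)} (g : G0 GC) : ℝ :=
  sInf {L : ℝ | ∃ c : ℝ → Matrix (Fin m) (Fin m) ℝ, (∀ i j, ContDiff ℝ 1 fun t => c t i j) ∧
    (∀ t ∈ Icc (0 : ℝ) 1, ∃ h : G0 GC, mat h = c t) ∧ c 0 = 1 ∧ c 1 = mat g ∧ L = curveLength c}

/-- Smooth functions on the closed submanifold `G` of `GL(m, ℝ)`: the restrictions to `G` of smooth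
functions on the open set of invertible matrices. -/
def IsSmoothOnGroup {GC : Subgroup (GL (Fin m) ℂ)} (f : G0 GC → ℂ) : Prop :=
  ∃ F : (Fin m → Fin m → ℝ) → ℂ,
    ContDiffOn ℝ ∞ F {A | (Matrix.of A).det ≠ 0} ∧ ∀ g : G0 GC, f g = F (fun i j => mat g i j)

/-- `dL(X) f (g) = d/dh f (exp (-hX) g)` at `h = 0`. -/
def dL {GC : Subgroup (GL (Fin m) ℂ)} (X : lieAlg GC) (f : G0 GC → ℂ) (g : G0 GC) : ℂ :=
  deriv (fun h : ℝ => f (expG X (-h) * g)) 0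

/-- `dL(X₁ ⋯ X_k) f` for a monomial in the enveloping algebra. -/
def dLWord {GC : Subgroup (GL (Fin m) ℂ)} (w : List (lieAlg GC)) (f : G0 GC → ℂ) : G0 GC → ℂ :=
  w.foldr dL f

/-- The space `𝒮(G)` of rapidly decreasing functions. As the monomials in elements of `𝔤` span the
universal enveloping algebra of its complexification, it suffices to demand the conditions for
them. -/
structure IsRapidlyDecreasing {GC : Subgroup (GL (Fin m) ℂ)} [MeasurableSpace (G0 GC)]
    (μ : Measure (G0 GC)) (f : G0 GC → ℂ) : Prop where
  smooth : IsSmoothOnGroup f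
  decay : ∀ κ : ℝ, 0 ≤ κ → ∀ w : List (lieAlg GC), ∃ C : ℝ, ∀ g : G0 GC,
    ‖dLWord w f g‖ ≤ C * Real.exp (-κ * gnorm g)
  integrable : ∀ κ : ℝ, 0 ≤ κ → ∀ w : List (lieAlg GC),
    Integrable (fun g : G0 GC => (Real.exp (κ * gnorm g) : ℂ) * dLWord w f g) μ

/-- The operator `π(f) = ∫ f(g) π(g) dg`, where `(π(g) φ)(v) = φ(ρ(g)⁻¹ v)`. -/
def piOp {GC : Subgroup (GL (Fin m) ℂ)} [MeasurableSpace (G0 GC)] (μ : Measure (G0 GC))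
    (ρ : GC →* GL (Fin n) ℂ) (f : G0 GC → ℂ) (φ : VR n → ℂ) (v : VR n) : ℂ :=
  ∫ g : G0 GC, f g * φ (act ρ g.1⁻¹ v) ∂μ

/-! ### The relative invariant and its character -/

/-- The real polynomial function `p : V_ℝ → ℝ`. -/
def pfun (p : MvPolynomial (Fin n) ℝ) (v : VR n) : ℝ := MvPolynomial.eval v.ofLp p

open Classical in
/-- The character `χ` of the relative invariant `p`: the number `χ(g)` with
`p(ρ(g) v) = χ(g) p(v)` for all `v`. -/
def character {GC : Subgroup (GL (Fin m) ℂ)} (ρ : GC →* GL (Fin n) ℂ)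
    (p : MvPolynomial (Fin n) ℝ) (g : realPoints GC) : ℝ :=
  if h : ∃ c : ℝ, ∀ v : VR n, pfun p (act ρ g v) = c * pfun p v then h.choose else 0

/-- `X ∈ 𝔤(p)`, i.e. `dχ(X) = 0`. -/
def InLieAlgP {GC : Subgroup (GL (Fin m) ℂ)} (ρ : GC →* GL (Fin n) ℂ)
    (p : MvPolynomial (Fin n) ℝ) (X : lieAlg GC) : Prop :=
  deriv (fun h : ℝ => character ρ p (expR X h)) 0 = 0

/-- On `U` the fundamental vector fields of `X₁, …, X_{n-1}` form a frame of the tangent bundles of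
the level sets of `p`; the tangent space of the level set through `v` is the kernel of `dp(v)`. -/
def IsFrameOn {GC : Subgroup (GL (Fin m) ℂ)} (ρ : GC →* GL (Fin (d + 1)) ℂ)
    (p : MvPolynomial (Fin (d + 1)) ℝ) (X : Fin d → lieAlg GC) (U : Set (VR (d + 1))) : Prop :=
  ∀ v ∈ U, Submodule.span ℝ (Set.range fun i => fundField ρ (X i) v) =
    LinearMap.ker (fderiv ℝ (pfun p) v : VR (d + 1) →ₗ[ℝ] ℝ)

/-- Local transitivity of `G_ℝ(p)` along the level sets of `p` in `V_ℝ - S_ℝ^sing`. -/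
def HasLocalFrames {GC : Subgroup (GL (Fin m) ℂ)} (ρ : GC →* GL (Fin (d + 1)) ℂ)
    (p : MvPolynomial (Fin (d + 1)) ℝ) : Prop :=
  ∀ v ∈ regularDomain ρ, ∃ Z : Set (VR (d + 1)), IsOpen Z ∧ v ∈ Z ∧ Z ⊆ regularDomain ρ ∧
    ∃ X : Fin d → lieAlg GC, (∀ i, InLieAlgP ρ p (X i)) ∧ IsFrameOn ρ p X Z

/-! ### Charts -/

/-- The vector `(t, x₂, …, x_n)`. -/
def setFirst (t : ℝ) (x : VR (d + 1)) : VR (d + 1) :=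
  WithLp.toLp 2 (Fin.cons t fun i : Fin d => x i.succ)

/-- The map `v ↦ (p(v), v_{l₁}, …, v_{l_{n-1}})`. -/
def kappa (p : MvPolynomial (Fin (d + 1)) ℝ) (l : Fin d → Fin (d + 1)) (v : VR (d + 1)) :
    VR (d + 1) :=
  WithLp.toLp 2 (Fin.cons (pfun p v) fun i : Fin d => v (l i))

/-- A chart `(κ, U)` of `V_ℝ - S_ℝ^sing` of the form `κ(v) = (p(v), v_{l₁}, …, v_{l_{n-1}})`,
where `{l₁, …, l_{n-1}, j} = {1, …, n}`, together with a larger chart domain `U₁` on which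
`∂p/∂v_j ≠ 0` and the level sets of `p` are framed by elements of `𝔤(p)`, and a cutoff function
`c ∈ C_c^∞(U₁)` which is equal to `1` on `U`. -/
structure AdaptedChart {GC : Subgroup (GL (Fin m) ℂ)} (ρ : GC →* GL (Fin (d + 1)) ℂ)
    (p : MvPolynomial (Fin (d + 1)) ℝ) where
  j : Fin (d + 1)
  l : Fin d → Fin (d + 1)
  l_injective : Function.Injective l
  l_ne : ∀ i, l i ≠ j
  U : Set (VR (d + 1))
  U₁ : Set (VR (d + 1))
  isOpen_U : IsOpen U
  isOpen_U₁ : IsOpen U₁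
  subset : U ⊆ U₁
  U₁_subset : U₁ ⊆ regularDomain ρ
  injOn : InjOn (kappa p l) U₁
  pderiv_ne : ∀ v ∈ U₁, MvPolynomial.eval v.ofLp (MvPolynomial.pderiv j p) ≠ 0
  X : Fin d → lieAlg GC
  X_mem : ∀ i, InLieAlgP ρ p (X i)
  frame : IsFrameOn ρ p X U₁
  c : VR (d + 1) → ℝ
  c_smooth : ContDiff ℝ ∞ c
  c_compact : HasCompactSupport c
  c_support : tsupport c ⊆ U₁
  c_one : ∀ v ∈ U, c v = 1

namespace AdaptedChart

variable {GC : Subgroup (GL (Fin m) ℂ)} {ρ : GC →* GL (Fin (d + 1)) ℂ}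
  {p : MvPolynomial (Fin (d + 1)) ℝ}

/-- The chart domain `Ũ = κ(U)` in `ℝⁿ`. -/
def tildeU (γ : AdaptedChart ρ p) : Set (VR (d + 1)) := kappa p γ.l '' γ.U

/-- `Ũ_ε = {x ∈ Ũ : ε x₁ ≥ 0}`, for `ε = 1` or `ε = -1`. -/
def tildeUSide (γ : AdaptedChart ρ p) (ε : ℝ) : Set (VR (d + 1)) := {x ∈ γ.tildeU | 0 ≤ ε * x 0}

/-- The inverse `κ⁻¹ : Ũ → U` of the chart. -/
def kinv (γ : AdaptedChart ρ p) : VR (d + 1) → VR (d + 1) := Function.invFunOn (kappa p γ.l) γ.U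

/-- The pull-back `u ∘ κ`, a function on `U` extended by zero. -/
def pullback (γ : AdaptedChart ρ p) (u : VR (d + 1) → ℂ) : VR (d + 1) → ℂ :=
  γ.U.indicator (u ∘ kappa p γ.l)

variable [MeasurableSpace (G0 GC)]

/-- The local operator `A_f u = [π(f)|_U (u ∘ κ)] ∘ κ⁻¹`. -/
def localOp (γ : AdaptedChart ρ p) (μ : Measure (G0 GC)) (f : G0 GC → ℂ)
    (u : VR (d + 1) → ℂ) (x : VR (d + 1)) : ℂ :=
  piOp μ ρ f (γ.pullback u) (γ.kinv x)

/-- The amplitude `a_f(x, ξ) = e^{-i x·ξ} ∫ f(g) e^{i κ(g⁻¹ v)·ξ} c(g⁻¹ v) dg`, with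
`v = κ⁻¹(x)`. -/
def amplitude (γ : AdaptedChart ρ p) (μ : Measure (G0 GC)) (f : G0 GC → ℂ)
    (x ξ : VR (d + 1)) : ℂ :=
  Complex.exp (-Complex.I * (inner ℝ x ξ : ℝ)) *
    ∫ g : G0 GC, f g *
      Complex.exp (Complex.I * (inner ℝ (kappa p γ.l (act ρ g.1⁻¹ (γ.kinv x))) ξ : ℝ)) *
      (γ.c (act ρ g.1⁻¹ (γ.kinv x)) : ℂ) ∂μ

/-- The symbol `ã_f(x, ξ) =
e^{-i (1, x₂, …, x_n)·ξ} ∫ f(g) e^{i (χ(g⁻¹), (g⁻¹ v)_{l₁}, …, (g⁻¹ v)_{l_{n-1}})·ξ} c(g⁻¹ v) dg`,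
with `v = κ⁻¹(x)`. -/
def symbol (γ : AdaptedChart ρ p) (μ : Measure (G0 GC)) (f : G0 GC → ℂ)
    (x ξ : VR (d + 1)) : ℂ :=
  Complex.exp (-Complex.I * (inner ℝ (setFirst 1 x) ξ : ℝ)) *
    ∫ g : G0 GC, f g *
      Complex.exp (Complex.I * (inner ℝ (setFirst (character ρ p g.1⁻¹)
        (kappa p γ.l (act ρ g.1⁻¹ (γ.kinv x)))) ξ : ℝ)) *
      (γ.c (act ρ g.1⁻¹ (γ.kinv x)) : ℂ) ∂μ

end AdaptedChart

/-! ### Symbols and totally characteristic operators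

Below, `W` is an open subset of `ℝⁿ` or a relatively open subset of a closed half space; in the
second case, smoothness on `W` is smoothness up to the boundary. -/

/-- The symbol class `S^r(W × ℝⁿ)`. -/
def IsSymbol (r : ℝ) (W : Set (VR n)) (a : VR n → VR n → ℂ) : Prop :=
  ContDiffOn ℝ ∞ (fun z : VR n × VR n => a z.1 z.2) (W ×ˢ univ) ∧
  ∀ (k j : ℕ) (K : Set (VR n)), K ⊆ W → IsCompact K → ∃ C : ℝ, ∀ x ∈ K, ∀ ξ : VR n,
    ‖iteratedFDeriv ℝ k (fun η => iteratedFDerivWithin ℝ j (fun y => a y η) W x) ξ‖ ≤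
      C * (1 + ‖ξ‖ ^ 2) ^ ((r - k) / 2)

/-- The lacunary condition: `∫ e^{i (1 - t) ξ₁} a(x, ξ₁, ξ') dξ₁ = 0` for `t < 0`. -/
def IsLacunary (W : Set (VR (d + 1))) (a : VR (d + 1) → VR (d + 1) → ℂ) : Prop :=
  ∀ x ∈ W, ∀ ξ : VR (d + 1), ∀ t : ℝ, t < 0 →
    ∫ s : ℝ, Complex.exp (Complex.I * (((1 - t) * s : ℝ) : ℂ)) * a x (setFirst s ξ) = 0

/-- The class `S^{-∞}_la(W × ℝⁿ)` of lacunary symbols of order `-∞`. -/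
def IsLacunarySmoothingSymbol (W : Set (VR (d + 1))) (a : VR (d + 1) → VR (d + 1) → ℂ) : Prop :=
  (∀ r : ℝ, IsSymbol r W a) ∧ IsLacunary W a

/-- The space `C_c^∞(W)`; its elements are extended by zero to `ℝⁿ`. -/
def IsTestFunction (W : Set (VR n)) (u : VR n → ℂ) : Prop :=
  ContDiffOn ℝ ∞ u W ∧ ∃ K : Set (VR n), IsCompact K ∧ K ⊆ W ∧ ∀ x ∉ K, u x = 0

/-- The half space `{x : ε x₁ ≥ 0}`; for `ε = 1` this is `Z = [0, ∞) × ℝ^{n-1}`, and for `ε = -1`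
it is the image of `Z` under the reflection `x₁ ↦ -x₁`. -/
def halfSpace (ε : ℝ) : Set (VR (d + 1)) := {x | 0 ≤ ε * x 0}

/-- The formal adjoint of the operator with amplitude `a(x, x₁ξ₁, ξ')`, written in the variables
`λ = x₁ ξ₁`, `s = x₁ / y₁`:
`A^* φ(y) = (2π)^{-n} ∫∫ e^{i (1/s - 1, y' - x')·(λ, ξ')} \bar a(y₁ s, x', λ, ξ') φ(y₁ s, x')
dλ dξ' (ds / s) dx'`.
Here `z = (s, x')` and `ζ = (λ, ξ')`. The formula is invariant under `x₁ ↦ -x₁`. -/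
def bAdjoint (a : VR (d + 1) → VR (d + 1) → ℂ) (φ : VR (d + 1) → ℂ) (y : VR (d + 1)) : ℂ :=
  (((2 * Real.pi) ^ (d + 1))⁻¹ : ℝ) *
    ∫ z in {z : VR (d + 1) | 0 < z 0},
      (∫ ζ : VR (d + 1), Complex.exp (Complex.I *
          (inner ℝ (setFirst ((z 0)⁻¹ - 1) (y - z)) ζ : ℝ)) *
        (starRingEnd ℂ) (a (setFirst (y 0 * z 0) z) ζ)) *
      φ (setFirst (y 0 * z 0) z) * (((z 0)⁻¹ : ℝ) : ℂ)

/-- `B` is the operator `∫∫ e^{i (x - y)·ξ} a(x, x₁ξ₁, ξ') u(y) dy dξ / (2π)^n` on the half space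
with lacunary `a`: by definition, the adjoint of `bAdjoint a`. -/
def IsBOperator (ε : ℝ) (a : VR (d + 1) → VR (d + 1) → ℂ)
    (B : (VR (d + 1) → ℂ) → VR (d + 1) → ℂ) : Prop :=
  ∀ u φ : VR (d + 1) → ℂ, IsTestFunction (halfSpace ε) u → IsTestFunction (halfSpace ε) φ →
    ∫ x in halfSpace ε, B u x * (starRingEnd ℂ) (φ x) =
      ∫ y in halfSpace ε, u y * (starRingEnd ℂ) (bAdjoint a φ y)

/-- `A : C_c^∞(W) → C^∞(W)` is linear and continuous. -/
structure IsContinuousOperator (W : Set (VR n)) (A : (VR n → ℂ) → VR n → ℂ) : Prop where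
  map_add : ∀ u v, IsTestFunction W u → IsTestFunction W v → ∀ x ∈ W,
    A (fun y => u y + v y) x = A u x + A v x
  map_smul : ∀ (z : ℂ) (u), IsTestFunction W u → ∀ x ∈ W, A (fun y => z * u y) x = z * A u x
  smooth : ∀ u, IsTestFunction W u → ContDiffOn ℝ ∞ (A u) W
  continuous : ∀ K L : Set (VR n), IsCompact K → K ⊆ W → IsCompact L → L ⊆ W → ∀ N : ℕ,
    ∃ (N' : ℕ) (C : ℝ), ∀ u, IsTestFunction W u → (∀ x ∉ K, u x = 0) → ∀ b : ℝ, 0 ≤ b →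
      (∀ k ≤ N', ∀ x ∈ K, ‖iteratedFDerivWithin ℝ k u W x‖ ≤ b) →
      ∀ k ≤ N, ∀ x ∈ L, ‖iteratedFDerivWithin ℝ k (A u) W x‖ ≤ C * b

/-- The class `L_b^{-∞}(W)` of totally characteristic pseudodifferential operators of order `-∞`
on a relatively open subset `W` of the half space `{ε x₁ ≥ 0}`: the continuous linear operators `A`
such that, for all `v, w ∈ C_c^∞(W)`, the operator `v A w` is of the form `IsBOperator` for a
lacunary symbol of order `-∞`. -/
def IsTotallyCharacteristicSmoothing (ε : ℝ) (W : Set (VR (d + 1)))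
    (A : (VR (d + 1) → ℂ) → VR (d + 1) → ℂ) : Prop :=
  IsContinuousOperator W A ∧
  ∀ v w : VR (d + 1) → ℂ, IsTestFunction W v → IsTestFunction W w →
    ∃ a : VR (d + 1) → VR (d + 1) → ℂ, IsLacunarySmoothingSymbol (halfSpace ε) a ∧
      IsBOperator ε a fun u x => v x * A (fun y => w y * u y) x

end PHV

end

/-!
In the chart `κ`, the operator `π(f)` is an integral over the group of the translations
`u ↦ u(κ(g⁻¹v))`, and the group acts on the first coordinate `x₁ = p(v)` by the positive character
`χ`. Fourier inversion writes it as a pseudodifferential operator whose amplitude is the oscillatory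
integral `∫ f(g) c(g⁻¹v) e^{iΘ·ζ} dg` with phase `Θ(x, g) = (χ(g⁻¹) - 1, (g⁻¹v)_l - x')`, at
`ζ = (x₁ξ₁, ξ')`. The point is that `g ↦ Θ(x, g)` is a submersion over the chart domain, also at
points of the hypersurface `p = 0`; integration by parts along the group then gives arbitrary decay
in `ζ`.

*The group.* By the Nullstellensatz an irreducible equation of the singular set is a relative
invariant (`pfun_act`). A linear algebraic group is a closed group of matrices, so near the identity
it consists of exponentials (`IsClosedUnitGroup.eventually_exists_exp`). Hence its elements are joined
to the identity by smooth curves, and a Gronwall argument bounds the entries of `g` and `g⁻¹`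
exponentially in `|g|` (`exists_abs_mat_le`): the functions `f` that decrease faster than any
exponential stay integrable after multiplication by polynomial functions on the group.

*The submersion.* The differential of `χ` is not zero (`exists_deriv_character_ne_zero`): otherwise
`χ` would be locally constant, hence a regular function with countably many values on the complex
group. Such a function is constant (`eq_one_of_countable_range`), since the coordinate ring has
countable dimension over the uncountable field `ℂ` and the group is Zariski connected; but then `p`
would be constant on the dense orbit. An element of the Lie algebra with `dχ ≠ 0`, moved by the
adjoint action to the point `g⁻¹v`, and the frame of the chart, which is tangent to the level sets
of `p`, give a right inverse of the Jacobian of the phase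
(`IsRelInvariant.exists_inverse_phaseLeftDeriv`).

*Symbol estimates.* The class `AdaptedChart.IsAmp` of amplitudes contains `f(g) c(g⁻¹v) ψ(κ(g⁻¹v))`
and is closed under derivatives in `x` and along the group. Integration by parts
(`AdaptedChart.IsAmp.exists_coord_mul`) absorbs every power of `ζ` into the amplitude, so that
oscillatory integrals are symbols of order `-∞` (`AdaptedChart.IsAmp.isSymbol`). All of this is done
for functions `ψ` on a set `H` which is the whole space or one of the half spaces `±x₁ ≥ 0`
(`IsSide`), with derivatives up to the boundary. They are lacunary because `χ(g⁻¹) - t > 0` for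
`t < 0` (`AdaptedChart.IsAmp.isLacunary`).

*The operators.* The formula for `A_f` on the chart is Fourier inversion
(`AdaptedChart.localOp_eq_oscillatory`). On a half space, `v A_f w` has as symbol the oscillatory
integral of `v(x) f(g) c(g⁻¹v) w(κ(g⁻¹v))`. Its Fourier transform in `ζ` is an integrable kernel in
the variables `x` and `σ = (y₁/x₁, y')`, which pairs with test functions by restriction to the orbit
map (`AdaptedChart.IsAmp.integral_mul_bKernel`). Two substitutions and Fubini's theorem identify the
operator with this kernel with the adjoint that defines totally characteristic operators
(`isBOperator_of_kernel`).
-/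

noncomputable section

namespace PHV

set_option linter.unusedSectionVars false

variable {m n d : ℕ}

/-! ### The exponential map and closed subgroups -/

section Cartan

open Filter Topology

variable {𝔸 : Type*} [NormedRing 𝔸] [NormedAlgebra ℚ 𝔸] [NormedAlgebra ℝ 𝔸] [CompleteSpace 𝔸]

theorem exp_neg_mul_exp (X : 𝔸) : NormedSpace.exp (-X) * NormedSpace.exp X = 1 := by
  rw [← NormedSpace.exp_add_of_commute (Commute.neg_left (Commute.refl X)), neg_add_cancel,
    NormedSpace.exp_zero]

/-- A multiplicative subset of an algebra which is a group and is closed in the group of units. -/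
structure IsClosedUnitGroup (H : Submonoid 𝔸) : Prop where
  inv : ∀ x ∈ H, ∃ y ∈ H, x * y = 1
  closed : ∀ x ∈ closure (H : Set 𝔸), IsUnit x → x ∈ H

variable {H : Submonoid 𝔸}

theorem IsClosedUnitGroup.exp_neg_mem (hH : IsClosedUnitGroup H) {X : 𝔸}
    (hX : NormedSpace.exp X ∈ H) : NormedSpace.exp (-X) ∈ H := by
  obtain ⟨y, hy, hxy⟩ := hH.inv _ hX
  have : NormedSpace.exp (-X) = y := by
    calc NormedSpace.exp (-X) = NormedSpace.exp (-X) * (NormedSpace.exp X * y) := by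
          rw [hxy, mul_one]
      _ = y := by rw [← mul_assoc, exp_neg_mul_exp, one_mul]
  rwa [this]

/-- Rescaled limits of logarithms of group elements generate one-parameter subgroups: if
`exp (Zₖ) ∈ H` and `rₖ Zₖ → X` with `rₖ → ∞`, then `exp (t X)` is the limit of
`exp (Zₖ) ^ ⌊t rₖ⌋`. -/
theorem IsClosedUnitGroup.exp_smul_mem_of_tendsto (hH : IsClosedUnitGroup H) {Z : ℕ → 𝔸}
    {r : ℕ → ℝ} {X : 𝔸} (hr : Tendsto r atTop atTop)
    (hZ : ∀ᶠ k in atTop, NormedSpace.exp (Z k) ∈ H)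
    (hX : Tendsto (fun k => r k • Z k) atTop (𝓝 X)) (t : ℝ) :
    NormedSpace.exp (t • X) ∈ H := by
  have key : ∀ t : ℝ, 0 ≤ t → NormedSpace.exp (t • X) ∈ H := by
    intro t ht
    refine hH.closed _ ?_ (NormedSpace.isUnit_exp _)
    have h1 : Tendsto (fun k => ((⌊t * r k⌋₊ : ℝ) / r k) • (r k • Z k)) atTop (𝓝 (t • X)) :=
      ((tendsto_nat_floor_mul_div_atTop ht).comp hr).smul hX
    have h2 := (NormedSpace.exp_continuous.tendsto (t • X)).comp h1
    refine mem_closure_of_tendsto h2 ?_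
    filter_upwards [hZ, hr.eventually_gt_atTop 0] with k hk hk0
    have : ((⌊t * r k⌋₊ : ℝ) / r k) • (r k • Z k) = ⌊t * r k⌋₊ • Z k := by
      rw [smul_smul, div_mul_cancel₀ _ hk0.ne', Nat.cast_smul_eq_nsmul]
    simp only [Function.comp_apply, SetLike.mem_coe]
    rw [this, NormedSpace.exp_nsmul]
    exact pow_mem hk _
  rcases le_total 0 t with ht | ht
  · exact key t ht
  · have := hH.exp_neg_mem (key (-t) (by linarith))
    rwa [neg_smul, neg_neg] at this

theorem hasDerivAt_exp_smul_zero (X : 𝔸) :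
    HasDerivAt (fun t : ℝ => NormedSpace.exp (t • X)) X 0 := by
  simpa using hasDerivAt_exp_smul_const (𝕂 := ℝ) X 0

/-- The Lie algebra of a closed group of units is closed under addition: `X + Y` is the derivative
at `0` of `log (exp (tX) exp (tY))`. -/
theorem IsClosedUnitGroup.exp_smul_add_mem (hH : IsClosedUnitGroup H) {X Y : 𝔸}
    (hX : ∀ t : ℝ, NormedSpace.exp (t • X) ∈ H) (hY : ∀ t : ℝ, NormedSpace.exp (t • Y) ∈ H)
    (t : ℝ) : NormedSpace.exp (t • (X + Y)) ∈ H := by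
  have hs : HasStrictFDerivAt (NormedSpace.exp : 𝔸 → 𝔸)
      ((ContinuousLinearEquiv.refl ℝ 𝔸 : 𝔸 ≃L[ℝ] 𝔸) : 𝔸 →L[ℝ] 𝔸) 0 :=
    hasStrictFDerivAt_exp_zero (𝕂 := ℝ) (𝔸 := 𝔸)
  have hprod : HasDerivAt (fun t : ℝ => NormedSpace.exp (t • X) * NormedSpace.exp (t • Y))
      (X + Y) 0 := by
    simpa [NormedSpace.exp_zero] using (hasDerivAt_exp_smul_zero X).fun_mul
      (hasDerivAt_exp_smul_zero Y)
  -- the logarithm of `exp (tX) exp (tY)` is a curve through `0` with derivative `X + Y`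
  have hlog : HasDerivAt (fun t : ℝ => hs.localInverse _ _ _
      (NormedSpace.exp (t • X) * NormedSpace.exp (t • Y))) (X + Y) 0 := by
    have h1 := hs.to_localInverse.hasFDerivAt
    have h2 : NormedSpace.exp (0 : 𝔸) =
      NormedSpace.exp ((0 : ℝ) • X) * NormedSpace.exp ((0 : ℝ) • Y) := by
      simp [NormedSpace.exp_zero]
    rw [h2] at h1
    exact h1.comp_hasDerivAt (0 : ℝ) hprod
  have hlog0 : hs.localInverse _ _ _ (NormedSpace.exp ((0 : ℝ) • X) *
      NormedSpace.exp ((0 : ℝ) • Y)) = 0 := by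
    have := hs.localInverse_apply_image
    simpa [NormedSpace.exp_zero] using this
  have hev : ∀ᶠ t : ℝ in 𝓝 0, NormedSpace.exp (hs.localInverse _ _ _
      (NormedSpace.exp (t • X) * NormedSpace.exp (t • Y))) =
      NormedSpace.exp (t • X) * NormedSpace.exp (t • Y) := by
    have hc := hprod.continuousAt.tendsto
    have h2 : NormedSpace.exp ((0 : ℝ) • X) * NormedSpace.exp ((0 : ℝ) • Y) =
      NormedSpace.exp (0 : 𝔸) := by
      simp [NormedSpace.exp_zero]
    rw [h2] at hc
    exact hc.eventually hs.eventually_right_inverse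
  have hseq : Tendsto (fun k : ℕ => 1 / ((k : ℝ) + 1)) atTop (𝓝[≠] 0) := by
    refine tendsto_nhdsWithin_iff.2 ⟨tendsto_one_div_add_atTop_nhds_zero_nat, ?_⟩
    exact Eventually.of_forall fun k => by
      simp only [mem_compl_iff, mem_singleton_iff]; positivity
  have hslope := (hasDerivAt_iff_tendsto_slope.1 hlog).comp hseq
  -- the curve at `t = 1 / (k + 1)`, multiplied by `k + 1`, tends to its derivative
  refine hH.exp_smul_mem_of_tendsto (r := fun k : ℕ => (k : ℝ) + 1)
    (Z := fun k : ℕ => hs.localInverse _ _ _ (NormedSpace.exp ((1 / ((k : ℝ) + 1)) • X) *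
      NormedSpace.exp ((1 / ((k : ℝ) + 1)) • Y))) ?_ ?_ ?_ t
  · exact tendsto_atTop_add_const_right _ _ tendsto_natCast_atTop_atTop
  · filter_upwards [(tendsto_nhdsWithin_iff.1 hseq).1.eventually hev] with k hk
    rw [hk]
    exact mul_mem (hX _) (hY _)
  · refine hslope.congr fun k => ?_
    simp only [Function.comp_apply, slope_def_module, hlog0, sub_zero, one_div, inv_inv]

/-- The Lie algebra of a closed group of units. -/
def IsClosedUnitGroup.lie (hH : IsClosedUnitGroup H) : Submodule ℝ 𝔸 where
  carrier := {X | ∀ t : ℝ, NormedSpace.exp (t • X) ∈ H}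
  add_mem' hX hY := hH.exp_smul_add_mem hX hY
  zero_mem' t := by simp [NormedSpace.exp_zero, one_mem]
  smul_mem' c X hX t := by
    have := hX (t * c)
    rwa [mul_smul] at this

/-- Cartan's closed subgroup theorem, in the form that the exponential map of the Lie algebra covers
a neighbourhood of the identity in the group. In the coordinates `exp X * exp Y`, with `X` in the
Lie algebra and `Y` in a linear complement, group elements close to the identity have `Y = 0`:
otherwise a limit of the directions `Y / ‖Y‖` would lie in the Lie algebra. -/
theorem IsClosedUnitGroup.eventually_exists_exp [FiniteDimensional ℝ 𝔸]
    (hH : IsClosedUnitGroup H) :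
    ∀ᶠ h in 𝓝 (1 : 𝔸), h ∈ H → ∃ X ∈ hH.lie, NormedSpace.exp X = h := by
  -- near `0`, the map `(X, Y) ↦ exp X * exp Y` on `lie × M` has a local inverse `L`
  obtain ⟨M, hM⟩ := Submodule.exists_isCompl hH.lie
  let e : (hH.lie × M) ≃L[ℝ] 𝔸 :=
    (Submodule.prodEquivOfIsCompl hH.lie M hM).toContinuousLinearEquiv
  have hF : HasStrictFDerivAt (fun z : hH.lie × M =>
      NormedSpace.exp (z.1 : 𝔸) * NormedSpace.exp (z.2 : 𝔸)) (e : (hH.lie × M) →L[ℝ] 𝔸) 0 := by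
    have h0 := hasStrictFDerivAt_exp_zero (𝕂 := ℝ) (𝔸 := 𝔸)
    have h1 : HasStrictFDerivAt (fun z : hH.lie × M => NormedSpace.exp (z.1 : 𝔸))
        (hH.lie.subtypeL.comp (ContinuousLinearMap.fst ℝ hH.lie M)) 0 :=
      HasStrictFDerivAt.comp (g := (NormedSpace.exp : 𝔸 → 𝔸))
        (f := fun z : hH.lie × M => (z.1 : 𝔸)) (0 : hH.lie × M) h0
        (hH.lie.subtypeL.comp (ContinuousLinearMap.fst ℝ hH.lie M)).hasStrictFDerivAt
    have h2 : HasStrictFDerivAt (fun z : hH.lie × M => NormedSpace.exp (z.2 : 𝔸))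
        (M.subtypeL.comp (ContinuousLinearMap.snd ℝ hH.lie M)) 0 :=
      HasStrictFDerivAt.comp (g := (NormedSpace.exp : 𝔸 → 𝔸))
        (f := fun z : hH.lie × M => (z.2 : 𝔸)) (0 : hH.lie × M) h0
        (M.subtypeL.comp (ContinuousLinearMap.snd ℝ hH.lie M)).hasStrictFDerivAt
    refine (h1.mul' h2).congr_fderiv ?_
    ext z
    · simp [NormedSpace.exp_zero, e]
    · simp [NormedSpace.exp_zero, e]
  have h10 : NormedSpace.exp (((0 : hH.lie × M).1 : hH.lie) : 𝔸) *
      NormedSpace.exp (((0 : hH.lie × M).2 : M) : 𝔸) = 1 := by simp [NormedSpace.exp_zero]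
  set L := hF.localInverse _ _ _ with hL
  have hLc : Tendsto L (𝓝 1) (𝓝 0) := by
    have := hF.localInverse_tendsto
    rwa [h10] at this
  have hR : ∀ᶠ h in 𝓝 (1 : 𝔸),
      NormedSpace.exp ((L h).1 : 𝔸) * NormedSpace.exp ((L h).2 : 𝔸) = h := by
    have := hF.eventually_right_inverse
    rwa [h10] at this
  -- otherwise there is a sequence of group elements tending to `1` with nonzero component in `M`
  by_contra hcon
  obtain ⟨h, hh1, hh⟩ := exists_seq_forall_of_frequently ((not_eventually.1 hcon).and_eventually hR)
  have hmem : ∀ k, h k ∈ H := fun k => by by_contra hk; exact (hh k).1 fun h => absurd h hk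
  have hY0 : ∀ k, (L (h k)).2 ≠ 0 := by
    intro k hk
    refine (hh k).1 fun _ => ⟨(L (h k)).1, (L (h k)).1.2, ?_⟩
    have := (hh k).2
    rwa [hk, Submodule.coe_zero, NormedSpace.exp_zero, mul_one] at this
  have hexp : ∀ k, NormedSpace.exp ((L (h k)).2 : 𝔸) ∈ H := by
    intro k
    have h1 := congrArg (NormedSpace.exp (-((L (h k)).1 : 𝔸)) * ·) (hh k).2
    simp only [← mul_assoc, exp_neg_mul_exp, one_mul] at h1
    rw [h1]
    refine mul_mem (hH.exp_neg_mem ?_) (hmem k)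
    simpa using (L (h k)).1.2 1
  have hYlim : Tendsto (fun k => (L (h k)).2) atTop (𝓝 0) :=
    (continuous_snd.tendsto (0 : hH.lie × M)).comp (hLc.comp hh1)
  -- a limit `Y` of the normalized components lies in the unit sphere of `M` and in the Lie
  -- algebra
  have hsph : ∀ k, ‖(L (h k)).2‖⁻¹ • (L (h k)).2 ∈ Metric.sphere (0 : M) 1 := by
    intro k
    simp [norm_smul, hY0 k]
  obtain ⟨Y, hYs, σ, hσ, hYσ⟩ := (isCompact_sphere (0 : M) 1).tendsto_subseq hsph
  have hYlie : (Y : 𝔸) ∈ hH.lie := by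
    refine fun t => hH.exp_smul_mem_of_tendsto (Z := fun k => ((L (h (σ k))).2 : 𝔸))
      (r := fun k => ‖(L (h (σ k))).2‖⁻¹) ?_ (Eventually.of_forall fun k => hexp _) ?_ t
    · refine Tendsto.inv_tendsto_nhdsGT_zero (tendsto_nhdsWithin_iff.2 ⟨?_, ?_⟩)
      · have := (hYlim.comp hσ.tendsto_atTop).norm
        simpa using this
      · exact Eventually.of_forall fun k => norm_pos_iff.2 (hY0 _)
    · exact (continuous_subtype_val.tendsto Y).comp hYσ
  have hYz : (Y : 𝔸) = 0 := by
    have := hM.disjoint.le_bot (show (Y : 𝔸) ∈ hH.lie ⊓ M from ⟨hYlie, Y.2⟩)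
    simpa using this
  have : ‖Y‖ = 1 := by simpa using hYs
  rw [show Y = 0 from Subtype.ext hYz] at this
  simp at this

end Cartan

/-! ### Linear algebraic groups as Lie groups -/

section LieGroup

open Filter Topology
open scoped Matrix.Norms.Frobenius

/-- The matrices of the elements of a linear group. -/
def matSubmonoid {𝕜 : Type*} [RCLike 𝕜] (K : Subgroup (GL (Fin m) 𝕜)) :
    Submonoid (Matrix (Fin m) (Fin m) 𝕜) :=
  K.toSubmonoid.map (Units.coeHom _)

theorem coe_mem_matSubmonoid {𝕜 : Type*} [RCLike 𝕜] {K : Subgroup (GL (Fin m) 𝕜)}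
    {g : GL (Fin m) 𝕜} : (g : Matrix (Fin m) (Fin m) 𝕜) ∈ matSubmonoid K ↔ g ∈ K := by
  constructor
  · rintro ⟨h, hh, hgh⟩
    rwa [← Units.ext hgh]
  · exact fun h => ⟨g, h, rfl⟩

/-- The topology of the units is induced from the algebra, so that a closed linear group is closed
relative to the invertible matrices. -/
theorem isClosedUnitGroup_matSubmonoid {𝕜 : Type*} [RCLike 𝕜] {K : Subgroup (GL (Fin m) 𝕜)}
    (hK : IsClosed (K : Set (GL (Fin m) 𝕜))) : IsClosedUnitGroup (matSubmonoid K) where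
  inv := by
    rintro _ ⟨g, hg, rfl⟩
    exact ⟨_, ⟨g⁻¹, K.inv_mem hg, rfl⟩, by simp⟩
  closed := by
    rintro _ hx ⟨u, rfl⟩
    rw [coe_mem_matSubmonoid, ← SetLike.mem_coe, ← hK.closure_eq]
    have he : IsEmbedding (Units.val : GL (Fin m) 𝕜 → Matrix (Fin m) (Fin m) 𝕜) :=
      Units.isOpenEmbedding_val.isEmbedding
    rw [he.closure_eq_preimage_closure_image]
    exact hx

theorem isClosed_of_isAlgebraicSubgroup {GC : Subgroup (GL (Fin m) ℂ)}
    (h : IsAlgebraicSubgroup ℝ GC) : IsClosed (GC : Set (GL (Fin m) ℂ)) := by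
  obtain ⟨P, hP⟩ := h
  have : (GC : Set (GL (Fin m) ℂ)) = ⋂ q ∈ P, {g : GL (Fin m) ℂ |
      MvPolynomial.aeval (fun ij : Fin m × Fin m => g.1 ij.1 ij.2) q = 0} := by
    ext g
    simp [hP g]
  rw [this]
  refine isClosed_biInter fun q _ => isClosed_eq ?_ continuous_const
  have h1 : Continuous fun g : GL (Fin m) ℂ => fun ij : Fin m × Fin m => g.1 ij.1 ij.2 :=
    continuous_pi fun ij => Units.continuous_val.matrix_elem ij.1 ij.2
  simp only [MvPolynomial.aeval_def, MvPolynomial.eval₂_eq_eval_map]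
  exact (MvPolynomial.continuous_eval _).comp h1

theorem continuous_map_algebraMap : Continuous
    (Matrix.GeneralLinearGroup.map (n := Fin m) (algebraMap ℝ ℂ)) := by
  refine Continuous.units_map _ ?_
  exact continuous_id.matrix_map Complex.continuous_ofReal

theorem isClosed_realPoints {GC : Subgroup (GL (Fin m) ℂ)} (h : IsAlgebraicSubgroup ℝ GC) :
    IsClosed (realPoints GC : Set (GL (Fin m) ℝ)) :=
  (isClosed_of_isAlgebraicSubgroup h).preimage continuous_map_algebraMap

/-- Near the identity, a closed linear group consists of exponentials of its Lie algebra. -/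
theorem eventually_exists_exp {𝕜 : Type*} [RCLike 𝕜] {K : Subgroup (GL (Fin m) 𝕜)}
    (hK : IsClosed (K : Set (GL (Fin m) 𝕜))) :
    ∀ᶠ g : K in 𝓝 1, ∃ X ∈ (isClosedUnitGroup_matSubmonoid hK).lie,
      NormedSpace.exp X = (g.1.1 : Matrix (Fin m) (Fin m) 𝕜) := by
  have hc : Continuous fun g : K => (g.1.1 : Matrix (Fin m) (Fin m) 𝕜) :=
    Units.continuous_val.comp continuous_subtype_val
  have h := (hc.tendsto (1 : K)).eventually
    (isClosedUnitGroup_matSubmonoid hK).eventually_exists_exp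
  filter_upwards [h] with g hg
  exact hg (coe_mem_matSubmonoid.2 g.2)

theorem mem_lieAlg_iff {GC : Subgroup (GL (Fin m) ℂ)}
    (hK : IsClosed (realPoints GC : Set (GL (Fin m) ℝ))) (X : Matrix (Fin m) (Fin m) ℝ) :
    X ∈ (isClosedUnitGroup_matSubmonoid hK).lie ↔ X ∈ lieAlg GC :=
  forall_congr' fun t => coe_mem_matSubmonoid (g := expGL (t • X))

theorem expR_neg {GC : Subgroup (GL (Fin m) ℂ)} (X : lieAlg GC) (t : ℝ) :
    expR X (-t) = (expR X t)⁻¹ := by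
  apply Subtype.ext
  apply Units.ext
  change NormedSpace.exp ((-t) • X.1) = NormedSpace.exp (-(t • X.1))
  rw [neg_smul]

theorem expR_add {GC : Subgroup (GL (Fin m) ℂ)} (X : lieAlg GC) (s t : ℝ) :
    expR X (s + t) = expR X s * expR X t := by
  apply Subtype.ext
  apply Units.ext
  change NormedSpace.exp ((s + t) • X.1) = NormedSpace.exp (s • X.1) * NormedSpace.exp (t • X.1)
  rw [add_smul, Matrix.exp_add_of_commute]
  exact ((Commute.refl X.1).smul_left s).smul_right t

@[simp] theorem expR_zero {GC : Subgroup (GL (Fin m) ℂ)} (X : lieAlg GC) : expR X 0 = 1 := by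
  apply Subtype.ext
  apply Units.ext
  simp [expR, expGL]

theorem expG_neg {GC : Subgroup (GL (Fin m) ℂ)} (X : lieAlg GC) (t : ℝ) :
    expG X (-t) = (expG X t)⁻¹ := Subtype.ext (expR_neg X t)

theorem expG_add {GC : Subgroup (GL (Fin m) ℂ)} (X : lieAlg GC) (s t : ℝ) :
    expG X (s + t) = expG X s * expG X t := Subtype.ext (expR_add X s t)

@[simp] theorem expG_zero {GC : Subgroup (GL (Fin m) ℂ)} (X : lieAlg GC) : expG X 0 = 1 :=
  Subtype.ext (expR_zero X)

theorem mat_mul {GC : Subgroup (GL (Fin m) ℂ)} (g h : G0 GC) : mat (g * h) = mat g * mat h := rfl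

@[simp] theorem mat_one {GC : Subgroup (GL (Fin m) ℂ)} : mat (1 : G0 GC) = 1 := rfl

theorem mat_inv_mul {GC : Subgroup (GL (Fin m) ℂ)} (g : G0 GC) : mat g⁻¹ * mat g = 1 := by
  rw [← mat_mul, inv_mul_cancel, mat_one]

theorem mat_expG {GC : Subgroup (GL (Fin m) ℂ)} (X : lieAlg GC) (t : ℝ) :
    mat (expG X t) = NormedSpace.exp (t • X.1) := rfl

theorem continuous_mat {GC : Subgroup (GL (Fin m) ℂ)} :
    Continuous (mat : G0 GC → Matrix (Fin m) (Fin m) ℝ) :=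
  Units.continuous_val.comp (continuous_subtype_val.comp continuous_subtype_val)

theorem continuous_expG {GC : Subgroup (GL (Fin m) ℂ)} (X : lieAlg GC) : Continuous (expG X) :=
  ((continuous_expGL X.1).subtype_mk _).subtype_mk _

/-- A subgroup of the real points that contains all exponentials contains the identity
component. -/
theorem connectedComponentOfOne_le {GC : Subgroup (GL (Fin m) ℂ)} (h : IsAlgebraicSubgroup ℝ GC)
    (Γ : Subgroup (realPoints GC)) (hΓ : ∀ X : lieAlg GC, expR X 1 ∈ Γ) :
    Subgroup.connectedComponentOfOne ↥(realPoints GC) ≤ Γ := by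
  have hcl := isClosed_realPoints h
  have hopen : IsOpen (Γ : Set (realPoints GC)) := by
    refine Subgroup.isOpen_of_mem_nhds Γ (g := 1) ?_
    filter_upwards [eventually_exists_exp hcl] with g hg
    obtain ⟨X, hX, hXg⟩ := hg
    have := hΓ ⟨X, (mem_lieAlg_iff hcl X).1 hX⟩
    have hg : g = expR ⟨X, (mem_lieAlg_iff hcl X).1 hX⟩ 1 := by
      apply Subtype.ext
      apply Units.ext
      change _ = NormedSpace.exp ((1 : ℝ) • X)
      rw [one_smul, hXg]
    rwa [hg]
  -- an open subgroup is closed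
  have hclopen : IsClopen (Γ : Set (realPoints GC)) := ⟨Γ.isClosed_of_isOpen hopen, hopen⟩
  exact hclopen.connectedComponent_subset Γ.one_mem

theorem contDiff_exp_smul_apply (X : Matrix (Fin m) (Fin m) ℝ) (i j : Fin m) :
    ContDiff ℝ 1 fun t : ℝ => NormedSpace.exp (t • X) i j := by
  have hd : ∀ t : ℝ, HasDerivAt (fun t : ℝ => NormedSpace.exp (t • X))
      (NormedSpace.exp (t • X) * X) t := fun t => hasDerivAt_exp_smul_const X t
  have hc : Continuous fun t : ℝ => NormedSpace.exp (t • X) :=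
    NormedSpace.exp_continuous.comp (continuous_id.smul continuous_const)
  have h1 : ContDiff ℝ 1 fun t : ℝ => NormedSpace.exp (t • X) := by
    rw [contDiff_one_iff_deriv]
    refine ⟨fun t => (hd t).differentiableAt, ?_⟩
    exact (hc.mul continuous_const).congr fun t => (hd t).deriv.symm
  exact (Matrix.entryLinearMap ℝ ℝ i j).toContinuousLinearMap.contDiff.comp h1

/-- Any two points of the identity component are joined by a curve that is a product of
one-parameter subgroups. -/
theorem exists_smooth_curve {GC : Subgroup (GL (Fin m) ℂ)} (h : IsAlgebraicSubgroup ℝ GC)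
    (g : G0 GC) : ∃ c : ℝ → G0 GC, (∀ i j, ContDiff ℝ 1 fun t => mat (c t) i j) ∧
      c 0 = 1 ∧ c 1 = g := by
  have key : Subgroup.connectedComponentOfOne ↥(realPoints GC) ≤
      Subgroup.closure (range fun X : lieAlg GC => expR X 1) :=
    connectedComponentOfOne_le h _ fun X => Subgroup.subset_closure ⟨X, rfl⟩
  -- the inverses of the curves are carried along to handle inverses of group elements
  suffices H : ∀ k ∈ Subgroup.closure (range fun X : lieAlg GC => expR X 1),
      ∃ c : ℝ → G0 GC, (∀ i j, ContDiff ℝ 1 fun t => mat (c t) i j) ∧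
      (∀ i j, ContDiff ℝ 1 fun t => mat (c t)⁻¹ i j) ∧ c 0 = 1 ∧ (c 1).1 = k by
    obtain ⟨c, h1, -, h2, h3⟩ := H g.1 (key g.2)
    exact ⟨c, h1, h2, Subtype.ext h3⟩
  intro k hk
  have hmul : ∀ c c' : ℝ → G0 GC, (∀ i j, ContDiff ℝ 1 fun t => mat (c t) i j) →
      (∀ i j, ContDiff ℝ 1 fun t => mat (c' t) i j) →
      ∀ i j, ContDiff ℝ 1 fun t => mat (c t * c' t) i j := by
    intro c c' hc hc' i j
    simp only [mat_mul, Matrix.mul_apply]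
    exact ContDiff.sum fun l _ => (hc i l).mul (hc' l j)
  induction hk using Subgroup.closure_induction with
  | mem x hx =>
    obtain ⟨X, rfl⟩ := hx
    refine ⟨expG X, fun i j => contDiff_exp_smul_apply X.1 i j, fun i j => ?_, expG_zero X, rfl⟩
    simp only [← expG_neg, mat_expG]
    exact (contDiff_exp_smul_apply X.1 i j).comp contDiff_neg
  | one => exact ⟨fun _ => 1, fun i j => contDiff_const, fun i j => contDiff_const, rfl, rfl⟩
  | mul x y _ _ hx hy =>
    obtain ⟨c, h1, h2, h3, h4⟩ := hx
    obtain ⟨c', h1', h2', h3', h4'⟩ := hy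
    refine ⟨fun t => c t * c' t, hmul c c' h1 h1', ?_, by simp [h3, h3'], by simp [h4, h4']⟩
    simp only [mul_inv_rev]
    exact hmul _ _ h2' h2
  | inv x _ hx =>
    obtain ⟨c, h1, h2, h3, h4⟩ := hx
    exact ⟨fun t => (c t)⁻¹, h2, by simpa using h1, by simp [h3], by simp [h4]⟩

theorem norm_matrix_apply_le (A : Matrix (Fin m) (Fin m) ℝ) (i j : Fin m) : |A i j| ≤ ‖A‖ := by
  rw [Matrix.frobenius_norm_def, ← Real.sqrt_eq_rpow]
  refine Real.le_sqrt_of_sq_le ?_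
  calc |A i j| ^ 2 = ‖A i j‖ ^ (2 : ℝ) := by simp
    _ ≤ ∑ j', ‖A i j'‖ ^ (2 : ℝ) :=
        Finset.single_le_sum (f := fun j' => ‖A i j'‖ ^ (2 : ℝ)) (fun _ _ => by positivity)
          (Finset.mem_univ j)
    _ ≤ _ := Finset.single_le_sum (f := fun i' => ∑ j', ‖A i' j'‖ ^ (2 : ℝ))
          (fun _ _ => by positivity) (Finset.mem_univ i)

/-- A Gronwall inequality with a variable coefficient. The summands `1` make the comparison with
the solution of the differential equation strict. -/
theorem norm_le_of_norm_deriv_le_mul {E : Type*} [NormedAddCommGroup E] [NormedSpace ℝ E]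
    {y y' : ℝ → E} {s : ℝ → ℝ} (hy : ∀ t ∈ Icc (0 : ℝ) 1, HasDerivAt y (y' t) t)
    (hs : ContinuousOn s (Icc 0 1))
    (hbd : ∀ t ∈ Icc (0 : ℝ) 1, ‖y' t‖ ≤ s t * ‖y t‖) :
    ‖y 1‖ ≤ (‖y 0‖ + 1) * Real.exp ((∫ t in (0 : ℝ)..1, s t) + 1) := by
  set B : ℝ → ℝ := fun t => (‖y 0‖ + 1) * Real.exp ((∫ τ in (0 : ℝ)..t, s τ) + t) with hB
  have hint : IntervalIntegrable s volume 0 1 :=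
    (hs.mono (by rw [uIcc_of_le zero_le_one])).intervalIntegrable
  have hprim : ContinuousOn (fun t => ∫ τ in (0 : ℝ)..t, s τ) (Icc 0 1) := by
    have := intervalIntegral.continuousOn_primitive_interval'
      (μ := volume) (f := s) (b₁ := 0) (b₂ := 1) (a := 0) hint (by simp)
    rwa [uIcc_of_le zero_le_one] at this
  refine image_norm_le_of_norm_deriv_right_lt_deriv_boundary' (f := y) (f' := y') (a := 0) (b := 1)
    (B := B) (B' := fun t => (‖y 0‖ + 1) * (Real.exp ((∫ τ in (0 : ℝ)..t, s τ) + t) * (s t + 1)))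
    (fun t ht => (hy t ht).continuousAt.continuousWithinAt)
    (fun t ht => (hy t (Ico_subset_Icc_self ht)).hasDerivWithinAt) ?_ ?_ ?_ ?_
    (right_mem_Icc.2 zero_le_one)
  · simp [hB]
  · exact continuousOn_const.mul (Real.continuous_exp.comp_continuousOn (hprim.add continuousOn_id))
  · intro t ht
    have h1 : HasDerivWithinAt (fun t => ∫ τ in (0 : ℝ)..t, s τ) (s t) (Ici t) t := by
      have hint' : IntervalIntegrable s volume 0 t :=
        hint.mono_set (by
          rw [uIcc_of_le ht.1, uIcc_of_le zero_le_one]; exact Icc_subset_Icc_right ht.2.le)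
      have hmem : Icc (0 : ℝ) 1 ∈ 𝓝[>] t :=
        mem_of_superset (Ioo_mem_nhdsGT ht.2)
          (fun u hu => ⟨ht.1.trans hu.1.le, hu.2.le⟩)
      refine intervalIntegral.integral_hasDerivWithinAt_right hint' (t := Ioi t) ?_ ?_
      · exact ⟨Icc 0 1, hmem, hs.aestronglyMeasurable measurableSet_Icc⟩
      · exact (hs t (Ico_subset_Icc_self ht)).mono_of_mem_nhdsWithin hmem
    exact (((h1.add (hasDerivWithinAt_id t _)).exp).const_mul _)
  · intro t ht hEq
    have hpos : 0 < B t := by simp only [hB]; positivity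
    calc ‖y' t‖ ≤ s t * ‖y t‖ := hbd t (Ico_subset_Icc_self ht)
      _ = s t * B t := by rw [hEq]
      _ < (s t + 1) * B t := by nlinarith
      _ = _ := by simp only [hB]; ring

theorem hasDerivAt_matrix {c : ℝ → Matrix (Fin m) (Fin m) ℝ}
    (hc : ∀ i j, ContDiff ℝ 1 fun t => c t i j) (t : ℝ) :
    HasDerivAt c (Matrix.of fun k l => deriv (fun s => c s k l) t) t := by
  have h1 : c = fun s => ∑ i, ∑ j, c s i j • Matrix.single i j (1 : ℝ) := by
    funext s
    conv_lhs => rw [Matrix.matrix_eq_sum_single (c s)]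
    simp [Matrix.smul_single]
  have h2 : HasDerivAt (fun s => ∑ i, ∑ j, c s i j • Matrix.single i j (1 : ℝ))
      (∑ i, ∑ j, deriv (fun s => c s i j) t • Matrix.single i j (1 : ℝ)) t :=
    HasDerivAt.fun_sum fun i _ => HasDerivAt.fun_sum fun j _ =>
      (((hc i j).differentiable one_ne_zero) t).hasDerivAt.smul_const _
  rw [← h1] at h2
  rw [Matrix.matrix_eq_sum_single (Matrix.of fun k l => deriv (fun s => c s k l) t)]
  simpa [Matrix.smul_single] using h2

theorem curveLength_eq (c : ℝ → Matrix (Fin m) (Fin m) ℝ) : curveLength c =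
    ∫ t in (0 : ℝ)..1, ‖(c t)⁻¹ * Matrix.of fun k l => deriv (fun s => c s k l) t‖ := by
  simp only [curveLength, Matrix.frobenius_norm_def, ← Real.sqrt_eq_rpow]
  simp

/-- Along a curve of invertible matrices, the norms of the matrix and of its inverse grow at most
exponentially with the length for the left invariant metric. -/
theorem norm_le_exp_curveLength {c c' : ℝ → Matrix (Fin m) (Fin m) ℝ}
    (hc : ∀ i j, ContDiff ℝ 1 fun t => c t i j) (hinv : ∀ t ∈ Icc (0 : ℝ) 1, c' t * c t = 1)
    (h0 : c 0 = 1) :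
    ‖c 1‖ ≤ (‖(1 : Matrix (Fin m) (Fin m) ℝ)‖ + 1) * Real.exp (curveLength c + 1) ∧
    ‖c' 1‖ ≤ (‖(1 : Matrix (Fin m) (Fin m) ℝ)‖ + 1) * Real.exp (curveLength c + 1) := by
  set D : ℝ → Matrix (Fin m) (Fin m) ℝ := fun t =>
    Matrix.of fun k l => deriv (fun s => c s k l) t with hD
  have hcD : ∀ t, HasDerivAt c (D t) t := hasDerivAt_matrix hc
  have hinv' : ∀ t ∈ Icc (0 : ℝ) 1, (c t)⁻¹ = c' t := fun t ht =>
    Matrix.inv_eq_left_inv (hinv t ht)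
  have hunit : ∀ t ∈ Icc (0 : ℝ) 1, IsUnit (c t) := fun t ht =>
    IsUnit.of_mul_eq_one (c' t) (mul_eq_one_comm.1 (hinv t ht))
  have hDc : Continuous D := continuous_matrix fun i j => (hc i j).continuous_deriv le_rfl
  have hring : ∀ t ∈ Icc (0 : ℝ) 1, HasDerivAt (fun t => (c t)⁻¹) (-(c t)⁻¹ * D t * (c t)⁻¹) t := by
    intro t ht
    obtain ⟨u, hu⟩ := hunit t ht
    have h1 : HasFDerivAt Ring.inverse _ (c t) := hu ▸ hasFDerivAt_ringInverse (𝕜 := ℝ) u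
    have h2 := h1.comp_hasDerivAt t (hcD t)
    have h3 : (fun t => (c t)⁻¹) = Ring.inverse ∘ c :=
      funext fun t => Matrix.nonsing_inv_eq_ringInverse (c t)
    have hu' : (c t)⁻¹ = ((u⁻¹ : (Matrix (Fin m) (Fin m) ℝ)ˣ) : Matrix (Fin m) (Fin m) ℝ) := by
      rw [← hu, Matrix.coe_units_inv]
    have h4 : (-((ContinuousLinearMap.mulLeftRight ℝ (Matrix (Fin m) (Fin m) ℝ))
        (u⁻¹ : (Matrix (Fin m) (Fin m) ℝ)ˣ)) (u⁻¹ : (Matrix (Fin m) (Fin m) ℝ)ˣ)) (D t) =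
        -(c t)⁻¹ * D t * (c t)⁻¹ := by
      rw [hu']
      simp
    exact h3 ▸ h2.congr_deriv h4
  have hsc : ContinuousOn (fun t => ‖(c t)⁻¹ * D t‖) (Icc 0 1) := by
    refine ContinuousOn.norm (ContinuousOn.mul (fun t ht => ?_) hDc.continuousOn)
    exact (hring t ht).continuousAt.continuousWithinAt
  have hlen : curveLength c = ∫ t in (0 : ℝ)..1, ‖(c t)⁻¹ * D t‖ := curveLength_eq c
  constructor
  · have := norm_le_of_norm_deriv_le_mul (y := c) (y' := D) (s := fun t => ‖(c t)⁻¹ * D t‖)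
      (fun t _ => hcD t) hsc (fun t ht => ?_)
    · rwa [h0, ← hlen] at this
    · have h1 : D t = c t * ((c t)⁻¹ * D t) := by
        rw [hinv' t ht, ← mul_assoc, mul_eq_one_comm.1 (hinv t ht), one_mul]
      calc ‖D t‖ = ‖c t * ((c t)⁻¹ * D t)‖ := by rw [← h1]
        _ ≤ ‖c t‖ * ‖(c t)⁻¹ * D t‖ := norm_mul_le _ _
        _ = _ := mul_comm _ _
  · have := norm_le_of_norm_deriv_le_mul (y := fun t => (c t)⁻¹)
      (y' := fun t => -(c t)⁻¹ * D t * (c t)⁻¹) (s := fun t => ‖(c t)⁻¹ * D t‖)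
      hring hsc (fun t ht => ?_)
    · rwa [h0, inv_one, ← hlen, hinv' 1 (right_mem_Icc.2 zero_le_one)] at this
    · calc ‖-(c t)⁻¹ * D t * (c t)⁻¹‖ = ‖((c t)⁻¹ * D t) * (c t)⁻¹‖ := by
            rw [neg_mul, neg_mul, norm_neg]
        _ ≤ _ := norm_mul_le _ _

/-- The matrix entries of `g` and `g⁻¹` grow at most exponentially in `|g|`. -/
theorem exists_abs_mat_le {GC : Subgroup (GL (Fin m) ℂ)} (h : IsAlgebraicSubgroup ℝ GC) :
    ∃ C : ℝ, 0 < C ∧ ∀ (g : G0 GC) (i j : Fin m),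
      |mat g i j| ≤ C * Real.exp (gnorm g) ∧ |mat g⁻¹ i j| ≤ C * Real.exp (gnorm g) := by
  set M := ‖(1 : Matrix (Fin m) (Fin m) ℝ)‖ + 1 with hM
  have hM0 : 0 < M := by positivity
  refine ⟨M * Real.exp 1, by positivity, fun g i j => ?_⟩
  -- a bound by the lengths of all curves from `1` to `g` passes to the infimum `|g|` after taking
  -- logarithms; the infimum is over a nonempty set
  have hlog : ∀ a : ℝ, (∀ L : ℝ, (∃ c : ℝ → Matrix (Fin m) (Fin m) ℝ,
      (∀ i j, ContDiff ℝ 1 fun t => c t i j) ∧ (∀ t ∈ Icc (0 : ℝ) 1, ∃ h : G0 GC, mat h = c t) ∧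
      c 0 = 1 ∧ c 1 = mat g ∧ L = curveLength c) → |a| ≤ M * Real.exp (L + 1)) →
      |a| ≤ M * Real.exp 1 * Real.exp (gnorm g) := by
    intro a ha
    rcases eq_or_ne a 0 with rfl | ha0
    · rw [abs_zero]; positivity
    have hpos : 0 < |a| / (M * Real.exp 1) := by positivity
    have hle : Real.log (|a| / (M * Real.exp 1)) ≤ gnorm g := by
      refine le_csInf ?_ fun L hL => ?_
      · obtain ⟨c, hc, hc0, hc1⟩ := exists_smooth_curve h g
        exact ⟨_, fun t => mat (c t), hc, fun t _ => ⟨c t, rfl⟩, by simp [hc0], by simp [hc1], rfl⟩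
      · rw [Real.log_le_iff_le_exp hpos, div_le_iff₀ (by positivity)]
        have := ha L hL
        rw [Real.exp_add] at this
        linarith
    rw [Real.log_le_iff_le_exp hpos, div_le_iff₀ (by positivity)] at hle
    linarith
  have hkey : ∀ L : ℝ, (∃ c : ℝ → Matrix (Fin m) (Fin m) ℝ,
      (∀ i j, ContDiff ℝ 1 fun t => c t i j) ∧ (∀ t ∈ Icc (0 : ℝ) 1, ∃ h : G0 GC, mat h = c t) ∧
      c 0 = 1 ∧ c 1 = mat g ∧ L = curveLength c) →
      ‖mat g‖ ≤ M * Real.exp (L + 1) ∧ ‖mat g⁻¹‖ ≤ M * Real.exp (L + 1) := by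
    rintro L ⟨c, hc, hcG, h0, h1, rfl⟩
    have hinv : ∀ t ∈ Icc (0 : ℝ) 1, (c t)⁻¹ * c t = 1 := by
      intro t ht
      obtain ⟨k, hk⟩ := hcG t ht
      rw [← hk, Matrix.inv_eq_left_inv (mat_inv_mul k), mat_inv_mul]
    have := norm_le_exp_curveLength hc hinv h0
    rwa [h1, Matrix.inv_eq_left_inv (mat_inv_mul g)] at this
  exact ⟨hlog _ fun L hL => (norm_matrix_apply_le _ i j).trans (hkey L hL).1,
    hlog _ fun L hL => (norm_matrix_apply_le _ i j).trans (hkey L hL).2⟩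

end LieGroup

/-! ### The relative invariant -/

section Invariant

variable {GC : Subgroup (GL (Fin m) ℂ)} {ρ : GC →* GL (Fin n) ℂ}

theorem orbit_mulVec (ρ : GC →* GL (Fin n) ℂ) (g : GC) (v : Fin n → ℂ) :
    orbit ρ ((ρ g).1 *ᵥ v) = orbit ρ v := by
  ext w
  constructor
  · rintro ⟨h, rfl⟩
    refine ⟨h * g, ?_⟩
    simp [Matrix.mulVec_mulVec]
  · rintro ⟨h, rfl⟩
    refine ⟨h * g⁻¹, ?_⟩
    simp [Matrix.mulVec_mulVec, mul_assoc]

/-- The polynomial `v ↦ q (A v)`. -/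
def linSubst (A : Matrix (Fin n) (Fin n) ℂ) :
    MvPolynomial (Fin n) ℂ →ₐ[ℂ] MvPolynomial (Fin n) ℂ :=
  MvPolynomial.aeval fun i => ∑ j, MvPolynomial.C (A i j) * MvPolynomial.X j

theorem eval_linSubst (A : Matrix (Fin n) (Fin n) ℂ) (q : MvPolynomial (Fin n) ℂ)
    (v : Fin n → ℂ) : MvPolynomial.eval v (linSubst A q) = MvPolynomial.eval (A *ᵥ v) q := by
  induction q using MvPolynomial.induction_on with
  | C a => simp [linSubst]
  | add p q hp hq => simp only [map_add, hp, hq]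
  | mul_X p i hp =>
    simp only [map_mul, hp, MvPolynomial.eval_X]
    congr 1
    simp [linSubst, Matrix.mulVec, dotProduct]

/-- By the Nullstellensatz, since `q ∘ g` vanishes on the invariant set of zeros of `q`. -/
theorem dvd_linSubst {q : MvPolynomial (Fin n) ℂ} (hq : Irreducible q)
    (hS : singularSet ρ = {v | MvPolynomial.eval v q = 0}) (g : GC) :
    q ∣ linSubst (ρ g).1 q := by
  have hprime : (Ideal.span {q}).IsPrime :=
    (Ideal.span_singleton_prime hq.ne_zero).2 hq.prime
  have hmem : linSubst (ρ g).1 q ∈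
      MvPolynomial.vanishingIdeal ℂ (MvPolynomial.zeroLocus ℂ (Ideal.span {q})) := by
    intro v hv
    have hv0 : v ∈ singularSet ρ := by
      rw [hS]
      simpa [MvPolynomial.aeval_eq_eval] using hv q (Ideal.mem_span_singleton_self q)
    have hgv : (ρ g).1 *ᵥ v ∈ singularSet ρ := by
      change ¬ IsZariskiDense (orbit ρ ((ρ g).1 *ᵥ v))
      rw [orbit_mulVec]
      exact hv0
    rw [hS] at hgv
    rw [MvPolynomial.aeval_eq_eval]
    simpa [eval_linSubst] using hgv
  rw [MvPolynomial.IsPrime.vanishingIdeal_zeroLocus] at hmem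
  exact Ideal.mem_span_singleton.1 hmem

/-- An irreducible equation of the singular set is a relative invariant. By the Nullstellensatz,
`q` divides `q ∘ g` and `q ∘ g⁻¹`, so that `q` and `q ∘ g` are associated. -/
theorem exists_relative_invariant {q : MvPolynomial (Fin n) ℂ} (hq : Irreducible q)
    (hS : singularSet ρ = {v | MvPolynomial.eval v q = 0}) (g : GC) :
    ∃ c : ℂ, ∀ v, MvPolynomial.eval ((ρ g).1 *ᵥ v) q = c * MvPolynomial.eval v q := by
  have h1 := dvd_linSubst hq hS g
  have h2 : linSubst (ρ g).1 q ∣ q := by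
    have h3 := map_dvd (linSubst (ρ g).1) (dvd_linSubst hq hS g⁻¹)
    have h4 : linSubst (ρ g).1 (linSubst (ρ g⁻¹).1 q) = q := by
      refine MvPolynomial.funext fun v => ?_
      rw [eval_linSubst, eval_linSubst, Matrix.mulVec_mulVec, map_inv]
      simp
    rwa [h4] at h3
  obtain ⟨u, hu⟩ := associated_of_dvd_dvd h1 h2
  obtain ⟨c, -, hc⟩ := MvPolynomial.isUnit_iff_eq_C_of_isReduced.1 u.isUnit
  refine ⟨c, fun v => ?_⟩
  rw [← eval_linSubst, ← hu, hc, map_mul, MvPolynomial.eval_C, mul_comm]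

/-! ### The real representation -/

/-- The real matrix `ρ(g)`. -/
def rhoR (ρ : GC →* GL (Fin n) ℂ) (g : realPoints GC) : Matrix (Fin n) (Fin n) ℝ :=
  (ρ (toComplex g)).1.map Complex.re

theorem act_apply (g : realPoints GC) (v : VR n) (i : Fin n) :
    act ρ g v i = ∑ j, rhoR ρ g i j * v j := rfl

/-- The point of the affine space of pairs (matrix, inverse determinant) given by `g`. -/
def coordsR (g : realPoints GC) : Option (Fin m × Fin m) → ℝ :=
  fun o => o.elim (g.1.1.det)⁻¹ fun ij => g.1.1 ij.1 ij.2

theorem coe_coordsR (g : realPoints GC) (o : Option (Fin m × Fin m)) :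
    ((coordsR g o : ℝ) : ℂ) = o.elim ((toComplex g).1.1.det)⁻¹
      (fun ij => (toComplex g).1.1 ij.1 ij.2) := by
  have h : (toComplex g).1.1 = g.1.1.map (algebraMap ℝ ℂ) := rfl
  rcases o with _ | ij
  · have h2 := (RingHom.map_det (algebraMap ℝ ℂ) g.1.1).symm
    rw [RingHom.mapMatrix_apply, ← h] at h2
    simp only [Option.elim_none, h2, coordsR]
    simp
  · simp [coordsR, h]

theorem rhoR_spec (hR : IsRealRational ρ) (g : realPoints GC) (i j : Fin n) :
    ((rhoR ρ g i j : ℝ) : ℂ) = (ρ (toComplex g)).1 i j := by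
  obtain ⟨R, hR⟩ := hR
  have h : (ρ (toComplex g)).1 i j = ((MvPolynomial.aeval (coordsR g) (R i j) : ℝ) : ℂ) := by
    rw [hR, ← funext (coe_coordsR g)]
    exact MvPolynomial.aeval_algebraMap_apply ℂ (coordsR g) (R i j)
  simp only [rhoR, Matrix.map_apply]
  rw [h, Complex.ofReal_re]

/-- The matrix coefficients of the real representation are polynomials in the entries and the
inverse determinant of the group element. -/
theorem exists_rhoR_eq (hR : IsRealRational ρ) :
    ∃ R : Fin n → Fin n → MvPolynomial (Option (Fin m × Fin m)) ℝ,
      ∀ (g : realPoints GC) (i j : Fin n), rhoR ρ g i j = MvPolynomial.aeval (coordsR g) (R i j) := by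
  have hR' := hR
  obtain ⟨R, hR⟩ := hR
  refine ⟨R, fun g i j => Complex.ofReal_injective ?_⟩
  rw [rhoR_spec hR', hR, ← funext (coe_coordsR g)]
  exact MvPolynomial.aeval_algebraMap_apply ℂ (coordsR g) (R i j)

theorem toComplex_mul (g h : realPoints GC) : toComplex (g * h) = toComplex g * toComplex h :=
  Subtype.ext (map_mul _ g.1 h.1)

theorem toComplex_one : toComplex (1 : realPoints GC) = 1 := Subtype.ext (map_one _)

theorem rhoR_map (hR : IsRealRational ρ) (g : realPoints GC) :
    (rhoR ρ g).map (algebraMap ℝ ℂ) = (ρ (toComplex g)).1 := by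
  ext i j
  exact rhoR_spec hR g i j

theorem rhoR_mul (hR : IsRealRational ρ) (g h : realPoints GC) :
    rhoR ρ (g * h) = rhoR ρ g * rhoR ρ h := by
  have hinj : Function.Injective (fun A : Matrix (Fin n) (Fin n) ℝ => A.map (algebraMap ℝ ℂ)) :=
    Matrix.map_injective Complex.ofReal_injective
  apply hinj
  simp only
  rw [Matrix.map_mul, rhoR_map hR, rhoR_map hR, rhoR_map hR, toComplex_mul, map_mul, Units.val_mul]

theorem rhoR_one : rhoR ρ (1 : realPoints GC) = 1 := by
  ext i j
  simp [rhoR, toComplex_one, Matrix.one_apply]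
  split_ifs <;> simp

theorem act_eq (g : realPoints GC) (v : VR n) :
    act ρ g v = WithLp.toLp 2 (rhoR ρ g *ᵥ v.ofLp) := rfl

theorem act_mul (hR : IsRealRational ρ) (g h : realPoints GC) (v : VR n) :
    act ρ (g * h) v = act ρ g (act ρ h v) := by
  simp [act_eq, rhoR_mul hR, Matrix.mulVec_mulVec]

@[simp] theorem act_one (v : VR n) : act ρ (1 : realPoints GC) v = v := by
  simp [act_eq, rhoR_one]

theorem eval_map_ofReal (p : MvPolynomial (Fin n) ℝ) (v : Fin n → ℝ) :
    MvPolynomial.eval (fun i => (v i : ℂ)) (MvPolynomial.map (algebraMap ℝ ℂ) p) =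
      (MvPolynomial.eval v p : ℝ) := by
  have := MvPolynomial.map_eval (algebraMap ℝ ℂ) v p
  exact this.symm

variable {p : MvPolynomial (Fin n) ℝ}

theorem exists_pfun_ne_zero (hp : Irreducible (MvPolynomial.map (algebraMap ℝ ℂ) p)) :
    ∃ v : VR n, pfun p v ≠ 0 := by
  by_contra! h
  have : p = 0 := MvPolynomial.funext fun v => by
    rw [map_zero]
    exact h (WithLp.toLp 2 v)
  rw [this, map_zero] at hp
  exact not_irreducible_zero hp

/-- The value of the relative invariant is multiplied by a scalar under the real group. -/
theorem exists_character (hR : IsRealRational ρ)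
    (hp : Irreducible (MvPolynomial.map (algebraMap ℝ ℂ) p))
    (hS : singularSet ρ = {v | MvPolynomial.eval v (MvPolynomial.map (algebraMap ℝ ℂ) p) = 0})
    (g : realPoints GC) : ∃ c : ℝ, ∀ v : VR n, pfun p (act ρ g v) = c * pfun p v := by
  obtain ⟨c, hc⟩ := exists_relative_invariant hp hS (toComplex g)
  have hreal : ∀ v : VR n, ((pfun p (act ρ g v) : ℝ) : ℂ) = c * (pfun p v : ℝ) := by
    intro v
    have h1 := hc fun i => (v i : ℂ)
    have h2 : (ρ (toComplex g)).1 *ᵥ (fun i => (v i : ℂ)) = fun i => ((act ρ g v i : ℝ) : ℂ) := by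
      ext i
      rw [act_apply]
      push_cast
      simp only [rhoR_spec hR]
      rfl
    rw [h2, eval_map_ofReal, eval_map_ofReal] at h1
    exact h1
  obtain ⟨v₀, hv₀⟩ := exists_pfun_ne_zero hp
  have hc' : c = ((pfun p (act ρ g v₀) / pfun p v₀ : ℝ) : ℂ) := by
    have h0 : ((pfun p v₀ : ℝ) : ℂ) ≠ 0 := by exact_mod_cast hv₀
    push_cast
    rw [eq_div_iff h0, hreal v₀]
  refine ⟨pfun p (act ρ g v₀) / pfun p v₀, fun v => Complex.ofReal_injective ?_⟩
  rw [hreal v, hc']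
  push_cast
  rfl

theorem pfun_act (hR : IsRealRational ρ)
    (hp : Irreducible (MvPolynomial.map (algebraMap ℝ ℂ) p))
    (hS : singularSet ρ = {v | MvPolynomial.eval v (MvPolynomial.map (algebraMap ℝ ℂ) p) = 0})
    (g : realPoints GC) (v : VR n) : pfun p (act ρ g v) = character ρ p g * pfun p v := by
  have h := exists_character hR hp hS g
  rw [character, dif_pos h]
  exact h.choose_spec v

/-- A real rational representation together with a nonzero relative invariant `p`. -/
structure IsRelInvariant (ρ : GC →* GL (Fin n) ℂ) (p : MvPolynomial (Fin n) ℝ) : Prop where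
  rational : IsRealRational ρ
  ne_zero : ∃ v : VR n, pfun p v ≠ 0
  map_act : ∀ (g : realPoints GC) (v : VR n), pfun p (act ρ g v) = character ρ p g * pfun p v

theorem IsRelInvariant.character_mul (h : IsRelInvariant ρ p) (g k : realPoints GC) :
    character ρ p (g * k) = character ρ p g * character ρ p k := by
  obtain ⟨v, hv⟩ := h.ne_zero
  have h1 := h.map_act (g * k) v
  rw [act_mul h.rational, h.map_act, h.map_act, ← mul_assoc] at h1
  exact (mul_right_cancel₀ hv h1).symm

theorem IsRelInvariant.character_one (h : IsRelInvariant ρ p) :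
    character ρ p (1 : realPoints GC) = 1 := by
  obtain ⟨v, hv⟩ := h.ne_zero
  have h1 := h.map_act 1 v
  rw [act_one] at h1
  exact mul_right_cancel₀ hv (by rw [one_mul, ← h1])

theorem IsRelInvariant.character_inv_mul (h : IsRelInvariant ρ p) (g : realPoints GC) :
    character ρ p g⁻¹ * character ρ p g = 1 := by
  rw [← h.character_mul, inv_mul_cancel, h.character_one]

end Invariant

/-! ### Polynomial functions on the group -/

section PolynomialFunctions

variable {GC : Subgroup (GL (Fin m) ℂ)} {ρ : GC →* GL (Fin n) ℂ} {p : MvPolynomial (Fin n) ℝ}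

/-- The algebra of functions on `G` generated by the matrix entries of `g` and of `g⁻¹`. -/
def polyFun (GC : Subgroup (GL (Fin m) ℂ)) : Subalgebra ℝ (G0 GC → ℝ) :=
  Algebra.adjoin ℝ ((range fun ij : Fin m × Fin m => fun g : G0 GC => mat g ij.1 ij.2) ∪
    range fun ij : Fin m × Fin m => fun g : G0 GC => mat g⁻¹ ij.1 ij.2)

theorem mat_mem_polyFun (i j : Fin m) : (fun g : G0 GC => mat g i j) ∈ polyFun GC :=
  Algebra.subset_adjoin (Or.inl ⟨(i, j), rfl⟩)

theorem mat_inv_mem_polyFun (i j : Fin m) : (fun g : G0 GC => mat g⁻¹ i j) ∈ polyFun GC :=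
  Algebra.subset_adjoin (Or.inr ⟨(i, j), rfl⟩)

theorem polyFun_sum {ι : Type*} {s : Finset ι} {P : ι → G0 GC → ℝ}
    (h : ∀ i ∈ s, P i ∈ polyFun GC) : (fun g => ∑ i ∈ s, P i g) ∈ polyFun GC := by
  have := (polyFun GC).sum_mem h
  convert this using 1
  ext g
  simp

theorem polyFun_mul {P Q : G0 GC → ℝ} (hP : P ∈ polyFun GC) (hQ : Q ∈ polyFun GC) :
    (fun g => P g * Q g) ∈ polyFun GC := (polyFun GC).mul_mem hP hQ

theorem polyFun_add {P Q : G0 GC → ℝ} (hP : P ∈ polyFun GC) (hQ : Q ∈ polyFun GC) :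
    (fun g => P g + Q g) ∈ polyFun GC := (polyFun GC).add_mem hP hQ

theorem polyFun_const (c : ℝ) : (fun _ => c) ∈ polyFun GC := (polyFun GC).algebraMap_mem c

theorem polyFun_const_mul {P : G0 GC → ℝ} (c : ℝ) (hP : P ∈ polyFun GC) :
    (fun g => c * P g) ∈ polyFun GC := polyFun_mul (polyFun_const c) hP

@[elab_as_elim]
theorem polyFun_induction {Q : ∀ P : G0 GC → ℝ, P ∈ polyFun GC → Prop}
    (mat_ : ∀ i j, Q _ (mat_mem_polyFun i j)) (inv_ : ∀ i j, Q _ (mat_inv_mem_polyFun i j))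
    (const : ∀ c : ℝ, Q _ (polyFun_const c))
    (add : ∀ P P' hP hP', Q P hP → Q P' hP' → Q _ (polyFun_add hP hP'))
    (mul : ∀ P P' hP hP', Q P hP → Q P' hP' → Q _ (polyFun_mul hP hP')) {P : G0 GC → ℝ}
    (hP : P ∈ polyFun GC) : Q P hP := by
  induction hP using Algebra.adjoin_induction with
  | mem x hx =>
    rcases hx with ⟨ij, rfl⟩ | ⟨ij, rfl⟩
    · exact mat_ _ _
    · exact inv_ _ _
  | algebraMap r => exact const r
  | add x y h1 h2 hx hy => exact add x y h1 h2 hx hy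
  | mul x y h1 h2 hx hy => exact mul x y h1 h2 hx hy

theorem polyFun_aeval {σ : Type*} {P : G0 GC → σ → ℝ}
    (h : ∀ s, (fun g => P g s) ∈ polyFun GC) (q : MvPolynomial σ ℝ) :
    (fun g => MvPolynomial.aeval (P g) q) ∈ polyFun GC := by
  induction q using MvPolynomial.induction_on with
  | C a => simpa using polyFun_const a
  | add p q hp hq => simpa only [map_add] using polyFun_add hp hq
  | mul_X p i hp => simpa only [map_mul, MvPolynomial.aeval_X] using polyFun_mul hp (h i)

theorem polyFun_inv {P : G0 GC → ℝ} (hP : P ∈ polyFun GC) : (fun g => P g⁻¹) ∈ polyFun GC := by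
  induction hP using polyFun_induction with
  | mat_ i j => exact mat_inv_mem_polyFun i j
  | inv_ i j => simpa only [inv_inv] using mat_mem_polyFun i j
  | const c => exact polyFun_const c
  | add P P' _ _ h h' => exact polyFun_add h h'
  | mul P P' hP hP' h h' => exact polyFun_mul h h'

theorem polyFun_det_inv : (fun g : G0 GC => (mat g).det⁻¹) ∈ polyFun GC := by
  have h : ∀ g : G0 GC, (mat g).det⁻¹ = (mat g⁻¹).det := by
    intro g
    have := congrArg Matrix.det (mat_inv_mul g)
    rw [Matrix.det_mul, Matrix.det_one] at this
    exact (eq_inv_of_mul_eq_one_left this).symm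
  simp only [h]
  simp only [Matrix.det_apply]
  refine polyFun_sum fun σ _ => ?_
  have h2 : (fun g : G0 GC => ∏ i, mat g⁻¹ (σ i) i) ∈ polyFun GC := by
    have := (polyFun GC).prod_mem (t := Finset.univ)
      (f := fun i => fun g : G0 GC => mat g⁻¹ (σ i) i) fun i _ => mat_inv_mem_polyFun _ _
    convert this using 1
    ext g
    simp
  rcases Int.units_eq_one_or (Equiv.Perm.sign σ) with h | h
  · simpa [h] using h2
  · simpa [h, Units.neg_smul] using polyFun_const_mul (-1) h2

theorem rhoR_mem_polyFun (hR : IsRealRational ρ) (i j : Fin n) :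
    (fun g : G0 GC => rhoR ρ g.1 i j) ∈ polyFun GC := by
  obtain ⟨R, hR⟩ := exists_rhoR_eq hR
  simp only [hR]
  refine polyFun_aeval (fun o => ?_) _
  rcases o with _ | ij
  · exact polyFun_det_inv
  · exact mat_mem_polyFun _ _

theorem character_mem_polyFun (h : IsRelInvariant ρ p) :
    (fun g : G0 GC => character ρ p g.1) ∈ polyFun GC := by
  obtain ⟨v, hv⟩ := h.ne_zero
  have h1 : ∀ g : G0 GC, character ρ p g.1 =
      (pfun p v)⁻¹ * MvPolynomial.aeval (fun i => act ρ g.1 v i) p := by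
    intro g
    have := h.map_act g.1 v
    rw [MvPolynomial.aeval_eq_eval]
    change _ = (pfun p v)⁻¹ * pfun p (act ρ g.1 v)
    rw [this]
    field_simp
  simp only [h1]
  refine polyFun_const_mul _ (polyFun_aeval (fun i => ?_) _)
  simp only [act_apply]
  exact polyFun_sum fun j _ =>
    polyFun_mul (rhoR_mem_polyFun h.rational i j) (polyFun_const _)

theorem curveLength_nonneg (c : ℝ → Matrix (Fin m) (Fin m) ℝ) : 0 ≤ curveLength c :=
  intervalIntegral.integral_nonneg zero_le_one fun _ _ => Real.sqrt_nonneg _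

theorem gnorm_nonneg (g : G0 GC) : 0 ≤ gnorm g := by
  refine Real.sInf_nonneg ?_
  rintro L ⟨c, -, -, -, -, rfl⟩
  exact curveLength_nonneg c

/-- Polynomial functions grow at most exponentially in `|g|`. -/
theorem exists_polyFun_le (hG : IsAlgebraicSubgroup ℝ GC) {P : G0 GC → ℝ} (hP : P ∈ polyFun GC) :
    ∃ κ C : ℝ, 0 ≤ κ ∧ 0 ≤ C ∧ ∀ g, |P g| ≤ C * Real.exp (κ * gnorm g) := by
  obtain ⟨C₀, hC₀, hmat⟩ := exists_abs_mat_le hG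
  induction hP using polyFun_induction with
  | mat_ i j => exact ⟨1, C₀, zero_le_one, hC₀.le, fun g => by simpa using (hmat g i j).1⟩
  | inv_ i j => exact ⟨1, C₀, zero_le_one, hC₀.le, fun g => by simpa using (hmat g i j).2⟩
  | const c => exact ⟨0, |c|, le_rfl, abs_nonneg c, fun g => by simp⟩
  | add P P' _ _ h h' =>
    obtain ⟨κ, C, hκ, hC, h⟩ := h
    obtain ⟨κ', C', hκ', hC', h'⟩ := h'
    refine ⟨κ + κ', C + C', by positivity, by positivity, fun g => ?_⟩
    have h1 : Real.exp (κ * gnorm g) ≤ Real.exp ((κ + κ') * gnorm g) :=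
      Real.exp_le_exp.2 (by nlinarith [gnorm_nonneg g, mul_nonneg hκ' (gnorm_nonneg g)])
    have h2 : Real.exp (κ' * gnorm g) ≤ Real.exp ((κ + κ') * gnorm g) :=
      Real.exp_le_exp.2 (by nlinarith [gnorm_nonneg g, mul_nonneg hκ (gnorm_nonneg g)])
    calc |P g + P' g| ≤ |P g| + |P' g| := abs_add_le _ _
      _ ≤ C * Real.exp (κ * gnorm g) + C' * Real.exp (κ' * gnorm g) := add_le_add (h g) (h' g)
      _ ≤ C * Real.exp ((κ + κ') * gnorm g) + C' * Real.exp ((κ + κ') * gnorm g) := by gcongr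
      _ = _ := by ring
  | mul P P' hP hP' h h' =>
    obtain ⟨κ, C, hκ, hC, h⟩ := h
    obtain ⟨κ', C', hκ', hC', h'⟩ := h'
    refine ⟨κ + κ', C * C', by positivity, by positivity, fun g => ?_⟩
    calc |P g * P' g| = |P g| * |P' g| := abs_mul _ _
      _ ≤ (C * Real.exp (κ * gnorm g)) * (C' * Real.exp (κ' * gnorm g)) := by
          gcongr
          · exact h g
          · exact h' g
      _ = _ := by rw [add_mul, Real.exp_add]; ring

theorem continuous_mat_inv : Continuous fun g : G0 GC => mat g⁻¹ :=
  continuous_mat.comp continuous_inv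

theorem continuous_polyFun {P : G0 GC → ℝ} (hP : P ∈ polyFun GC) : Continuous P := by
  induction hP using polyFun_induction with
  | mat_ i j => exact continuous_mat.matrix_elem i j
  | inv_ i j => exact continuous_mat_inv.matrix_elem i j
  | const c => exact continuous_const
  | add P P' _ _ h h' => exact h.add h'
  | mul P P' hP hP' h h' => exact h.mul h'

/-- `F'` is the derivative of `F` along the left translations by `exp (-hX)`. -/
def HasLeftDeriv {E : Type*} [NormedAddCommGroup E] [NormedSpace ℝ E] (X : lieAlg GC)
    (F F' : G0 GC → E) : Prop :=
  ∀ g, HasDerivAt (fun h : ℝ => F (expG X (-h) * g)) (F' g) 0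

open scoped Matrix.Norms.Frobenius in
theorem hasDerivAt_exp_smul_apply (X : Matrix (Fin m) (Fin m) ℝ) (i j : Fin m) :
    HasDerivAt (fun t : ℝ => NormedSpace.exp (t • X) i j) (X i j) 0 := by
  have h := hasDerivAt_exp_smul_zero X
  exact (Matrix.entryLinearMap ℝ ℝ i j).toContinuousLinearMap.hasFDerivAt.comp_hasDerivAt (0 : ℝ) h

/-- Polynomial functions on the group are closed under derivatives along left translations. -/
theorem exists_leftDeriv_polyFun (X : lieAlg GC) {P : G0 GC → ℝ} (hP : P ∈ polyFun GC) :
    ∃ P' ∈ polyFun GC, HasLeftDeriv X P P' := by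
  induction hP using polyFun_induction with
  | mat_ i j =>
    refine ⟨fun g => ∑ l, -X.1 i l * mat g l j, polyFun_sum fun l _ =>
      polyFun_const_mul _ (mat_mem_polyFun l j), fun g => ?_⟩
    simp only [mat_mul, Matrix.mul_apply, mat_expG]
    refine HasDerivAt.fun_sum fun l _ => HasDerivAt.mul_const ?_ _
    have h1 := hasDerivAt_exp_smul_apply X.1 i l
    have h2 : HasDerivAt (fun t : ℝ => NormedSpace.exp (t • X.1) i l) (X.1 i l) (-0) := by
      rwa [neg_zero]
    simpa [Function.comp_def] using h2.comp (0 : ℝ) (hasDerivAt_neg (0 : ℝ))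
  | inv_ i j =>
    refine ⟨fun g => ∑ l, mat g⁻¹ i l * X.1 l j, polyFun_sum fun l _ =>
      polyFun_mul (mat_inv_mem_polyFun i l) (polyFun_const _), fun g => ?_⟩
    simp only [mul_inv_rev, ← expG_neg, neg_neg, mat_mul, Matrix.mul_apply, mat_expG]
    exact HasDerivAt.fun_sum fun l _ => (hasDerivAt_exp_smul_apply X.1 l j).const_mul _
  | const c => exact ⟨_, polyFun_const 0, fun g => hasDerivAt_const _ _⟩
  | add P P' _ _ h h' =>
    obtain ⟨Q, hQ, h⟩ := h
    obtain ⟨Q', hQ', h'⟩ := h'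
    exact ⟨_, polyFun_add hQ hQ', fun g => (h g).add (h' g)⟩
  | mul P P' hP hP' h h' =>
    obtain ⟨Q, hQ, hd⟩ := h
    obtain ⟨Q', hQ', hd'⟩ := h'
    refine ⟨_, polyFun_add (polyFun_mul hQ hP') (polyFun_mul hP hQ'), fun g => ?_⟩
    simpa using (hd g).fun_mul (hd' g)

end PolynomialFunctions

/-! ### Regular functions on algebraic groups -/

section Character

open Filter Topology

/-- If a function `χ` in a countably generated algebra of functions is such that `χ - c` is
invertible in the algebra for uncountably many constants `c`, then `χ` is algebraic: the functions
`(χ - c)⁻¹` are linearly dependent, since the algebra has countable dimension. -/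
theorem exists_polynomial_of_uncountable_inverses {σ G : Type} [Countable σ] (pt : G → σ → ℂ)
    (Q : MvPolynomial σ ℂ) (S : Set ℂ) (hS : ¬ S.Countable)
    (hinv : ∀ c ∈ S, ∃ r : MvPolynomial σ ℂ, ∀ g,
      MvPolynomial.eval (pt g) r * (MvPolynomial.eval (pt g) Q - c) = 1) :
    ∃ T : Polynomial ℂ, T ≠ 0 ∧ ∀ g, T.eval (MvPolynomial.eval (pt g) Q) = 0 := by
  classical
  choose! r hr using hinv
  let ev : MvPolynomial σ ℂ →ₗ[ℂ] (G → ℂ) :=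
    LinearMap.pi fun g => (MvPolynomial.aeval (pt g)).toLinearMap
  have hev : ∀ q g, ev q g = MvPolynomial.eval (pt g) q := fun q g => by
    simp [ev, MvPolynomial.aeval_eq_eval]
  -- uncountably many elements of a space of countable dimension
  have hdep : ¬ LinearIndependent ℂ fun c : S => ev (r c) := by
    intro h
    have h1 : LinearIndependent ℂ fun c : S => r c := LinearIndependent.of_comp ev h
    have h2 := h1.cardinal_le_rank
    rw [← (MvPolynomial.basisMonomials σ ℂ).mk_eq_rank''] at h2
    have h3 : Cardinal.mk S ≤ Cardinal.aleph0 := h2.trans Cardinal.mk_le_aleph0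
    exact hS (Cardinal.le_aleph0_iff_set_countable.1 h3)
  rw [not_linearIndependent_iff] at hdep
  obtain ⟨s, a, hsum, c₀, hc₀, ha⟩ := hdep
  -- clear denominators in the relation `∑ a_c (Q - c)⁻¹ = 0`; the resulting polynomial does not
  -- vanish at `c₀`, where all summands but one do
  refine ⟨∑ c ∈ s, Polynomial.C (a c) * ∏ c' ∈ s.erase c, (Polynomial.X - Polynomial.C (c' : ℂ)),
    fun hT => ?_, fun g => ?_⟩
  · have h1 := congrArg (Polynomial.eval (c₀ : ℂ)) hT
    rw [Polynomial.eval_finsetSum, Polynomial.eval_zero, Finset.sum_eq_single c₀] at h1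
    · simp only [Polynomial.eval_mul, Polynomial.eval_C, Polynomial.eval_prod, Polynomial.eval_sub,
        Polynomial.eval_X, mul_eq_zero, ha, false_or] at h1
      obtain ⟨c', hc', h0⟩ := Finset.prod_eq_zero_iff.1 h1
      exact (Finset.mem_erase.1 hc').1 (Subtype.ext (sub_eq_zero.1 h0).symm)
    · intro c _ hne
      simp only [Polynomial.eval_mul, Polynomial.eval_prod, Polynomial.eval_sub,
        Polynomial.eval_X, Polynomial.eval_C]
      rw [Finset.prod_eq_zero (Finset.mem_erase.2 ⟨hne.symm, hc₀⟩) (sub_self _), mul_zero]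
    · exact fun h => absurd hc₀ h
  · set x := MvPolynomial.eval (pt g) Q with hx
    have h1 := congrFun hsum g
    simp only [Finset.sum_apply, Pi.smul_apply, hev, smul_eq_mul, Pi.zero_apply] at h1
    have h2 : ∀ c ∈ s, (a c) * ∏ c' ∈ s.erase c, (x - c') =
        (∏ c' ∈ s, (x - c')) * (a c * MvPolynomial.eval (pt g) (r c)) := by
      intro c hc
      rw [← Finset.mul_prod_erase s _ hc]
      have := hr c c.2 g
      calc a c * ∏ c' ∈ s.erase c, (x - c') =
          a c * (∏ c' ∈ s.erase c, (x - c')) * (MvPolynomial.eval (pt g) (r c) * (x - c)) := by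
            rw [this, mul_one]
        _ = _ := by ring
    simp only [Polynomial.eval_finsetSum, Polynomial.eval_mul, Polynomial.eval_prod,
      Polynomial.eval_sub, Polynomial.eval_X, Polynomial.eval_C]
    rw [Finset.sum_congr rfl h2, ← Finset.mul_sum, h1, mul_zero]

/-- The entries and the inverse determinant of a matrix. -/
def coordsC (A : Matrix (Fin m) (Fin m) ℂ) : Option (Fin m × Fin m) → ℂ :=
  fun o => o.elim A.det⁻¹ fun ij => A ij.1 ij.2

/-- Denominators can be cleared in functions on the general linear group. -/
theorem exists_clear_det (Q : MvPolynomial (Option (Fin m × Fin m)) ℂ) :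
    ∃ (N : ℕ) (Q' : MvPolynomial (Fin m × Fin m) ℂ), ∀ A : Matrix (Fin m) (Fin m) ℂ, A.det ≠ 0 →
      MvPolynomial.eval (fun ij : Fin m × Fin m => A ij.1 ij.2) Q' =
        A.det ^ N * MvPolynomial.eval (coordsC A) Q := by
  let D : MvPolynomial (Fin m × Fin m) ℂ := (Matrix.mvPolynomialX (Fin m) (Fin m) ℂ).det
  have hD : ∀ A : Matrix (Fin m) (Fin m) ℂ,
      MvPolynomial.eval (fun ij : Fin m × Fin m => A ij.1 ij.2) D = A.det := by
    intro A
    rw [RingHom.map_det]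
    congr 1
    ext i j
    simp [Matrix.mvPolynomialX]
  induction Q using MvPolynomial.induction_on with
  | C a => exact ⟨0, MvPolynomial.C a, fun A _ => by simp⟩
  | add p q hp hq =>
    obtain ⟨N, p', hp⟩ := hp
    obtain ⟨M, q', hq⟩ := hq
    refine ⟨N + M, D ^ M * p' + D ^ N * q', fun A hA => ?_⟩
    simp only [map_add, map_mul, map_pow, hD, hp A hA, hq A hA]
    ring
  | mul_X p o hp =>
    obtain ⟨N, p', hp⟩ := hp
    rcases o with _ | ij
    · refine ⟨N + 1, p', fun A hA => ?_⟩
      simp only [map_mul, MvPolynomial.eval_X, hp A hA, coordsC, Option.elim_none]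
      field_simp
      ring
    · refine ⟨N, p' * MvPolynomial.X ij, fun A hA => ?_⟩
      simp only [map_mul, MvPolynomial.eval_X, hp A hA, coordsC, Option.elim_some]
      ring

theorem det_ne_zero (g : GL (Fin m) ℂ) : g.1.det ≠ 0 :=
  ((Matrix.isUnit_iff_isUnit_det _).1 g.isUnit).ne_zero

/-- A regular function on a Zariski connected group which takes only finitely many values is
constant. -/
theorem eq_one_of_finite_range {GC : Subgroup (GL (Fin m) ℂ)} (hc : IsZariskiConnected GC)
    (Q : MvPolynomial (Option (Fin m × Fin m)) ℂ)
    (h1 : MvPolynomial.eval (coordsC (1 : Matrix (Fin m) (Fin m) ℂ)) Q = 1)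
    (hfin : (range fun g : GC => MvPolynomial.eval (coordsC g.1.1) Q).Finite) (g : GC) :
    MvPolynomial.eval (coordsC g.1.1) Q = 1 := by
  classical
  set V := hfin.toFinset.erase 1
  -- the group is the disjoint union of the closed sets where `Q = 1` and where `Q` takes one of
  -- its other values
  obtain ⟨N, Q₁, hQ₁⟩ := exists_clear_det (Q - 1)
  obtain ⟨M, Q₂, hQ₂⟩ := exists_clear_det (∏ c ∈ V, (Q - MvPolynomial.C c))
  have hz1 : ∀ k : GL (Fin m) ℂ, k ∈ zeroSetGL {Q₁} ↔
      MvPolynomial.eval (coordsC k.1) Q = 1 := by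
    intro k
    simp only [zeroSetGL, mem_singleton_iff, forall_eq, mem_ofPred_eq, hQ₁ _ (det_ne_zero k),
      mul_eq_zero, pow_eq_zero_iff', det_ne_zero k, false_and, false_or, map_sub, map_one,
      sub_eq_zero]
  have hz2 : ∀ k : GL (Fin m) ℂ, k ∈ zeroSetGL {Q₂} ↔
      MvPolynomial.eval (coordsC k.1) Q ∈ V := by
    intro k
    simp only [zeroSetGL, mem_singleton_iff, forall_eq, mem_ofPred_eq, hQ₂ _ (det_ne_zero k),
      mul_eq_zero, pow_eq_zero_iff', det_ne_zero k, false_and, false_or, map_prod, map_sub,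
      MvPolynomial.eval_C, Finset.prod_eq_zero_iff, sub_eq_zero, exists_eq_right']
  have hcov : (GC : Set (GL (Fin m) ℂ)) ⊆ zeroSetGL {Q₁} ∪ zeroSetGL {Q₂} := by
    intro k hk
    by_cases h : MvPolynomial.eval (coordsC k.1) Q = 1
    · exact Or.inl ((hz1 k).2 h)
    · exact Or.inr ((hz2 k).2 (Finset.mem_erase.2 ⟨h, hfin.mem_toFinset.2 ⟨⟨k, hk⟩, rfl⟩⟩))
  have hdisj : (GC : Set (GL (Fin m) ℂ)) ∩ (zeroSetGL {Q₁} ∩ zeroSetGL {Q₂}) = ∅ := by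
    rw [eq_empty_iff_forall_notMem]
    rintro k ⟨-, hk1, hk2⟩
    exact (Finset.mem_erase.1 ((hz2 k).1 hk2)).1 ((hz1 k).1 hk1)
  rcases hc _ _ hcov hdisj with h | h
  · exact (hz1 g.1).1 (h g.2)
  · exact absurd ((hz2 1).1 (h GC.one_mem)) fun h2 => (Finset.mem_erase.1 h2).1 h1

/-- A nowhere vanishing regular function on an algebraic group has a regular inverse. -/
theorem exists_inverse_of_ne_zero {GC : Subgroup (GL (Fin m) ℂ)} (hG : IsAlgebraicSubgroup ℝ GC)
    (Q : MvPolynomial (Option (Fin m × Fin m)) ℂ)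
    (hQ : ∀ g : GC, MvPolynomial.eval (coordsC g.1.1) Q ≠ 0) :
    ∃ r : MvPolynomial (Option (Fin m × Fin m)) ℂ, ∀ g : GC,
      MvPolynomial.eval (coordsC g.1.1) r * MvPolynomial.eval (coordsC g.1.1) Q = 1 := by
  obtain ⟨P, hP⟩ := hG
  let emb : MvPolynomial (Fin m × Fin m) ℝ → MvPolynomial (Option (Fin m × Fin m)) ℂ :=
    fun q => MvPolynomial.rename some (MvPolynomial.map (algebraMap ℝ ℂ) q)
  have hemb : ∀ q (x : Option (Fin m × Fin m) → ℂ), MvPolynomial.eval x (emb q) =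
      MvPolynomial.aeval (fun ij => x (some ij)) q := by
    intro q x
    simp only [emb, MvPolynomial.eval_rename, MvPolynomial.eval_map, MvPolynomial.aeval_def]
    rfl
  -- the equation `t * det A = 1` of the general linear group
  let Dt : MvPolynomial (Option (Fin m × Fin m)) ℂ := MvPolynomial.X none *
    MvPolynomial.rename some (Matrix.mvPolynomialX (Fin m) (Fin m) ℂ).det - 1
  have hDt : ∀ x : Option (Fin m × Fin m) → ℂ, MvPolynomial.eval x Dt =
      x none * (Matrix.of fun i j => x (some (i, j))).det - 1 := by
    intro x
    simp only [Dt, map_sub, map_mul, MvPolynomial.eval_X, MvPolynomial.eval_rename, map_one]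
    rw [RingHom.map_det]
    congr 3
    ext i j
    simp [Matrix.mvPolynomialX]
  set I : Ideal (MvPolynomial (Option (Fin m × Fin m)) ℂ) := Ideal.span (emb '' P ∪ {Dt}) with hI
  have hIg : ∀ g : GC, ∀ q ∈ I, MvPolynomial.eval (coordsC g.1.1) q = 0 := by
    intro g q hq
    have : I ≤ RingHom.ker (MvPolynomial.eval (coordsC g.1.1)) := by
      rw [hI, Ideal.span_le]
      rintro _ (⟨q, hq, rfl⟩ | rfl)
      · change MvPolynomial.eval _ _ = 0
        rw [hemb]
        exact (hP g.1).1 g.2 q hq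
      · change MvPolynomial.eval _ _ = 0
        rw [hDt]
        simp only [coordsC, Option.elim_none, Option.elim_some]
        rw [show (Matrix.of fun i j => g.1.1 i j) = g.1.1 from rfl, inv_mul_cancel₀ (det_ne_zero g.1),
          sub_self]
    exact this hq
  -- a common zero of the equations of the group and of `Q` would be a group element
  have hempty : MvPolynomial.zeroLocus ℂ (I ⊔ Ideal.span {Q}) = ∅ := by
    rw [eq_empty_iff_forall_notMem]
    intro x hx
    have hx' : ∀ q ∈ I ⊔ Ideal.span {Q}, MvPolynomial.eval x q = 0 := fun q hq => by
      rw [← MvPolynomial.aeval_eq_eval]; exact hx q hq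
    have h1 : x none * (Matrix.of fun i j => x (some (i, j))).det = 1 := by
      have := hx' Dt (Ideal.mem_sup_left (Ideal.subset_span (Or.inr rfl)))
      rw [hDt] at this
      exact sub_eq_zero.1 this
    set A := Matrix.of fun i j => x (some (i, j)) with hA
    have hdet : A.det ≠ 0 := right_ne_zero_of_mul_eq_one h1
    obtain ⟨k, hk⟩ := (Matrix.isUnit_iff_isUnit_det A).2 (isUnit_iff_ne_zero.2 hdet)
    have hkG : k ∈ GC := by
      rw [hP k]
      intro q hq
      have := hx' (emb q) (Ideal.mem_sup_left (Ideal.subset_span (Or.inl ⟨q, hq, rfl⟩)))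
      rw [hemb] at this
      rw [hk]
      exact this
    have hxk : x = coordsC k.1 := by
      funext o
      rcases o with _ | ij
      · simp only [coordsC, Option.elim_none, hk]
        exact eq_inv_of_mul_eq_one_left h1
      · simp [coordsC, hk, hA]
    refine hQ ⟨k, hkG⟩ ?_
    have := hx' Q (Ideal.mem_sup_right (Ideal.mem_span_singleton_self Q))
    rwa [hxk] at this
  -- hence these equations generate the unit ideal
  have htop : (1 : MvPolynomial (Option (Fin m × Fin m)) ℂ) ∈ I ⊔ Ideal.span {Q} := by
    have h1 := MvPolynomial.vanishingIdeal_zeroLocus_eq_radical (K := ℂ) (I ⊔ Ideal.span {Q})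
    rw [hempty] at h1
    have h2 : (1 : MvPolynomial (Option (Fin m × Fin m)) ℂ) ∈ (I ⊔ Ideal.span {Q}).radical := by
      rw [← h1]
      exact fun x hx => absurd hx (notMem_empty x)
    obtain ⟨N, hN⟩ := h2
    rwa [one_pow] at hN
  obtain ⟨q, hq, s, hs, hqs⟩ := Submodule.mem_sup.1 htop
  obtain ⟨r, rfl⟩ := Ideal.mem_span_singleton'.1 hs
  refine ⟨r, fun g => ?_⟩
  have := congrArg (MvPolynomial.eval (coordsC g.1.1)) hqs
  rwa [map_add, hIg g q hq, zero_add, map_mul, map_one] at this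

/-- A regular function with countably many values on a Zariski connected group, and with value `1`
at the identity, is equal to `1`. -/
theorem eq_one_of_countable_range {GC : Subgroup (GL (Fin m) ℂ)} (hG : IsAlgebraicSubgroup ℝ GC)
    (hc : IsZariskiConnected GC) (Q : MvPolynomial (Option (Fin m × Fin m)) ℂ)
    (h1 : MvPolynomial.eval (coordsC (1 : Matrix (Fin m) (Fin m) ℂ)) Q = 1)
    (hcount : (range fun g : GC => MvPolynomial.eval (coordsC g.1.1) Q).Countable) (g : GC) :
    MvPolynomial.eval (coordsC g.1.1) Q = 1 := by
  refine eq_one_of_finite_range hc Q h1 ?_ g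
  obtain ⟨T, hT0, hT⟩ := exists_polynomial_of_uncountable_inverses
    (fun g : GC => coordsC g.1.1) Q (range fun g : GC => MvPolynomial.eval (coordsC g.1.1) Q)ᶜ
    (fun h => not_countable_complex (by
      have := h.union hcount
      rwa [compl_union_self] at this))
    (fun c hc => by
      obtain ⟨r, hr⟩ := exists_inverse_of_ne_zero hG (Q - MvPolynomial.C c) fun g h => hc ⟨g, by
        rw [map_sub, MvPolynomial.eval_C] at h
        exact sub_eq_zero.1 h⟩
      exact ⟨r, fun g => by simpa using hr g⟩)
  refine T.roots.toFinset.finite_toSet.subset ?_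
  rintro _ ⟨g, rfl⟩
  simp only [Finset.mem_coe, Multiset.mem_toFinset]
  exact (Polynomial.mem_roots hT0).2 (hT g)

end Character

/-! ### The differential of the character -/

section CharacterDerivative

open Filter Topology

variable {GC : Subgroup (GL (Fin m) ℂ)} {ρ : GC →* GL (Fin n) ℂ} {p : MvPolynomial (Fin n) ℝ}

theorem differentiableAt_eval {𝕜 E σ : Type*} [NontriviallyNormedField 𝕜] [NormedAddCommGroup E]
    [NormedSpace 𝕜 E] {f : E → σ → 𝕜} {a : E} (hf : ∀ s, DifferentiableAt 𝕜 (fun x => f x s) a)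
    (q : MvPolynomial σ 𝕜) : DifferentiableAt 𝕜 (fun x => MvPolynomial.eval (f x) q) a := by
  induction q using MvPolynomial.induction_on with
  | C c => simp
  | add p q hp hq => simpa only [map_add] using hp.fun_add hq
  | mul_X p i hp => simpa only [map_mul, MvPolynomial.eval_X] using hp.fun_mul (hf i)

/-- The Lie algebra of a complex linear group. -/
def lieAlgC (K : Subgroup (GL (Fin m) ℂ)) : Set (Matrix (Fin m) (Fin m) ℂ) :=
  {X | ∀ t : ℝ, NormedSpace.exp (t • X) ∈ matSubmonoid K}

theorem add_mem_lieAlgC (hG : IsAlgebraicSubgroup ℝ GC) {X Y : Matrix (Fin m) (Fin m) ℂ}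
    (hX : X ∈ lieAlgC GC) (hY : Y ∈ lieAlgC GC) : X + Y ∈ lieAlgC GC := by
  open scoped Matrix.Norms.Frobenius in
  exact (isClosedUnitGroup_matSubmonoid
    (isClosed_of_isAlgebraicSubgroup hG)).exp_smul_add_mem hX hY

theorem eventually_exists_exp_lieAlgC (hG : IsAlgebraicSubgroup ℝ GC) :
    ∀ᶠ g : GC in 𝓝 1, ∃ X ∈ lieAlgC GC, NormedSpace.exp X = g.1.1 :=
  eventually_exists_exp (isClosed_of_isAlgebraicSubgroup hG)

theorem exp_map_ringHom {𝕜 : Type*} [RCLike 𝕜] (f : 𝕜 →+* ℂ) (hf : Continuous f)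
    (X : Matrix (Fin m) (Fin m) 𝕜) :
    (NormedSpace.exp X).map f = NormedSpace.exp (X.map f) := by
  open scoped Matrix.Norms.Frobenius in
  exact NormedSpace.map_exp (f.mapMatrix (m := Fin m)) (continuous_id.matrix_map hf) X

theorem differentiableAt_coordsC (Q : MvPolynomial (Option (Fin m × Fin m)) ℂ)
    {a : Fin m × Fin m → ℂ} (ha : (Matrix.of fun i j => a (i, j)).det ≠ 0) :
    DifferentiableAt ℂ (fun a : Fin m × Fin m → ℂ =>
      MvPolynomial.eval (coordsC (Matrix.of fun i j => a (i, j))) Q) a := by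
  refine differentiableAt_eval (fun o => ?_) Q
  have hentry : ∀ ij : Fin m × Fin m,
      DifferentiableAt ℂ (fun a : Fin m × Fin m → ℂ => a ij) a := fun ij =>
    differentiableAt_apply ij a
  have hdet : DifferentiableAt ℂ
      (fun a : Fin m × Fin m → ℂ => (Matrix.of fun i j => a (i, j)).det) a := by
    have h : (fun a : Fin m × Fin m → ℂ => (Matrix.of fun i j => a (i, j)).det) = fun a =>
        MvPolynomial.eval a (Matrix.mvPolynomialX (Fin m) (Fin m) ℂ).det := by
      funext a
      rw [RingHom.map_det]
      congr 1
      ext i j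
      simp [Matrix.mvPolynomialX]
    rw [h]
    exact differentiableAt_eval hentry _
  rcases o with _ | ij
  · exact hdet.fun_inv ha
  · exact hentry ij

theorem hasDerivAt_exp_smul_matrix_apply (X : Matrix (Fin m) (Fin m) ℂ) (i j : Fin m) (z : ℂ) :
    HasDerivAt (fun z : ℂ => NormedSpace.exp (z • X) i j) ((NormedSpace.exp (z • X) * X) i j) z := by
  open scoped Matrix.Norms.Frobenius in
  exact (Matrix.entryLinearMap ℂ ℂ i j).toContinuousLinearMap.hasFDerivAt.comp_hasDerivAt z
    (hasDerivAt_exp_smul_const (𝕂 := ℂ) X z)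

/-- The Lie algebra of a complex algebraic group is closed under multiplication by `i`, because
`q (exp (z X))` is an entire function of `z` for each defining polynomial `q`. -/
theorem I_smul_mem_lie (hG : IsAlgebraicSubgroup ℝ GC) {X : Matrix (Fin m) (Fin m) ℂ}
    (hX : X ∈ lieAlgC GC) :
    Complex.I • X ∈ lieAlgC GC := by
  obtain ⟨P, hP⟩ := id hG
  have hmem : ∀ z : ℂ, NormedSpace.exp (z • X) ∈ matSubmonoid GC ↔
      ∀ q ∈ P, MvPolynomial.aeval
        (fun ij : Fin m × Fin m => NormedSpace.exp (z • X) ij.1 ij.2) q = 0 := by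
    intro z
    obtain ⟨u, hu⟩ := Matrix.isUnit_exp (z • X)
    rw [← hu, coe_mem_matSubmonoid, hP]
  have hzero : ∀ q ∈ P, ∀ z : ℂ, MvPolynomial.aeval
      (fun ij : Fin m × Fin m => NormedSpace.exp (z • X) ij.1 ij.2) q = 0 := by
    intro q hq
    have hd : Differentiable ℂ fun z : ℂ => MvPolynomial.aeval
        (fun ij : Fin m × Fin m => NormedSpace.exp (z • X) ij.1 ij.2) q := by
      intro z
      simp only [MvPolynomial.aeval_def, MvPolynomial.eval₂_eq_eval_map]
      refine differentiableAt_eval (fun ij => ?_) _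
      exact (hasDerivAt_exp_smul_matrix_apply X ij.1 ij.2 z).differentiableAt
    have han : AnalyticOnNhd ℂ (fun z : ℂ => MvPolynomial.aeval
        (fun ij : Fin m × Fin m => NormedSpace.exp (z • X) ij.1 ij.2) q) univ :=
      fun z _ => hd.analyticAt z
    have hreal : ∀ t : ℝ, MvPolynomial.aeval
        (fun ij : Fin m × Fin m => NormedSpace.exp ((t : ℂ) • X) ij.1 ij.2) q = 0 := by
      intro t
      refine (hmem t).1 ?_ q hq
      have := hX t
      rwa [← Complex.coe_smul] at this
    have hseq : Tendsto (fun k : ℕ => (((1 / ((k : ℝ) + 1) : ℝ)) : ℂ)) atTop (𝓝[≠] 0) := by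
      refine tendsto_nhdsWithin_iff.2 ⟨?_, Eventually.of_forall fun k => ?_⟩
      · have := (Complex.continuous_ofReal.tendsto 0).comp tendsto_one_div_add_atTop_nhds_zero_nat
        simpa [Function.comp_def] using this
      · simp only [mem_compl_iff, mem_singleton_iff, Complex.ofReal_eq_zero]
        positivity
    -- the entire function vanishes on the real axis, hence at points accumulating at `0`
    have hfreq : ∃ᶠ z in 𝓝[≠] (0 : ℂ), MvPolynomial.aeval
        (fun ij : Fin m × Fin m => NormedSpace.exp (z • X) ij.1 ij.2) q = 0 :=
      hseq.frequently (Eventually.of_forall fun k => hreal _).frequently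
    exact fun z => han.eqOn_zero_of_preconnected_of_frequently_eq_zero isPreconnected_univ
      (mem_univ 0) hfreq (mem_univ z)
  intro t
  rw [← Complex.coe_smul, smul_smul]
  exact (hmem _).2 fun q hq => hzero q hq _

/-- The defining equations have real coefficients, so that the complex group is stable under
complex conjugation. -/
theorem conj_mem_lie (hG : IsAlgebraicSubgroup ℝ GC) {X : Matrix (Fin m) (Fin m) ℂ}
    (hX : X ∈ lieAlgC GC) :
    X.map (starRingEnd ℂ) ∈
      lieAlgC GC := by
  obtain ⟨P, hP⟩ := id hG
  intro t
  have h1 : t • X.map (starRingEnd ℂ) = (t • X).map (starRingEnd ℂ) := by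
    ext i j
    simp
  rw [h1, ← exp_map_ringHom (starRingEnd ℂ) Complex.continuous_conj]
  obtain ⟨g, hg, hgX⟩ := hX t
  have hgX : (g : Matrix (Fin m) (Fin m) ℂ) = NormedSpace.exp (t • X) := hgX
  rw [← hgX]
  have : Matrix.GeneralLinearGroup.map (starRingEnd ℂ) g ∈ GC := by
    rw [hP]
    intro q hq
    have h2 := (hP g).1 hg q hq
    have h3 := congrArg (starRingEnd ℂ) h2
    rw [map_zero] at h3
    rw [← h3]
    simp only [MvPolynomial.aeval_def]
    rw [← MvPolynomial.coe_eval₂Hom, ← MvPolynomial.coe_eval₂Hom, MvPolynomial.map_eval₂Hom]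
    have h4 : (starRingEnd ℂ).comp (algebraMap ℝ ℂ) = algebraMap ℝ ℂ := by
      ext r
      simp
    rw [h4]
    rfl
  exact coe_mem_matSubmonoid.2 this

/-- The complex Lie algebra is the complexification of the real one: a complex linear form that
vanishes on the real Lie algebra vanishes on the complex one. -/
theorem eq_zero_of_eq_zero_on_lieAlg (hG : IsAlgebraicSubgroup ℝ GC)
    (L : Matrix (Fin m) (Fin m) ℂ →ₗ[ℂ] ℂ)
    (hL : ∀ X : lieAlg GC, L (X.1.map (algebraMap ℝ ℂ)) = 0) {X : Matrix (Fin m) (Fin m) ℂ}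
    (hX : X ∈ lieAlgC GC) :
    L X = 0 := by
  -- `Y + conj Y` is real; this is applied to `Y = X` and `Y = i X`
  have key : ∀ Y ∈ lieAlgC GC,
      L (Y + Y.map (starRingEnd ℂ)) = 0 := by
    intro Y hY
    have hmem := add_mem_lieAlgC hG hY (conj_mem_lie hG hY)
    set Z : Matrix (Fin m) (Fin m) ℝ := Matrix.of fun i j => 2 * (Y i j).re with hZ
    have hYZ : Y + Y.map (starRingEnd ℂ) = Z.map (algebraMap ℝ ℂ) := by
      ext i j
      simp [hZ, Complex.add_conj]
    rw [hYZ] at hmem ⊢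
    refine hL ⟨Z, fun t => ?_⟩
    have h1 := hmem t
    have h2 : t • Z.map (algebraMap ℝ ℂ) = (t • Z).map (algebraMap ℝ ℂ) := by
      ext i j
      simp
    rw [h2, ← exp_map_ringHom (algebraMap ℝ ℂ) Complex.continuous_ofReal] at h1
    exact coe_mem_matSubmonoid (g := Matrix.GeneralLinearGroup.map (algebraMap ℝ ℂ)
      (expGL (t • Z))).1 h1
  have h1 := key X hX
  have h2 := key _ (I_smul_mem_lie hG hX)
  have h3 : (Complex.I • X).map (starRingEnd ℂ) = -(Complex.I • X.map (starRingEnd ℂ)) := by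
    ext i j
    simp
  rw [h3, map_add, map_neg, map_smul, map_smul, ← sub_eq_add_neg, ← smul_sub, smul_eq_mul,
    mul_eq_zero] at h2
  have h4 := h2.resolve_left Complex.I_ne_zero
  rw [map_add] at h1
  linear_combination (h1 + h4) / 2

theorem eval_aeval {σ τ : Type*} (x : τ → ℂ) (F : σ → MvPolynomial τ ℂ) (q : MvPolynomial σ ℂ) :
    MvPolynomial.eval x (MvPolynomial.aeval F q) =
      MvPolynomial.eval (fun i => MvPolynomial.eval x (F i)) q := by
  induction q using MvPolynomial.induction_on with
  | C a => simp
  | add p q hp hq => simp only [map_add, hp, hq]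
  | mul_X p i hp => simp only [map_mul, hp, MvPolynomial.aeval_X, MvPolynomial.eval_X]

/-- The character of the relative invariant as a regular function on the complex group. -/
theorem exists_regular_character (hR : IsRealRational ρ) {q : MvPolynomial (Fin n) ℂ}
    {v₀ : Fin n → ℂ} :
    ∃ Q : MvPolynomial (Option (Fin m × Fin m)) ℂ, ∀ g : GC,
      MvPolynomial.eval (coordsC g.1.1) Q =
        MvPolynomial.eval ((ρ g).1 *ᵥ v₀) q / MvPolynomial.eval v₀ q := by
  obtain ⟨R, hR⟩ := hR
  refine ⟨MvPolynomial.C (MvPolynomial.eval v₀ q)⁻¹ * MvPolynomial.aeval (fun i => ∑ j,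
    MvPolynomial.map (algebraMap ℝ ℂ) (R i j) * MvPolynomial.C (v₀ j)) q, fun g => ?_⟩
  rw [map_mul, MvPolynomial.eval_C, div_eq_inv_mul]
  congr 1
  rw [eval_aeval]
  congr 2
  funext i
  simp only [map_sum, map_mul, MvPolynomial.eval_C, Matrix.mulVec, dotProduct]
  refine Finset.sum_congr rfl fun j _ => ?_
  rw [hR g i j, MvPolynomial.aeval_def, MvPolynomial.eval₂_eq_eval_map]
  rfl

theorem secondCountableTopology_linearGroup {𝕜 : Type*} [RCLike 𝕜] :
    SecondCountableTopology (GL (Fin m) 𝕜) := by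
  open scoped Matrix.Norms.Frobenius in
  exact (Units.isOpenEmbedding_val (R := Matrix (Fin m) (Fin m) 𝕜)).isEmbedding
    |>.secondCountableTopology

/-- The differential of the character is not zero on the real Lie algebra. Otherwise it would
vanish on the complex Lie algebra, so the character would be locally constant on the complex group
and would take only countably many values; then it would be trivial, and `p` would be constant on
the dense orbit. -/
theorem exists_deriv_character_ne_zero (hPV : IsReductivePHV GC ρ)
    (hp : Irreducible (MvPolynomial.map (algebraMap ℝ ℂ) p))
    (hpS : singularSet ρ = {v | MvPolynomial.eval v (MvPolynomial.map (algebraMap ℝ ℂ) p) = 0}) :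
    ∃ X : lieAlg GC, deriv (fun h : ℝ => character ρ p (expR X h)) 0 ≠ 0 := by
  by_contra! hall
  have hG := hPV.algebraic
  set q := MvPolynomial.map (algebraMap ℝ ℂ) p with hq
  obtain ⟨v₀, hdense⟩ := hPV.prehomogeneous
  have hv₀ : MvPolynomial.eval v₀ q ≠ 0 := by
    intro h
    have h1 : v₀ ∈ singularSet ρ := by
      rw [hpS]
      exact h
    exact h1 hdense
  obtain ⟨Q, hQ⟩ := exists_regular_character (GC := GC) (ρ := ρ) hPV.rational (q := q) (v₀ := v₀)
  set χ : GC → ℂ := fun g => MvPolynomial.eval (coordsC g.1.1) Q with hχ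
  have hinv : ∀ (g : GC) v, MvPolynomial.eval ((ρ g).1 *ᵥ v) q = χ g * MvPolynomial.eval v q := by
    intro g v
    obtain ⟨c, hc⟩ := exists_relative_invariant hp hpS g
    have : χ g = c := by
      simp only [hχ]
      rw [hQ, hc, mul_div_cancel_right₀ _ hv₀]
    rw [this, hc]
  have hmul : ∀ g k : GC, χ (g * k) = χ g * χ k := by
    intro g k
    have h1 := hinv (g * k) v₀
    rw [map_mul, Units.val_mul, ← Matrix.mulVec_mulVec, hinv, hinv, ← mul_assoc] at h1
    exact (mul_right_cancel₀ hv₀ h1).symm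
  have hone : χ 1 = 1 := by
    have h1 := hinv 1 v₀
    rw [map_one, Units.val_one, Matrix.one_mulVec] at h1
    exact mul_right_cancel₀ hv₀ (by rw [one_mul, ← h1])
  -- the character as a function `F` on matrices, with differential `L` at the identity
  set F : (Fin m × Fin m → ℂ) → ℂ := fun a =>
    MvPolynomial.eval (coordsC (Matrix.of fun i j => a (i, j))) Q with hF
  set a₁ : Fin m × Fin m → ℂ := fun ij => (1 : Matrix (Fin m) (Fin m) ℂ) ij.1 ij.2 with ha₁
  have hFd : DifferentiableAt ℂ F a₁ := by
    refine differentiableAt_coordsC Q ?_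
    have : (Matrix.of fun i j => a₁ (i, j)) = (1 : Matrix (Fin m) (Fin m) ℂ) := rfl
    rw [this, Matrix.det_one]
    exact one_ne_zero
  let L : Matrix (Fin m) (Fin m) ℂ →ₗ[ℂ] ℂ := (fderiv ℂ F a₁).toLinearMap ∘ₗ
    (LinearMap.pi fun ij : Fin m × Fin m => Matrix.entryLinearMap ℂ ℂ ij.1 ij.2)
  have hFexp : ∀ X : Matrix (Fin m) (Fin m) ℂ, HasDerivAt (fun t : ℝ => F fun ij =>
      NormedSpace.exp ((t : ℂ) • X) ij.1 ij.2) (L X) 0 := by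
    intro X
    have h1 : HasDerivAt (fun (z : ℂ) (ij : Fin m × Fin m) => NormedSpace.exp (z • X) ij.1 ij.2)
        (fun ij => X ij.1 ij.2) 0 := by
      refine hasDerivAt_pi.2 fun ij => ?_
      simpa using hasDerivAt_exp_smul_matrix_apply X ij.1 ij.2 0
    have h2 : HasFDerivAt F (fderiv ℂ F a₁)
        (fun ij : Fin m × Fin m => NormedSpace.exp ((0 : ℂ) • X) ij.1 ij.2) := by
      simpa [ha₁] using hFd.hasFDerivAt
    have h3 := h2.comp_hasDerivAt (0 : ℂ) h1
    have h4 : HasDerivAt (F ∘ fun (z : ℂ) (ij : Fin m × Fin m) =>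
        NormedSpace.exp (z • X) ij.1 ij.2) (L X) ((0 : ℝ) : ℂ) := by
      rw [Complex.ofReal_zero]
      exact h3
    exact h4.comp_ofReal
  have hchar : ∀ g : realPoints GC, ((character ρ p g : ℝ) : ℂ) = χ (toComplex g) := by
    intro g
    obtain ⟨v, hv⟩ := exists_pfun_ne_zero hp
    have h1 := hinv (toComplex g) fun i => (v i : ℂ)
    have h2 : (ρ (toComplex g)).1 *ᵥ (fun i => (v i : ℂ)) = fun i => ((act ρ g v i : ℝ) : ℂ) := by
      ext i
      rw [act_apply]
      push_cast
      simp only [rhoR_spec hPV.rational]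
      rfl
    rw [h2, hq, eval_map_ofReal, eval_map_ofReal] at h1
    change ((pfun p (act ρ g v) : ℝ) : ℂ) = _ * ((pfun p v : ℝ) : ℂ) at h1
    rw [pfun_act hPV.rational hp hpS] at h1
    push_cast at h1
    exact mul_right_cancel₀ (by exact_mod_cast hv) h1
  -- by assumption `L` vanishes on the real Lie algebra
  have hLreal : ∀ X : lieAlg GC, L (X.1.map (algebraMap ℝ ℂ)) = 0 := by
    intro X
    have h1 := hFexp (X.1.map (algebraMap ℝ ℂ))
    have h2 : (fun t : ℝ => F fun ij => NormedSpace.exp ((t : ℂ) • X.1.map (algebraMap ℝ ℂ))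
        ij.1 ij.2) = fun t : ℝ => ((character ρ p (expR X t) : ℝ) : ℂ) := by
      funext t
      rw [hchar]
      have h3 : NormedSpace.exp ((t : ℂ) • X.1.map (algebraMap ℝ ℂ)) =
          (toComplex (expR X t)).1.1 := by
        have h4 : (t : ℂ) • X.1.map (algebraMap ℝ ℂ) = (t • X.1).map (algebraMap ℝ ℂ) := by
          ext i j
          simp
        rw [h4, ← exp_map_ringHom (algebraMap ℝ ℂ) Complex.continuous_ofReal]
        rfl
      rw [h3]
      rfl
    rw [h2] at h1
    have hre : HasDerivAt (fun t : ℝ => character ρ p (expR X t))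
        (L (X.1.map (algebraMap ℝ ℂ))).re 0 := by
      have := Complex.reCLM.hasFDerivAt.comp_hasDerivAt (0 : ℝ) h1
      simpa [Function.comp_def] using this
    have him : HasDerivAt (fun _ : ℝ => (0 : ℝ)) (L (X.1.map (algebraMap ℝ ℂ))).im 0 := by
      have := Complex.imCLM.hasFDerivAt.comp_hasDerivAt (0 : ℝ) h1
      simpa [Function.comp_def] using this
    apply Complex.ext
    · rw [← hre.deriv, hall X, Complex.zero_re]
    · exact him.unique (hasDerivAt_const _ _)
  -- along one-parameter subgroups the character is a homomorphism with derivative zero at `0`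
  have hexp1 : ∀ X ∈ lieAlgC GC, ∀ g : GC, NormedSpace.exp X = g.1.1 → χ g = 1 := by
    intro X hX g hg
    have hL0 := eq_zero_of_eq_zero_on_lieAlg hG L hLreal hX
    have hd := hFexp X
    rw [hL0] at hd
    choose u hu huX using hX
    have huX : ∀ t, (u t : Matrix (Fin m) (Fin m) ℂ) = NormedSpace.exp (t • X) := huX
    set φ : ℝ → ℂ := fun t => χ ⟨u t, hu t⟩ with hφ
    have hφF : φ = fun t : ℝ => F fun ij => NormedSpace.exp ((t : ℂ) • X) ij.1 ij.2 := by
      funext t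
      simp only [hφ, hχ, hF, huX, Complex.coe_smul]
      rfl
    rw [← hφF] at hd
    have hadd : ∀ s t, φ (s + t) = φ s * φ t := by
      intro s t
      simp only [hφ]
      rw [← hmul]
      congr 1
      apply Subtype.ext
      apply Units.ext
      change (u (s + t) : Matrix (Fin m) (Fin m) ℂ) = u s * u t
      rw [huX, huX, huX, add_smul, Matrix.exp_add_of_commute]
      exact ((Commute.refl X).smul_left s).smul_right t
    have hd' : ∀ t, HasDerivAt φ 0 t := by
      intro t
      have h1 : HasDerivAt (fun s => φ t * φ (s - t)) (φ t * 0) t := by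
        refine HasDerivAt.const_mul _ ?_
        have h2 : HasDerivAt φ 0 (t - t) := by rwa [sub_self]
        simpa using h2.comp_sub_const t t
      rw [mul_zero] at h1
      refine h1.congr_of_eventuallyEq (Eventually.of_forall fun s => ?_)
      change φ s = φ t * φ (s - t)
      rw [← hadd, add_sub_cancel]
    have hconst := is_const_of_deriv_eq_zero (fun t => (hd' t).differentiableAt)
      (fun t => (hd' t).deriv) 1 0
    have hg1 : (⟨u 1, hu 1⟩ : GC) = g := by
      apply Subtype.ext
      apply Units.ext
      rw [← hg, huX, one_smul]
    have hg0 : (⟨u 0, hu 0⟩ : GC) = 1 := by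
      apply Subtype.ext
      apply Units.ext
      change (u 0 : Matrix (Fin m) (Fin m) ℂ) = 1
      rw [huX, zero_smul, NormedSpace.exp_zero]
    simp only [hφ, hg1, hg0, hone] at hconst
    exact hconst
  have hnhds : ∀ᶠ g : GC in 𝓝 1, χ g = 1 := by
    filter_upwards [eventually_exists_exp_lieAlgC hG] with g hg
    obtain ⟨X, hX, hXg⟩ := hg
    exact hexp1 X hX g hXg
  -- the level sets of the character are open and disjoint, hence countable in number
  have hopen : ∀ c, IsOpen {g : GC | χ g = c} := by
    intro c
    rw [isOpen_iff_mem_nhds]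
    intro g hg
    have h1 : Tendsto (fun k : GC => g⁻¹ * k) (𝓝 g) (𝓝 1) := by
      have : Continuous fun k : GC => g⁻¹ * k := continuous_const.mul continuous_id
      simpa using this.tendsto g
    filter_upwards [h1.eventually hnhds] with k hk
    have h2 := hmul g (g⁻¹ * k)
    rw [hk, mul_inv_cancel_left, mul_one] at h2
    exact h2.trans hg
  have hcount : (range χ).Countable := by
    have := secondCountableTopology_linearGroup (m := m) (𝕜 := ℂ)
    have : SecondCountableTopology GC := Topology.IsEmbedding.subtypeVal.secondCountableTopology
    refine Set.PairwiseDisjoint.countable_of_isOpen (s := fun c => {g : GC | χ g = c}) ?_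
      (fun c _ => hopen c) fun c hc => hc
    intro c _ c' _ hcc'
    refine Set.disjoint_left.2 fun g hg hg' => hcc' ?_
    exact hg.symm.trans hg'
  have htriv : ∀ g, χ g = 1 := eq_one_of_countable_range hG hPV.connected Q hone hcount
  -- so `q` is constant on the dense orbit
  have hconst : q - MvPolynomial.C (MvPolynomial.eval v₀ q) = 0 := by
    have h1 : q - MvPolynomial.C (MvPolynomial.eval v₀ q) ∈
        MvPolynomial.vanishingIdeal ℂ (orbit ρ v₀) := by
      rintro _ ⟨g, rfl⟩
      rw [MvPolynomial.aeval_eq_eval]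
      rw [map_sub, MvPolynomial.eval_C, hinv, htriv, one_mul, sub_self]
    rw [hdense] at h1
    exact h1
  rw [sub_eq_zero] at hconst
  apply hp.not_isUnit
  rw [hconst]
  exact (isUnit_iff_ne_zero.2 hv₀).map MvPolynomial.C

end CharacterDerivative

/-! ### Adapted charts -/

section Charts

open Filter Topology

variable {GC : Subgroup (GL (Fin m) ℂ)}

theorem hasFDerivAt_pfun (p : MvPolynomial (Fin n) ℝ) (v : VR n) :
    HasFDerivAt (pfun p) (∑ i, MvPolynomial.eval v.ofLp (MvPolynomial.pderiv i p) •
      (EuclideanSpace.proj i : VR n →L[ℝ] ℝ)) v := by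
  have hX : ∀ i, HasFDerivAt (fun v : VR n => v i) (EuclideanSpace.proj i : VR n →L[ℝ] ℝ) v :=
    fun i => (EuclideanSpace.proj i : VR n →L[ℝ] ℝ).hasFDerivAt
  induction p using MvPolynomial.induction_on with
  | C a =>
    simp only [MvPolynomial.pderiv_C, map_zero, zero_smul, Finset.sum_const_zero]
    have : pfun (MvPolynomial.C a) = fun _ : VR n => a := by
      funext v
      simp [pfun]
    rw [this]
    exact hasFDerivAt_const a v
  | add p q hp hq =>
    have : pfun (p + q) = fun v : VR n => pfun p v + pfun q v := by
      funext v
      simp [pfun]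
    rw [this]
    refine (hp.add hq).congr_fderiv ?_
    simp only [map_add, add_smul, Finset.sum_add_distrib]
  | mul_X p i hp =>
    have : pfun (p * MvPolynomial.X i) = fun v : VR n => pfun p v * v i := by
      funext v
      simp [pfun]
    rw [this]
    refine (hp.mul (hX i)).congr_fderiv ?_
    ext u
    simp only [MvPolynomial.pderiv_mul, map_add, map_mul, MvPolynomial.eval_X, pfun, add_smul,
      Finset.sum_add_distrib, add_apply, sum_apply,
      smul_apply, smul_eq_mul, PiLp.proj_apply, Finset.mul_sum]
    rw [add_comm]
    congr 1
    · exact Finset.sum_congr rfl fun k _ => by ring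
    · rw [Finset.sum_eq_single i]
      · simp
      · intro k _ hk
        rw [MvPolynomial.pderiv_X_of_ne hk.symm]
        simp
      · simp

theorem fderiv_pfun_apply (p : MvPolynomial (Fin n) ℝ) (v u : VR n) :
    fderiv ℝ (pfun p) v u = ∑ i, MvPolynomial.eval v.ofLp (MvPolynomial.pderiv i p) * u i := by
  rw [(hasFDerivAt_pfun p v).fderiv]
  simp

theorem contDiff_pfun (p : MvPolynomial (Fin n) ℝ) : ContDiff ℝ ∞ (pfun p) := by
  induction p using MvPolynomial.induction_on with
  | C a =>
    have : pfun (MvPolynomial.C a) = fun _ : VR n => a := by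
      funext v
      simp [pfun]
    rw [this]
    exact contDiff_const
  | add p q hp hq =>
    have : pfun (p + q) = fun v : VR n => pfun p v + pfun q v := by
      funext v
      simp [pfun]
    rw [this]
    exact hp.add hq
  | mul_X p i hp =>
    have : pfun (p * MvPolynomial.X i) = fun v : VR n => pfun p v * v i := by
      funext v
      simp [pfun]
    rw [this]
    exact hp.mul (EuclideanSpace.proj i : VR n →L[ℝ] ℝ).contDiff

@[simp] theorem kappa_zero (p : MvPolynomial (Fin (d + 1)) ℝ) (l : Fin d → Fin (d + 1))
    (v : VR (d + 1)) : kappa p l v 0 = pfun p v := rfl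

@[simp] theorem setFirst_zero (t : ℝ) (x : VR (d + 1)) : setFirst t x 0 = t := rfl

@[simp] theorem setFirst_succ (t : ℝ) (x : VR (d + 1)) (i : Fin d) :
    setFirst t x i.succ = x i.succ := rfl

theorem contDiff_kappa (p : MvPolynomial (Fin (d + 1)) ℝ) (l : Fin d → Fin (d + 1)) :
    ContDiff ℝ ∞ (kappa p l) := by
  rw [contDiff_euclidean]
  intro i
  refine Fin.cases ?_ (fun i => ?_) i
  · exact contDiff_pfun p
  · exact (EuclideanSpace.proj (l i) : VR (d + 1) →L[ℝ] ℝ).contDiff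

theorem fderiv_kappa_zero (p : MvPolynomial (Fin (d + 1)) ℝ) (l : Fin d → Fin (d + 1))
    (v u : VR (d + 1)) : fderiv ℝ (kappa p l) v u 0 = fderiv ℝ (pfun p) v u := by
  have h := ((contDiff_kappa p l).differentiable (by simp) v).hasFDerivAt
  have h1 := (EuclideanSpace.proj 0 : VR (d + 1) →L[ℝ] ℝ).hasFDerivAt.comp v h
  have h2 : HasFDerivAt (pfun p)
      ((EuclideanSpace.proj 0 : VR (d + 1) →L[ℝ] ℝ) ∘L fderiv ℝ (kappa p l) v) v := h1
  rw [h2.fderiv]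
  rfl

theorem fderiv_kappa_succ (p : MvPolynomial (Fin (d + 1)) ℝ) (l : Fin d → Fin (d + 1))
    (v u : VR (d + 1)) (i : Fin d) : fderiv ℝ (kappa p l) v u i.succ = u (l i) := by
  have h := ((contDiff_kappa p l).differentiable (by simp) v).hasFDerivAt
  have h1 := (EuclideanSpace.proj i.succ : VR (d + 1) →L[ℝ] ℝ).hasFDerivAt.comp v h
  have h2 : HasFDerivAt (fun v : VR (d + 1) => v (l i))
      ((EuclideanSpace.proj i.succ : VR (d + 1) →L[ℝ] ℝ) ∘L fderiv ℝ (kappa p l) v) v := h1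
  have h3 := h2.unique (EuclideanSpace.proj (l i) : VR (d + 1) →L[ℝ] ℝ).hasFDerivAt
  exact congrArg (fun L : VR (d + 1) →L[ℝ] ℝ => L u) h3

/-- The indices `l₁, …, l_{n-1}` exhaust the complement of `j`. -/
theorem exists_index_of_ne {l : Fin d → Fin (d + 1)} (hl : Function.Injective l)
    {j : Fin (d + 1)} (hlj : ∀ i, l i ≠ j) {k : Fin (d + 1)} (hk : k ≠ j) : ∃ i, l i = k := by
  classical
  have h1 : Finset.univ.image l = Finset.univ.erase j := by
    refine Finset.eq_of_subset_of_card_le (fun k hk => ?_) ?_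
    · obtain ⟨i, -, rfl⟩ := Finset.mem_image.1 hk
      exact Finset.mem_erase.2 ⟨hlj i, Finset.mem_univ _⟩
    · rw [Finset.card_image_of_injective _ hl, Finset.card_erase_of_mem (Finset.mem_univ _)]
      simp
  have h2 : k ∈ Finset.univ.image l := by
    rw [h1]
    exact Finset.mem_erase.2 ⟨hk, Finset.mem_univ _⟩
  obtain ⟨i, -, hi⟩ := Finset.mem_image.1 h2
  exact ⟨i, hi⟩

/-- The map `κ` is a local diffeomorphism where `∂p/∂v_j ≠ 0`. -/
theorem exists_kappa_local_inverse (p : MvPolynomial (Fin (d + 1)) ℝ) {l : Fin d → Fin (d + 1)}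
    (hl : Function.Injective l) {j : Fin (d + 1)} (hlj : ∀ i, l i ≠ j) {v : VR (d + 1)}
    (hv : MvPolynomial.eval v.ofLp (MvPolynomial.pderiv j p) ≠ 0) :
    ∃ e : OpenPartialHomeomorph (VR (d + 1)) (VR (d + 1)), (e : VR (d + 1) → VR (d + 1)) = kappa p l ∧
      v ∈ e.source ∧ ContDiffAt ℝ ∞ e.symm (kappa p l v) := by
  have hinj : Function.Injective (fderiv ℝ (kappa p l) v : VR (d + 1) →ₗ[ℝ] VR (d + 1)) := by
    rw [← LinearMap.ker_eq_bot, LinearMap.ker_eq_bot']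
    intro u hu
    have hu' : ∀ i, fderiv ℝ (kappa p l) v u i = 0 := fun i => by
      have : fderiv ℝ (kappa p l) v u = 0 := hu
      rw [this]
      rfl
    have hne : ∀ k, k ≠ j → u k = 0 := by
      intro k hk
      obtain ⟨i, rfl⟩ := exists_index_of_ne hl hlj hk
      rw [← fderiv_kappa_succ p l v u i]
      exact hu' _
    have h0 := hu' 0
    rw [fderiv_kappa_zero, fderiv_pfun_apply, Finset.sum_eq_single j
      (fun k _ hk => by rw [hne k hk, mul_zero]) (by simp), mul_eq_zero] at h0
    ext k
    by_cases hk : k = j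
    · rw [hk]
      exact h0.resolve_left hv
    · exact hne k hk
  let E : VR (d + 1) ≃L[ℝ] VR (d + 1) :=
    (LinearEquiv.ofInjectiveEndo _ hinj).toContinuousLinearEquiv
  have hE : (E : VR (d + 1) →L[ℝ] VR (d + 1)) = fderiv ℝ (kappa p l) v := by
    ext u
    rfl
  have hd : HasFDerivAt (kappa p l) (E : VR (d + 1) →L[ℝ] VR (d + 1)) v := by
    rw [hE]
    exact ((contDiff_kappa p l).differentiable (by simp) v).hasFDerivAt
  have hc : ContDiffAt ℝ ∞ (kappa p l) v := (contDiff_kappa p l).contDiffAt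
  refine ⟨hc.toOpenPartialHomeomorph _ hd (by simp), hc.toOpenPartialHomeomorph_coe hd (by simp),
    hc.mem_toOpenPartialHomeomorph_source hd (by simp), ?_⟩
  exact hc.to_localInverse hd (by simp)

/-- The adapted charts cover the complement of the singular points of the hypersurface. -/
theorem exists_adaptedChart {ρ : GC →* GL (Fin (d + 1)) ℂ} {p : MvPolynomial (Fin (d + 1)) ℝ}
    (hframes : HasLocalFrames ρ p) {v : VR (d + 1)} (hv : v ∈ regularDomain ρ) :
    ∃ γ : AdaptedChart ρ p, v ∈ γ.U := by
  obtain ⟨Z, hZ, hvZ, hZr, X, hX, hframe⟩ := hframes v hv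
  obtain ⟨j, hj⟩ : ∃ j, MvPolynomial.eval v.ofLp (MvPolynomial.pderiv j p) ≠ 0 := by
    -- otherwise the kernel of `dp(v)` has dimension `d + 1`, but is spanned by `d` vectors
    by_contra! hall
    have hker : LinearMap.ker (fderiv ℝ (pfun p) v : VR (d + 1) →ₗ[ℝ] ℝ) = ⊤ := by
      rw [LinearMap.ker_eq_top]
      ext1 u
      change fderiv ℝ (pfun p) v u = 0
      simp [fderiv_pfun_apply, hall]
    have h1 := hframe v hvZ
    rw [hker] at h1
    have h2 := finrank_range_le_card (R := ℝ) fun i => fundField ρ (X i) v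
    rw [Set.finrank, h1, finrank_top, finrank_euclideanSpace_fin, Fintype.card_fin] at h2
    omega
  obtain ⟨e, he, hve, -⟩ := exists_kappa_local_inverse p (Fin.succAbove_right_injective (p := j))
    (j := j) (fun i => Fin.succAbove_ne j i) hj
  set U₁ : Set (VR (d + 1)) := Z ∩ e.source ∩
    {w | MvPolynomial.eval w.ofLp (MvPolynomial.pderiv j p) ≠ 0} with hU₁
  have hopen : IsOpen U₁ := by
    refine (hZ.inter e.open_source).inter ?_
    exact isOpen_ne.preimage (contDiff_pfun (MvPolynomial.pderiv j p)).continuous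
  have hvU : v ∈ U₁ := ⟨⟨hvZ, hve⟩, hj⟩
  obtain ⟨r, hr, hball⟩ := Metric.isOpen_iff.1 hopen v hvU
  let b : ContDiffBump v := ⟨r / 4, r / 2, by positivity, by linarith⟩
  have hb : Metric.closedBall v (r / 2) ⊆ U₁ :=
    (Metric.closedBall_subset_ball (by linarith)).trans hball
  exact ⟨{
    j := j
    l := j.succAbove
    l_injective := Fin.succAbove_right_injective
    l_ne := fun i => Fin.succAbove_ne j i
    U := Metric.ball v (r / 4)
    U₁ := U₁
    isOpen_U := Metric.isOpen_ball
    isOpen_U₁ := hopen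
    subset := (Metric.ball_subset_ball (by linarith)).trans hball
    U₁_subset := fun w hw => hZr hw.1.1
    injOn := by
      rw [← he]
      exact e.injOn.mono fun w hw => hw.1.2
    pderiv_ne := fun w hw => hw.2
    X := X
    X_mem := hX
    frame := fun w hw => hframe w hw.1.1
    c := b
    c_smooth := b.contDiff
    c_compact := b.hasCompactSupport
    c_support := by
      rw [b.tsupport_eq]
      exact hb
    c_one := fun w hw => b.one_of_mem_closedBall (Metric.ball_subset_closedBall hw) },
    Metric.mem_ball_self (by positivity)⟩

namespace AdaptedChart

variable {ρ : GC →* GL (Fin (d + 1)) ℂ} {p : MvPolynomial (Fin (d + 1)) ℝ} (γ : AdaptedChart ρ p)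

theorem kinv_mem {x : VR (d + 1)} (hx : x ∈ γ.tildeU) : γ.kinv x ∈ γ.U :=
  Function.invFunOn_mem hx

theorem kappa_kinv {x : VR (d + 1)} (hx : x ∈ γ.tildeU) : kappa p γ.l (γ.kinv x) = x :=
  Function.invFunOn_eq hx

theorem pfun_kinv {x : VR (d + 1)} (hx : x ∈ γ.tildeU) : pfun p (γ.kinv x) = x 0 := by
  rw [← kappa_zero p γ.l, γ.kappa_kinv hx]

theorem kinv_kappa {v : VR (d + 1)} (hv : v ∈ γ.U) : γ.kinv (kappa p γ.l v) = v :=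
  γ.injOn (γ.subset (γ.kinv_mem (mem_image_of_mem _ hv))) (γ.subset hv)
    (γ.kappa_kinv (mem_image_of_mem _ hv))

theorem isOpen_tildeU : IsOpen γ.tildeU := by
  rw [isOpen_iff_mem_nhds]
  rintro _ ⟨v, hv, rfl⟩
  obtain ⟨e, he, hve, -⟩ := exists_kappa_local_inverse p γ.l_injective γ.l_ne
    (γ.pderiv_ne v (γ.subset hv))
  have h := e.map_nhds_eq hve
  rw [he] at h
  rw [← h]
  exact image_mem_map (γ.isOpen_U.mem_nhds hv)

theorem contDiffOn_kinv : ContDiffOn ℝ ∞ γ.kinv γ.tildeU := by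
  rintro _ ⟨v, hv, rfl⟩
  refine ContDiffAt.contDiffWithinAt ?_
  obtain ⟨e, he, hve, hsmooth⟩ := exists_kappa_local_inverse p γ.l_injective γ.l_ne
    (γ.pderiv_ne v (γ.subset hv))
  -- near `κ(v)`, the inverse `κ⁻¹` of the chart agrees with the local inverse
  refine hsmooth.congr_of_eventuallyEq ?_
  have hκv : kappa p γ.l v = e v := by rw [he]
  have htar : e v ∈ e.target := e.map_source hve
  have h1 : ∀ᶠ y in 𝓝 (e v), e.symm y ∈ γ.U := by
    have := (e.continuousAt_symm htar).tendsto
    rw [e.left_inv hve] at this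
    exact this.eventually (γ.isOpen_U.mem_nhds hv)
  rw [hκv]
  filter_upwards [h1, e.open_target.mem_nhds htar] with y hyU hyt
  have h2 : kappa p γ.l (e.symm y) = y := by
    rw [← he, e.right_inv hyt]
  conv_lhs => rw [← h2]
  exact γ.kinv_kappa hyU

/-- The components along the coordinates `v_{l₁}, …, v_{l_{n-1}}` of the fundamental vector fields
of the frame. -/
def frameMatrix (w : VR (d + 1)) : Matrix (Fin d) (Fin d) ℝ :=
  Matrix.of fun i k => fundField ρ (γ.X i) w (γ.l k)

/-- The tangent spaces of the level sets of `p` project isomorphically along the `j`-th coordinate,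
so that the frame stays a frame after projection. -/
theorem det_frameMatrix_ne_zero {w : VR (d + 1)} (hw : w ∈ γ.U₁) : (γ.frameMatrix w).det ≠ 0 := by
  classical
  have hspan := γ.frame w hw
  have hj := γ.pderiv_ne w hw
  set a := MvPolynomial.eval w.ofLp (MvPolynomial.pderiv γ.j p) with ha
  have hex : ∀ k : Fin d, ∃ c : Fin d → ℝ, ∀ k', ∑ i, c i * γ.frameMatrix w i k' =
      (1 : Matrix (Fin d) (Fin d) ℝ) k k' := by
    intro k
    set b := MvPolynomial.eval w.ofLp (MvPolynomial.pderiv (γ.l k) p) with hb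
    -- the tangent vector that projects to the `k`-th standard basis vector
    set u : VR (d + 1) := EuclideanSpace.single (γ.l k) (1 : ℝ) -
      (b / a) • EuclideanSpace.single γ.j (1 : ℝ) with hu
    have hker : u ∈ LinearMap.ker (fderiv ℝ (pfun p) w : VR (d + 1) →ₗ[ℝ] ℝ) := by
      change fderiv ℝ (pfun p) w u = 0
      have hsingle : ∀ i, fderiv ℝ (pfun p) w (EuclideanSpace.single i (1 : ℝ)) =
          MvPolynomial.eval w.ofLp (MvPolynomial.pderiv i p) := by
        intro i
        rw [fderiv_pfun_apply, Finset.sum_eq_single i]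
        · simp
        · intro k _ hk
          simp [hk]
        · simp
      rw [hu, map_sub, map_smul, hsingle, hsingle, smul_eq_mul, div_mul_cancel₀ _ hj, sub_self]
    rw [← hspan, Submodule.mem_span_range_iff_exists_fun] at hker
    obtain ⟨c, hc⟩ := hker
    refine ⟨c, fun k' => ?_⟩
    have h1 := congrArg (fun z : VR (d + 1) => z (γ.l k')) hc
    simp only [WithLp.ofLp_sum, WithLp.ofLp_smul, Finset.sum_apply, Pi.smul_apply,
      smul_eq_mul] at h1
    simp only [frameMatrix, Matrix.of_apply]
    rw [h1, hu]
    have h2 : γ.l k' ≠ γ.j := γ.l_ne k'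
    by_cases hkk : k = k'
    · subst hkk
      simp [h2]
    · have h3 : γ.l k' ≠ γ.l k := fun h => hkk (γ.l_injective h).symm
      simp [h2, h3, Matrix.one_apply_ne hkk]
  choose C hC using hex
  have hmul : Matrix.of C * γ.frameMatrix w = 1 := by
    ext k k'
    rw [Matrix.mul_apply]
    exact hC k k'
  intro h0
  have := congrArg Matrix.det hmul
  rw [Matrix.det_mul, h0, mul_zero, Matrix.det_one] at this
  exact zero_ne_one this

end AdaptedChart

end Charts

/-! ### Derivatives along left translations -/

section LeftDerivatives

open Filter Topology

variable {GC : Subgroup (GL (Fin m) ℂ)}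

theorem continuous_of_isSmoothOnGroup {f : G0 GC → ℂ} (hf : IsSmoothOnGroup f) :
    Continuous f := by
  obtain ⟨F, hF, hfF⟩ := hf
  have hmat : Continuous fun g : G0 GC => fun i j => mat g i j :=
    continuous_pi fun i => continuous_pi fun j => continuous_mat.matrix_elem i j
  have h : f = F ∘ fun g : G0 GC => fun i j => mat g i j := funext hfF
  rw [h]
  refine hF.continuousOn.comp_continuous hmat fun g => ?_
  change (mat g).det ≠ 0
  have := congrArg Matrix.det (mat_inv_mul g)
  rw [Matrix.det_mul, Matrix.det_one] at this
  exact right_ne_zero_of_mul_eq_one this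

/-- The left derivatives of smooth functions exist and are smooth: they are given by the
directional derivatives `-X A` of a smooth function on the invertible matrices `A`. -/
theorem isSmoothOnGroup_dL (X : lieAlg GC) {f : G0 GC → ℂ} (hf : IsSmoothOnGroup f) :
    IsSmoothOnGroup (dL X f) ∧ HasLeftDeriv X f (dL X f) := by
  obtain ⟨F, hF, hfF⟩ := hf
  have hopen : IsOpen {A : Fin m → Fin m → ℝ | (Matrix.of A).det ≠ 0} := by
    refine isOpen_ne.preimage ?_
    exact Continuous.matrix_det continuous_id
  have hdet : ∀ g : G0 GC, (fun i j => mat g i j) ∈ {A : Fin m → Fin m → ℝ | (Matrix.of A).det ≠ 0} := by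
    intro g
    change (mat g).det ≠ 0
    have := congrArg Matrix.det (mat_inv_mul g)
    rw [Matrix.det_mul, Matrix.det_one] at this
    exact right_ne_zero_of_mul_eq_one this
  have hder : ∀ g : G0 GC, HasDerivAt (fun h : ℝ => f (expG X (-h) * g))
      (fderiv ℝ F (fun i j => mat g i j) fun i j => ∑ l, -X.1 i l * mat g l j) 0 := by
    intro g
    have h1 : HasDerivAt (fun h : ℝ => fun i j => mat (expG X (-h) * g) i j)
        (fun i j => ∑ l, -X.1 i l * mat g l j) 0 := by
      refine hasDerivAt_pi.2 fun i => hasDerivAt_pi.2 fun j => ?_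
      simp only [mat_mul, Matrix.mul_apply, mat_expG]
      refine HasDerivAt.fun_sum fun l _ => HasDerivAt.mul_const ?_ _
      have h1 := hasDerivAt_exp_smul_apply X.1 i l
      have h2 : HasDerivAt (fun t : ℝ => NormedSpace.exp (t • X.1) i l) (X.1 i l) (-0) := by
        rwa [neg_zero]
      simpa [Function.comp_def] using h2.comp (0 : ℝ) (hasDerivAt_neg (0 : ℝ))
    have h2 : HasFDerivAt F (fderiv ℝ F fun i j => mat g i j)
        ((fun h : ℝ => fun i j => mat (expG X (-h) * g) i j) 0) := by
      have h3 := (hF.contDiffAt (hopen.mem_nhds (hdet g))).differentiableAt (by simp)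
      simpa using h3.hasFDerivAt
    have h3 := h2.comp_hasDerivAt (0 : ℝ) h1
    have h4 : (fun h : ℝ => f (expG X (-h) * g)) =
        F ∘ fun h : ℝ => fun i j => mat (expG X (-h) * g) i j := funext fun h => hfF _
    rw [h4]
    exact h3
  have hdL : ∀ g, dL X f g = fderiv ℝ F (fun i j => mat g i j) fun i j =>
      ∑ l, -X.1 i l * mat g l j := fun g => (hder g).deriv
  refine ⟨⟨fun A => fderiv ℝ F A fun i j => ∑ l, -X.1 i l * A l j, ?_, hdL⟩, fun g => ?_⟩
  · refine ContDiffOn.clm_apply (hF.fderiv_of_isOpen hopen (by simp)) (ContDiff.contDiffOn ?_)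
    refine contDiff_pi.2 fun i => contDiff_pi.2 fun j => ContDiff.sum fun l _ => ?_
    exact contDiff_const.mul (contDiff_apply_apply ℝ ℝ l j)
  · rw [hdL]
    exact hder g

theorem isSmoothOnGroup_dLWord {f : G0 GC → ℂ} (hf : IsSmoothOnGroup f)
    (w : List (lieAlg GC)) : IsSmoothOnGroup (dLWord w f) := by
  induction w with
  | nil => exact hf
  | cons X w ih => exact (isSmoothOnGroup_dL X ih).1

theorem hasLeftDeriv_dLWord {f : G0 GC → ℂ} (hf : IsSmoothOnGroup f) (X : lieAlg GC)
    (w : List (lieAlg GC)) : HasLeftDeriv X (dLWord w f) (dLWord (X :: w) f) :=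
  (isSmoothOnGroup_dL X (isSmoothOnGroup_dLWord hf w)).2

/-- A left derivative at `0` gives the derivative along the whole one-parameter subgroup. -/
theorem HasLeftDeriv.hasDerivAt {E : Type*} [NormedAddCommGroup E] [NormedSpace ℝ E]
    {X : lieAlg GC} {F F' : G0 GC → E} (h : HasLeftDeriv X F F') (g : G0 GC) (t : ℝ) :
    HasDerivAt (fun h : ℝ => F (expG X (-h) * g)) (F' (expG X (-t) * g)) t := by
  have h1 := h (expG X (-t) * g)
  have h2 : HasDerivAt (fun h : ℝ => F (expG X (-h) * (expG X (-t) * g)))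
      (F' (expG X (-t) * g)) (t - t) := by rwa [sub_self]
  have h3 := h2.comp_sub_const t t
  refine h3.congr_of_eventuallyEq (Eventually.of_forall fun s => ?_)
  simp only
  rw [← mul_assoc, ← expG_add]
  congr 3
  ring

/-- The differential at the identity of a polynomial function on the group is the restriction of a
linear form on matrices. -/
theorem exists_linear_deriv {P : G0 GC → ℝ} (hP : P ∈ polyFun GC) :
    ∃ L : Matrix (Fin m) (Fin m) ℝ →ₗ[ℝ] ℝ, ∀ X : lieAlg GC,
      HasDerivAt (fun h : ℝ => P (expG X h)) (L X.1) 0 := by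
  induction hP using polyFun_induction with
  | mat_ i j =>
    exact ⟨Matrix.entryLinearMap ℝ ℝ i j, fun X => hasDerivAt_exp_smul_apply X.1 i j⟩
  | inv_ i j =>
    refine ⟨-Matrix.entryLinearMap ℝ ℝ i j, fun X => ?_⟩
    have h2 : HasDerivAt (fun t : ℝ => NormedSpace.exp (t • X.1) i j) (X.1 i j) (-0) := by
      rw [neg_zero]
      exact hasDerivAt_exp_smul_apply X.1 i j
    have h3 := h2.comp (0 : ℝ) (hasDerivAt_neg (0 : ℝ))
    simp only [← expG_neg, mat_expG]
    simpa [Function.comp_def] using h3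
  | const c => exact ⟨0, fun X => hasDerivAt_const _ _⟩
  | add P P' _ _ h h' =>
    obtain ⟨L, h⟩ := h
    obtain ⟨L', h'⟩ := h'
    exact ⟨L + L', fun X => (h X).add (h' X)⟩
  | mul P P' _ _ h h' =>
    obtain ⟨L, h⟩ := h
    obtain ⟨L', h'⟩ := h'
    refine ⟨P' 1 • L + P 1 • L', fun X => ?_⟩
    have := (h X).fun_mul (h' X)
    simp only [expG_zero] at this
    refine this.congr_deriv ?_
    simp [mul_comm]

variable {ρ : GC →* GL (Fin n) ℂ} {p : MvPolynomial (Fin n) ℝ}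

/-- The differential of the character, as a linear form on matrices. -/
def IsRelInvariant.dchi (hrel : IsRelInvariant ρ p) : Matrix (Fin m) (Fin m) ℝ →ₗ[ℝ] ℝ :=
  (exists_linear_deriv (character_mem_polyFun hrel)).choose

theorem IsRelInvariant.hasDerivAt_character (hrel : IsRelInvariant ρ p) (X : lieAlg GC) :
    HasDerivAt (fun h : ℝ => character ρ p (expR X h)) (hrel.dchi X.1) 0 :=
  (exists_linear_deriv (character_mem_polyFun hrel)).choose_spec X

/-- The matrix coefficients of the differential of the representation, as linear forms on
matrices. -/
def IsRelInvariant.drho (hrel : IsRelInvariant ρ p) (i j : Fin n) :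
    Matrix (Fin m) (Fin m) ℝ →ₗ[ℝ] ℝ :=
  (exists_linear_deriv (rhoR_mem_polyFun hrel.rational i j)).choose

theorem IsRelInvariant.hasDerivAt_rhoR (hrel : IsRelInvariant ρ p) (i j : Fin n) (X : lieAlg GC) :
    HasDerivAt (fun h : ℝ => rhoR ρ (expR X h) i j) (hrel.drho i j X.1) 0 :=
  (exists_linear_deriv (rhoR_mem_polyFun hrel.rational i j)).choose_spec X

theorem IsRelInvariant.hasDerivAt_act (hrel : IsRelInvariant ρ p) (X : lieAlg GC) (v : VR n) :
    HasDerivAt (fun h : ℝ => act ρ (expR X h) v)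
      (WithLp.toLp 2 fun i => ∑ j, hrel.drho i j X.1 * v j) 0 := by
  rw [hasDerivAt_iff_hasFDerivAt, ← hasFDerivWithinAt_univ, hasFDerivWithinAt_euclidean]
  intro i
  rw [hasFDerivWithinAt_univ]
  have h1 : HasDerivAt (fun h : ℝ => act ρ (expR X h) v i) (∑ j, hrel.drho i j X.1 * v j) 0 := by
    simp only [act_apply]
    exact HasDerivAt.fun_sum fun j _ => (hrel.hasDerivAt_rhoR i j X).mul_const _
  refine h1.hasFDerivAt.congr_fderiv ?_
  ext
  simp

theorem IsRelInvariant.fundField_apply (hrel : IsRelInvariant ρ p) (X : lieAlg GC) (v : VR n)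
    (i : Fin n) : fundField ρ X v i = ∑ j, hrel.drho i j X.1 * v j := by
  rw [fundField, (hrel.hasDerivAt_act X v).deriv]

theorem IsRelInvariant.hasDerivAt_act_fundField (hrel : IsRelInvariant ρ p) (X : lieAlg GC)
    (v : VR n) : HasDerivAt (fun h : ℝ => act ρ (expR X h) v) (fundField ρ X v) 0 := by
  rw [fundField, (hrel.hasDerivAt_act X v).deriv]
  exact hrel.hasDerivAt_act X v

theorem IsRelInvariant.hasLeftDeriv_character_inv (hrel : IsRelInvariant ρ p) (X : lieAlg GC) :
    HasLeftDeriv X (fun g : G0 GC => character ρ p g.1⁻¹)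
      fun g => character ρ p g.1⁻¹ * hrel.dchi X.1 := by
  intro g
  have h : ∀ h : ℝ, character ρ p (expG X (-h) * g).1⁻¹ =
      character ρ p g.1⁻¹ * character ρ p (expR X h) := by
    intro h
    rw [← hrel.character_mul]
    congr 1
    have : (expG X (-h) * g)⁻¹ = g⁻¹ * expG X h := by rw [mul_inv_rev, ← expG_neg, neg_neg]
    exact congrArg Subtype.val this
  simp only [h]
  exact (hrel.hasDerivAt_character X).const_mul _

theorem act_inv_expG_mul (hR : IsRealRational ρ) (X : lieAlg GC) (h : ℝ) (g : G0 GC) (v : VR n) :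
    act ρ (expG X (-h) * g).1⁻¹ v = act ρ g.1⁻¹ (act ρ (expR X h) v) := by
  rw [← act_mul hR]
  congr 1
  have : (expG X (-h) * g)⁻¹ = g⁻¹ * expG X h := by rw [mul_inv_rev, ← expG_neg, neg_neg]
  exact congrArg Subtype.val this

/-- The action of a group element as a continuous linear map. -/
def actL (ρ : GC →* GL (Fin n) ℂ) (g : realPoints GC) : VR n →L[ℝ] VR n :=
  LinearMap.toContinuousLinearMap
    { toFun := act ρ g
      map_add' := fun v w => by simp [act_eq, Matrix.mulVec_add]
      map_smul' := fun c v => by simp [act_eq, Matrix.mulVec_smul] }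

@[simp] theorem actL_apply (g : realPoints GC) (v : VR n) : actL ρ g v = act ρ g v := rfl

theorem IsRelInvariant.hasLeftDeriv_act_inv (hrel : IsRelInvariant ρ p) (X : lieAlg GC)
    (v : VR n) : HasLeftDeriv X (fun g : G0 GC => act ρ g.1⁻¹ v)
      fun g => act ρ g.1⁻¹ (fundField ρ X v) := by
  intro g
  simp only [act_inv_expG_mul hrel.rational]
  exact (actL ρ g.1⁻¹).hasFDerivAt.comp_hasDerivAt (0 : ℝ) (hrel.hasDerivAt_act_fundField X v)

/-- The adjoint action. -/
def adLie (g : G0 GC) (Y : lieAlg GC) : lieAlg GC :=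
  ⟨mat g * Y.1 * mat g⁻¹, fun t => by
    have h : expGL (t • (mat g * Y.1 * mat g⁻¹)) = (g.1 * expR Y t * g.1⁻¹).1 := by
      apply Units.ext
      change NormedSpace.exp (t • (mat g * Y.1 * mat g⁻¹)) =
        mat g * NormedSpace.exp (t • Y.1) * mat g⁻¹
      have h1 := Matrix.exp_units_conj g.1.1 (t • Y.1)
      rw [show t • (mat g * Y.1 * mat g⁻¹) = mat g * (t • Y.1) * mat g⁻¹ by simp]
      exact h1
    rw [h]
    exact (g.1 * expR Y t * g.1⁻¹).2⟩

theorem expR_adLie (g : G0 GC) (Y : lieAlg GC) (t : ℝ) :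
    expR (adLie g Y) t = g.1 * expR Y t * g.1⁻¹ := by
  apply Subtype.ext
  apply Units.ext
  change NormedSpace.exp (t • (mat g * Y.1 * mat g⁻¹)) =
    mat g * NormedSpace.exp (t • Y.1) * mat g⁻¹
  have h1 := Matrix.exp_units_conj g.1.1 (t • Y.1)
  rw [show t • (mat g * Y.1 * mat g⁻¹) = mat g * (t • Y.1) * mat g⁻¹ by simp]
  exact h1

/-- The differential of a character is invariant under the adjoint action. -/
theorem IsRelInvariant.dchi_adLie (hrel : IsRelInvariant ρ p) (g : G0 GC) (Y : lieAlg GC) :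
    hrel.dchi (adLie g Y).1 = hrel.dchi Y.1 := by
  refine (hrel.hasDerivAt_character (adLie g Y)).unique ?_
  have : (fun h : ℝ => character ρ p (expR (adLie g Y) h)) =
      fun h => character ρ p (expR Y h) := by
    funext h
    rw [expR_adLie, hrel.character_mul, hrel.character_mul, mul_right_comm, mul_comm (character ρ p g.1),
      hrel.character_inv_mul, one_mul]
  rw [this]
  exact hrel.hasDerivAt_character Y

/-- The fundamental vector fields are equivariant: the field of `Ad(g) Y` at `v` is the image under
`g` of the field of `Y` at `g⁻¹v`. -/
theorem IsRelInvariant.fundField_adLie (hrel : IsRelInvariant ρ p) (g : G0 GC) (Y : lieAlg GC)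
    (v : VR n) : act ρ g.1⁻¹ (fundField ρ (adLie g Y) v) = fundField ρ Y (act ρ g.1⁻¹ v) := by
  have h1 := (actL ρ g.1⁻¹).hasFDerivAt.comp_hasDerivAt (0 : ℝ)
    (hrel.hasDerivAt_act_fundField (adLie g Y) v)
  have h2 := hrel.hasDerivAt_act_fundField Y (act ρ g.1⁻¹ v)
  have hfun : (⇑(actL ρ g.1⁻¹) ∘ fun h => act ρ (expR (adLie g Y) h) v) =
      fun h => act ρ (expR Y h) (act ρ g.1⁻¹ v) := by
    funext h
    simp only [Function.comp_apply, actL_apply]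
    rw [expR_adLie, ← act_mul hrel.rational, ← act_mul hrel.rational]
    congr 1
    group
  rw [hfun] at h1
  exact h1.unique h2

/-- There are finitely many elements of the Lie algebra such that the coefficients of `Ad(g) Y`
with respect to them can be chosen as polynomial functions of `g`. -/
theorem exists_adLie_eq_sum (GC : Subgroup (GL (Fin m) ℂ)) :
    ∃ (r : ℕ) (B : Fin r → lieAlg GC), ∀ Y : lieAlg GC, ∃ c : Fin r → G0 GC → ℝ,
      (∀ k, c k ∈ polyFun GC) ∧ ∀ g, (adLie g Y).1 = ∑ k, c k g • (B k).1 := by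
  -- `lieAlg GC` is only a set of matrices here: take a basis of its span that consists of its
  -- elements, and a linear left inverse `q` of the basis expansion
  obtain ⟨b, hb, hspan, hli⟩ := exists_linearIndependent ℝ (lieAlg GC)
  have hfin : Finite b := hli.finite
  obtain ⟨r, ⟨e⟩⟩ := Finite.exists_equiv_fin b
  have hli' : LinearIndependent ℝ fun k : Fin r => ((e.symm k : b) : Matrix (Fin m) (Fin m) ℝ) :=
    hli.comp _ e.symm.injective
  have hinj : Function.Injective
      (Fintype.linearCombination ℝ fun k : Fin r => ((e.symm k : b) : Matrix (Fin m) (Fin m) ℝ)) :=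
    hli'.fintypeLinearCombination_injective
  obtain ⟨q, hq⟩ := LinearMap.exists_leftInverse_of_injective _ (LinearMap.ker_eq_bot.2 hinj)
  refine ⟨r, fun k => ⟨_, hb (e.symm k).2⟩, fun Y => ⟨fun k g => q (adLie g Y).1 k, ?_, ?_⟩⟩
  · intro k
    have h1 : ∀ g : G0 GC, q (adLie g Y).1 k = ∑ i, ∑ j,
        (∑ a, (∑ a', mat g i a' * Y.1 a' a) * mat g⁻¹ a j) * q (Matrix.single i j 1) k := by
      intro g
      conv_lhs => rw [Matrix.matrix_eq_sum_single (adLie g Y).1]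
      simp only [map_sum, Finset.sum_apply]
      refine Finset.sum_congr rfl fun i _ => Finset.sum_congr rfl fun j _ => ?_
      have h2 : Matrix.single i j ((adLie g Y).1 i j) =
          (adLie g Y).1 i j • Matrix.single i j (1 : ℝ) := by simp [Matrix.smul_single]
      rw [h2, map_smul, Pi.smul_apply, smul_eq_mul]
      rfl
    simp only [h1]
    refine polyFun_sum fun i _ => polyFun_sum fun j _ => polyFun_mul (polyFun_sum fun a _ =>
      polyFun_mul (polyFun_sum fun a' _ => ?_) (mat_inv_mem_polyFun a j)) (polyFun_const _)
    exact polyFun_mul (mat_mem_polyFun i a') (polyFun_const _)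
  · intro g
    have hmem : (adLie g Y).1 ∈ LinearMap.range (Fintype.linearCombination ℝ
        fun k : Fin r => ((e.symm k : b) : Matrix (Fin m) (Fin m) ℝ)) := by
      rw [Fintype.range_linearCombination]
      have h1 : Set.range (fun k : Fin r => ((e.symm k : b) : Matrix (Fin m) (Fin m) ℝ)) = b := by
        ext x
        constructor
        · rintro ⟨k, rfl⟩
          exact (e.symm k).2
        · exact fun hx => ⟨e ⟨x, hx⟩, by simp⟩
      rw [h1, hspan]
      exact Submodule.subset_span (adLie g Y).2
    obtain ⟨a, ha⟩ := hmem
    have h2 : q (adLie g Y).1 = a := by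
      rw [← ha]
      exact LinearMap.congr_fun hq a
    simp only [h2]
    rw [← ha, Fintype.linearCombination_apply]

end LeftDerivatives

/-! ### Derivatives of the phase along the group -/

section InverseFrame

theorem contDiffOn_det {E : Type*} [NormedAddCommGroup E] [NormedSpace ℝ E] {S : Set E} {N : ℕ}
    {A : E → Matrix (Fin N) (Fin N) ℝ} (hA : ∀ i j, ContDiffOn ℝ ∞ (fun z => A z i j) S) :
    ContDiffOn ℝ ∞ (fun z => (A z).det) S := by
  simp only [Matrix.det_apply']
  exact ContDiffOn.sum fun σ _ => contDiffOn_const.mul (contDiffOn_prod fun i _ => hA _ _)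

theorem contDiffOn_matrix_inv {E : Type*} [NormedAddCommGroup E] [NormedSpace ℝ E] {S : Set E}
    {N : ℕ} {A : E → Matrix (Fin N) (Fin N) ℝ} (hA : ∀ i j, ContDiffOn ℝ ∞ (fun z => A z i j) S)
    (hdet : ∀ z ∈ S, (A z).det ≠ 0) (i j : Fin N) :
    ContDiffOn ℝ ∞ (fun z => (A z)⁻¹ i j) S := by
  simp only [Matrix.inv_def, Ring.inverse_eq_inv', Matrix.smul_apply, smul_eq_mul,
    Matrix.adjugate_apply]
  refine ((contDiffOn_det hA).inv hdet).mul (contDiffOn_det fun i' j' => ?_)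
  by_cases h : i' = j
  · subst h
    simpa using contDiffOn_const
  · simpa [Matrix.updateRow_ne h] using hA i' j'

variable {GC : Subgroup (GL (Fin m) ℂ)} {ρ : GC →* GL (Fin (d + 1)) ℂ}
  {p : MvPolynomial (Fin (d + 1)) ℝ}

theorem IsRelInvariant.contDiff_fundField (hrel : IsRelInvariant ρ p) (X : lieAlg GC)
    (i : Fin (d + 1)) : ContDiff ℝ ∞ fun v => fundField ρ X v i := by
  simp only [hrel.fundField_apply]
  refine ContDiff.sum fun j _ => contDiff_const.mul ?_
  exact (PiLp.proj (𝕜 := ℝ) 2 (fun _ : Fin (d + 1) => ℝ) j).contDiff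

/-- The derivative along `X` of the components `χ(g⁻¹)` and `(g⁻¹v)_{l_i}` of the phase. -/
def IsRelInvariant.phaseLeftDeriv (hrel : IsRelInvariant ρ p) (l : Fin d → Fin (d + 1))
    (X : lieAlg GC) (v : VR (d + 1)) (g : G0 GC) : Fin (d + 1) → ℝ :=
  Fin.cons (character ρ p g.1⁻¹ * hrel.dchi X.1) fun i => act ρ g.1⁻¹ (fundField ρ X v) (l i)

/-- The derivatives along `Ad(g) Y` of the phase are functions of `g⁻¹v`. -/
theorem IsRelInvariant.sum_phaseLeftDeriv (hrel : IsRelInvariant ρ p) (l : Fin d → Fin (d + 1))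
    {r : ℕ} {B : Fin r → lieAlg GC} {Y : lieAlg GC} {c : Fin r → G0 GC → ℝ} {g : G0 GC}
    (h : (adLie g Y).1 = ∑ k, c k g • (B k).1) (v : VR (d + 1)) (a : Fin (d + 1)) :
    ∑ k, c k g * hrel.phaseLeftDeriv l (B k) v g a =
      (Fin.cons (character ρ p g.1⁻¹ * hrel.dchi Y.1)
        fun i => fundField ρ Y (act ρ g.1⁻¹ v) (l i) : Fin (d + 1) → ℝ) a := by
  refine Fin.cases ?_ (fun i => ?_) a
  · simp only [phaseLeftDeriv, Fin.cons_zero]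
    rw [← hrel.dchi_adLie g Y, h, map_sum, Finset.mul_sum]
    refine Finset.sum_congr rfl fun k _ => ?_
    rw [map_smul, smul_eq_mul]
    ring
  · simp only [phaseLeftDeriv, Fin.cons_succ]
    rw [← hrel.fundField_adLie g Y v]
    simp only [act_apply, hrel.fundField_apply, h, map_sum, map_smul, Finset.mul_sum,
      Finset.sum_mul, smul_eq_mul]
    rw [Finset.sum_comm]
    refine Finset.sum_congr rfl fun j _ => ?_
    rw [Finset.sum_comm]
    refine Finset.sum_congr rfl fun j' _ => Finset.sum_congr rfl fun k _ => ?_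
    ring

/-- The Jacobian of the phase along the group has a right inverse over the points `g⁻¹v ∈ U₁`: an
element of the Lie algebra with `dχ ≠ 0` moves the first component, the frame moves the others. The
entries of the inverse are sums of products of smooth functions of `g⁻¹v` and polynomial functions
of `g`. -/
theorem IsRelInvariant.exists_inverse_phaseLeftDeriv (hrel : IsRelInvariant ρ p)
    (γ : AdaptedChart ρ p) {X₀ : lieAlg GC} (hX₀ : hrel.dchi X₀.1 ≠ 0) :
    ∃ (r : ℕ) (B : Fin r → lieAlg GC), ∀ a : Fin (d + 1),
      ∃ (η : Option (Fin d) → VR (d + 1) → ℝ) (P : Option (Fin d) → Fin r → G0 GC → ℝ),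
        (∀ τ, ContDiffOn ℝ ∞ (η τ) γ.U₁) ∧ (∀ τ k, P τ k ∈ polyFun GC) ∧
        ∀ (v : VR (d + 1)) (g : G0 GC), act ρ g.1⁻¹ v ∈ γ.U₁ → ∀ a',
          ∑ k, (∑ τ, η τ (act ρ g.1⁻¹ v) * P τ k g) * hrel.phaseLeftDeriv γ.l (B k) v g a' =
            if a = a' then 1 else 0 := by
  obtain ⟨r, B, hB⟩ := exists_adLie_eq_sum GC
  choose c hc hcB using hB
  -- the frame lies in the kernel of `dχ`, so that it does not move the first component
  have hdX : ∀ i, hrel.dchi (γ.X i).1 = 0 := fun i => by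
    rw [← (hrel.hasDerivAt_character (γ.X i)).deriv]
    exact γ.X_mem i
  set N : VR (d + 1) → Matrix (Fin d) (Fin d) ℝ := fun w => (γ.frameMatrix w)⁻¹ with hN
  have hNs : ∀ i j, ContDiffOn ℝ ∞ (fun w => N w i j) γ.U₁ := fun i j =>
    contDiffOn_matrix_inv (fun i j => (hrel.contDiff_fundField (γ.X i) (γ.l j)).contDiffOn)
      (fun w hw => γ.det_frameMatrix_ne_zero hw) i j
  have hNmul : ∀ w ∈ γ.U₁, ∀ i' j, ∑ i, N w i' i * fundField ρ (γ.X i) w (γ.l j) =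
      if i' = j then 1 else 0 := by
    intro w hw i' j
    have h1 : N w * γ.frameMatrix w = 1 :=
      Matrix.nonsing_inv_mul _ (isUnit_iff_ne_zero.2 (γ.det_frameMatrix_ne_zero hw))
    have h2 := congrFun (congrFun h1 i') j
    rw [Matrix.mul_apply, Matrix.one_apply] at h2
    exact h2
  -- the sum over the elements `Ad(g) X₀` and `Ad(g) X_i`
  have key : ∀ (η : Option (Fin d) → ℝ) (q : ℝ) (v : VR (d + 1)) (g : G0 GC) (a' : Fin (d + 1)),
      ∑ k, (∑ τ : Option (Fin d), η τ * (q * c (τ.elim X₀ γ.X) k g)) *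
        hrel.phaseLeftDeriv γ.l (B k) v g a' = q * ∑ τ : Option (Fin d), η τ *
        (Fin.cons (character ρ p g.1⁻¹ * hrel.dchi (τ.elim X₀ γ.X).1)
        fun i => fundField ρ (τ.elim X₀ γ.X) (act ρ g.1⁻¹ v) (γ.l i) : Fin (d + 1) → ℝ) a' := by
    intro η q v g a'
    simp only [← hrel.sum_phaseLeftDeriv γ.l (hcB _ g) v a', Finset.mul_sum, Finset.sum_mul]
    rw [Finset.sum_comm]
    refine Finset.sum_congr rfl fun τ _ => Finset.sum_congr rfl fun k _ => ?_
    ring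
  refine ⟨r, B, fun a => ?_⟩
  -- the first row is `X₀`, corrected by the frame so as to fix the other components; the other
  -- rows come from the inverse of the frame matrix
  refine Fin.cases ?_ (fun i' => ?_) a
  · refine ⟨fun τ w => τ.elim 1 fun i => -∑ i', fundField ρ X₀ w (γ.l i') * N w i' i,
      fun τ k g => (character ρ p g.1 * (hrel.dchi X₀.1)⁻¹) * c (τ.elim X₀ γ.X) k g,
      fun τ => ?_, fun τ k => ?_, fun v g hw a' => ?_⟩
    · rcases τ with _ | i
      · exact contDiffOn_const
      · exact (ContDiffOn.sum fun i' _ =>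
          (hrel.contDiff_fundField X₀ (γ.l i')).contDiffOn.mul (hNs i' i)).neg
    · exact polyFun_mul (polyFun_mul (character_mem_polyFun hrel) (polyFun_const _)) (hc _ k)
    · rw [key (fun τ => τ.elim 1 fun i => -∑ i', fundField ρ X₀ (act ρ g.1⁻¹ v) (γ.l i') *
        N (act ρ g.1⁻¹ v) i' i)]
      rw [Fintype.sum_option]
      refine Fin.cases ?_ (fun j => ?_) a'
      · simp only [Fin.cons_zero, Option.elim, hdX, mul_zero, Finset.sum_const_zero, add_zero,
          one_mul, if_true]
        have := hrel.character_inv_mul g.1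
        rw [mul_comm] at this
        field_simp
        exact this
      · simp only [Fin.cons_succ, Option.elim, one_mul]
        rw [if_neg (Fin.succ_ne_zero j).symm]
        have : ∑ i, -(∑ i', fundField ρ X₀ (act ρ g.1⁻¹ v) (γ.l i') * N (act ρ g.1⁻¹ v) i' i) *
            fundField ρ (γ.X i) (act ρ g.1⁻¹ v) (γ.l j) =
            -fundField ρ X₀ (act ρ g.1⁻¹ v) (γ.l j) := by
          simp only [neg_mul, Finset.sum_neg_distrib, Finset.sum_mul]
          rw [Finset.sum_comm]
          simp only [mul_assoc, ← Finset.mul_sum, hNmul _ hw]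
          simp
        rw [this, add_neg_cancel, mul_zero]
  · refine ⟨fun τ w => τ.elim 0 fun i => N w i' i, fun τ k g => 1 * c (τ.elim X₀ γ.X) k g,
      fun τ => ?_, fun τ k => ?_, fun v g hw a' => ?_⟩
    · rcases τ with _ | i
      · exact contDiffOn_const
      · exact hNs i' i
    · exact polyFun_mul (polyFun_const _) (hc _ k)
    · rw [key (fun τ => τ.elim 0 fun i => N (act ρ g.1⁻¹ v) i' i)]
      rw [Fintype.sum_option]
      refine Fin.cases ?_ (fun j => ?_) a'
      · simp [hdX, Fin.succ_ne_zero]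
      · simp only [Fin.cons_succ, Option.elim, zero_mul, zero_add, one_mul, hNmul _ hw,
          Fin.succ_inj]

end InverseFrame

/-! ### Sides of the hypersurface and the building blocks of amplitudes -/

section Gradients

variable {F : Type*} [NormedAddCommGroup F] [NormedSpace ℝ F]

/-- The linear map on `ℝⁿ` with prescribed values on the standard basis. -/
def ofBasis (T : Fin n → F) : VR n →L[ℝ] F :=
  ∑ b, (PiLp.proj (𝕜 := ℝ) 2 (fun _ : Fin n => ℝ) b).smulRight (T b)

theorem ofBasis_apply (T : Fin n → F) (e : VR n) : ofBasis T e = ∑ b, e b • T b := by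
  simp [ofBasis, sum_apply]

@[simp] theorem ofBasis_single (T : Fin n → F) (b : Fin n) :
    ofBasis T (EuclideanSpace.single b 1) = T b := by
  rw [ofBasis_apply, Finset.sum_eq_single b]
  · simp
  · intro b' _ h
    simp [h]
  · simp

theorem vec_eq_sum_single (e : VR n) : e = ∑ b, e b • EuclideanSpace.single b (1 : ℝ) := by
  ext i
  simp [Pi.single_apply]

/-- A linear map on `ℝⁿ` is determined by its values on the standard basis. -/
theorem eq_ofBasis (L : VR n →L[ℝ] F) : L = ofBasis fun b => L (EuclideanSpace.single b 1) := by
  ext e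
  conv_lhs => rw [vec_eq_sum_single e]
  simp [ofBasis_apply]

theorem ofBasis_eq {L : VR n →L[ℝ] F} {T : Fin n → F}
    (h : ∀ b, L (EuclideanSpace.single b 1) = T b) : L = ofBasis T := by
  rw [eq_ofBasis L]
  congr 1
  exact funext h

theorem norm_ofBasis_le (T : Fin n → F) : ‖ofBasis T‖ ≤ ∑ b, ‖T b‖ := by
  refine (norm_sum_le _ _).trans (Finset.sum_le_sum fun b _ => ?_)
  rw [ContinuousLinearMap.norm_smulRight_apply]
  refine mul_le_of_le_one_left (norm_nonneg _) ?_
  refine ContinuousLinearMap.opNorm_le_bound _ zero_le_one fun e => ?_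
  rw [one_mul]
  exact PiLp.norm_apply_le e b

end Gradients

section Sides

/-- The closed convex sets `H` in `ℝⁿ` with interior points that are given by a condition on the
sign of the first coordinate: the whole space and the two half spaces. -/
structure IsSide (H : Set (VR (d + 1))) : Prop where
  convex : Convex ℝ H
  isClosed : IsClosed H
  interior_nonempty : (interior H).Nonempty
  mem_of_scale : ∀ x ∈ H, ∀ (y : VR (d + 1)) (c : ℝ), 0 < c → y 0 = c * x 0 → y ∈ H

theorem IsSide.uniqueDiffOn {H : Set (VR (d + 1))} (hH : IsSide H) : UniqueDiffOn ℝ H :=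
  uniqueDiffOn_convex hH.convex hH.interior_nonempty

variable {GC : Subgroup (GL (Fin m) ℂ)} {ρ : GC →* GL (Fin (d + 1)) ℂ}
  {p : MvPolynomial (Fin (d + 1)) ℝ}

/-- The character is positive on the identity component. -/
theorem IsRelInvariant.character_pos (hrel : IsRelInvariant ρ p) (g : G0 GC) :
    0 < character ρ p g.1 := by
  have hconn : PreconnectedSpace (G0 GC) :=
    Subtype.preconnectedSpace (isPreconnected_connectedComponent (x := (1 : realPoints GC)))
  have hcont : Continuous fun g : G0 GC => character ρ p g.1 :=
    continuous_polyFun (character_mem_polyFun hrel)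
  have hpre := (isPreconnected_range hcont).ordConnected
  by_contra hg
  have h1 : (0 : ℝ) ∈ Set.range fun g : G0 GC => character ρ p g.1 := by
    refine hpre.out ⟨g, rfl⟩ ⟨1, rfl⟩ ⟨not_lt.1 hg, ?_⟩
    change 0 ≤ character ρ p (1 : realPoints GC)
    rw [hrel.character_one]
    exact zero_le_one
  obtain ⟨k, hk⟩ := h1
  have h2 := hrel.character_inv_mul k.1
  simp only at hk
  rw [hk, mul_zero] at h2
  exact zero_ne_one h2

theorem IsRelInvariant.character_inv_pos (hrel : IsRelInvariant ρ p) (g : G0 GC) :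
    0 < character ρ p g.1⁻¹ := hrel.character_pos g⁻¹

theorem IsRelInvariant.continuous_act_inv (hrel : IsRelInvariant ρ p) (v : VR (d + 1)) :
    Continuous fun g : G0 GC => act ρ g.1⁻¹ v := by
  refine (PiLp.continuous_toLp 2 _).comp (continuous_pi fun i => ?_)
  have : ∀ g : G0 GC, (act ρ g.1⁻¹ v) i = ∑ j, rhoR ρ g.1⁻¹ i j * v j := fun g => act_apply _ _ _
  change Continuous fun g : G0 GC => (act ρ g.1⁻¹ v) i
  simp only [this]
  exact continuous_finsetSum _ fun j _ => (continuous_polyFun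
    (polyFun_inv (rhoR_mem_polyFun hrel.rational i j))).mul continuous_const

namespace AdaptedChart

variable (γ : AdaptedChart ρ p)

/-- The point `g⁻¹v`, with `v = κ⁻¹(x)`. -/
def pt (x : VR (d + 1)) (g : G0 GC) : VR (d + 1) := act ρ g.1⁻¹ (γ.kinv x)

/-- In the chart the group acts on the first coordinate by the character. -/
theorem kappa_pt_zero (hrel : IsRelInvariant ρ p) {x : VR (d + 1)} (hx : x ∈ γ.tildeU)
    (g : G0 GC) : kappa p γ.l (γ.pt x g) 0 = character ρ p g.1⁻¹ * x 0 := by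
  rw [kappa_zero, pt, hrel.map_act, γ.pfun_kinv hx]

variable {H : Set (VR (d + 1))}

theorem kappa_pt_mem (hrel : IsRelInvariant ρ p) (hH : IsSide H) {x : VR (d + 1)}
    (hx : x ∈ γ.tildeU ∩ H) (g : G0 GC) : kappa p γ.l (γ.pt x g) ∈ H :=
  hH.mem_of_scale x hx.2 _ _ (hrel.character_inv_pos g) (γ.kappa_pt_zero hrel hx.1 g)

theorem uniqueDiffOn_inter (hH : IsSide H) : UniqueDiffOn ℝ (γ.tildeU ∩ H) := by
  rw [inter_comm]
  exact hH.uniqueDiffOn.inter γ.isOpen_tildeU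

variable (H) in
/-- The function `φ(w) D^kψ(κ(w))(e₁, …, e_k)`, with the derivatives taken within `H`. -/
def bumpTerm (φ : VR (d + 1) → ℝ) (k : ℕ) (e : Fin k → VR (d + 1)) (ψ : VR (d + 1) → ℂ)
    (w : VR (d + 1)) : ℂ :=
  (φ w : ℂ) * iteratedFDerivWithin ℝ k ψ H (kappa p γ.l w) e

variable (H) in
/-- The partial derivatives of `bumpTerm`. -/
def bumpTermDeriv (φ : VR (d + 1) → ℝ) (k : ℕ) (e : Fin k → VR (d + 1)) (j : Fin (d + 1))
    (ψ : VR (d + 1) → ℂ) (w : VR (d + 1)) : ℂ :=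
  γ.bumpTerm H (fun w => fderiv ℝ φ w (EuclideanSpace.single j 1)) k e ψ w +
    ∑ a, γ.bumpTerm H
      (fun w => φ w * fderiv ℝ (kappa p γ.l) w (EuclideanSpace.single j 1) a) (k + 1)
      (Fin.cons (EuclideanSpace.single a 1) e) ψ w

/-- Since `ψ` is smooth only on `H`, the derivative is taken within the preimage of `H`. -/
theorem hasFDerivWithinAt_bumpTerm (hH : IsSide H) {φ : VR (d + 1) → ℝ} (hφ : ContDiff ℝ ∞ φ)
    (k : ℕ) (e : Fin k → VR (d + 1)) {ψ : VR (d + 1) → ℂ} (hψ : ContDiffOn ℝ ∞ ψ H)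
    {w : VR (d + 1)} (hw : kappa p γ.l w ∈ H) :
    HasFDerivWithinAt (γ.bumpTerm H φ k e ψ) (ofBasis fun j => γ.bumpTermDeriv H φ k e j ψ w)
      (kappa p γ.l ⁻¹' H) w := by
  have hφ' : HasFDerivWithinAt (fun w => (φ w : ℂ))
      (Complex.ofRealCLM.comp (fderiv ℝ φ w)) (kappa p γ.l ⁻¹' H) w :=
    (Complex.ofRealCLM.hasFDerivAt.comp w
      (hφ.differentiable (by simp) w).hasFDerivAt).hasFDerivWithinAt
  have hκ : HasFDerivWithinAt (kappa p γ.l) (fderiv ℝ (kappa p γ.l) w) (kappa p γ.l ⁻¹' H) w :=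
    ((contDiff_kappa p γ.l).differentiable (by simp) w).hasFDerivAt.hasFDerivWithinAt
  have hD : HasFDerivWithinAt (iteratedFDerivWithin ℝ k ψ H)
      (fderivWithin ℝ (iteratedFDerivWithin ℝ k ψ H) H (kappa p γ.l w)) H (kappa p γ.l w) :=
    (hψ.differentiableOn_iteratedFDerivWithin (by exact_mod_cast WithTop.coe_lt_top _)
      hH.uniqueDiffOn _ hw).hasFDerivWithinAt
  have hDκ := hD.comp w hκ (mapsTo_preimage _ _)
  have hDe := (ContinuousMultilinearMap.apply ℝ (fun _ : Fin k => VR (d + 1)) ℂ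
    e).hasFDerivAt.comp_hasFDerivWithinAt w hDκ
  have h := hφ'.mul hDe
  refine h.congr_fderiv (ofBasis_eq fun j => ?_)
  rw [bumpTermDeriv]
  have hsum : fderiv ℝ (kappa p γ.l) w (EuclideanSpace.single j 1) = ∑ a,
      fderiv ℝ (kappa p γ.l) w (EuclideanSpace.single j 1) a • EuclideanSpace.single a (1 : ℝ) :=
    vec_eq_sum_single _
  have hit : ∀ a, iteratedFDerivWithin ℝ (k + 1) ψ H (kappa p γ.l w)
      (Fin.cons (EuclideanSpace.single a 1) e) =
      fderivWithin ℝ (iteratedFDerivWithin ℝ k ψ H) H (kappa p γ.l w)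
        (EuclideanSpace.single a 1) e := fun a => by
    rw [iteratedFDerivWithin_succ_apply_left]
    rfl
  simp only [bumpTerm, hit]
  simp only [add_apply, smul_apply, ContinuousLinearMap.comp_apply, Function.comp_apply,
    ContinuousMultilinearMap.apply_apply, smul_eq_mul, Complex.ofRealCLM_apply]
  conv_lhs => rw [hsum]
  simp only [map_sum, map_smul, sum_apply, smul_apply, Finset.mul_sum]
  rw [add_comm, mul_comm]
  congr 1
  refine Finset.sum_congr rfl fun a _ => ?_
  rw [Complex.real_smul]
  push_cast
  ring

end AdaptedChart

end Sides

/-! ### The class of amplitudes -/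

namespace AdaptedChart

section Amplitudes

variable {GC : Subgroup (GL (Fin m) ℂ)} {ρ : GC →* GL (Fin (d + 1)) ℂ}
  {p : MvPolynomial (Fin (d + 1)) ℝ} (γ : AdaptedChart ρ p) (f : G0 GC → ℂ)
  (H : Set (VR (d + 1)))

/-- The class of amplitudes: the sums of products of a function of `x`, a polynomial function of
`g`, a derivative of `f`, and a function `φ(w) D^kψ(κ(w))(e₁, …, e_k)` of `w = g⁻¹κ⁻¹(x)`. They
depend linearly on the function `ψ` on `H`. -/
inductive IsAmp : ((VR (d + 1) → ℂ) → VR (d + 1) → G0 GC → ℂ) → Prop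
  | zero : IsAmp fun _ _ _ => 0
  | base (w : List (lieAlg GC)) (φ : VR (d + 1) → ℝ) (k : ℕ) (e : Fin k → VR (d + 1))
      (hφ : ContDiff ℝ ∞ φ) (hφc : HasCompactSupport φ) (hφs : tsupport φ ⊆ γ.U₁) :
      IsAmp fun ψ x g => dLWord w f g * γ.bumpTerm H φ k e ψ (γ.pt x g)
  | coeff (s : VR (d + 1) → ℂ) (hs : ContDiffOn ℝ ∞ s (γ.tildeU ∩ H)) (T) (hT : IsAmp T) :
      IsAmp fun ψ x g => s x * T ψ x g
  | poly (P : G0 GC → ℝ) (hP : P ∈ polyFun GC) (T) (hT : IsAmp T) :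
      IsAmp fun ψ x g => (P g : ℂ) * T ψ x g
  | add (T T') (hT : IsAmp T) (hT' : IsAmp T') : IsAmp fun ψ x g => T ψ x g + T' ψ x g

/-- The functions of `x` and `g` that act on the class of amplitudes by multiplication. -/
def IsMult (c : VR (d + 1) → G0 GC → ℂ) : Prop :=
  ∀ T, γ.IsAmp f H T → γ.IsAmp f H fun ψ x g => c x g * T ψ x g

variable {γ f H}

theorem IsAmp.sum {ι : Type*} (s : Finset ι) {T : ι → (VR (d + 1) → ℂ) → VR (d + 1) → G0 GC → ℂ}
    (h : ∀ i ∈ s, γ.IsAmp f H (T i)) : γ.IsAmp f H fun ψ x g => ∑ i ∈ s, T i ψ x g := by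
  classical
  induction s using Finset.induction_on with
  | empty => simpa using IsAmp.zero
  | insert i s hi ih =>
    simp only [Finset.sum_insert hi]
    exact .add _ _ (h i (Finset.mem_insert_self i s))
      (ih fun j hj => h j (Finset.mem_insert_of_mem hj))

theorem isMult_coeff {s : VR (d + 1) → ℂ} (hs : ContDiffOn ℝ ∞ s (γ.tildeU ∩ H)) :
    γ.IsMult f H fun x _ => s x := fun T hT => .coeff s hs T hT

theorem isMult_coeff_real {s : VR (d + 1) → ℝ} (hs : ContDiffOn ℝ ∞ s (γ.tildeU ∩ H)) :
    γ.IsMult f H fun x _ => (s x : ℂ) := isMult_coeff (Complex.ofRealCLM.contDiff.comp_contDiffOn hs)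

theorem isMult_const (z : ℂ) : γ.IsMult f H fun _ _ => z := isMult_coeff contDiffOn_const

theorem isMult_poly {P : G0 GC → ℝ} (hP : P ∈ polyFun GC) : γ.IsMult f H fun _ g => (P g : ℂ) :=
  fun T hT => .poly P hP T hT

theorem IsMult.mul {c c' : VR (d + 1) → G0 GC → ℂ} (h : γ.IsMult f H c) (h' : γ.IsMult f H c') :
    γ.IsMult f H fun x g => c x g * c' x g := by
  intro T hT
  simp only [mul_assoc]
  exact h _ (h' _ hT)

theorem IsMult.add {c c' : VR (d + 1) → G0 GC → ℂ} (h : γ.IsMult f H c) (h' : γ.IsMult f H c') :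
    γ.IsMult f H fun x g => c x g + c' x g := by
  intro T hT
  simp only [add_mul]
  exact .add _ _ (h _ hT) (h' _ hT)

theorem IsMult.sub {c c' : VR (d + 1) → G0 GC → ℂ} (h : γ.IsMult f H c) (h' : γ.IsMult f H c') :
    γ.IsMult f H fun x g => c x g - c' x g := by
  have := h.add ((isMult_const (-1)).mul h')
  simpa [sub_eq_add_neg] using this

theorem IsMult.sum {ι : Type*} (s : Finset ι) {c : ι → VR (d + 1) → G0 GC → ℂ}
    (h : ∀ i ∈ s, γ.IsMult f H (c i)) : γ.IsMult f H fun x g => ∑ i ∈ s, c i x g := by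
  intro T hT
  simp only [Finset.sum_mul]
  exact IsAmp.sum s fun i hi => h i hi T hT

/-- The components of `g⁻¹σ(x)` for a smooth vector valued function `σ`. -/
theorem isMult_act (hrel : IsRelInvariant ρ p) {σ : VR (d + 1) → VR (d + 1)}
    (hσ : ∀ j, ContDiffOn ℝ ∞ (fun x => σ x j) (γ.tildeU ∩ H)) (i : Fin (d + 1)) :
    γ.IsMult f H fun x g => (act ρ g.1⁻¹ (σ x) i : ℂ) := by
  simp only [act_apply, Complex.ofReal_sum, Complex.ofReal_mul]
  exact IsMult.sum _ fun j _ => (isMult_poly (polyFun_inv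
    (rhoR_mem_polyFun hrel.rational i j))).mul (isMult_coeff_real (hσ j))

theorem contDiff_mul_of_tsupport_subset {φ η : VR (d + 1) → ℝ} {O : Set (VR (d + 1))}
    (hO : IsOpen O) (hφ : ContDiff ℝ ∞ φ) (hs : tsupport φ ⊆ O) (hη : ContDiffOn ℝ ∞ η O) :
    ContDiff ℝ ∞ fun w => φ w * η w := by
  rw [contDiff_iff_contDiffAt]
  intro w
  by_cases hw : w ∈ O
  · exact hφ.contDiffAt.mul (hη.contDiffAt (hO.mem_nhds hw))
  · have h1 : φ =ᶠ[nhds w] 0 := notMem_tsupport_iff_eventuallyEq.1 fun h => hw (hs h)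
    refine (contDiffAt_const (c := (0 : ℝ))).congr_of_eventuallyEq ?_
    filter_upwards [h1] with w' hw'
    rw [hw']
    simp

/-- Smooth functions on `U₁`, evaluated at `g⁻¹v`, act on amplitudes. -/
theorem isMult_pt {η : VR (d + 1) → ℝ} (hη : ContDiffOn ℝ ∞ η γ.U₁) :
    γ.IsMult f H fun x g => (η (γ.pt x g) : ℂ) := by
  intro T hT
  induction hT with
  | zero => simpa using IsAmp.zero
  | base w φ k e hφ hφc hφs =>
    have := IsAmp.base (f := f) (H := H) w (fun w => φ w * η w) k e
      (contDiff_mul_of_tsupport_subset γ.isOpen_U₁ hφ hφs hη) (hφc.mul_right)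
      (tsupport_mul_subset_left.trans hφs)
    convert this using 4 with ψ x g
    simp only [bumpTerm]
    push_cast
    ring
  | coeff s hs T hT ih =>
    simpa only [mul_left_comm] using IsAmp.coeff s hs _ ih
  | poly P hP T hT ih =>
    simpa only [mul_left_comm] using IsAmp.poly P hP _ ih
  | add T T' hT hT' ih ih' =>
    simpa only [mul_add] using IsAmp.add _ _ ih ih'

/-- Amplitudes are supported over `U₁`. -/
theorem IsAmp.eq_zero {T : (VR (d + 1) → ℂ) → VR (d + 1) → G0 GC → ℂ} (hT : γ.IsAmp f H T)
    (ψ : VR (d + 1) → ℂ) {x : VR (d + 1)} {g : G0 GC} (h : γ.pt x g ∉ γ.U₁) : T ψ x g = 0 := by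
  induction hT with
  | zero => rfl
  | base w φ k e hφ hφc hφs =>
    have : φ (γ.pt x g) = 0 := image_eq_zero_of_notMem_tsupport fun h' => h (hφs h')
    simp [bumpTerm, this]
  | coeff s hs T hT ih => simp only [ih, mul_zero]
  | poly P hP T hT ih => simp only [ih, mul_zero]
  | add T T' hT hT' ih ih' => simp only [ih, ih', add_zero]

theorem IsAmp.continuous (hrel : IsRelInvariant ρ p) (hH : IsSide H) (hf : IsSmoothOnGroup f)
    {T : (VR (d + 1) → ℂ) → VR (d + 1) → G0 GC → ℂ} (hT : γ.IsAmp f H T)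
    {ψ : VR (d + 1) → ℂ} (hψ : ContDiffOn ℝ ∞ ψ H) {x : VR (d + 1)}
    (hx : x ∈ γ.tildeU ∩ H) : Continuous fun g => T ψ x g := by
  induction hT with
  | zero => exact continuous_const
  | base w φ k e hφ hφc hφs =>
    have h1 := continuous_of_isSmoothOnGroup (isSmoothOnGroup_dLWord hf w)
    have h2 : Continuous fun g : G0 GC => γ.pt x g := hrel.continuous_act_inv _
    have h3 : ContinuousOn (fun y => iteratedFDerivWithin ℝ k ψ H y e) H :=
      (ContinuousMultilinearMap.apply ℝ (fun _ : Fin k => VR (d + 1)) ℂ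
        e).continuous.comp_continuousOn
        (hψ.continuousOn_iteratedFDerivWithin (by exact_mod_cast le_top) hH.uniqueDiffOn)
    have h4 : Continuous fun g : G0 GC => iteratedFDerivWithin ℝ k ψ H
        (kappa p γ.l (γ.pt x g)) e :=
      h3.comp_continuous ((contDiff_kappa p γ.l).continuous.comp h2)
        fun g => γ.kappa_pt_mem hrel hH hx g
    exact h1.mul ((Complex.continuous_ofReal.comp (hφ.continuous.comp h2)).mul h4)
  | coeff s hs T hT ih => exact continuous_const.mul ih
  | poly P hP T hT ih => exact (Complex.continuous_ofReal.comp (continuous_polyFun hP)).mul ih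
  | add T T' hT hT' ih ih' => exact ih.add ih'

theorem isAmp_bumpTermDeriv (w : List (lieAlg GC)) {φ : VR (d + 1) → ℝ} (k : ℕ)
    (e : Fin k → VR (d + 1)) (hφ : ContDiff ℝ ∞ φ) (hφc : HasCompactSupport φ)
    (hφs : tsupport φ ⊆ γ.U₁) (j : Fin (d + 1)) :
    γ.IsAmp f H fun ψ x g => dLWord w f g * γ.bumpTermDeriv H φ k e j ψ (γ.pt x g) := by
  simp only [bumpTermDeriv, mul_add, Finset.mul_sum]
  refine .add _ _ (.base w _ k e ?_ ?_ ?_) (IsAmp.sum _ fun a _ => .base w _ (k + 1) _ ?_ ?_ ?_)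
  · exact (hφ.fderiv_right (by simp)).clm_apply contDiff_const
  · exact hφc.fderiv_apply ℝ _
  · exact (tsupport_fderiv_apply_subset ℝ _).trans hφs
  · refine hφ.mul ?_
    exact (PiLp.proj (𝕜 := ℝ) 2 (fun _ : Fin (d + 1) => ℝ) a).contDiff.comp
      (((contDiff_kappa p γ.l).fderiv_right (by simp)).clm_apply contDiff_const)
  · exact hφc.mul_right
  · exact tsupport_mul_subset_left.trans hφs

theorem contDiffOn_kinv_inter : ContDiffOn ℝ ∞ γ.kinv (γ.tildeU ∩ H) :=
  γ.contDiffOn_kinv.mono inter_subset_left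

/-- Derivatives of amplitudes with respect to `x` are amplitudes. -/
theorem IsAmp.exists_hasFDerivWithinAt (hrel : IsRelInvariant ρ p) (hH : IsSide H)
    {T : (VR (d + 1) → ℂ) → VR (d + 1) → G0 GC → ℂ} (hT : γ.IsAmp f H T) :
    ∃ T' : Fin (d + 1) → (VR (d + 1) → ℂ) → VR (d + 1) → G0 GC → ℂ,
      (∀ b, γ.IsAmp f H (T' b)) ∧ ∀ ψ, ContDiffOn ℝ ∞ ψ H → ∀ x ∈ γ.tildeU ∩ H, ∀ g,
        HasFDerivWithinAt (fun x => T ψ x g) (ofBasis fun b => T' b ψ x g) (γ.tildeU ∩ H) x := by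
  induction hT with
  | zero =>
    refine ⟨fun _ _ _ _ => 0, fun _ => .zero, fun ψ _ x _ g => ?_⟩
    refine (hasFDerivWithinAt_const _ _ _).congr_fderiv (ofBasis_eq fun b => ?_)
    rfl
  | base w φ k e hφ hφc hφs =>
    set D : Fin (d + 1) → VR (d + 1) → VR (d + 1) := fun b x =>
      fderivWithin ℝ γ.kinv (γ.tildeU ∩ H) x (EuclideanSpace.single b 1)
    have hD : ∀ b j, ContDiffOn ℝ ∞ (fun x => D b x j) (γ.tildeU ∩ H) := fun b j =>
      (PiLp.proj (𝕜 := ℝ) 2 (fun _ : Fin (d + 1) => ℝ) j).contDiff.comp_contDiffOn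
        ((contDiffOn_kinv_inter.fderivWithin (γ.uniqueDiffOn_inter hH) (by simp)).clm_apply
          contDiffOn_const)
    refine ⟨fun b ψ x g => ∑ j, (act ρ g.1⁻¹ (D b x) j : ℂ) *
      (dLWord w f g * γ.bumpTermDeriv H φ k e j ψ (γ.pt x g)), fun b => IsAmp.sum _ fun j _ =>
        isMult_act hrel (hD b) j _ (isAmp_bumpTermDeriv w k e hφ hφc hφs j), ?_⟩
    intro ψ hψ x hx g
    have h1 := γ.hasFDerivWithinAt_bumpTerm hH hφ k e hψ (γ.kappa_pt_mem hrel hH hx g)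
    have h2 : HasFDerivWithinAt γ.kinv (fderivWithin ℝ γ.kinv (γ.tildeU ∩ H) x)
        (γ.tildeU ∩ H) x :=
      (contDiffOn_kinv_inter.differentiableOn (by simp) x hx).hasFDerivWithinAt
    have h3 := (actL ρ g.1⁻¹).hasFDerivAt.comp_hasFDerivWithinAt x h2
    have h4 := h1.comp x h3 fun y hy => γ.kappa_pt_mem hrel hH hy g
    refine (h4.const_mul (dLWord w f g)).congr_fderiv (ofBasis_eq fun b => ?_)
    simp only [smul_apply, ContinuousLinearMap.comp_apply, actL_apply, ofBasis_apply, smul_eq_mul,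
      Finset.mul_sum]
    refine Finset.sum_congr rfl fun j _ => ?_
    rw [Complex.real_smul]
    ring
  | coeff s hs T hT ih =>
    obtain ⟨T', hT', h⟩ := ih
    refine ⟨fun b ψ x g => s x * T' b ψ x g +
      fderivWithin ℝ s (γ.tildeU ∩ H) x (EuclideanSpace.single b 1) * T ψ x g, fun b =>
      .add _ _ (.coeff s hs _ (hT' b)) (.coeff _ ?_ _ hT), fun ψ hψ x hx g => ?_⟩
    · exact (hs.fderivWithin (γ.uniqueDiffOn_inter hH) (by simp)).clm_apply contDiffOn_const
    · have h1 := (hs.differentiableOn (by simp) x hx).hasFDerivWithinAt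
      refine (h1.mul (h ψ hψ x hx g)).congr_fderiv (ofBasis_eq fun b => ?_)
      simp only [add_apply, smul_apply, ofBasis_single, smul_eq_mul]
      ring
  | poly P hP T hT ih =>
    obtain ⟨T', hT', h⟩ := ih
    refine ⟨fun b ψ x g => P g * T' b ψ x g, fun b => .poly P hP _ (hT' b),
      fun ψ hψ x hx g => ?_⟩
    refine ((h ψ hψ x hx g).const_mul (P g : ℂ)).congr_fderiv (ofBasis_eq fun b => ?_)
    simp only [smul_apply, ofBasis_single, smul_eq_mul]
  | add T₁ T₂ hT hT' ih ih' =>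
    obtain ⟨T₁', hT₁', h⟩ := ih
    obtain ⟨T₂', hT₂', h'⟩ := ih'
    refine ⟨fun b ψ x g => T₁' b ψ x g + T₂' b ψ x g, fun b => .add _ _ (hT₁' b) (hT₂' b),
      fun ψ hψ x hx g => ?_⟩
    refine ((h ψ hψ x hx g).add (h' ψ hψ x hx g)).congr_fderiv (ofBasis_eq fun b => ?_)
    simp only [add_apply, ofBasis_single]

/-- Derivatives of amplitudes along the group are amplitudes. -/
theorem IsAmp.exists_hasLeftDeriv (hrel : IsRelInvariant ρ p) (hH : IsSide H)
    (hf : IsSmoothOnGroup f) {T : (VR (d + 1) → ℂ) → VR (d + 1) → G0 GC → ℂ}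
    (hT : γ.IsAmp f H T) (X : lieAlg GC) :
    ∃ T', γ.IsAmp f H T' ∧ ∀ ψ, ContDiffOn ℝ ∞ ψ H → ∀ x ∈ γ.tildeU ∩ H,
        HasLeftDeriv X (T ψ x) (T' ψ x) := by
  induction hT with
  | zero => exact ⟨_, .zero, fun ψ _ x _ g => hasDerivAt_const _ _⟩
  | base w φ k e hφ hφc hφs =>
    have hσ : ∀ j, ContDiffOn ℝ ∞ (fun x => fundField ρ X (γ.kinv x) j) (γ.tildeU ∩ H) := fun j =>
      (hrel.contDiff_fundField X j).comp_contDiffOn contDiffOn_kinv_inter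
    refine ⟨fun ψ x g => dLWord (X :: w) f g * γ.bumpTerm H φ k e ψ (γ.pt x g) +
      ∑ j, (act ρ g.1⁻¹ (fundField ρ X (γ.kinv x)) j : ℂ) *
      (dLWord w f g * γ.bumpTermDeriv H φ k e j ψ (γ.pt x g)),
      .add _ _ (.base _ φ k e hφ hφc hφs) (IsAmp.sum _ fun j _ =>
        isMult_act hrel hσ j _ (isAmp_bumpTermDeriv w k e hφ hφc hφs j)), ?_⟩
    intro ψ hψ x hx g
    have h0 := hasLeftDeriv_dLWord hf X w g
    have h1 := γ.hasFDerivWithinAt_bumpTerm hH hφ k e hψ (γ.kappa_pt_mem hrel hH hx g)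
    have h2 := hrel.hasLeftDeriv_act_inv X (γ.kinv x) g
    have hg : expG X (-0) * g = g := by rw [neg_zero, expG_zero, one_mul]
    have h1' : HasFDerivWithinAt (γ.bumpTerm H φ k e ψ)
      (ofBasis fun j => γ.bumpTermDeriv H φ k e j ψ (γ.pt x g))
      (kappa p γ.l ⁻¹' H) (act ρ (expG X (-0) * g).1⁻¹ (γ.kinv x)) := by rwa [hg]
    have h3 := h1'.comp_hasDerivAt (0 : ℝ) h2
      (Filter.Eventually.of_forall fun t => γ.kappa_pt_mem hrel hH hx (expG X (-t) * g))
    have h4 := h0.mul h3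
    refine h4.congr_deriv ?_
    simp only [Function.comp_apply, hg, ofBasis_apply, Finset.mul_sum]
    refine congrArg₂ (· + ·) rfl (Finset.sum_congr rfl fun j _ => ?_)
    rw [Complex.real_smul]
    ring
  | coeff s hs T hT ih =>
    obtain ⟨T', hT', h⟩ := ih
    exact ⟨_, .coeff s hs _ hT', fun ψ hψ x hx g => (h ψ hψ x hx g).const_mul _⟩
  | poly P hP T hT ih =>
    obtain ⟨T', hT', h⟩ := ih
    obtain ⟨P', hP', hPP⟩ := exists_leftDeriv_polyFun X hP
    refine ⟨fun ψ x g => P' g * T ψ x g + P g * T' ψ x g,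
      .add _ _ (.poly P' hP' _ hT) (.poly P hP _ hT'), fun ψ hψ x hx g => ?_⟩
    have h1 := (hPP g).ofReal_comp.mul (h ψ hψ x hx g)
    have hg : expG X (-0) * g = g := by rw [neg_zero, expG_zero, one_mul]
    refine h1.congr_deriv ?_
    rw [hg]
  | add T₁ T₂ hT hT' ih ih' =>
    obtain ⟨T₁', hT₁', h⟩ := ih
    obtain ⟨T₂', hT₂', h'⟩ := ih'
    exact ⟨_, .add _ _ hT₁' hT₂', fun ψ hψ x hx g => (h ψ hψ x hx g).add (h' ψ hψ x hx g)⟩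

/-- Amplitudes are dominated by integrable functions on the group, uniformly for `x` in compact
sets and linearly in bounds for finitely many derivatives of `ψ`. -/
theorem IsAmp.exists_bound [MeasurableSpace (G0 GC)] {μ : Measure (G0 GC)}
    (hG : IsAlgebraicSubgroup ℝ GC) (hrel : IsRelInvariant ρ p) (hH : IsSide H)
    (hf : IsRapidlyDecreasing μ f)
    {T : (VR (d + 1) → ℂ) → VR (d + 1) → G0 GC → ℂ} (hT : γ.IsAmp f H T)
    {K : Set (VR (d + 1))} (hK : IsCompact K) (hKW : K ⊆ γ.tildeU ∩ H) :
    ∀ q : ℝ, 0 ≤ q → ∃ (N : ℕ) (h : G0 GC → ℝ), Integrable h μ ∧ (∀ g, 0 ≤ h g) ∧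
      ∀ (ψ : VR (d + 1) → ℂ) (b : ℝ), 0 ≤ b →
        (∀ k ≤ N, ∀ y ∈ H, ‖iteratedFDerivWithin ℝ k ψ H y‖ ≤ b) →
        ∀ x ∈ K, ∀ g, Real.exp (q * gnorm g) * ‖T ψ x g‖ ≤ h g * b := by
  induction hT with
  | zero => exact fun q _ => ⟨0, 0, integrable_zero _ _ _, fun _ => le_rfl, by simp⟩
  | base w φ k e hφ hφc hφs =>
    intro q hq
    obtain ⟨C, hC⟩ := hφ.continuous.bounded_above_of_compact_support hφc
    refine ⟨k, fun g => ‖(Real.exp (q * gnorm g) : ℂ) * dLWord w f g‖ * (C * ∏ i, ‖e i‖),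
      (hf.integrable q hq w).norm.mul_const _, fun g => ?_, fun ψ b hb hψ x hx g => ?_⟩
    · have : 0 ≤ C := (norm_nonneg _).trans (hC 0)
      positivity
    · have hC0 : 0 ≤ C := (norm_nonneg _).trans (hC 0)
      have h1 := hψ k le_rfl _ (γ.kappa_pt_mem hrel hH (hKW hx) g)
      have h2 : ‖γ.bumpTerm H φ k e ψ (γ.pt x g)‖ ≤ C * (b * ∏ i, ‖e i‖) := by
        rw [bumpTerm, norm_mul, Complex.norm_real]
        refine mul_le_mul (hC _) ((ContinuousMultilinearMap.le_opNorm _ _).trans ?_)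
          (norm_nonneg _) hC0
        gcongr
      simp only [norm_mul, Complex.norm_real, Real.norm_of_nonneg (Real.exp_pos _).le]
      calc Real.exp (q * gnorm g) * (‖dLWord w f g‖ * ‖γ.bumpTerm H φ k e ψ (γ.pt x g)‖)
          ≤ Real.exp (q * gnorm g) * (‖dLWord w f g‖ * (C * (b * ∏ i, ‖e i‖))) := by gcongr
        _ = _ := by ring
  | coeff s hs T hT ih =>
    intro q hq
    obtain ⟨N, h, hint, h0, hb⟩ := ih q hq
    obtain ⟨C, hC⟩ := hK.exists_bound_of_continuousOn (hs.continuousOn.mono hKW)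
    refine ⟨N, fun g => |C| * h g, hint.const_mul _, fun g => mul_nonneg (abs_nonneg _) (h0 g),
      fun ψ b hb0 hψ x hx g => ?_⟩
    rw [norm_mul]
    calc Real.exp (q * gnorm g) * (‖s x‖ * ‖T ψ x g‖)
        = ‖s x‖ * (Real.exp (q * gnorm g) * ‖T ψ x g‖) := by ring
      _ ≤ |C| * (h g * b) := by
        refine mul_le_mul ((hC x hx).trans (le_abs_self C)) (hb ψ b hb0 hψ x hx g) (by positivity)
          (abs_nonneg _)
      _ = _ := by ring
  | poly P hP T hT ih =>
    intro q hq
    -- the growth of polynomial functions is absorbed by the exponential weight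
    obtain ⟨q', C, hq', hC, hPb⟩ := exists_polyFun_le hG hP
    obtain ⟨N, h, hint, h0, hb⟩ := ih (q + q') (by positivity)
    refine ⟨N, fun g => C * h g, hint.const_mul _, fun g => mul_nonneg hC (h0 g),
      fun ψ b hb0 hψ x hx g => ?_⟩
    rw [norm_mul, Complex.norm_real, Real.norm_eq_abs]
    calc Real.exp (q * gnorm g) * (|P g| * ‖T ψ x g‖)
        ≤ Real.exp (q * gnorm g) * ((C * Real.exp (q' * gnorm g)) * ‖T ψ x g‖) := by
          gcongr
          exact hPb g
      _ = C * (Real.exp ((q + q') * gnorm g) * ‖T ψ x g‖) := by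
        rw [add_mul, Real.exp_add]
        ring
      _ ≤ C * (h g * b) := by
        exact mul_le_mul_of_nonneg_left (hb ψ b hb0 hψ x hx g) hC
      _ = _ := by ring
  | add T T' hT hT' ih ih' =>
    intro q hq
    obtain ⟨N, h, hint, h0, hb⟩ := ih q hq
    obtain ⟨N', h', hint', h0', hb'⟩ := ih' q hq
    refine ⟨max N N', fun g => h g + h' g, hint.add hint', fun g => add_nonneg (h0 g) (h0' g),
      fun ψ b hb0 hψ x hx g => ?_⟩
    have h1 := hb ψ b hb0 (fun k hk => hψ k (hk.trans (le_max_left _ _))) x hx g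
    have h2 := hb' ψ b hb0 (fun k hk => hψ k (hk.trans (le_max_right _ _))) x hx g
    calc Real.exp (q * gnorm g) * ‖T ψ x g + T' ψ x g‖
        ≤ Real.exp (q * gnorm g) * (‖T ψ x g‖ + ‖T' ψ x g‖) := by
          gcongr
          exact norm_add_le _ _
      _ ≤ (h g + h' g) * b := by
        rw [mul_add, add_mul]
        exact add_le_add h1 h2

end Amplitudes

end AdaptedChart

/-! ### Integration over the group -/

section Integration

open Filter Topology

/-- Differentiation under the integral sign within a convex set. -/
theorem hasFDerivWithinAt_integral {α : Type*} [MeasurableSpace α] {μ : Measure α} {E : Type*}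
    [NormedAddCommGroup E] [NormedSpace ℝ E] {S : Set E} (hS : Convex ℝ S) {z₀ : E} (hz₀ : z₀ ∈ S)
    {F : E → α → ℂ} {F' : E → α → E →L[ℝ] ℂ} (hint : ∀ z ∈ S, Integrable (F z) μ)
    (hint' : ∀ e, Integrable (fun a => F' z₀ a e) μ) {L : E →L[ℝ] ℂ}
    (hL : ∀ e, L e = ∫ a, F' z₀ a e ∂μ) {bound : α → ℝ} (hb : Integrable bound μ)
    (hle : ∀ a, ∀ z ∈ S, ‖F' z a‖ ≤ bound a)
    (hd : ∀ a, ∀ z ∈ S, HasFDerivWithinAt (fun z => F z a) (F' z a) S z) :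
    HasFDerivWithinAt (fun z => ∫ a, F z a ∂μ) L S z₀ := by
  -- the remainder of the difference quotient, which the mean value inequality bounds by twice the
  -- bound of the derivative
  set G : E → α → ℂ := fun z a => ((‖z - z₀‖⁻¹ : ℝ) : ℂ) * (F z a - F z₀ a - F' z₀ a (z - z₀))
  have hGint : ∀ z ∈ S, Integrable (G z) μ := fun z hz =>
    (((hint z hz).sub (hint z₀ hz₀)).sub (hint' _)).const_mul _
  have hlim : Tendsto (fun z => ∫ a, G z a ∂μ) (𝓝[S] z₀) (𝓝 (∫ _, (0 : ℂ) ∂μ)) := by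
    refine tendsto_integral_filter_of_dominated_convergence (fun a => 2 * bound a) ?_ ?_
      (hb.const_mul 2) ?_
    · filter_upwards [self_mem_nhdsWithin] with z hz
      exact (hGint z hz).aestronglyMeasurable
    · filter_upwards [self_mem_nhdsWithin] with z hz
      refine Eventually.of_forall fun a => ?_
      have h1 := Convex.norm_image_sub_le_of_norm_hasFDerivWithin_le (hd a) (hle a) hS hz₀ hz
      have h2 := (F' z₀ a).le_of_opNorm_le (hle a z₀ hz₀) (z - z₀)
      have h3 : ‖F z a - F z₀ a - F' z₀ a (z - z₀)‖ ≤ 2 * bound a * ‖z - z₀‖ := by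
        refine (norm_sub_le _ _).trans ?_
        linarith
      have hb0 : 0 ≤ bound a := (norm_nonneg _).trans (hle a z₀ hz₀)
      simp only [G, norm_mul, Complex.norm_real, norm_inv, norm_norm]
      rcases eq_or_ne z z₀ with rfl | hne
      · simpa using hb0
      · rw [inv_mul_le_iff₀ (norm_pos_iff.2 (sub_ne_zero.2 hne))]
        linarith
    · refine Eventually.of_forall fun a => ?_
      have := hasFDerivWithinAt_iff_tendsto.1 (hd a z₀ hz₀)
      rw [tendsto_zero_iff_norm_tendsto_zero]
      refine this.congr fun z => ?_
      simp only [G, norm_mul, Complex.norm_real, norm_inv, norm_norm]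
  rw [hasFDerivWithinAt_iff_tendsto]
  rw [integral_zero, tendsto_zero_iff_norm_tendsto_zero] at hlim
  refine hlim.congr' ?_
  filter_upwards [self_mem_nhdsWithin] with z hz
  have h1 : ∫ a, G z a ∂μ = ((‖z - z₀‖⁻¹ : ℝ) : ℂ) *
      (∫ a, F z a ∂μ - ∫ a, F z₀ a ∂μ - L (z - z₀)) := by
    have h2 : ∫ a, (F z a - F z₀ a - F' z₀ a (z - z₀)) ∂μ =
        ∫ a, (F z a - F z₀ a) ∂μ - ∫ a, F' z₀ a (z - z₀) ∂μ :=
      integral_sub ((hint z hz).sub (hint z₀ hz₀)) (hint' _)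
    rw [integral_const_mul, h2, integral_sub (hint z hz) (hint z₀ hz₀), hL]
  rw [h1, norm_mul, Complex.norm_real, norm_inv, norm_norm]

variable {GC : Subgroup (GL (Fin m) ℂ)}

theorem secondCountableTopology_G0 : SecondCountableTopology (G0 GC) := by
  have := secondCountableTopology_linearGroup (m := m) (𝕜 := ℝ)
  have : SecondCountableTopology (realPoints GC) :=
    Topology.IsEmbedding.subtypeVal.secondCountableTopology
  exact Topology.IsEmbedding.subtypeVal.secondCountableTopology

theorem sigmaCompactSpace_G0 (hG : IsAlgebraicSubgroup ℝ GC) : SigmaCompactSpace (G0 GC) := by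
  have h1 : SigmaCompactSpace (Matrix (Fin m) (Fin m) ℝ) :=
    inferInstanceAs (SigmaCompactSpace (Fin m → Fin m → ℝ))
  have h2 : SigmaCompactSpace (Matrix (Fin m) (Fin m) ℝ)ᵐᵒᵖ :=
    MulOpposite.opHomeomorph.symm.isClosedEmbedding.sigmaCompactSpace
  have h3 : SigmaCompactSpace (GL (Fin m) ℝ) :=
    Units.isClosedEmbedding_embedProduct.sigmaCompactSpace
  have h4 : SigmaCompactSpace (realPoints GC) :=
    (isClosed_realPoints hG).isClosedEmbedding_subtypeVal.sigmaCompactSpace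
  have h5 : IsClosed (Subgroup.connectedComponentOfOne ↥(realPoints GC) : Set (realPoints GC)) :=
    isClosed_connectedComponent
  exact h5.isClosedEmbedding_subtypeVal.sigmaCompactSpace

/-- The integral of a derivative along left translations vanishes: averaged over the translations
by `exp (-tX)`, `0 ≤ t ≤ 1`, it is the difference of the integrals of two translates of `Q`. -/
theorem integral_leftDeriv_eq_zero [MeasurableSpace (G0 GC)] [BorelSpace (G0 GC)]
    (hG : IsAlgebraicSubgroup ℝ GC) (μ : Measure (G0 GC)) [μ.IsHaarMeasure] {X : lieAlg GC}
    {Q Q' : G0 GC → ℂ} (h : HasLeftDeriv X Q Q') (hc : Continuous Q') (hQ : Integrable Q μ)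
    (hQ' : Integrable Q' μ) : ∫ g, Q' g ∂μ = 0 := by
  have := secondCountableTopology_G0 (GC := GC)
  have := sigmaCompactSpace_G0 hG
  have : SigmaFinite μ := inferInstance
  have hcont : Continuous fun z : ℝ × G0 GC => Q' (expG X (-z.1) * z.2) :=
    hc.comp (((continuous_expG X).comp continuous_fst.neg).mul continuous_snd)
  have hftc : ∀ g, ∫ t in (0 : ℝ)..1, Q' (expG X (-t) * g) = Q (expG X (-1) * g) - Q g := by
    intro g
    rw [intervalIntegral.integral_eq_sub_of_hasDerivAt (fun t _ => h.hasDerivAt g t)]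
    · simp
    · exact (hcont.comp (Continuous.prodMk_left g)).intervalIntegrable _ _
  have hint : Integrable (Function.uncurry fun (t : ℝ) (g : G0 GC) => Q' (expG X (-t) * g))
      ((volume.restrict (Ioc (0 : ℝ) 1)).prod μ) := by
    have hm : AEStronglyMeasurable (Function.uncurry fun (t : ℝ) (g : G0 GC) =>
        Q' (expG X (-t) * g)) ((volume.restrict (Ioc (0 : ℝ) 1)).prod μ) :=
      hcont.aestronglyMeasurable
    refine (integrable_prod_iff hm).2 ⟨Eventually.of_forall fun t => ?_, ?_⟩
    · exact hQ'.comp_mul_left (expG X (-t))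
    · have : (fun t : ℝ => ∫ g, ‖Function.uncurry (fun (t : ℝ) (g : G0 GC) =>
          Q' (expG X (-t) * g)) (t, g)‖ ∂μ) = fun _ => ∫ g, ‖Q' g‖ ∂μ := by
        funext t
        exact integral_mul_left_eq_self (fun g => ‖Q' g‖) (expG X (-t))
      rw [this]
      exact integrable_const _
  have hswap := integral_integral_swap hint
  have h1 : ∀ t : ℝ, ∫ g, Q' (expG X (-t) * g) ∂μ = ∫ g, Q' g ∂μ := fun t =>
    integral_mul_left_eq_self Q' _
  simp only [h1] at hswap
  rw [integral_const] at hswap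
  simp only [← intervalIntegral.integral_of_le zero_le_one, hftc] at hswap
  rw [integral_sub (hQ.comp_mul_left _) hQ, integral_mul_left_eq_self Q, sub_self] at hswap
  simpa using hswap

end Integration

/-! ### Oscillatory integrals over the group -/

section OfBasisPair

open ContinuousLinearMap

/-- The linear map on `ℝⁿ × ℝⁿ` with prescribed values on the standard basis. -/
def ofBasisPair (A B : Fin n → ℂ) : VR n × VR n →L[ℝ] ℂ :=
  (ofBasis A).comp (fst ℝ _ _) + (ofBasis B).comp (snd ℝ _ _)

theorem norm_ofBasisPair_le (A B : Fin n → ℂ) :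
    ‖ofBasisPair A B‖ ≤ ∑ b, ‖A b‖ + ∑ b, ‖B b‖ := by
  refine (norm_add_le _ _).trans (add_le_add ?_ ?_)
  · refine (opNorm_comp_le _ _).trans ?_
    exact (mul_le_of_le_one_right (norm_nonneg _) (norm_fst_le ..)).trans (norm_ofBasis_le A)
  · refine (opNorm_comp_le _ _).trans ?_
    exact (mul_le_of_le_one_right (norm_nonneg _) (norm_snd_le ..)).trans (norm_ofBasis_le B)

theorem ofBasisPair_apply (A B : Fin n → ℂ) (e : VR n × VR n) :
    ofBasisPair A B e = ∑ b, e.1 b • A b + ∑ b, e.2 b • B b := by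
  rw [ofBasisPair, add_apply, comp_apply, comp_apply, ofBasis_apply, ofBasis_apply]
  rfl

@[simp] theorem ofBasisPair_single_fst (A B : Fin n → ℂ) (b : Fin n) :
    ofBasisPair A B (EuclideanSpace.single b 1, 0) = A b := by
  simp [ofBasisPair]

@[simp] theorem ofBasisPair_single_snd (A B : Fin n → ℂ) (b : Fin n) :
    ofBasisPair A B (0, EuclideanSpace.single b 1) = B b := by
  simp [ofBasisPair]

theorem ofBasisPair_eq {L : VR n × VR n →L[ℝ] ℂ} {A B : Fin n → ℂ}
    (hA : ∀ b, L (EuclideanSpace.single b 1, 0) = A b)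
    (hB : ∀ b, L (0, EuclideanSpace.single b 1) = B b) : L = ofBasisPair A B := by
  have h1 : L.comp (inl ℝ _ _) = ofBasis A := ofBasis_eq hA
  have h2 : L.comp (inr ℝ _ _) = ofBasis B := ofBasis_eq hB
  refine ContinuousLinearMap.ext fun e => ?_
  rw [ofBasisPair, ← h1, ← h2]
  simp only [add_apply, comp_apply, inl_apply, inr_apply, coe_fst', coe_snd']
  rw [← map_add]
  simp

variable {α : Type*} [MeasurableSpace α] {μ : Measure α}

theorem integral_ofBasisPair {A B : α → Fin n → ℂ} (hA : ∀ b, Integrable (fun g => A g b) μ)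
    (hB : ∀ b, Integrable (fun g => B g b) μ) (e : VR n × VR n) :
    Integrable (fun g => ofBasisPair (A g) (B g) e) μ ∧
      ofBasisPair (fun b => ∫ g, A g b ∂μ) (fun b => ∫ g, B g b ∂μ) e =
        ∫ g, ofBasisPair (A g) (B g) e ∂μ := by
  simp only [ofBasisPair_apply]
  have hA' : ∀ b, Integrable (fun g => e.1 b • A g b) μ := fun b => (hA b).smul (e.1 b)
  have hB' : ∀ b, Integrable (fun g => e.2 b • B g b) μ := fun b => (hB b).smul (e.2 b)
  have h1 : Integrable (fun g => ∑ b, e.1 b • A g b) μ := integrable_finsetSum _ fun b _ => hA' b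
  have h2 : Integrable (fun g => ∑ b, e.2 b • B g b) μ := integrable_finsetSum _ fun b _ => hB' b
  refine ⟨h1.add h2, ?_⟩
  rw [integral_add h1 h2, integral_finsetSum _ fun b _ => hA' b,
    integral_finsetSum _ fun b _ => hB' b]
  simp only [integral_smul]

end OfBasisPair

theorem inner_eq_sum (u v : VR n) : inner ℝ u v = ∑ a, u a * v a := by
  simp [PiLp.inner_apply, mul_comm]

/-- Functions on `H` all of whose derivatives are bounded. -/
structure IsBddSmooth (H : Set (VR n)) (ψ : VR n → ℂ) : Prop where
  contDiffOn : ContDiffOn ℝ ∞ ψ H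
  bounded : ∀ N : ℕ, ∃ b : ℝ, 0 ≤ b ∧ ∀ k ≤ N, ∀ y ∈ H, ‖iteratedFDerivWithin ℝ k ψ H y‖ ≤ b

namespace AdaptedChart

variable {GC : Subgroup (GL (Fin m) ℂ)} {ρ : GC →* GL (Fin (d + 1)) ℂ}
  {p : MvPolynomial (Fin (d + 1)) ℝ} (γ : AdaptedChart ρ p)

/-- The phase `(χ(g⁻¹) - 1, (g⁻¹v)_l - x')`, with `v = κ⁻¹(x)`. -/
def phase (x : VR (d + 1)) (g : G0 GC) : VR (d + 1) :=
  setFirst (character ρ p g.1⁻¹) (kappa p γ.l (γ.pt x g)) - setFirst 1 x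

@[simp] theorem phase_zero (x : VR (d + 1)) (g : G0 GC) :
    γ.phase x g 0 = character ρ p g.1⁻¹ - 1 := rfl

@[simp] theorem phase_succ (x : VR (d + 1)) (g : G0 GC) (i : Fin d) :
    γ.phase x g i.succ = act ρ g.1⁻¹ (γ.kinv x) (γ.l i) - x i.succ := rfl

/-- The oscillating factor `e^{iΘ(x,g)·ζ}` with the phase `Θ`. -/
def osc (x ζ : VR (d + 1)) (g : G0 GC) : ℂ :=
  Complex.exp (Complex.I * (inner ℝ (γ.phase x g) ζ : ℝ))

theorem norm_osc (x ζ : VR (d + 1)) (g : G0 GC) : ‖γ.osc x ζ g‖ = 1 := by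
  rw [osc, mul_comm, Complex.norm_exp_ofReal_mul_I]

/-- The oscillatory integral `∫ T(ψ, x, g) e^{iΘ(x,g)·ζ} dg`. -/
def oscInt [MeasurableSpace (G0 GC)] (μ : Measure (G0 GC))
    (T : (VR (d + 1) → ℂ) → VR (d + 1) → G0 GC → ℂ) (ψ : VR (d + 1) → ℂ) (x ζ : VR (d + 1)) : ℂ :=
  ∫ g, T ψ x g * γ.osc x ζ g ∂μ

section Phase

variable {γ} {f : G0 GC → ℂ} {H : Set (VR (d + 1))}

theorem isMult_phase (hrel : IsRelInvariant ρ p) (a : Fin (d + 1)) :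
    γ.IsMult f H fun x g => (γ.phase x g a : ℂ) := by
  refine Fin.cases ?_ (fun i => ?_) a
  · simp only [phase_zero, Complex.ofReal_sub]
    exact (isMult_poly (polyFun_inv (character_mem_polyFun hrel))).sub (isMult_const _)
  · simp only [phase_succ, Complex.ofReal_sub]
    refine (isMult_act hrel (fun j => ?_) _).sub (isMult_coeff_real ?_)
    · exact (PiLp.proj (𝕜 := ℝ) 2 (fun _ : Fin (d + 1) => ℝ) j).contDiff.comp_contDiffOn
        contDiffOn_kinv_inter
    · exact (PiLp.proj (𝕜 := ℝ) 2 (fun _ : Fin (d + 1) => ℝ) i.succ).contDiff.contDiffOn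

theorem isMult_phaseLeftDeriv (hrel : IsRelInvariant ρ p) (X : lieAlg GC) (a : Fin (d + 1)) :
    γ.IsMult f H fun x g => (hrel.phaseLeftDeriv γ.l X (γ.kinv x) g a : ℂ) := by
  refine Fin.cases ?_ (fun i => ?_) a
  · simp only [IsRelInvariant.phaseLeftDeriv, Fin.cons_zero, Complex.ofReal_mul]
    exact (isMult_poly (polyFun_inv (character_mem_polyFun hrel))).mul (isMult_const _)
  · simp only [IsRelInvariant.phaseLeftDeriv, Fin.cons_succ]
    exact isMult_act hrel (fun j => (hrel.contDiff_fundField X j).comp_contDiffOn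
      contDiffOn_kinv_inter) _

theorem hasLeftDeriv_phase (hrel : IsRelInvariant ρ p) (X : lieAlg GC) (x : VR (d + 1))
    (a : Fin (d + 1)) : HasLeftDeriv X (fun g => γ.phase x g a)
      fun g => hrel.phaseLeftDeriv γ.l X (γ.kinv x) g a := by
  refine Fin.cases ?_ (fun i => ?_) a
  · intro g
    simp only [IsRelInvariant.phaseLeftDeriv, Fin.cons_zero, phase_zero]
    exact (hrel.hasLeftDeriv_character_inv X g).sub_const _
  · intro g
    simp only [IsRelInvariant.phaseLeftDeriv, Fin.cons_succ, phase_succ]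
    have h := (PiLp.proj (𝕜 := ℝ) 2 (fun _ : Fin (d + 1) => ℝ)
      (γ.l i)).hasFDerivAt.comp_hasDerivAt (0 : ℝ) (hrel.hasLeftDeriv_act_inv X (γ.kinv x) g)
    exact h.sub_const _

/-- The derivatives of the phase with respect to `x` act on amplitudes. -/
theorem exists_hasFDerivWithinAt_phase (hrel : IsRelInvariant ρ p) (hH : IsSide H) :
    ∃ q : Fin (d + 1) → Fin (d + 1) → VR (d + 1) → G0 GC → ℝ,
      (∀ b a, γ.IsMult f H fun x g => (q b a x g : ℂ)) ∧ ∀ x ∈ γ.tildeU ∩ H, ∀ g a,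
        HasFDerivWithinAt (fun x => γ.phase x g a) (ofBasis fun b => q b a x g)
          (γ.tildeU ∩ H) x := by
  set D : Fin (d + 1) → VR (d + 1) → VR (d + 1) := fun b x =>
    fderivWithin ℝ γ.kinv (γ.tildeU ∩ H) x (EuclideanSpace.single b 1)
  have hD : ∀ b j, ContDiffOn ℝ ∞ (fun x => D b x j) (γ.tildeU ∩ H) := fun b j =>
    (PiLp.proj (𝕜 := ℝ) 2 (fun _ : Fin (d + 1) => ℝ) j).contDiff.comp_contDiffOn
      ((contDiffOn_kinv_inter.fderivWithin (γ.uniqueDiffOn_inter hH) (by simp)).clm_apply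
        contDiffOn_const)
  refine ⟨fun b => Fin.cons (fun _ _ => 0) fun i x g => act ρ g.1⁻¹ (D b x) (γ.l i) -
    EuclideanSpace.single b (1 : ℝ) i.succ, fun b a => ?_, fun x hx g a => ?_⟩
  · refine Fin.cases ?_ (fun i => ?_) a
    · simpa using isMult_const 0
    · simp only [Fin.cons_succ, Complex.ofReal_sub]
      exact (isMult_act hrel (hD b) _).sub (isMult_const _)
  · refine Fin.cases ?_ (fun i => ?_) a
    · simp only [phase_zero, Fin.cons_zero]
      refine (hasFDerivWithinAt_const _ _ _).congr_fderiv (ofBasis_eq fun b => ?_)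
      rfl
    · simp only [phase_succ, Fin.cons_succ]
      have h2 : HasFDerivWithinAt γ.kinv (fderivWithin ℝ γ.kinv (γ.tildeU ∩ H) x)
          (γ.tildeU ∩ H) x :=
        (contDiffOn_kinv_inter.differentiableOn (by simp) x hx).hasFDerivWithinAt
      have h3 := ((PiLp.proj (𝕜 := ℝ) 2 (fun _ : Fin (d + 1) => ℝ) (γ.l i)).comp
        (actL ρ g.1⁻¹)).hasFDerivAt.comp_hasFDerivWithinAt x h2
      have h4 := (PiLp.proj (𝕜 := ℝ) 2 (fun _ : Fin (d + 1) => ℝ)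
        i.succ).hasFDerivAt.hasFDerivWithinAt (s := γ.tildeU ∩ H) (x := x)
      refine (h3.sub h4).congr_fderiv (ofBasis_eq fun b => ?_)
      rfl

end Phase

/-- The assumptions under which the oscillatory integrals are studied: `f` is rapidly decreasing on
the group of a relative invariant with nontrivial character, and `H` is the whole space or a half
space. -/
structure IsAdmissible [MeasurableSpace (G0 GC)] (ρ : GC →* GL (Fin (d + 1)) ℂ)
    (p : MvPolynomial (Fin (d + 1)) ℝ) (μ : Measure (G0 GC)) (f : G0 GC → ℂ)
    (H : Set (VR (d + 1))) : Prop where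
  algebraic : IsAlgebraicSubgroup ℝ GC
  rel : IsRelInvariant ρ p
  exists_dchi_ne_zero : ∃ X : lieAlg GC, rel.dchi X.1 ≠ 0
  side : IsSide H
  decreasing : IsRapidlyDecreasing μ f

variable [MeasurableSpace (G0 GC)] [BorelSpace (G0 GC)] {μ : Measure (G0 GC)} {γ}
  {f : G0 GC → ℂ} {H : Set (VR (d + 1))}
  {T : (VR (d + 1) → ℂ) → VR (d + 1) → G0 GC → ℂ} {ψ : VR (d + 1) → ℂ} {x ζ : VR (d + 1)}

theorem continuous_phase (hrel : IsRelInvariant ρ p) (x : VR (d + 1)) (a : Fin (d + 1)) :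
    Continuous fun g => γ.phase x g a := by
  refine Fin.cases ?_ (fun i => ?_) a
  · exact (continuous_polyFun (polyFun_inv (character_mem_polyFun hrel))).sub continuous_const
  · exact ((PiLp.continuous_apply 2 (fun _ : Fin (d + 1) => ℝ) (γ.l i)).comp
      (hrel.continuous_act_inv (γ.kinv x))).sub continuous_const

theorem continuous_osc (hrel : IsRelInvariant ρ p) (x ζ : VR (d + 1)) :
    Continuous (γ.osc x ζ) := by
  unfold osc
  simp only [inner_eq_sum]
  refine Complex.continuous_exp.comp (continuous_const.mul (Complex.continuous_ofReal.comp ?_))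
  exact continuous_finsetSum _ fun a _ => (continuous_phase hrel x a).mul continuous_const

/-- Amplitudes are dominated by integrable functions, locally uniformly in `x`. -/
theorem IsAmp.exists_dominating (S : IsAdmissible ρ p μ f H) (hT : γ.IsAmp f H T)
    (hψ : IsBddSmooth H ψ) {K : Set (VR (d + 1))} (hK : IsCompact K)
    (hKW : K ⊆ γ.tildeU ∩ H) :
    ∃ h : G0 GC → ℝ, Integrable h μ ∧ (∀ g, 0 ≤ h g) ∧ ∀ x ∈ K, ∀ g, ‖T ψ x g‖ ≤ h g := by
  obtain ⟨N, h, hint, h0, hle⟩ := hT.exists_bound S.algebraic S.rel S.side S.decreasing hK hKW 0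
    le_rfl
  obtain ⟨b, hb, hψb⟩ := hψ.bounded N
  refine ⟨fun g => h g * b, hint.mul_const _, fun g => mul_nonneg (h0 g) hb, fun x hx g => ?_⟩
  simpa using hle ψ b hb hψb x hx g

theorem IsAmp.integrable (S : IsAdmissible ρ p μ f H) (hT : γ.IsAmp f H T)
    (hψ : IsBddSmooth H ψ) (hx : x ∈ γ.tildeU ∩ H) (ζ : VR (d + 1)) :
    Integrable (fun g => T ψ x g * γ.osc x ζ g) μ := by
  obtain ⟨h, hint, -, hle⟩ := hT.exists_dominating S hψ (isCompact_singleton (x := x))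
    (singleton_subset_iff.2 hx)
  refine hint.mono' ((hT.continuous S.rel S.side S.decreasing.smooth hψ.contDiffOn hx).mul
    (continuous_osc S.rel x ζ)).aestronglyMeasurable (Filter.Eventually.of_forall fun g => ?_)
  rw [norm_mul, norm_osc, mul_one]
  exact hle x rfl g

/-- Oscillatory integrals are bounded uniformly in the frequency and linearly in bounds for
finitely many derivatives of `ψ`. -/
theorem IsAmp.oscInt_le (S : IsAdmissible ρ p μ f H) (hT : γ.IsAmp f H T)
    {K : Set (VR (d + 1))} (hK : IsCompact K) (hKW : K ⊆ γ.tildeU ∩ H) :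
    ∃ (N : ℕ) (C : ℝ), ∀ (ψ : VR (d + 1) → ℂ) (b : ℝ), 0 ≤ b →
      (∀ k ≤ N, ∀ y ∈ H, ‖iteratedFDerivWithin ℝ k ψ H y‖ ≤ b) →
      ∀ x ∈ K, ∀ ζ, ‖γ.oscInt μ T ψ x ζ‖ ≤ C * b := by
  obtain ⟨N, h, hint, h0, hle⟩ := hT.exists_bound S.algebraic S.rel S.side S.decreasing hK hKW 0
    le_rfl
  refine ⟨N, ∫ g, h g ∂μ, fun ψ b hb hψb x hx ζ => ?_⟩
  rw [← integral_mul_const]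
  refine norm_integral_le_of_norm_le (hint.mul_const _) (Filter.Eventually.of_forall fun g => ?_)
  rw [norm_mul, norm_osc, mul_one]
  simpa using hle ψ b hb hψb x hx g

theorem oscInt_add {T' : (VR (d + 1) → ℂ) → VR (d + 1) → G0 GC → ℂ}
    (S : IsAdmissible ρ p μ f H) (hT : γ.IsAmp f H T) (hT' : γ.IsAmp f H T')
    (hψ : IsBddSmooth H ψ) (hx : x ∈ γ.tildeU ∩ H) (ζ : VR (d + 1)) :
    γ.oscInt μ (fun ψ x g => T ψ x g + T' ψ x g) ψ x ζ =
      γ.oscInt μ T ψ x ζ + γ.oscInt μ T' ψ x ζ := by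
  simp only [oscInt, add_mul]
  exact integral_add (hT.integrable S hψ hx ζ) (hT'.integrable S hψ hx ζ)

theorem oscInt_const_mul (z : ℂ) : γ.oscInt μ (fun ψ x g => z * T ψ x g) ψ x ζ =
    z * γ.oscInt μ T ψ x ζ := by
  simp only [oscInt, mul_assoc]
  exact integral_const_mul _ _

theorem oscInt_sum {ι : Type*} (s : Finset ι)
    {T : ι → (VR (d + 1) → ℂ) → VR (d + 1) → G0 GC → ℂ}
    (S : IsAdmissible ρ p μ f H) (hT : ∀ i, γ.IsAmp f H (T i))
    (hψ : IsBddSmooth H ψ) (hx : x ∈ γ.tildeU ∩ H) (ζ : VR (d + 1)) :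
    γ.oscInt μ (fun ψ x g => ∑ i ∈ s, T i ψ x g) ψ x ζ = ∑ i ∈ s, γ.oscInt μ (T i) ψ x ζ := by
  simp only [oscInt, Finset.sum_mul]
  exact integral_finsetSum _ fun i _ => (hT i).integrable S hψ hx ζ

/-- Integration by parts along the group: oscillatory integrals stay oscillatory integrals when
multiplied by a component of the frequency. -/
theorem IsAmp.exists_coord_mul [μ.IsHaarMeasure] (S : IsAdmissible ρ p μ f H)
    (hT : γ.IsAmp f H T) (a : Fin (d + 1)) :
    ∃ T', γ.IsAmp f H T' ∧ ∀ ψ, IsBddSmooth H ψ → ∀ x ∈ γ.tildeU ∩ H, ∀ ζ,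
      (ζ a : ℂ) * γ.oscInt μ T ψ x ζ = γ.oscInt μ T' ψ x ζ := by
  obtain ⟨X₀, hX₀⟩ := S.exists_dchi_ne_zero
  obtain ⟨r, B, hB⟩ := S.rel.exists_inverse_phaseLeftDeriv γ hX₀
  obtain ⟨η, P, hη, hP, hinv⟩ := hB a
  set M : Fin r → VR (d + 1) → G0 GC → ℝ := fun k x g => ∑ τ, η τ (γ.pt x g) * P τ k g with hM
  have hMmult : ∀ k, γ.IsMult f H fun x g => (M k x g : ℂ) := by
    intro k
    simp only [hM, Complex.ofReal_sum, Complex.ofReal_mul]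
    exact IsMult.sum _ fun τ _ => (isMult_pt (hη τ)).mul (isMult_poly (hP τ k))
  have hMT : ∀ k, γ.IsAmp f H fun ψ x g => M k x g * T ψ x g := fun k => hMmult k T hT
  choose T' hT' hder using fun k =>
    (hMT k).exists_hasLeftDeriv S.rel S.side S.decreasing.smooth (B k)
  refine ⟨fun ψ x g => Complex.I * ∑ k, T' k ψ x g,
    isMult_const _ _ (IsAmp.sum _ fun k _ => hT' k), fun ψ hψ x hx ζ => ?_⟩
  set J : Fin r → Fin (d + 1) → (VR (d + 1) → ℂ) → VR (d + 1) → G0 GC → ℂ := fun k a' ψ x g =>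
    (S.rel.phaseLeftDeriv γ.l (B k) (γ.kinv x) g a' : ℂ) * (M k x g * T ψ x g) with hJ
  have hJamp : ∀ k a', γ.IsAmp f H (J k a') := fun k a' =>
    isMult_phaseLeftDeriv S.rel (B k) a' _ (hMT k)
  -- the integral of the derivative along `B k` of `M k * T` times the oscillating factor
  have hzero : ∀ k, γ.oscInt μ (T' k) ψ x ζ +
      Complex.I * ∑ a', (ζ a' : ℂ) * γ.oscInt μ (J k a') ψ x ζ = 0 := by
    intro k
    have hosc : HasLeftDeriv (B k) (γ.osc x ζ) fun g => Complex.I *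
        (∑ a', (S.rel.phaseLeftDeriv γ.l (B k) (γ.kinv x) g a' : ℂ) * ζ a') * γ.osc x ζ g := by
      intro g
      unfold osc
      simp only [inner_eq_sum]
      have h1 := HasDerivAt.fun_sum (u := Finset.univ) fun a' _ =>
        (hasLeftDeriv_phase (γ := γ) S.rel (B k) x a' g).mul_const (ζ a')
      have hg : expG (B k) (-0) * g = g := by rw [neg_zero, expG_zero, one_mul]
      have h2 := (h1.ofReal_comp.const_mul Complex.I).cexp
      refine h2.congr_deriv ?_
      simp only [hg]
      push_cast
      ring
    have hQ : HasLeftDeriv (B k) (fun g => M k x g * T ψ x g * γ.osc x ζ g) fun g =>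
        T' k ψ x g * γ.osc x ζ g + Complex.I * ∑ a', (ζ a' : ℂ) * (J k a' ψ x g * γ.osc x ζ g) := by
      intro g
      have h1 := (hder k ψ hψ.contDiffOn x hx g).mul (hosc g)
      have hg : expG (B k) (-0) * g = g := by rw [neg_zero, expG_zero, one_mul]
      refine h1.congr_deriv ?_
      simp only [hg, hJ, Finset.mul_sum, Finset.sum_mul]
      refine congrArg₂ (· + ·) rfl (Finset.sum_congr rfl fun a' _ => ?_)
      ring
    have hi1 := (hT' k).integrable S hψ hx ζ
    have hi2 : Integrable (fun g => Complex.I * ∑ a', (ζ a' : ℂ) * (J k a' ψ x g * γ.osc x ζ g)) μ :=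
      (integrable_finsetSum _ fun a' _ => ((hJamp k a').integrable S hψ hx ζ).const_mul _).const_mul _
    have hc : ∀ {T : (VR (d + 1) → ℂ) → VR (d + 1) → G0 GC → ℂ}, γ.IsAmp f H T →
        Continuous fun g => T ψ x g * γ.osc x ζ g := fun hT =>
      (hT.continuous S.rel S.side S.decreasing.smooth hψ.contDiffOn hx).mul
        (continuous_osc S.rel x ζ)
    have := integral_leftDeriv_eq_zero S.algebraic μ hQ
      ((hc (hT' k)).add (continuous_const.mul (continuous_finsetSum _ fun a' _ =>
        continuous_const.mul (hc (hJamp k a'))))) ((hMT k).integrable S hψ hx ζ) (hi1.add hi2)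
    rw [integral_add hi1 hi2, integral_const_mul, integral_finsetSum _ fun a' _ =>
      ((hJamp k a').integrable S hψ hx ζ).const_mul _] at this
    simp only [integral_const_mul] at this
    exact this
  -- the sums of the remaining integrals are evaluated with the right inverse of the Jacobian
  have hsumJ : ∀ a', ∑ k, γ.oscInt μ (J k a') ψ x ζ = if a = a' then γ.oscInt μ T ψ x ζ else 0 := by
    intro a'
    rw [← oscInt_sum _ S (fun k => hJamp k a') hψ hx ζ]
    have hpt : ∀ g, ∑ k, J k a' ψ x g = if a = a' then T ψ x g else 0 := by
      intro g
      by_cases hg : γ.pt x g ∈ γ.U₁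
      · have h1 := hinv (γ.kinv x) g hg a'
        have h2 : ∑ k, J k a' ψ x g = ((∑ k, M k x g *
            S.rel.phaseLeftDeriv γ.l (B k) (γ.kinv x) g a' : ℝ) : ℂ) * T ψ x g := by
          push_cast
          rw [Finset.sum_mul]
          refine Finset.sum_congr rfl fun k _ => ?_
          simp only [hJ]
          ring
        rw [h2]
        have h3 : ∑ k, M k x g * S.rel.phaseLeftDeriv γ.l (B k) (γ.kinv x) g a' =
          if a = a' then 1 else 0 := h1
        rw [h3]
        split_ifs <;> simp
      · have h1 : T ψ x g = 0 := hT.eq_zero ψ hg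
        simp [hJ, h1]
    simp only [oscInt, hpt]
    split_ifs <;> simp
  have hfin := Finset.sum_eq_zero fun k (_ : k ∈ Finset.univ) => hzero k
  rw [Finset.sum_add_distrib, ← Finset.mul_sum, Finset.sum_comm] at hfin
  simp only [← Finset.mul_sum, hsumJ] at hfin
  simp only [mul_ite, mul_zero, Finset.sum_ite_eq, Finset.mem_univ, if_true] at hfin
  rw [oscInt_const_mul, oscInt_sum _ S hT' hψ hx ζ, eq_neg_of_add_eq_zero_left hfin]
  linear_combination ((ζ a : ℂ) * γ.oscInt μ T ψ x ζ) * Complex.I_sq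

end AdaptedChart

/-! ### Derivatives of oscillatory integrals -/

namespace AdaptedChart

open Filter Topology

variable {GC : Subgroup (GL (Fin m) ℂ)} {ρ : GC →* GL (Fin (d + 1)) ℂ}
  {p : MvPolynomial (Fin (d + 1)) ℝ} {γ : AdaptedChart ρ p} [MeasurableSpace (G0 GC)]
  [BorelSpace (G0 GC)] {μ : Measure (G0 GC)} {f : G0 GC → ℂ} {H : Set (VR (d + 1))}
  {T : (VR (d + 1) → ℂ) → VR (d + 1) → G0 GC → ℂ}

/-- Every point of `W × ℝⁿ`, where `W = Ũ ∩ H`, has convex neighbourhoods of the form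
`S × ball ζ₀ 1` with `S` contained in a compact subset of `W`. -/
theorem exists_convex_nhds (γ : AdaptedChart ρ p) (hH : IsSide H) {x : VR (d + 1)}
    (hx : x ∈ γ.tildeU ∩ H) : ∃ S K : Set (VR (d + 1)), Convex ℝ S ∧ x ∈ S ∧ S ⊆ K ∧ IsCompact K ∧
      K ⊆ γ.tildeU ∩ H ∧ S ∈ 𝓝[γ.tildeU ∩ H] x := by
  obtain ⟨δ, hδ, hball⟩ := Metric.nhds_basis_closedBall.mem_iff.1 (γ.isOpen_tildeU.mem_nhds hx.1)
  refine ⟨Metric.ball x δ ∩ H, Metric.closedBall x δ ∩ H, (convex_ball x δ).inter hH.convex,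
    ⟨Metric.mem_ball_self hδ, hx.2⟩, inter_subset_inter_left _ Metric.ball_subset_closedBall,
    (isCompact_closedBall x δ).inter_right hH.isClosed, inter_subset_inter_left _ hball, ?_⟩
  filter_upwards [mem_nhdsWithin_of_mem_nhds (Metric.ball_mem_nhds x hδ), self_mem_nhdsWithin]
    with y hy hy'
  exact ⟨hy, hy'.2⟩

/-- The derivative of the oscillating factor in the position and the frequency, given the
derivatives `q` of the phase. -/
theorem hasFDerivWithinAt_osc {D : Set (VR (d + 1) × VR (d + 1))} {y η : VR (d + 1)} {g : G0 GC}
    {q : Fin (d + 1) → Fin (d + 1) → ℝ}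
    (hq : ∀ a, HasFDerivWithinAt ((fun x => γ.phase x g a) ∘ Prod.fst)
      ((ofBasis fun b => q b a).comp (ContinuousLinearMap.fst ℝ (VR (d + 1)) (VR (d + 1))))
      D (y, η)) :
    HasFDerivWithinAt (fun z : VR (d + 1) × VR (d + 1) => γ.osc z.1 z.2 g)
      (ofBasisPair (fun b => γ.osc y η g * (Complex.I * ∑ a, (η a : ℂ) * q b a))
        fun c => γ.osc y η g * (Complex.I * γ.phase y g c)) D (y, η) := by
  have hsnd : ∀ a, HasFDerivWithinAt (fun z : VR (d + 1) × VR (d + 1) => z.2 a)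
      ((PiLp.proj (𝕜 := ℝ) 2 (fun _ : Fin (d + 1) => ℝ) a).comp
        (ContinuousLinearMap.snd ℝ (VR (d + 1)) (VR (d + 1)))) D (y, η) :=
    fun a => ((PiLp.proj (𝕜 := ℝ) 2 (fun _ : Fin (d + 1) => ℝ) a).comp
      (ContinuousLinearMap.snd ℝ (VR (d + 1)) (VR (d + 1)))).hasFDerivAt.hasFDerivWithinAt
  set L : VR (d + 1) × VR (d + 1) →L[ℝ] ℝ := ∑ a, (γ.phase y g a •
    ((PiLp.proj (𝕜 := ℝ) 2 (fun _ : Fin (d + 1) => ℝ) a).comp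
        (ContinuousLinearMap.snd ℝ (VR (d + 1)) (VR (d + 1)))) + η a •
    ((ofBasis fun b => q b a).comp (ContinuousLinearMap.fst ℝ (VR (d + 1)) (VR (d + 1))))) with hL
  have h1 : HasFDerivWithinAt
      (fun z : VR (d + 1) × VR (d + 1) => inner ℝ (γ.phase z.1 g) z.2) L D (y, η) := by
    simp only [inner_eq_sum]
    exact HasFDerivWithinAt.fun_sum fun a _ => (hq a).mul (hsnd a)
  have h2 := ((Complex.ofRealCLM.hasFDerivAt.comp_hasFDerivWithinAt (y, η) h1).const_mul
    Complex.I).cexp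
  have h3 : HasFDerivWithinAt (fun z : VR (d + 1) × VR (d + 1) => γ.osc z.1 z.2 g)
    (γ.osc y η g • Complex.I • Complex.ofRealCLM.comp L) D (y, η) := h2
  refine h3.congr_fderiv (ofBasisPair_eq (fun b => ?_) fun c => ?_)
  · simp only [smul_apply, ContinuousLinearMap.comp_apply, Complex.ofRealCLM_apply, smul_eq_mul, hL,
      sum_apply, add_apply, ContinuousLinearMap.coe_fst', ContinuousLinearMap.coe_snd',
      ofBasis_single, map_zero, mul_zero, zero_add]
    push_cast
    rfl
  · simp only [smul_apply, ContinuousLinearMap.comp_apply, Complex.ofRealCLM_apply, smul_eq_mul, hL,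
      sum_apply, add_apply, ContinuousLinearMap.coe_fst', ContinuousLinearMap.coe_snd',
      map_zero, mul_zero, add_zero, PiLp.proj_apply]
    rw [Finset.sum_eq_single c (fun a _ hac => by simp [hac]) (by simp)]
    simp

/-- The derivatives of oscillatory integrals with respect to `x` and `ζ` are oscillatory
integrals. -/
theorem IsAmp.exists_hasFDerivWithinAt_oscInt [μ.IsHaarMeasure] (S : IsAdmissible ρ p μ f H)
    (hT : γ.IsAmp f H T) :
    ∃ A B : Fin (d + 1) → (VR (d + 1) → ℂ) → VR (d + 1) → G0 GC → ℂ,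
      (∀ b, γ.IsAmp f H (A b)) ∧ (∀ b, γ.IsAmp f H (B b)) ∧
      ∀ ψ, IsBddSmooth H ψ → ∀ x ∈ γ.tildeU ∩ H, ∀ ζ,
        HasFDerivWithinAt (fun z : VR (d + 1) × VR (d + 1) => γ.oscInt μ T ψ z.1 z.2)
          (ofBasisPair (fun b => γ.oscInt μ (A b) ψ x ζ) fun b => γ.oscInt μ (B b) ψ x ζ)
          ((γ.tildeU ∩ H) ×ˢ univ) (x, ζ) := by
  obtain ⟨T', hT', hTder⟩ := hT.exists_hasFDerivWithinAt S.rel S.side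
  obtain ⟨q, hq, hqder⟩ := exists_hasFDerivWithinAt_phase (γ := γ) (f := f) S.rel S.side
  have hqT : ∀ b a, γ.IsAmp f H fun ψ x g => q b a x g * T ψ x g := fun b a => hq b a T hT
  choose R hR hRmul using fun b a => (hqT b a).exists_coord_mul (μ := μ) S a
  have hΘT : ∀ c, γ.IsAmp f H fun ψ x g => Complex.I * (γ.phase x g c * T ψ x g) := fun c =>
    isMult_const _ _ (isMult_phase S.rel c T hT)
  refine ⟨fun b ψ x g => T' b ψ x g + Complex.I * ∑ a, R b a ψ x g,
    fun c ψ x g => Complex.I * (γ.phase x g c * T ψ x g), fun b => .add _ _ (hT' b)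
    (isMult_const _ _ (IsAmp.sum _ fun a _ => hR b a)), hΘT, fun ψ hψ x hx ζ => ?_⟩
  obtain ⟨D, K, hDconv, hxD, hDK, hK, hKW, hDnhds⟩ := γ.exists_convex_nhds S.side hx
  -- dominating functions for the three kinds of terms in the derivative of the integrand:
  -- derivatives of the amplitude in `x`, of the phase in `x`, and of the oscillating factor in
  -- `ζ`
  obtain ⟨hA, hAint, hA0, hAle⟩ : ∃ h : G0 GC → ℝ, Integrable h μ ∧ (∀ g, 0 ≤ h g) ∧
      ∀ x ∈ K, ∀ g, ∑ b, ‖T' b ψ x g‖ ≤ h g := by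
    choose h hint h0 hle using fun b => (hT' b).exists_dominating S hψ hK hKW
    exact ⟨fun g => ∑ b, h b g, integrable_finsetSum _ fun b _ => hint b,
      fun g => Finset.sum_nonneg fun b _ => h0 b g,
      fun x hx g => Finset.sum_le_sum fun b _ => hle b x hx g⟩
  obtain ⟨hB, hBint, hB0, hBle⟩ : ∃ h : G0 GC → ℝ, Integrable h μ ∧ (∀ g, 0 ≤ h g) ∧
      ∀ x ∈ K, ∀ g, ∑ b, ∑ a, ‖q b a x g * T ψ x g‖ ≤ h g := by
    choose h hint h0 hle using fun b a => (hqT b a).exists_dominating S hψ hK hKW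
    exact ⟨fun g => ∑ b, ∑ a, h b a g,
      integrable_finsetSum _ fun b _ => integrable_finsetSum _ fun a _ => hint b a,
      fun g => Finset.sum_nonneg fun b _ => Finset.sum_nonneg fun a _ => h0 b a g,
      fun x hx g => Finset.sum_le_sum fun b _ => Finset.sum_le_sum fun a _ => hle b a x hx g⟩
  obtain ⟨hC, hCint, hC0, hCle⟩ : ∃ h : G0 GC → ℝ, Integrable h μ ∧ (∀ g, 0 ≤ h g) ∧
      ∀ x ∈ K, ∀ g, ∑ c, ‖Complex.I * (γ.phase x g c * T ψ x g)‖ ≤ h g := by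
    choose h hint h0 hle using fun b => (hΘT b).exists_dominating S hψ hK hKW
    exact ⟨fun g => ∑ b, h b g, integrable_finsetSum _ fun b _ => hint b,
      fun g => Finset.sum_nonneg fun b _ => h0 b g,
      fun x hx g => Finset.sum_le_sum fun b _ => hle b x hx g⟩
  set A : VR (d + 1) × VR (d + 1) → G0 GC → Fin (d + 1) → ℂ := fun z g b =>
    (T' b ψ z.1 g * γ.osc z.1 z.2 g +
      Complex.I * ∑ a, (z.2 a : ℂ) * (q b a z.1 g * T ψ z.1 g * γ.osc z.1 z.2 g)) with hAdef
  set B : VR (d + 1) × VR (d + 1) → G0 GC → Fin (d + 1) → ℂ := fun z g c =>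
    Complex.I * (γ.phase z.1 g c * T ψ z.1 g) * γ.osc z.1 z.2 g with hBdef
  have hDW : D ⊆ γ.tildeU ∩ H := hDK.trans hKW
  -- the derivative of the integrand
  have hder : ∀ g, ∀ z ∈ D ×ˢ Metric.ball ζ 1,
      HasFDerivWithinAt (fun z : VR (d + 1) × VR (d + 1) => T ψ z.1 g * γ.osc z.1 z.2 g)
        (ofBasisPair (A z g) (B z g)) (D ×ˢ Metric.ball ζ 1) z := by
    rintro g ⟨y, η⟩ ⟨hy, hη⟩
    have hfst : HasFDerivWithinAt (Prod.fst : VR (d + 1) × VR (d + 1) → VR (d + 1))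
        (ContinuousLinearMap.fst ℝ _ _) (D ×ˢ Metric.ball ζ 1) (y, η) :=
      hasFDerivAt_fst.hasFDerivWithinAt
    have hmaps : MapsTo (Prod.fst : VR (d + 1) × VR (d + 1) → VR (d + 1))
        (D ×ˢ Metric.ball ζ 1) (γ.tildeU ∩ H) := fun z hz => hDW hz.1
    have h1 := (hTder ψ hψ.contDiffOn y (hDW hy) g).comp (y, η) hfst hmaps
    have h2 := hasFDerivWithinAt_osc fun a => (hqder y (hDW hy) g a).comp (y, η) hfst hmaps
    refine (h1.mul h2).congr_fderiv (ofBasisPair_eq (fun b => ?_) fun c => ?_)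
    · simp only [hAdef, add_apply, smul_apply, ContinuousLinearMap.comp_apply,
        Function.comp_apply, ofBasis_single, ofBasisPair_single_fst, smul_eq_mul,
        ContinuousLinearMap.coe_fst', Finset.mul_sum]
      rw [add_comm, mul_comm]
      refine congrArg₂ (· + ·) rfl (Finset.sum_congr rfl fun a _ => ?_)
      ring
    · simp only [hBdef, add_apply, smul_apply, ContinuousLinearMap.comp_apply,
        Function.comp_apply, ofBasisPair_single_snd, smul_eq_mul,
        ContinuousLinearMap.coe_fst', map_zero]
      ring
  have hK1 : ∀ z ∈ D ×ˢ Metric.ball ζ 1, z.1 ∈ γ.tildeU ∩ H := fun z hz => hDW hz.1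
  have hAint' : ∀ z ∈ D ×ˢ Metric.ball ζ 1, ∀ b, Integrable (fun g => A z g b) μ := by
    intro z hz b
    refine ((hT' b).integrable S hψ (hK1 z hz) z.2).add (Integrable.const_mul ?_ _)
    exact integrable_finsetSum _ fun a _ =>
      ((hqT b a).integrable S hψ (hK1 z hz) z.2).const_mul _
  have hBint' : ∀ z ∈ D ×ˢ Metric.ball ζ 1, ∀ b, Integrable (fun g => B z g b) μ :=
    fun z hz b => (hΘT b).integrable S hψ (hK1 z hz) z.2
  have hmem : (x, ζ) ∈ D ×ˢ Metric.ball ζ 1 := ⟨hxD, Metric.mem_ball_self one_pos⟩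
  -- integration by parts absorbs the factors `ζ_a` from the derivative of the phase
  have hAeq : ∀ b, γ.oscInt μ (fun ψ x g => T' b ψ x g + Complex.I * ∑ a, R b a ψ x g) ψ x ζ =
      ∫ g, A (x, ζ) g b ∂μ := by
    intro b
    rw [oscInt_add S (hT' b) (isMult_const _ _ (IsAmp.sum _ fun a _ => hR b a)) hψ hx,
      oscInt_const_mul, oscInt_sum _ S (hR b) hψ hx]
    simp only [← hRmul b _ ψ hψ x hx ζ, hAdef]
    rw [integral_add ((hT' b).integrable S hψ hx ζ), integral_const_mul, integral_finsetSum]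
    · simp only [integral_const_mul]
      rfl
    · exact fun a _ => ((hqT b a).integrable S hψ hx ζ).const_mul _
    · exact Integrable.const_mul (integrable_finsetSum _ fun a _ =>
        ((hqT b a).integrable S hψ hx ζ).const_mul _) _
  have hmain := hasFDerivWithinAt_integral (μ := μ) (hDconv.prod (convex_ball ζ 1)) hmem
    (L := ofBasisPair (fun b => ∫ g, A (x, ζ) g b ∂μ) fun b => ∫ g, B (x, ζ) g b ∂μ)
    (F := fun z g => T ψ z.1 g * γ.osc z.1 z.2 g)
    (F' := fun z g => ofBasisPair (A z g) (B z g))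
    (bound := fun g => hA g + (‖ζ‖ + 1) * hB g + hC g)
    (fun z hz => hT.integrable S hψ (hK1 z hz) z.2)
    (fun e => (integral_ofBasisPair (hAint' _ hmem) (hBint' _ hmem) e).1)
    (fun e => (integral_ofBasisPair (hAint' _ hmem) (hBint' _ hmem) e).2)
    ((hAint.add (hBint.const_mul _)).add hCint) (fun g z hz => ?_) hder
  · have : (fun b => γ.oscInt μ (fun ψ x g => T' b ψ x g + Complex.I * ∑ a, R b a ψ x g) ψ x ζ) =
        fun b => ∫ g, A (x, ζ) g b ∂μ := funext hAeq
    rw [this]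
    refine HasFDerivWithinAt.mono_of_mem_nhdsWithin hmain ?_
    rw [nhdsWithin_prod_eq, nhdsWithin_univ]
    exact prod_mem_prod hDnhds (Metric.ball_mem_nhds ζ one_pos)
  · refine (norm_ofBasisPair_le _ _).trans (add_le_add ?_ ?_)
    · refine le_trans (Finset.sum_le_sum fun b _ => ?_)
        ((Finset.sum_add_distrib (s := Finset.univ) (f := fun b => ‖T' b ψ z.1 g‖)
          (g := fun b => (‖ζ‖ + 1) * ∑ a, ‖q b a z.1 g * T ψ z.1 g‖)).trans_le
          (add_le_add (hAle z.1 (hDK hz.1) g) ?_))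
      · refine (norm_add_le _ _).trans (add_le_add ?_ ?_)
        · rw [norm_mul, norm_osc, mul_one]
        · rw [norm_mul, Complex.norm_I, one_mul, Finset.mul_sum]
          refine (norm_sum_le _ _).trans (Finset.sum_le_sum fun a _ => ?_)
          rw [norm_mul, norm_mul _ (γ.osc _ _ _), norm_osc, mul_one, Complex.norm_real]
          refine mul_le_mul_of_nonneg_right ?_ (norm_nonneg _)
          refine (PiLp.norm_apply_le z.2 a).trans ?_
          -- `|ζ_a| ≤ ‖ζ‖ + 1` on the unit ball around the given frequency
          have h1 : ‖z.2 - ζ‖ < 1 := mem_ball_iff_norm.1 hz.2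
          have h2 := norm_add_le ζ (z.2 - ζ)
          rw [add_sub_cancel] at h2
          linarith
      · rw [← Finset.mul_sum]
        exact mul_le_mul_of_nonneg_left (hBle z.1 (hDK hz.1) g) (by positivity)
    · refine le_trans (Finset.sum_le_sum fun b _ => ?_) (hCle z.1 (hDK hz.1) g)
      simp only [hBdef]
      rw [norm_mul _ (γ.osc _ _ _), norm_osc, mul_one]

end AdaptedChart

/-! ### Symbol estimates for oscillatory integrals -/

section IteratedDerivatives

/-- If the derivatives of the members of a class of functions are given by members of the class,
then iterated derivatives are finite sums of members of the class with coefficients that do not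
depend on the parameters. -/
theorem exists_iteratedFDerivWithin_eq_sum {Par : Type*} {V : Set Par} {S : Set (VR n)}
    (hS : UniqueDiffOn ℝ S) {𝒜 : Set (Par → VR n → ℂ)}
    (hder : ∀ a ∈ 𝒜, ∃ a' : Fin n → Par → VR n → ℂ, (∀ b, a' b ∈ 𝒜) ∧ ∀ θ ∈ V, ∀ x ∈ S,
      HasFDerivWithinAt (a θ) (ofBasis fun b => a' b θ x) S x)
    {F : Type*} [NormedAddCommGroup F] [NormedSpace ℝ F] {ι : Type} [Fintype ι]
    {a : ι → Par → VR n → ℂ} (ha : ∀ i, a i ∈ 𝒜) (M : ι → ℂ →L[ℝ] F) (j : ℕ) :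
    ∃ (κ : Type) (_ : Fintype κ) (a' : κ → Par → VR n → ℂ) (M' : κ → ℂ →L[ℝ] (VR n) [×j]→L[ℝ] F),
      (∀ i, a' i ∈ 𝒜) ∧ ∀ θ ∈ V, ∀ x ∈ S,
        iteratedFDerivWithin ℝ j (fun y => ∑ i, M i (a i θ y)) S x = ∑ i, M' i (a' i θ x) := by
  induction j with
  | zero =>
    refine ⟨ι, inferInstance, a, fun i => ((continuousMultilinearCurryFin0 ℝ (VR n)
      F).symm.toContinuousLinearEquiv : F →L[ℝ] _).comp (M i), ha, fun θ _ x _ => ?_⟩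
    rw [iteratedFDerivWithin_zero_eq_comp]
    simp only [Function.comp_apply, map_sum]
    rfl
  | succ j ih =>
    obtain ⟨κ, _, a', M', ha', h⟩ := ih
    choose a'' ha'' hder' using fun i => hder (a' i) (ha' i)
    set Φ : (VR n →L[ℝ] (VR n) [×j]→L[ℝ] F) →L[ℝ] (VR n) [×(j + 1)]→L[ℝ] F :=
      (continuousMultilinearCurryLeftEquiv ℝ (fun _ : Fin (j + 1) => VR n)
        F).symm.toContinuousLinearEquiv.toContinuousLinearMap
    refine ⟨κ × Fin n, inferInstance, fun i => a'' i.1 i.2, fun i => Φ.comp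
      ((ContinuousLinearMap.smulRightL ℝ (VR n) _
        (PiLp.proj (𝕜 := ℝ) 2 (fun _ : Fin n => ℝ) i.2)).comp (M' i.1)),
      fun i => ha'' i.1 i.2, fun θ hθ x hx => ?_⟩
    rw [iteratedFDerivWithin_succ_eq_comp_left, Function.comp_apply]
    have h1 : HasFDerivWithinAt (iteratedFDerivWithin ℝ j (fun y => ∑ i, M i (a i θ y)) S)
        (∑ i, (M' i).comp (ofBasis fun b => a'' i b θ x)) S x := by
      refine HasFDerivWithinAt.congr ?_ (fun y hy => h θ hθ y hy) (h θ hθ x hx)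
      exact HasFDerivWithinAt.fun_sum fun i _ =>
        (M' i).hasFDerivAt.comp_hasFDerivWithinAt x (hder' i θ hθ x hx)
    rw [h1.fderivWithin (hS x hx)]
    have h2 : ∀ i, (M' i).comp (ofBasis fun b => a'' i b θ x) = ∑ b,
        ContinuousLinearMap.smulRightL ℝ (VR n) _
        (PiLp.proj (𝕜 := ℝ) 2 (fun _ : Fin n => ℝ) b) (M' i (a'' i b θ x)) := by
      intro i
      refine ContinuousLinearMap.ext fun e => ?_
      rw [ContinuousLinearMap.comp_apply, ofBasis_apply, map_sum, sum_apply]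
      refine Finset.sum_congr rfl fun b _ => ?_
      rw [map_smul]
      rfl
    simp only [h2]
    rw [Fintype.sum_prod_type]
    change Φ _ = _
    simp only [map_sum]
    rfl

end IteratedDerivatives

namespace AdaptedChart

variable {GC : Subgroup (GL (Fin m) ℂ)} {ρ : GC →* GL (Fin (d + 1)) ℂ}
  {p : MvPolynomial (Fin (d + 1)) ℝ} {γ : AdaptedChart ρ p} [MeasurableSpace (G0 GC)]
  [BorelSpace (G0 GC)] {μ : Measure (G0 GC)} {f : G0 GC → ℂ} {H : Set (VR (d + 1))}
  {T : (VR (d + 1) → ℂ) → VR (d + 1) → G0 GC → ℂ}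

/-- Induction on the order of differentiability for all amplitudes at once. -/
theorem IsAmp.contDiffOn_oscInt [μ.IsHaarMeasure] (S : IsAdmissible ρ p μ f H)
    (hT : γ.IsAmp f H T) {ψ : VR (d + 1) → ℂ} (hψ : IsBddSmooth H ψ) :
    ContDiffOn ℝ ∞ (fun z : VR (d + 1) × VR (d + 1) => γ.oscInt μ T ψ z.1 z.2)
      ((γ.tildeU ∩ H) ×ˢ univ) := by
  refine contDiffOn_infty.2 fun k => ?_
  induction k generalizing T with
  | zero =>
    obtain ⟨A, B, -, -, hder⟩ := hT.exists_hasFDerivWithinAt_oscInt S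
    refine contDiffOn_zero.2 fun z hz => ?_
    exact (hder ψ hψ z.1 hz.1 z.2).continuousWithinAt
  | succ k ih =>
    obtain ⟨A, B, hA, hB, hder⟩ := hT.exists_hasFDerivWithinAt_oscInt S
    push_cast
    rw [contDiffOn_succ_iff_hasFDerivWithinAt_of_uniqueDiffOn
      ((γ.uniqueDiffOn_inter S.side).prod uniqueDiffOn_univ)]
    refine ⟨by simp, _, ?_, fun z hz => hder ψ hψ z.1 hz.1 z.2⟩
    unfold ofBasisPair ofBasis
    refine ContDiffOn.add (ContDiffOn.clm_comp ?_ contDiffOn_const)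
      (ContDiffOn.clm_comp ?_ contDiffOn_const)
    · exact ContDiffOn.sum fun b _ => contDiffOn_const.smulRight (ih (hA b))
    · exact ContDiffOn.sum fun b _ => contDiffOn_const.smulRight (ih (hB b))

/-- Oscillatory integrals decrease rapidly in the frequency: every power of `1 + |ζ|²` is absorbed
by integration by parts. -/
theorem IsAmp.exists_pow_mul [μ.IsHaarMeasure] (S : IsAdmissible ρ p μ f H)
    (hT : γ.IsAmp f H T) (R : ℕ) :
    ∃ T', γ.IsAmp f H T' ∧ ∀ ψ, IsBddSmooth H ψ → ∀ x ∈ γ.tildeU ∩ H, ∀ ζ : VR (d + 1),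
      (((1 + ‖ζ‖ ^ 2) ^ R : ℝ) : ℂ) * γ.oscInt μ T ψ x ζ = γ.oscInt μ T' ψ x ζ := by
  induction R with
  | zero => exact ⟨T, hT, fun ψ _ x _ ζ => by simp⟩
  | succ R ih =>
    obtain ⟨T₁, hT₁, h₁⟩ := ih
    choose T₂ hT₂ h₂ using fun a => hT₁.exists_coord_mul (μ := μ) S a
    choose T₃ hT₃ h₃ using fun a => (hT₂ a).exists_coord_mul (μ := μ) S a
    refine ⟨_, .add _ _ hT₁ (IsAmp.sum Finset.univ fun a _ => hT₃ a), fun ψ hψ x hx ζ => ?_⟩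
    rw [oscInt_add S hT₁ (IsAmp.sum Finset.univ fun a _ => hT₃ a) hψ hx,
      oscInt_sum _ S hT₃ hψ hx]
    simp only [← h₃ _ ψ hψ x hx, ← h₂ _ ψ hψ x hx, ← h₁ ψ hψ x hx]
    rw [EuclideanSpace.norm_sq_eq]
    simp only [Real.norm_eq_abs, sq_abs]
    push_cast
    rw [pow_succ, mul_add, mul_one, add_mul, Finset.mul_sum, Finset.sum_mul]
    refine congrArg₂ (· + ·) rfl (Finset.sum_congr rfl fun a _ => ?_)
    ring

/-- Mixed derivatives of oscillatory integrals, multiplied by powers of the frequency, are dominated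
by finitely many oscillatory integrals. -/
theorem IsAmp.exists_norm_iteratedFDeriv_le [μ.IsHaarMeasure] (S : IsAdmissible ρ p μ f H)
    (hT : γ.IsAmp f H T) (k j R : ℕ) :
    ∃ (κ : Type) (_ : Fintype κ) (T' : κ → (VR (d + 1) → ℂ) → VR (d + 1) → G0 GC → ℂ)
      (c : κ → ℝ), (∀ i, γ.IsAmp f H (T' i)) ∧ (∀ i, 0 ≤ c i) ∧
      ∀ ψ, IsBddSmooth H ψ → ∀ x ∈ γ.tildeU ∩ H, ∀ ζ : VR (d + 1),
        (1 + ‖ζ‖ ^ 2) ^ R * ‖iteratedFDeriv ℝ k (fun η => iteratedFDerivWithin ℝ j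
          (fun y => γ.oscInt μ T ψ y η) (γ.tildeU ∩ H) x) ζ‖ ≤
          ∑ i, c i * ‖γ.oscInt μ (T' i) ψ x ζ‖ := by
  -- derivatives in `x`, with `(ψ, ζ)` as parameters
  obtain ⟨ι, _, a, M, ha, haM⟩ := exists_iteratedFDerivWithin_eq_sum
    (Par := (VR (d + 1) → ℂ) × VR (d + 1)) (V := {ψ | IsBddSmooth H ψ} ×ˢ univ)
    (γ.uniqueDiffOn_inter S.side)
    (𝒜 := {a | ∃ T, γ.IsAmp f H T ∧ a = fun θ x => γ.oscInt μ T θ.1 x θ.2}) (by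
      rintro _ ⟨T, hT, rfl⟩
      obtain ⟨A, B, hA, -, hder⟩ := hT.exists_hasFDerivWithinAt_oscInt S
      refine ⟨fun b θ x => γ.oscInt μ (A b) θ.1 x θ.2, fun b => ⟨_, hA b, rfl⟩,
        fun θ hθ x hx => ?_⟩
      have h1 : HasFDerivWithinAt (fun y : VR (d + 1) => (y, θ.2))
          (ContinuousLinearMap.inl ℝ (VR (d + 1)) (VR (d + 1))) (γ.tildeU ∩ H) x :=
        hasFDerivAt_prodMk_left x θ.2 |>.hasFDerivWithinAt
      have h2 := (hder θ.1 hθ.1 x hx θ.2).comp x h1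
        (fun y hy => mk_mem_prod hy (mem_univ _))
      refine h2.congr_fderiv (ofBasis_eq fun b => ?_)
      exact ofBasisPair_single_fst _ _ b)
    (ι := Unit) (a := fun _ θ x => γ.oscInt μ T θ.1 x θ.2) (fun _ => ⟨T, hT, rfl⟩)
    (fun _ => ContinuousLinearMap.id ℝ ℂ) j
  choose T₁ hT₁ haT₁ using ha
  -- derivatives in `ζ`, with `(ψ, x)` as parameters
  set a₁ : ι → (VR (d + 1) → ℂ) × VR (d + 1) → VR (d + 1) → ℂ := fun i θ ζ =>
    γ.oscInt μ (T₁ i) θ.1 θ.2 ζ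
  obtain ⟨κ, _, a', M', ha', haM'⟩ := exists_iteratedFDerivWithin_eq_sum
    (Par := (VR (d + 1) → ℂ) × VR (d + 1)) (V := {ψ | IsBddSmooth H ψ} ×ˢ (γ.tildeU ∩ H))
    (S := univ) uniqueDiffOn_univ
    (𝒜 := {a | ∃ T, γ.IsAmp f H T ∧ a = fun θ ζ => γ.oscInt μ T θ.1 θ.2 ζ}) (by
      rintro _ ⟨T, hT, rfl⟩
      obtain ⟨A, B, -, hB, hder⟩ := hT.exists_hasFDerivWithinAt_oscInt S
      refine ⟨fun b θ ζ => γ.oscInt μ (B b) θ.1 θ.2 ζ, fun b => ⟨_, hB b, rfl⟩,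
        fun θ hθ ζ _ => ?_⟩
      have h1 : HasFDerivWithinAt (fun η : VR (d + 1) => (θ.2, η))
          (ContinuousLinearMap.inr ℝ (VR (d + 1)) (VR (d + 1))) univ ζ :=
        hasFDerivAt_prodMk_right θ.2 ζ |>.hasFDerivWithinAt
      have h2 := (hder θ.1 hθ.1 θ.2 hθ.2 ζ).comp ζ h1
        (fun η _ => mk_mem_prod hθ.2 (mem_univ _))
      refine h2.congr_fderiv (ofBasis_eq fun b => ?_)
      exact ofBasisPair_single_snd _ _ b)
    (a := a₁) (fun i => ⟨T₁ i, hT₁ i, rfl⟩) M k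
  choose T₂ hT₂ haT₂ using ha'
  choose T₃ hT₃ hR using fun i => (hT₂ i).exists_pow_mul (μ := μ) S R
  refine ⟨κ, inferInstance, T₃, fun i => ‖M' i‖, hT₃, fun i => norm_nonneg (M' i),
    fun ψ hψ x hx ζ => ?_⟩
  have h1 : (fun η => iteratedFDerivWithin ℝ j (fun y => γ.oscInt μ T ψ y η) (γ.tildeU ∩ H) x) =
      fun η => ∑ i, M i (γ.oscInt μ (T₁ i) ψ x η) := by
    funext η
    have h2 := haM (ψ, η) ⟨hψ, mem_univ _⟩ x hx
    simpa [haT₁] using h2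
  have h3 := haM' (ψ, x) ⟨hψ, hx⟩ ζ (mem_univ _)
  rw [iteratedFDerivWithin_univ] at h3
  rw [h1, h3]
  have hpos : 0 ≤ (1 + ‖ζ‖ ^ 2) ^ R := by positivity
  refine (mul_le_mul_of_nonneg_left (norm_sum_le _ _) hpos).trans ?_
  rw [Finset.mul_sum]
  refine Finset.sum_le_sum fun i _ => ?_
  rw [← hR i ψ hψ x hx ζ, norm_mul, Complex.norm_real, Real.norm_of_nonneg hpos, haT₂]
  calc (1 + ‖ζ‖ ^ 2) ^ R * ‖M' i (γ.oscInt μ (T₂ i) ψ x ζ)‖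
      ≤ (1 + ‖ζ‖ ^ 2) ^ R * (‖M' i‖ * ‖γ.oscInt μ (T₂ i) ψ x ζ‖) := by
        gcongr
        exact (M' i).le_opNorm _
    _ = _ := by ring

/-- Oscillatory integrals are symbols of order `-∞`. -/
theorem IsAmp.isSymbol [μ.IsHaarMeasure] (S : IsAdmissible ρ p μ f H) (hT : γ.IsAmp f H T)
    {ψ : VR (d + 1) → ℂ} (hψ : IsBddSmooth H ψ) (r : ℝ) :
    IsSymbol r (γ.tildeU ∩ H) (γ.oscInt μ T ψ) := by
  refine ⟨hT.contDiffOn_oscInt S hψ, fun k j K hKW hK => ?_⟩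
  -- it suffices to gain the power `(1 + |ζ|²)^{-R}` with `-R ≤ (r - k) / 2`
  obtain ⟨R, hR⟩ := exists_nat_ge (-((r - k) / 2))
  obtain ⟨κ, _, T', c, hT', hc, hle⟩ := hT.exists_norm_iteratedFDeriv_le (μ := μ) S k j R
  choose N C hC using fun i => (hT' i).oscInt_le S hK hKW
  choose b hb0 hb using fun i => hψ.bounded (N i)
  refine ⟨∑ i, c i * (C i * b i), fun x hx ζ => ?_⟩
  have h1 := (hle ψ hψ x (hKW hx) ζ).trans (Finset.sum_le_sum fun i _ =>
    mul_le_mul_of_nonneg_left (hC i ψ (b i) (hb0 i) (hb i) x hx ζ) (hc i))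
  have hpos : (0 : ℝ) < 1 + ‖ζ‖ ^ 2 := by positivity
  have h2 : 0 ≤ ∑ i, c i * (C i * b i) := le_trans (by positivity) h1
  have h3 : ((1 + ‖ζ‖ ^ 2) ^ R)⁻¹ ≤ (1 + ‖ζ‖ ^ 2) ^ ((r - k) / 2) := by
    rw [← Real.rpow_natCast, ← Real.rpow_neg hpos.le]
    refine Real.rpow_le_rpow_of_exponent_le ?_ (by linarith)
    nlinarith [sq_nonneg ‖ζ‖]
  calc _ = ((1 + ‖ζ‖ ^ 2) ^ R)⁻¹ * ((1 + ‖ζ‖ ^ 2) ^ R * ‖iteratedFDeriv ℝ k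
          (fun η => iteratedFDerivWithin ℝ j (fun y => γ.oscInt μ T ψ y η) (γ.tildeU ∩ H) x) ζ‖) := by
        field_simp
    _ ≤ ((1 + ‖ζ‖ ^ 2) ^ R)⁻¹ * ∑ i, c i * (C i * b i) := by gcongr
    _ ≤ (1 + ‖ζ‖ ^ 2) ^ ((r - k) / 2) * ∑ i, c i * (C i * b i) := by gcongr
    _ = _ := mul_comm _ _

/-- The derivatives in `x` of an oscillatory integral are bounded linearly in terms of finitely many
derivatives of `ψ`. -/
theorem IsAmp.exists_norm_iteratedFDerivWithin_le [μ.IsHaarMeasure] (S : IsAdmissible ρ p μ f H)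
    (hT : γ.IsAmp f H T) {K : Set (VR (d + 1))} (hK : IsCompact K)
    (hKW : K ⊆ γ.tildeU ∩ H) (j : ℕ) (ζ : VR (d + 1)) :
    ∃ (N : ℕ) (C : ℝ), 0 ≤ C ∧ ∀ ψ, IsBddSmooth H ψ → ∀ b : ℝ, 0 ≤ b →
      (∀ k ≤ N, ∀ y ∈ H, ‖iteratedFDerivWithin ℝ k ψ H y‖ ≤ b) →
      ∀ x ∈ K, ‖iteratedFDerivWithin ℝ j (fun y => γ.oscInt μ T ψ y ζ) (γ.tildeU ∩ H) x‖ ≤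
        C * b := by
  obtain ⟨κ, _, T', c, hT', hc, hle⟩ := hT.exists_norm_iteratedFDeriv_le (μ := μ) S 0 j 0
  choose N C hC using fun i => (hT' i).oscInt_le S hK hKW
  refine ⟨Finset.univ.sup N, ∑ i, c i * |C i|, Finset.sum_nonneg fun i _ =>
    mul_nonneg (hc i) (abs_nonneg _), fun ψ hψ b hb0 hb x hx => ?_⟩
  have h1 := hle ψ hψ x (hKW hx) ζ
  rw [pow_zero, one_mul, norm_iteratedFDeriv_zero] at h1
  refine h1.trans ?_
  rw [Finset.sum_mul]
  refine Finset.sum_le_sum fun i _ => ?_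
  rw [mul_assoc]
  refine mul_le_mul_of_nonneg_left ?_ (hc i)
  refine (hC i ψ b hb0 (fun k hk => hb k (hk.trans (Finset.le_sup (Finset.mem_univ i)))) x hx
    ζ).trans ?_
  exact mul_le_mul_of_nonneg_right (le_abs_self _) hb0

end AdaptedChart

/-! ### The local operators -/

section TestFunctions

open Filter Topology

theorem isSide_univ : IsSide (univ : Set (VR (d + 1))) :=
  ⟨convex_univ, isClosed_univ, by simp, fun _ _ _ _ _ _ => mem_univ _⟩

theorem continuous_coord (i : Fin n) : Continuous fun x : VR n => x i :=
  PiLp.continuous_apply 2 (fun _ : Fin n => ℝ) i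

theorem contDiff_coord (i : Fin n) : ContDiff ℝ ∞ fun x : VR n => x i :=
  (PiLp.proj (𝕜 := ℝ) 2 (fun _ : Fin n => ℝ) i).contDiff

theorem isSide_halfSpace {ε : ℝ} (hε : ε = 1 ∨ ε = -1) :
    IsSide (halfSpace ε : Set (VR (d + 1))) := by
  have hcont : Continuous fun x : VR (d + 1) => ε * x 0 := continuous_const.mul (continuous_coord 0)
  refine ⟨?_, isClosed_le continuous_const hcont, ?_, ?_⟩
  · intro x hx y hy a b ha hb _
    simp only [halfSpace, mem_ofPred_eq] at hx hy ⊢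
    simp only [PiLp.add_apply, PiLp.smul_apply, smul_eq_mul]
    nlinarith [mul_nonneg ha hx, mul_nonneg hb hy]
  · refine ⟨EuclideanSpace.single 0 ε, mem_interior.2 ⟨{x | 0 < ε * x 0}, fun x hx => (le_of_lt (show 0 < ε * x 0 from hx) : 0 ≤ ε * x 0),
      isOpen_lt continuous_const hcont, ?_⟩⟩
    rcases hε with rfl | rfl <;> simp
  · intro x hx y c hc hy
    simp only [halfSpace, mem_ofPred_eq] at hx ⊢
    rw [hy, mul_left_comm]
    positivity

variable {O H : Set (VR n)} {u : VR n → ℂ}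

theorem eventually_eq_zero_of_notMem {K : Set (VR n)} (hK : IsCompact K)
    (hu : ∀ x ∉ K, u x = 0) {y : VR n} (hy : y ∉ K) : u =ᶠ[𝓝 y] fun _ => 0 := by
  filter_upwards [hK.isClosed.isOpen_compl.mem_nhds hy] with z hz
  exact hu z hz

/-- The extension by zero of a test function on a relatively open subset is smooth. -/
theorem IsTestFunction.contDiffOn_extend (hO : IsOpen O) (hu : IsTestFunction (O ∩ H) u) :
    ContDiffOn ℝ ∞ u H := by
  obtain ⟨hsmooth, K, hK, hKW, hzero⟩ := hu
  intro y hy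
  by_cases hyK : y ∈ K
  · refine (hsmooth y (hKW hyK)).mono_of_mem_nhdsWithin ?_
    exact inter_mem (mem_nhdsWithin_of_mem_nhds (hO.mem_nhds (hKW hyK).1)) self_mem_nhdsWithin
  · exact (contDiffAt_const.congr_of_eventuallyEq
      (eventually_eq_zero_of_notMem hK hzero hyK)).contDiffWithinAt

theorem iteratedFDerivWithin_eq_zero {K : Set (VR n)} (hK : IsCompact K)
    (hu : ∀ x ∉ K, u x = 0) {y : VR n} (hy : y ∉ K) (k : ℕ) :
    iteratedFDerivWithin ℝ k u H y = 0 := by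
  have h1 : u =ᶠ[𝓝[H] y] fun _ => 0 :=
    (eventually_eq_zero_of_notMem hK hu hy).filter_mono nhdsWithin_le_nhds
  rw [h1.iteratedFDerivWithin_eq (hu y hy)]
  simp

/-- Bounds for the derivatives within `O ∩ H` of a function with compact support are bounds for its
derivatives within `H`. -/
theorem norm_iteratedFDerivWithin_le_of_inter (hO : IsOpen O) {K : Set (VR n)} (hK : IsCompact K)
    (hKW : K ⊆ O ∩ H) (hu : ∀ x ∉ K, u x = 0) {k : ℕ} {b : ℝ} (hb : 0 ≤ b)
    (h : ∀ x ∈ K, ‖iteratedFDerivWithin ℝ k u (O ∩ H) x‖ ≤ b) (y : VR n) :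
    ‖iteratedFDerivWithin ℝ k u H y‖ ≤ b := by
  by_cases hyK : y ∈ K
  · have h1 := h y hyK
    rwa [inter_comm, iteratedFDerivWithin_inter_open hO (hKW hyK).1] at h1
  · rw [iteratedFDerivWithin_eq_zero hK hu hyK, norm_zero]
    exact hb

theorem IsTestFunction.isBddSmooth (hO : IsOpen O) (hH : UniqueDiffOn ℝ H)
    (hu : IsTestFunction (O ∩ H) u) : IsBddSmooth H u := by
  have hs := hu.contDiffOn_extend hO
  obtain ⟨-, K, hK, hKW, hzero⟩ := hu
  refine ⟨hs, fun N => ?_⟩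
  have h1 : ∀ k : ℕ, ∃ b, ∀ x ∈ K, ‖iteratedFDerivWithin ℝ k u H x‖ ≤ b := fun k =>
    hK.exists_bound_of_continuousOn
      ((hs.continuousOn_iteratedFDerivWithin (by exact_mod_cast le_top) hH).mono
        (hKW.trans inter_subset_right))
  choose b hb using h1
  refine ⟨∑ k ∈ Finset.range (N + 1), |b k|, Finset.sum_nonneg fun _ _ => abs_nonneg _,
    fun k hk y hy => ?_⟩
  by_cases hyK : y ∈ K
  · refine (hb k y hyK).trans ((le_abs_self _).trans ?_)
    exact Finset.single_le_sum (f := fun k => |b k|) (fun _ _ => abs_nonneg _)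
      (Finset.mem_range.2 (Nat.lt_succ_of_le hk))
  · rw [iteratedFDerivWithin_eq_zero hK hzero hyK, norm_zero]
    exact Finset.sum_nonneg fun _ _ => abs_nonneg _

theorem isBddSmooth_one : IsBddSmooth (univ : Set (VR n)) fun _ => 1 := by
  refine ⟨contDiffOn_const, fun N => ⟨1, zero_le_one, fun k _ y _ => ?_⟩⟩
  rcases k with _ | k
  · simp
  · rw [iteratedFDerivWithin_univ, iteratedFDeriv_succ_const]
    simp

end TestFunctions

theorem inner_setFirst (s t : ℝ) (y ξ : VR (d + 1)) :
    inner ℝ (setFirst s y) (setFirst t ξ) = s * t + ∑ i : Fin d, y i.succ * ξ i.succ := by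
  rw [inner_eq_sum, Fin.sum_univ_succ]
  simp

theorem setFirst_self (y : VR (d + 1)) : setFirst (y 0) y = y := by
  ext i
  refine Fin.cases rfl (fun i => rfl) i

/-- The first coordinate is moved from the position to the frequency. -/
theorem inner_setFirst_eq {y z ξ : VR (d + 1)} {s t : ℝ} (h0 : y 0 = s * t)
    (hz : ∀ i : Fin d, z i.succ = y i.succ) :
    inner ℝ (setFirst s z) (setFirst (t * ξ 0) ξ) = inner ℝ y ξ := by
  rw [inner_setFirst, inner_eq_sum, Fin.sum_univ_succ, h0]
  simp only [hz]
  ring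

namespace AdaptedChart

variable {GC : Subgroup (GL (Fin m) ℂ)} {ρ : GC →* GL (Fin (d + 1)) ℂ}
  {p : MvPolynomial (Fin (d + 1)) ℝ} (γ : AdaptedChart ρ p) (f : G0 GC → ℂ)
  (H : Set (VR (d + 1)))

/-- The amplitude `f(g) c(g⁻¹v) ψ(κ(g⁻¹v))`. -/
def baseAmp (ψ : VR (d + 1) → ℂ) (x : VR (d + 1)) (g : G0 GC) : ℂ :=
  f g * ((γ.c (γ.pt x g) : ℂ) * ψ (kappa p γ.l (γ.pt x g)))

/-- The case of the building block with no derivatives of `f` and `ψ`, and with the cutoff `c`. -/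
theorem isAmp_baseAmp : γ.IsAmp f H (γ.baseAmp f) := by
  have := IsAmp.base (f := f) (H := H) [] γ.c 0 Fin.elim0 γ.c_smooth γ.c_compact γ.c_support
  simp only [bumpTerm, iteratedFDerivWithin_zero_apply] at this
  exact this

/-- Functions on the chart, extended by zero, are cut off by `c`. -/
theorem pullback_eq {u : VR (d + 1) → ℂ} (hu : ∀ x ∉ γ.tildeU, u x = 0) (w : VR (d + 1)) :
    γ.pullback u w = (γ.c w : ℂ) * u (kappa p γ.l w) := by
  by_cases hw : w ∈ γ.U
  · rw [pullback, indicator_of_mem hw, γ.c_one w hw]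
    simp
  · rw [pullback, indicator_of_notMem hw]
    by_cases hκ : kappa p γ.l w ∈ γ.tildeU
    · have hw1 : w ∉ γ.U₁ := by
        intro hw1
        obtain ⟨w', hw', h⟩ := hκ
        exact hw (γ.injOn (γ.subset hw') hw1 h ▸ hw')
      rw [image_eq_zero_of_notMem_tsupport fun h => hw1 (γ.c_support h)]
      simp
    · rw [hu _ hκ, mul_zero]

variable [MeasurableSpace (G0 GC)] (μ : Measure (G0 GC))

theorem localOp_eq {u : VR (d + 1) → ℂ} (hu : ∀ x ∉ γ.tildeU, u x = 0) (x : VR (d + 1)) :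
    γ.localOp μ f u x = ∫ g, γ.baseAmp f u x g ∂μ := by
  simp only [localOp, piOp, γ.pullback_eq hu]
  rfl

theorem localOp_eq_oscInt {u : VR (d + 1) → ℂ} (hu : ∀ x ∉ γ.tildeU, u x = 0) (x : VR (d + 1)) :
    γ.localOp μ f u x = γ.oscInt μ (γ.baseAmp f) u x 0 := by
  rw [γ.localOp_eq f μ hu, oscInt]
  simp [osc]

theorem symbol_eq_oscInt (x ξ : VR (d + 1)) :
    γ.symbol μ f x ξ = γ.oscInt μ (γ.baseAmp f) (fun _ => 1) x ξ := by
  rw [symbol, oscInt, ← integral_const_mul]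
  refine integral_congr_ae (Filter.Eventually.of_forall fun g => ?_)
  simp only [baseAmp, osc, phase, inner_sub_left, mul_one]
  rw [Complex.ofReal_sub, mul_sub, sub_eq_neg_add, Complex.exp_add, neg_mul]
  simp only [pt]
  ring

/-- The first component of `κ(g⁻¹v)` is `χ(g⁻¹) x₁`, so that `x₁` can be moved to the frequency. -/
theorem amplitude_eq_symbol (hrel : IsRelInvariant ρ p) {x : VR (d + 1)} (hx : x ∈ γ.tildeU)
    (ξ : VR (d + 1)) :
    γ.amplitude μ f x ξ = γ.symbol μ f x (setFirst (x 0 * ξ 0) ξ) := by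
  have h1 : inner ℝ (setFirst 1 x) (setFirst (x 0 * ξ 0) ξ) = inner ℝ x ξ :=
    inner_setFirst_eq (by simp) fun _ => rfl
  have h2 : ∀ g : G0 GC, inner ℝ (setFirst (character ρ p g.1⁻¹)
      (kappa p γ.l (act ρ g.1⁻¹ (γ.kinv x)))) (setFirst (x 0 * ξ 0) ξ) =
      inner ℝ (kappa p γ.l (act ρ g.1⁻¹ (γ.kinv x))) ξ := fun g =>
    inner_setFirst_eq (γ.kappa_pt_zero hrel hx g) fun _ => rfl
  simp only [amplitude, symbol, h1, h2]

/-- The character is positive, so that the sign of the first coordinate is preserved. -/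
theorem localOp_indicator (hrel : IsRelInvariant ρ p) (ε : ℝ) (u : VR (d + 1) → ℂ)
    {x : VR (d + 1)} (hx : x ∈ γ.tildeUSide ε) :
    γ.localOp μ f u x = γ.localOp μ f ((γ.tildeUSide ε).indicator u) x := by
  simp only [localOp, piOp]
  refine integral_congr_ae (Filter.Eventually.of_forall fun g => ?_)
  simp only
  congr 1
  by_cases hw : act ρ g.1⁻¹ (γ.kinv x) ∈ γ.U
  · rw [pullback, pullback, indicator_of_mem hw, indicator_of_mem hw, Function.comp_apply,
      Function.comp_apply, indicator_of_mem]
    refine ⟨mem_image_of_mem _ hw, ?_⟩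
    have h1 := γ.kappa_pt_zero hrel hx.1 g
    rw [pt] at h1
    rw [h1, mul_left_comm]
    exact mul_nonneg (hrel.character_inv_pos g).le hx.2
  · rw [pullback, pullback, indicator_of_notMem hw, indicator_of_notMem hw]

variable {γ f H μ} [BorelSpace (G0 GC)]

theorem integrable_baseAmp (S : IsAdmissible ρ p μ f H) {ψ : VR (d + 1) → ℂ}
    (hψ : IsBddSmooth H ψ) {x : VR (d + 1)} (hx : x ∈ γ.tildeU ∩ H) :
    Integrable (γ.baseAmp f ψ x) μ := by
  have := (γ.isAmp_baseAmp f H).integrable S hψ hx 0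
  simpa [osc] using this

/-- The value `A_f u(x)` is the oscillatory integral at frequency zero with `ψ = u`, which depends
continuously on `u`. -/
theorem isContinuousOperator_localOp [μ.IsHaarMeasure] (S : IsAdmissible ρ p μ f H) :
    IsContinuousOperator (γ.tildeU ∩ H) (γ.localOp μ f) := by
  have hzero : ∀ {u : VR (d + 1) → ℂ}, IsTestFunction (γ.tildeU ∩ H) u → ∀ x ∉ γ.tildeU, u x = 0 := by
    rintro u ⟨-, K, -, hKW, hu⟩ x hx
    exact hu x fun h => hx (hKW h).1
  have hbdd : ∀ {u : VR (d + 1) → ℂ}, IsTestFunction (γ.tildeU ∩ H) u → IsBddSmooth H u :=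
    fun hu => hu.isBddSmooth γ.isOpen_tildeU S.side.uniqueDiffOn
  refine ⟨fun u v hu hv x hx => ?_, fun z u hu x hx => ?_, fun u hu => ?_, ?_⟩
  · rw [γ.localOp_eq f μ (hzero hu), γ.localOp_eq f μ (hzero hv), γ.localOp_eq f μ fun x hx => by
      rw [hzero hu x hx, hzero hv x hx, add_zero], ← integral_add
      (integrable_baseAmp S (hbdd hu) hx) (integrable_baseAmp S (hbdd hv) hx)]
    simp only [baseAmp, mul_add]
  · rw [γ.localOp_eq f μ (hzero hu), γ.localOp_eq f μ fun x hx => by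
      rw [hzero hu x hx, mul_zero], ← integral_const_mul]
    simp only [baseAmp, mul_left_comm _ z]
  · have h1 := (γ.isAmp_baseAmp f H).contDiffOn_oscInt S (hbdd hu)
    have h2 : ContDiffOn ℝ ∞ (fun x : VR (d + 1) => (x, (0 : VR (d + 1)))) (γ.tildeU ∩ H) :=
      (contDiff_id.prodMk contDiff_const).contDiffOn
    refine (h1.comp h2 fun x hx => ⟨hx, mem_univ _⟩).congr fun x hx => ?_
    exact γ.localOp_eq_oscInt f μ (hzero hu) x
  · intro K L hK hKW hL hLW N
    choose N' C hC hle using fun k : ℕ =>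
      (γ.isAmp_baseAmp f H).exists_norm_iteratedFDerivWithin_le (μ := μ) S hL hLW k 0
    refine ⟨(Finset.range (N + 1)).sup N', ∑ k ∈ Finset.range (N + 1), C k,
      fun u hu huK b hb hub k hk x hx => ?_⟩
    have hkN : k ∈ Finset.range (N + 1) := Finset.mem_range.2 (Nat.lt_succ_of_le hk)
    have h1 := hle k u (hbdd hu) b hb (fun k' hk' y _ =>
      norm_iteratedFDerivWithin_le_of_inter γ.isOpen_tildeU hK hKW huK hb
        (hub k' (hk'.trans (Finset.le_sup hkN))) y) x hx
    have h2 : iteratedFDerivWithin ℝ k (γ.localOp μ f u) (γ.tildeU ∩ H) x =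
        iteratedFDerivWithin ℝ k (fun y => γ.oscInt μ (γ.baseAmp f) u y 0) (γ.tildeU ∩ H) x :=
      iteratedFDerivWithin_congr (fun y _ => γ.localOp_eq_oscInt f μ (hzero hu) y) (hLW hx) k
    rw [h2]
    refine h1.trans (mul_le_mul_of_nonneg_right ?_ hb)
    exact Finset.single_le_sum (fun k _ => hC k) hkN

end AdaptedChart

/-! ### Fourier inversion -/

section Waves

open FourierTransform Filter Topology

/-- The plane wave `e^{i x·ξ}`. -/
def wave (x ξ : VR n) : ℂ := Complex.exp (Complex.I * (inner ℝ x ξ : ℝ))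

@[simp] theorem norm_wave (x ξ : VR n) : ‖wave x ξ‖ = 1 := by
  rw [wave, mul_comm]
  exact Complex.norm_exp_ofReal_mul_I _

theorem wave_add (x y ξ : VR n) : wave (x + y) ξ = wave x ξ * wave y ξ := by
  rw [wave, inner_add_left, Complex.ofReal_add, mul_add, Complex.exp_add]
  rfl

theorem continuous_wave : Continuous fun z : VR n × VR n => wave z.1 z.2 := by
  unfold wave
  fun_prop

theorem conj_wave (x ξ : VR n) : (starRingEnd ℂ) (wave x ξ) = wave (-x) ξ := by
  simp only [wave, ← Complex.exp_conj, map_mul, Complex.conj_I, Complex.conj_ofReal,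
    inner_neg_left, Complex.ofReal_neg]
  ring_nf

/-- The Fourier transform without factors `2π` in the exponent, in terms of the one of the library.
-/
theorem integral_wave_neg_mul (F : VR n → ℂ) (ξ : VR n) :
    ∫ y, wave (-y) ξ * F y = 𝓕 F ((2 * Real.pi)⁻¹ • ξ) := by
  rw [Real.fourier_eq']
  congr 1
  ext y
  rw [wave, smul_eq_mul, inner_neg_left, inner_smul_right]
  congr 2
  push_cast
  field_simp

/-- The inverse Fourier transform without factors `2π` in the exponent, in terms of the one of the
library. -/
theorem integral_wave_mul (F : VR n → ℂ) (θ : VR n) :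
    ∫ ξ, wave θ ξ * F ((2 * Real.pi)⁻¹ • ξ) = ((2 * Real.pi) ^ n : ℝ) * 𝓕⁻ F θ := by
  have h := Measure.integral_comp_inv_smul (volume : Measure (VR n))
    (fun ξ => wave θ ((2 * Real.pi) • ξ) * F ξ) (2 * Real.pi)
  simp only [smul_inv_smul₀ Real.two_pi_pos.ne', finrank_euclideanSpace, Fintype.card_fin] at h
  rw [h, abs_of_pos (by positivity), Complex.real_smul, Real.fourierInv_eq']
  congr 2
  ext ξ
  rw [wave, smul_eq_mul, inner_smul_right, real_inner_comm]
  congr 2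
  push_cast
  ring

variable {F : VR n → ℂ}

theorem integrable_fourier (hF : ContDiff ℝ ∞ F) (hc : HasCompactSupport F) :
    Integrable (𝓕 F) := by
  have h := (𝓕 (hc.toSchwartzMap hF)).integrable (μ := volume)
  rwa [SchwartzMap.fourier_coe] at h

theorem integrable_integral_wave (hF : ContDiff ℝ ∞ F) (hc : HasCompactSupport F) :
    Integrable fun ξ => ∫ y, wave (-y) ξ * F y := by
  simp only [integral_wave_neg_mul]
  exact (integrable_fourier hF hc).comp_smul (by positivity)

/-- Fourier inversion. -/
theorem integral_wave_mul_integral_wave (hF : ContDiff ℝ ∞ F) (hc : HasCompactSupport F)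
    (θ : VR n) :
    ∫ ξ, wave θ ξ * ∫ y, wave (-y) ξ * F y = ((2 * Real.pi) ^ n : ℝ) * F θ := by
  simp only [integral_wave_neg_mul]
  rw [integral_wave_mul (𝓕 F), hF.continuous.fourierInv_fourier_eq
    (hF.continuous.integrable_of_hasCompactSupport hc) (integrable_fourier hF hc)]

variable {α : Type*} [MeasurableSpace α] {μ : Measure α} [SFinite μ] {h : α → ℂ} {θ : α → VR n}

theorem integrable_mul_wave_prod (hh : Integrable h μ) (hθ : Measurable θ) {G : VR n → ℂ}
    (hG : Integrable G) :
    Integrable (fun z : VR n × α => h z.2 * wave (θ z.2) z.1 * G z.1) (volume.prod μ) := by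
  have h1 : Integrable (fun z : VR n × α => wave (θ z.2) z.1 * (G z.1 * h z.2))
      (volume.prod μ) := by
    refine (hG.mul_prod hh).bdd_mul (c := 1) ?_ (Eventually.of_forall fun z => (norm_wave _ _).le)
    exact (continuous_wave.measurable.comp
      ((hθ.comp measurable_snd).prodMk measurable_fst)).aestronglyMeasurable
  refine h1.congr (Eventually.of_forall fun z => ?_)
  simp only
  ring

/-- Superpositions of plane waves, tested against the Fourier transform of `F`. -/
theorem integrable_superposition (hh : Integrable h μ) (hθ : Measurable θ)
    (hF : ContDiff ℝ ∞ F) (hc : HasCompactSupport F) :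
    Integrable fun ξ => (∫ g, h g * wave (θ g) ξ ∂μ) * ∫ y, wave (-y) ξ * F y := by
  have h1 := (integrable_mul_wave_prod hh hθ (integrable_integral_wave hF hc)).integral_prod_left
  simpa only [integral_mul_const] using h1

/-- Tested against the Fourier transform of `F`, a superposition of plane waves with frequencies
`θ` gives the integral of `F ∘ θ`. -/
theorem integral_superposition (hh : Integrable h μ) (hθ : Measurable θ)
    (hF : ContDiff ℝ ∞ F) (hc : HasCompactSupport F) :
    ∫ ξ, (∫ g, h g * wave (θ g) ξ ∂μ) * ∫ y, wave (-y) ξ * F y =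
      ((2 * Real.pi) ^ n : ℝ) * ∫ g, h g * F (θ g) ∂μ := by
  simp only [← integral_mul_const]
  rw [integral_integral_swap
    (integrable_mul_wave_prod hh hθ (integrable_integral_wave hF hc)), ← integral_const_mul]
  congr 1
  ext g
  simp only [mul_assoc]
  rw [integral_const_mul, integral_wave_mul_integral_wave hF hc]
  ring

/-- The dual form: the Fourier transform of an integrable superposition of plane waves. -/
theorem integral_mul_integral_superposition (hh : Integrable h μ) (hθ : Measurable θ)
    (hF : ContDiff ℝ ∞ F) (hc : HasCompactSupport F)
    (ha : Integrable fun ξ => ∫ g, h g * wave (θ g) ξ ∂μ) :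
    ∫ y, F y * ∫ ξ, wave (-y) ξ * ∫ g, h g * wave (θ g) ξ ∂μ =
      ((2 * Real.pi) ^ n : ℝ) * ∫ g, h g * F (θ g) ∂μ := by
  have hFi := hF.continuous.integrable_of_hasCompactSupport hc (μ := volume)
  have h1 : Integrable (fun z : VR n × VR n => wave (-z.1) z.2 *
      (F z.1 * ∫ g, h g * wave (θ g) z.2 ∂μ)) (volume.prod volume) := by
    refine (hFi.mul_prod ha).bdd_mul (c := 1) ?_ (Eventually.of_forall fun z => (norm_wave _ _).le)
    exact (continuous_wave.comp (continuous_fst.neg.prodMk continuous_snd)).aestronglyMeasurable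
  rw [← integral_superposition hh hθ hF hc]
  have h2 := integral_integral_swap
    (f := fun y ξ => wave (-y) ξ * (F y * ∫ g, h g * wave (θ g) ξ ∂μ)) h1
  calc _ = ∫ y, ∫ ξ, wave (-y) ξ * (F y * ∫ g, h g * wave (θ g) ξ ∂μ) := by
        simp only [← integral_const_mul, mul_left_comm]
    _ = _ := h2
    _ = _ := by
        congr 1
        ext ξ
        rw [← integral_const_mul]
        congr 1
        ext y
        ring

/-- If the frequencies `θ` are bounded below by a positive number, then the superposition has mean
zero: with the regularization `e^{-εs²}` its integral is `O(ε^{-1/2} e^{-δ²/4ε})`. -/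
theorem integral_superposition_eq_zero {θ : α → ℝ} (hh : Integrable h μ) (hθ : Measurable θ)
    {δ : ℝ} (hδ : 0 < δ) (hle : ∀ g, δ ≤ θ g) :
    ∫ s : ℝ, ∫ g, h g * Complex.exp (Complex.I * θ g * s) ∂μ = 0 := by
  -- without integrability the integral is zero by convention
  by_cases hint : Integrable fun s : ℝ => ∫ g, h g * Complex.exp (Complex.I * θ g * s) ∂μ
  swap
  · exact integral_undef hint
  have hnorm : ∀ (g : α) (s : ℝ), ‖Complex.exp (Complex.I * θ g * s)‖ = 1 := fun g s => by
    rw [mul_assoc, mul_comm, ← Complex.ofReal_mul]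
    exact Complex.norm_exp_ofReal_mul_I _
  have hgauss : ∀ k : ℕ, ∀ s : ℝ, ‖Complex.exp (-((((k : ℝ) + 1)⁻¹ : ℝ) : ℂ) * s ^ 2)‖ ≤ 1 := by
    intro k s
    rw [Complex.norm_exp]
    have : (-((((k : ℝ) + 1)⁻¹ : ℝ) : ℂ) * s ^ 2).re = -((k : ℝ) + 1)⁻¹ * s ^ 2 := by
      rw [← Complex.ofReal_neg, ← Complex.ofReal_pow, ← Complex.ofReal_mul,
        Complex.ofReal_re]
    rw [this, Real.exp_le_one_iff, neg_mul, neg_nonpos]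
    positivity
  -- regularization with `ε = 1 / (k + 1)`
  have hlim : Tendsto (fun k : ℕ => ∫ s : ℝ, Complex.exp (-((((k : ℝ) + 1)⁻¹ : ℝ) : ℂ) * s ^ 2) *
      ∫ g, h g * Complex.exp (Complex.I * θ g * s) ∂μ) atTop
      (𝓝 (∫ s : ℝ, ∫ g, h g * Complex.exp (Complex.I * θ g * s) ∂μ)) := by
    refine tendsto_integral_of_dominated_convergence _ (fun k => ?_) hint.norm (fun k => ?_) ?_
    · exact (Continuous.aestronglyMeasurable (by fun_prop)).mul hint.aestronglyMeasurable
    · refine Eventually.of_forall fun s => ?_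
      rw [norm_mul]
      exact mul_le_of_le_one_left (norm_nonneg _) (hgauss k s)
    · refine Eventually.of_forall fun s => ?_
      have h1 : Tendsto (fun k : ℕ => Complex.exp (-((((k : ℝ) + 1)⁻¹ : ℝ) : ℂ) * s ^ 2)) atTop
          (𝓝 (Complex.exp (-((0 : ℝ) : ℂ) * s ^ 2))) := by
        have h2 : Tendsto (fun k : ℕ => ((k : ℝ) + 1)⁻¹) atTop (𝓝 0) := by
          simpa [one_div] using tendsto_one_div_add_atTop_nhds_zero_nat (𝕜 := ℝ)
        have h3 : Continuous fun ε : ℝ => Complex.exp (-(ε : ℂ) * s ^ 2) := by fun_prop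
        have h4 := (h3.tendsto 0).comp h2
        refine h4.congr fun k => ?_
        simp
      simpa using h1.mul_const (∫ g, h g * Complex.exp (Complex.I * θ g * s) ∂μ)
  refine tendsto_nhds_unique hlim ?_
  have hbound : ∀ k : ℕ, ‖∫ s : ℝ, Complex.exp (-((((k : ℝ) + 1)⁻¹ : ℝ) : ℂ) * s ^ 2) *
      ∫ g, h g * Complex.exp (Complex.I * θ g * s) ∂μ‖ ≤
      (Real.pi * ((k : ℝ) + 1)) ^ (1 / 2 : ℝ) * Real.exp (-(δ ^ 2 / 4) * ((k : ℝ) + 1)) *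
        ∫ g, ‖h g‖ ∂μ := by
    intro k
    have hk : (0 : ℝ) < ((k : ℝ) + 1)⁻¹ := by positivity
    have hgi : Integrable fun s : ℝ => Complex.exp (-((((k : ℝ) + 1)⁻¹ : ℝ) : ℂ) * s ^ 2) := by
      exact integrable_cexp_neg_mul_sq (by rwa [Complex.ofReal_re])
    have hprod : Integrable (fun z : ℝ × α => Complex.exp (-((((k : ℝ) + 1)⁻¹ : ℝ) : ℂ) * z.1 ^ 2) *
        (h z.2 * Complex.exp (Complex.I * θ z.2 * z.1))) (volume.prod μ) := by
      have h1 : Integrable (fun z : ℝ × α => Complex.exp (Complex.I * θ z.2 * z.1) *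
          (Complex.exp (-((((k : ℝ) + 1)⁻¹ : ℝ) : ℂ) * z.1 ^ 2) * h z.2)) (volume.prod μ) := by
        refine (hgi.mul_prod hh).bdd_mul (c := 1) ?_ (Eventually.of_forall fun z => (hnorm _ _).le)
        refine Measurable.aestronglyMeasurable ?_
        exact Complex.measurable_exp.comp ((measurable_const.mul
          (Complex.measurable_ofReal.comp (hθ.comp measurable_snd))).mul
          (Complex.measurable_ofReal.comp measurable_fst))
      refine h1.congr (Eventually.of_forall fun z => ?_)
      simp only
      ring
    -- Fubini, and the Fourier transform of a Gaussian
    have hswap : ∫ s : ℝ, Complex.exp (-((((k : ℝ) + 1)⁻¹ : ℝ) : ℂ) * s ^ 2) *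
        ∫ g, h g * Complex.exp (Complex.I * θ g * s) ∂μ = ∫ g, h g *
          ((Real.pi / ((((k : ℝ) + 1)⁻¹ : ℝ) : ℂ)) ^ (1 / 2 : ℂ) *
            Complex.exp (-(θ g : ℂ) ^ 2 / (4 * ((((k : ℝ) + 1)⁻¹ : ℝ) : ℂ)))) ∂μ := by
      simp only [← integral_const_mul]
      rw [integral_integral_swap hprod]
      congr 1
      ext g
      rw [← fourierIntegral_gaussian (b := ((((k : ℝ) + 1)⁻¹ : ℝ) : ℂ))
          (by rwa [Complex.ofReal_re]),
        ← integral_const_mul]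
      congr 1
      ext s
      push_cast
      ring
    rw [hswap, ← integral_const_mul]
    refine norm_integral_le_of_norm_le (hh.norm.const_mul _) (Eventually.of_forall fun g => ?_)
    have e1 : (Real.pi / ((((k : ℝ) + 1)⁻¹ : ℝ) : ℂ)) ^ (1 / 2 : ℂ) =
        (((Real.pi * ((k : ℝ) + 1)) ^ (1 / 2 : ℝ) : ℝ) : ℂ) := by
      rw [Complex.ofReal_cpow (by positivity)]
      push_cast
      rw [div_inv_eq_mul]
    have e2 : Complex.exp (-(θ g : ℂ) ^ 2 / (4 * ((((k : ℝ) + 1)⁻¹ : ℝ) : ℂ))) =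
        ((Real.exp (-(θ g ^ 2 / 4) * ((k : ℝ) + 1)) : ℝ) : ℂ) := by
      rw [Complex.ofReal_exp]
      congr 1
      push_cast
      field_simp
    rw [norm_mul, e1, e2, ← Complex.ofReal_mul, Complex.norm_real, Real.norm_of_nonneg
      (by positivity), mul_comm]
    have e3 : δ ^ 2 ≤ θ g ^ 2 := pow_le_pow_left₀ hδ.le (hle g) 2
    gcongr
  refine squeeze_zero_norm hbound ?_
  have h1 := (tendsto_rpow_mul_exp_neg_mul_atTop_nhds_zero (1 / 2) (δ ^ 2 / 4) (by positivity)).comp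
    (tendsto_atTop_add_const_right atTop (1 : ℝ) tendsto_natCast_atTop_atTop)
  have h2 := (h1.const_mul (Real.pi ^ (1 / 2 : ℝ))).mul_const (∫ g, ‖h g‖ ∂μ)
  rw [mul_zero, zero_mul] at h2
  refine h2.congr fun k => ?_
  simp only [Function.comp_apply]
  rw [Real.mul_rpow Real.pi_pos.le (by positivity)]
  ring

end Waves

/-! ### Dilations of the first coordinate -/

section Dilations

open Filter Topology

@[simp] theorem setFirst_setFirst (s t : ℝ) (x : VR (d + 1)) :
    setFirst s (setFirst t x) = setFirst s x := rfl

theorem continuous_setFirst : Continuous fun z : ℝ × VR (d + 1) => setFirst z.1 z.2 := by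
  refine (PiLp.continuous_toLp 2 _).comp (continuous_pi fun i => ?_)
  refine Fin.cases ?_ (fun i => ?_) i
  · exact continuous_fst
  · exact (continuous_coord i.succ).comp continuous_snd

/-- The dilation `(x₁, x') ↦ (c x₁, x')`. -/
def dilation (c : ℝ) : VR (d + 1) →ₗ[ℝ] VR (d + 1) :=
  Matrix.toLpLin 2 2 (Matrix.diagonal (Fin.cons c fun _ => 1))

theorem dilation_apply (c : ℝ) (x : VR (d + 1)) : dilation c x = setFirst (c * x 0) x := by
  ext i
  refine Fin.cases ?_ (fun i => ?_) i <;> simp [dilation, Matrix.mulVec_diagonal]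

theorem det_dilation (c : ℝ) : LinearMap.det (dilation c : VR (d + 1) →ₗ[ℝ] VR (d + 1)) = c := by
  rw [dilation, Matrix.toLpLin_eq_toLin, LinearMap.det_toLin, Matrix.det_diagonal,
    Fin.prod_univ_succ]
  simp

theorem dilation_inv_dilation {c : ℝ} (hc : c ≠ 0) (x : VR (d + 1)) :
    dilation c⁻¹ (dilation c x) = x := by
  simp only [dilation_apply, setFirst_zero, setFirst_setFirst]
  rw [inv_mul_cancel_left₀ hc, setFirst_self]

/-- For `c ≠ 0` the dilation is a homeomorphism. -/
def dilationHomeomorph {c : ℝ} (hc : c ≠ 0) : VR (d + 1) ≃ₜ VR (d + 1) where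
  toFun := dilation c
  invFun := dilation c⁻¹
  left_inv := dilation_inv_dilation hc
  right_inv x := by simpa using dilation_inv_dilation (inv_ne_zero hc) x
  continuous_toFun := LinearMap.continuous_of_finiteDimensional _
  continuous_invFun := LinearMap.continuous_of_finiteDimensional _

theorem map_dilation {c : ℝ} (hc : c ≠ 0) :
    Measure.map (dilation c : VR (d + 1) →ₗ[ℝ] VR (d + 1)) volume =
      ENNReal.ofReal |c⁻¹| • volume := by
  rw [Measure.map_linearMap_addHaar_eq_smul_addHaar _ (by rwa [det_dilation]), det_dilation]

/-- The change of variables `y = (c y₁, y')`. -/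
theorem integral_eq_integral_dilation {c : ℝ} (hc : c ≠ 0) (F : VR (d + 1) → ℂ) :
    ∫ y, F y = |c| * ∫ y, F (setFirst (c * y 0) y) := by
  have h := (dilationHomeomorph (d := d) hc).measurableEmbedding.integral_map (μ := volume) F
  change ∫ y, F y ∂(Measure.map (dilation c) volume) = ∫ y, F (dilation c y) at h
  rw [map_dilation hc, integral_smul_measure, ENNReal.toReal_ofReal (abs_nonneg _)] at h
  simp only [dilation_apply] at h
  rw [← h, abs_inv, Complex.real_smul, Complex.ofReal_inv, mul_inv_cancel_left₀]
  exact_mod_cast abs_ne_zero.2 hc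

theorem integrable_comp_dilation {c : ℝ} (hc : c ≠ 0) {F : VR (d + 1) → ℂ} :
    Integrable (fun y => F (setFirst (c * y 0) y)) ↔ Integrable F := by
  have h := (dilationHomeomorph (d := d) hc).measurableEmbedding.integrable_map_iff
    (μ := volume) (g := F)
  change Integrable F (Measure.map (dilation c) volume) ↔
    Integrable (fun y => F (dilation c y)) _ at h
  rw [map_dilation hc, integrable_smul_measure (by simp [hc]) ENNReal.ofReal_ne_top] at h
  simp only [dilation_apply] at h
  exact h.symm

/-- The hyperplane `{x₁ = 0}` is the kernel of a nonzero linear map. -/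
theorem ae_coord_zero_ne_zero : ∀ᵐ x : VR (d + 1), x 0 ≠ 0 := by
  have h : volume ((dilation 0 - LinearMap.id : VR (d + 1) →ₗ[ℝ] VR (d + 1)).ker : Set (VR (d + 1)))
      = 0 := by
    refine Measure.addHaar_submodule _ _ fun htop => ?_
    have h1 : EuclideanSpace.single 0 1 ∈ (dilation 0 - LinearMap.id :
      VR (d + 1) →ₗ[ℝ] VR (d + 1)).ker := htop ▸ Submodule.mem_top
    rw [LinearMap.mem_ker, LinearMap.sub_apply, dilation_apply, sub_eq_zero] at h1
    have h2 := congrArg (fun x : VR (d + 1) => x 0) h1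
    simp at h2
  refine measure_mono_null (fun x hx => ?_) h
  have hx0 : x 0 = 0 := not_not.1 hx
  rw [SetLike.mem_coe, LinearMap.mem_ker, LinearMap.sub_apply, dilation_apply, sub_eq_zero,
    zero_mul, LinearMap.id_apply]
  conv_rhs => rw [← setFirst_self x, hx0]

end Dilations

/-! ### Kernels of smoothing symbols -/

section Kernels

open FourierTransform Filter Topology

theorem wave_neg_comm (x ξ : VR n) : wave (-x) ξ = wave (-ξ) x := by
  rw [wave, wave, inner_neg_left, inner_neg_left, real_inner_comm]

/-- A family of functions whose derivatives decrease uniformly like `|ξ|^{-n-1}` has Fourier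
transforms that decrease uniformly like `|ξ|^{-n-1}`, hence are uniformly integrable. -/
theorem exists_integral_norm_fourier_le {ι : Type*} {a : ι → VR n → ℂ} {C : ℕ → ℝ}
    (ha : ∀ x, ContDiff ℝ ∞ (a x))
    (hC : ∀ x k ξ, ‖iteratedFDeriv ℝ k (a x) ξ‖ ≤ C k * (1 + ‖ξ‖ ^ 2) ^ (-((n : ℝ) + 1) / 2)) :
    ∃ M : ℝ, ∀ x ξ, ‖𝓕 (a x) ξ‖ ≤ M * (1 + ‖ξ‖) ^ (-((n : ℝ) + 1)) := by
  have hJ : Integrable fun ξ : VR n => (1 + ‖ξ‖ ^ 2) ^ (-((n : ℝ) + 1) / 2) :=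
    integrable_rpow_neg_one_add_norm_sq (by simp)
  set J := ∫ ξ : VR n, (1 + ‖ξ‖ ^ 2) ^ (-((n : ℝ) + 1) / 2) with hJdef
  have hint : ∀ x k, Integrable fun ξ => ‖iteratedFDeriv ℝ k (a x) ξ‖ := fun x k =>
    (hJ.const_mul (C k)).mono' ((ha x).continuous_iteratedFDeriv
      (by exact_mod_cast le_top)).norm.aestronglyMeasurable
      (Eventually.of_forall fun ξ => by rw [norm_norm]; exact hC x k ξ)
  have hpow : ∀ N : ℕ, ∀ x ξ, ‖ξ‖ ^ N * ‖𝓕 (a x) ξ‖ ≤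
      2 ^ N * ∑ k ∈ Finset.range (N + 1), C k * J := by
    intro N x ξ
    have h1 := Real.pow_mul_norm_iteratedFDeriv_fourier_le (f := a x) (K := 0) (N := (N : ℕ∞))
      ((ha x).of_le (by exact_mod_cast le_top)) (fun k l hk _ => by
        have hk0 : k = 0 := by simpa using hk
        subst hk0
        simpa using hint x l) (k := 0) (n := N) le_rfl le_rfl ξ
    simp only [norm_iteratedFDeriv_zero] at h1
    refine h1.trans ?_
    rw [Finset.sum_product]
    simp only [zero_add, Finset.range_one, Finset.sum_singleton, pow_zero, one_mul, Nat.cast_zero,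
      mul_zero]
    gcongr with k hk
    rw [hJdef, ← integral_const_mul]
    exact integral_mono (hint x k) (hJ.const_mul _) (hC x k)
  refine ⟨2 ^ n * ((2 ^ 0 * ∑ k ∈ Finset.range (0 + 1), C k * J) +
    2 ^ (n + 1) * ∑ k ∈ Finset.range (n + 1 + 1), C k * J), fun x ξ => ?_⟩
  have hpos : (0 : ℝ) < 1 + ‖ξ‖ := by positivity
  rw [Real.rpow_neg hpos.le, ← div_eq_mul_inv, le_div_iff₀ (by positivity)]
  have h2 : (1 + ‖ξ‖) ^ ((n : ℝ) + 1) = (1 + ‖ξ‖) ^ (n + 1) := by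
    exact_mod_cast Real.rpow_natCast (1 + ‖ξ‖) (n + 1)
  rw [h2]
  have h3 := add_pow_le zero_le_one (norm_nonneg ξ) (n + 1)
  rw [Nat.add_sub_cancel, one_pow] at h3
  have h4 := hpow 0 x ξ
  have h5 := hpow (n + 1) x ξ
  rw [pow_zero, one_mul] at h4
  calc ‖𝓕 (a x) ξ‖ * (1 + ‖ξ‖) ^ (n + 1) ≤ ‖𝓕 (a x) ξ‖ * (2 ^ n * (1 + ‖ξ‖ ^ (n + 1))) := by
        gcongr
    _ = 2 ^ n * (‖𝓕 (a x) ξ‖ + ‖ξ‖ ^ (n + 1) * ‖𝓕 (a x) ξ‖) := by ring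
    _ ≤ _ := by gcongr

/-- The kernel `k(x, σ) = (2π)^{-n} ∫ e^{-i(σ - (1, x'))·ζ} a(x, ζ) dζ` of a symbol in the
multiplicative variable `σ₁ = y₁/x₁`, `σ' = y'`. -/
def bKernel (a : VR (d + 1) → VR (d + 1) → ℂ) (x σ : VR (d + 1)) : ℂ :=
  (((2 * Real.pi) ^ (d + 1))⁻¹ : ℝ) * ∫ ζ, wave (-(σ - setFirst 1 x)) ζ * a x ζ

variable {a : VR (d + 1) → VR (d + 1) → ℂ} {W K : Set (VR (d + 1))}

theorem bKernel_eq (x σ : VR (d + 1)) : bKernel a x σ = (((2 * Real.pi) ^ (d + 1))⁻¹ : ℝ) *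
    𝓕 (a x) ((2 * Real.pi)⁻¹ • (σ - setFirst 1 x)) := by
  rw [← integral_wave_neg_mul, bKernel]
  simp only [wave_neg_comm]

/-- The derivatives of a symbol of order `-∞` in the frequency are bounded by multiples of the
integrable function `(1 + |ξ|²)^{-(n+1)/2}`, locally uniformly in `x`. -/
theorem exists_symbol_bounds (ha : ∀ r, IsSymbol r W a) (hKW : K ⊆ W) (hK : IsCompact K) :
    (∀ x ∈ W, ContDiff ℝ ∞ (a x)) ∧ ∃ C : ℕ → ℝ, ∀ x ∈ K, ∀ k ξ,
      ‖iteratedFDeriv ℝ k (a x) ξ‖ ≤ C k * (1 + ‖ξ‖ ^ 2) ^ (-(((d + 1 : ℕ) : ℝ) + 1) / 2) := by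
  constructor
  · intro x hx
    have h1 : ContDiffOn ℝ ∞ (fun ξ : VR (d + 1) => (x, ξ)) univ :=
      (contDiff_const.prodMk contDiff_id).contDiffOn
    exact contDiffOn_univ.1 ((ha 0).1.comp h1 fun ξ _ => ⟨hx, mem_univ _⟩)
  -- the order `k - (n + 1)` compensates the gain from `k` derivatives
  · choose C hC using fun k : ℕ =>
      (ha ((k : ℝ) - (((d + 1 : ℕ) : ℝ) + 1))).2 k 0 K hKW hK
    refine ⟨C, fun x hx k ξ => ?_⟩
    have h1 := hC k x hx ξ
    simp only [iteratedFDerivWithin_zero_eq_comp] at h1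
    have h2 := LinearIsometryEquiv.norm_iteratedFDeriv_comp_left
      (continuousMultilinearCurryFin0 ℝ (VR (d + 1)) ℂ).symm (a x) ξ k
    rw [← h2, show -(((d + 1 : ℕ) : ℝ) + 1) = (k : ℝ) - (((d + 1 : ℕ) : ℝ) + 1) - k by ring]
    exact h1

theorem integrable_symbol (ha : ∀ r, IsSymbol r W a) {x : VR (d + 1)} (hx : x ∈ W) :
    Integrable (a x) := by
  obtain ⟨h1, C, hC⟩ := exists_symbol_bounds ha (singleton_subset_iff.2 hx) isCompact_singleton
  have hJ : Integrable fun ξ : VR (d + 1) =>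
      (1 + ‖ξ‖ ^ 2) ^ (-(((d + 1 : ℕ) : ℝ) + 1) / 2) :=
    integrable_rpow_neg_one_add_norm_sq (by simp)
  refine (hJ.const_mul (C 0)).mono' (h1 x hx).continuous.aestronglyMeasurable
    (Eventually.of_forall fun ξ => ?_)
  have h2 := hC x rfl 0 ξ
  rwa [norm_iteratedFDeriv_zero] at h2

theorem continuous_bKernel {x : VR (d + 1)} (hx : Integrable (a x)) :
    Continuous (bKernel a x) := by
  have h2 : Continuous (𝓕 (a x)) := VectorFourier.fourierIntegral_continuous
    Real.continuous_fourierChar (by exact continuous_inner) hx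
  have h3 : Continuous fun σ : VR (d + 1) => (2 * Real.pi)⁻¹ • (σ - setFirst 1 x) := by fun_prop
  rw [show bKernel a x = _ from funext fun σ => bKernel_eq x σ]
  exact continuous_const.mul (h2.comp h3)

/-- The kernel of a symbol of order `-∞` is integrable in `σ`, locally uniformly in `x`. -/
theorem exists_integral_norm_bKernel_le (ha : ∀ r, IsSymbol r W a) (hKW : K ⊆ W)
    (hK : IsCompact K) :
    ∃ M : ℝ, ∀ x ∈ K, Integrable (bKernel a x) ∧ ∫ σ, ‖bKernel a x σ‖ ≤ M := by
  obtain ⟨h1, C, hC⟩ := exists_symbol_bounds ha hKW hK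
  obtain ⟨M, hM⟩ := exists_integral_norm_fourier_le (ι := K) (a := fun x => a x) (C := C)
    (fun x => h1 x (hKW x.2)) fun x => hC x x.2
  have hJ : Integrable fun ξ : VR (d + 1) => (1 + ‖ξ‖) ^ (-(((d + 1 : ℕ) : ℝ) + 1)) :=
    integrable_one_add_norm (by simp)
  have hJ' := hJ.comp_smul (R := (2 * Real.pi)⁻¹) (by positivity)
  set c : ℝ := ((2 * Real.pi) ^ (d + 1))⁻¹ with hc
  have hc0 : 0 ≤ c := by positivity
  have hle : ∀ x ∈ K, ∀ σ, ‖bKernel a x σ‖ ≤ c * (M *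
      (1 + ‖(2 * Real.pi)⁻¹ • (σ - setFirst 1 x)‖) ^ (-(((d + 1 : ℕ) : ℝ) + 1))) := by
    intro x hx σ
    rw [bKernel_eq, norm_mul, Complex.norm_real, Real.norm_of_nonneg hc0]
    exact mul_le_mul_of_nonneg_left (hM ⟨x, hx⟩ _) hc0
  have hint : ∀ x, Integrable fun σ : VR (d + 1) => c * (M *
      (1 + ‖(2 * Real.pi)⁻¹ • (σ - setFirst 1 x)‖) ^ (-(((d + 1 : ℕ) : ℝ) + 1))) := fun x =>
    ((hJ'.comp_sub_right (setFirst 1 x)).const_mul M).const_mul c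
  refine ⟨∫ σ : VR (d + 1), c * (M *
    (1 + ‖(2 * Real.pi)⁻¹ • σ‖) ^ (-(((d + 1 : ℕ) : ℝ) + 1))), fun x hx => ?_⟩
  have hk : Integrable (bKernel a x) := by
    refine (hint x).mono' ?_ (Eventually.of_forall (hle x hx))
    exact (continuous_bKernel (integrable_symbol ha (hKW hx))).aestronglyMeasurable
  refine ⟨hk, (integral_mono hk.norm (hint x) (hle x hx)).trans (le_of_eq ?_)⟩
  exact integral_sub_right_eq_self (fun σ : VR (d + 1) => c * (M *
    (1 + ‖(2 * Real.pi)⁻¹ • σ‖) ^ (-(((d + 1 : ℕ) : ℝ) + 1)))) (setFirst 1 x)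

end Kernels

/-! ### Lacunarity and the amplitude -/

namespace AdaptedChart

variable {GC : Subgroup (GL (Fin m) ℂ)} {ρ : GC →* GL (Fin (d + 1)) ℂ}
  {p : MvPolynomial (Fin (d + 1)) ℝ} {γ : AdaptedChart ρ p} [MeasurableSpace (G0 GC)]
  [BorelSpace (G0 GC)] {μ : Measure (G0 GC)} {f : G0 GC → ℂ} {H : Set (VR (d + 1))}
  {T : (VR (d + 1) → ℂ) → VR (d + 1) → G0 GC → ℂ} {ψ : VR (d + 1) → ℂ} {x : VR (d + 1)}

theorem sFinite_haar [μ.IsHaarMeasure] (hG : IsAlgebraicSubgroup ℝ GC) : SFinite μ := by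
  have := sigmaCompactSpace_G0 hG
  infer_instance

theorem continuous_character_inv (hrel : IsRelInvariant ρ p) :
    Continuous fun g : G0 GC => character ρ p g.1⁻¹ := by
  have h1 := hrel.continuous_act_inv
  obtain ⟨v, hv⟩ := hrel.ne_zero
  have h2 : (fun g : G0 GC => character ρ p g.1⁻¹) =
      fun g => pfun p (act ρ g.1⁻¹ v) / pfun p v := by
    ext g
    rw [hrel.map_act, mul_div_cancel_right₀ _ hv]
  rw [h2]
  exact ((contDiff_pfun p).continuous.comp (h1 v)).div_const _

theorem continuous_kappa_pt (hrel : IsRelInvariant ρ p) (γ : AdaptedChart ρ p)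
    (x : VR (d + 1)) : Continuous fun g => kappa p γ.l (γ.pt x g) :=
  (contDiff_kappa p γ.l).continuous.comp (hrel.continuous_act_inv _)

/-- The frequencies `χ(g⁻¹) - t` are positive for `t < 0`, whence lacunarity. -/
theorem IsAmp.isLacunary [μ.IsHaarMeasure] (S : IsAdmissible ρ p μ f H) (hT : γ.IsAmp f H T)
    (hψ : IsBddSmooth H ψ) : IsLacunary (γ.tildeU ∩ H) (γ.oscInt μ T ψ) := by
  intro x hx ξ t ht
  have : SFinite μ := sFinite_haar S.algebraic
  have h := integral_superposition_eq_zero (μ := μ)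
    (h := fun g => T ψ x g * γ.osc x (setFirst 0 ξ) g)
    (θ := fun g => character ρ p g.1⁻¹ - t) (hT.integrable S hψ hx _)
    ((continuous_character_inv S.rel).sub continuous_const).measurable (neg_pos.2 ht)
    fun g => by linarith [S.rel.character_inv_pos g]
  rw [← h]
  congr 1
  ext s
  rw [oscInt, ← integral_const_mul]
  congr 1
  ext g
  have h1 : inner ℝ (γ.phase x g) (setFirst s ξ) =
      (character ρ p g.1⁻¹ - 1) * s + inner ℝ (γ.phase x g) (setFirst 0 ξ) := by
    simp only [inner_eq_sum, Fin.sum_univ_succ, phase_zero, setFirst_zero, setFirst_succ]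
    ring
  rw [osc, osc, h1, Complex.ofReal_add, mul_add, Complex.exp_add]
  have h2 : Complex.exp (Complex.I * ((1 - t) * s : ℝ)) *
      Complex.exp (Complex.I * ((character ρ p g.1⁻¹ - 1) * s : ℝ)) =
      Complex.exp (Complex.I * (character ρ p g.1⁻¹ - t : ℝ) * s) := by
    rw [← Complex.exp_add]
    congr 1
    push_cast
    ring
  rw [← h2]
  ring

/-- The amplitude is a superposition of plane waves with frequencies on the orbit. -/
theorem amplitude_eq_wave (x ξ : VR (d + 1)) : γ.amplitude μ f x ξ = wave (-x) ξ *
    ∫ g, f g * (γ.c (γ.pt x g) : ℂ) * wave (kappa p γ.l (γ.pt x g)) ξ ∂μ := by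
  rw [amplitude, wave, inner_neg_left, Complex.ofReal_neg, mul_neg, neg_mul]
  congr 2
  ext g
  rw [wave]
  simp only [pt]
  ring

/-- In the chart, `π(f)` is the pseudodifferential operator with amplitude `a_f`. -/
theorem localOp_eq_oscillatory [μ.IsHaarMeasure] (S : IsAdmissible ρ p μ f univ)
    {u : VR (d + 1) → ℂ} (hu : IsTestFunction γ.tildeU u) (hx : x ∈ γ.tildeU) :
    Integrable (fun ξ : VR (d + 1) => ∫ y : VR (d + 1),
      Complex.exp (Complex.I * (inner ℝ (x - y) ξ : ℝ)) * γ.amplitude μ f x ξ * u y) ∧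
    γ.localOp μ f u x = (((2 * Real.pi) ^ (d + 1))⁻¹ : ℝ) *
      ∫ ξ : VR (d + 1), ∫ y : VR (d + 1),
        Complex.exp (Complex.I * (inner ℝ (x - y) ξ : ℝ)) * γ.amplitude μ f x ξ * u y := by
  have : SFinite μ := sFinite_haar S.algebraic
  have hsmooth : ContDiff ℝ ∞ u := by
    have h : IsTestFunction (γ.tildeU ∩ univ) u := by rwa [inter_univ]
    exact contDiffOn_univ.1 (h.contDiffOn_extend γ.isOpen_tildeU)
  obtain ⟨-, K, hK, hKU, hzero⟩ := hu
  have hcpt : HasCompactSupport u := HasCompactSupport.intro hK hzero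
  have hh : Integrable (fun g => f g * (γ.c (γ.pt x g) : ℂ)) μ := by
    have := integrable_baseAmp (γ := γ) S isBddSmooth_one ⟨hx, mem_univ x⟩
    unfold baseAmp at this
    simpa only [mul_one] using this
  have hθ := (continuous_kappa_pt S.rel γ x).measurable
  -- after the integration over `y` the waves `e^{±i x·ξ}` cancel
  have hinner : ∀ ξ : VR (d + 1), ∫ y : VR (d + 1),
      Complex.exp (Complex.I * (inner ℝ (x - y) ξ : ℝ)) * γ.amplitude μ f x ξ * u y =
      (∫ g, f g * (γ.c (γ.pt x g) : ℂ) * wave (kappa p γ.l (γ.pt x g)) ξ ∂μ) *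
        ∫ y, wave (-y) ξ * u y := by
    intro ξ
    rw [← integral_const_mul]
    congr 1
    ext y
    have h1 : wave x ξ * wave (-x) ξ = 1 := by
      rw [← wave_add, add_neg_cancel, wave, inner_zero_left]
      simp
    change wave (x - y) ξ * γ.amplitude μ f x ξ * u y = _
    rw [amplitude_eq_wave, sub_eq_add_neg, wave_add]
    linear_combination (wave (-y) ξ * (∫ g, f g * (γ.c (γ.pt x g) : ℂ) *
      wave (kappa p γ.l (γ.pt x g)) ξ ∂μ) * u y) * h1
  simp only [hinner]
  refine ⟨integrable_superposition hh hθ hsmooth hcpt, ?_⟩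
  rw [integral_superposition hh hθ hsmooth hcpt, ← mul_assoc, ← Complex.ofReal_mul,
    inv_mul_cancel₀ (by positivity), Complex.ofReal_one, one_mul,
    γ.localOp_eq f μ fun y hy => hzero y fun h => hy (hKU h)]
  simp only [baseAmp, mul_assoc]

end AdaptedChart

/-! ### Totally characteristic operators and their kernels -/

section BOperators

open Filter Topology

/-- The kernel in the variables `x`, `y`, multiplied by a function `φ` of `x`. -/
def bIntegrand (a : VR (d + 1) → VR (d + 1) → ℂ) (φ u : VR (d + 1) → ℂ) (x y : VR (d + 1)) : ℂ :=
  if 0 < x 0 * y 0 then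
    u y * bKernel a x (setFirst (y 0 / x 0) y) * (starRingEnd ℂ) (φ x) * ((|x 0|⁻¹ : ℝ) : ℂ)
  else 0

variable {a : VR (d + 1) → VR (d + 1) → ℂ} {u φ : VR (d + 1) → ℂ} {H : Set (VR (d + 1))}

/-- The substitution `x = (y₁ s, x')` in the definition of the adjoint. -/
theorem mul_conj_bAdjoint {y : VR (d + 1)} (hy : y 0 ≠ 0) :
    u y * (starRingEnd ℂ) (bAdjoint a φ y) = ∫ x, bIntegrand a φ u x y := by
  rw [integral_eq_integral_dilation hy, bAdjoint, map_mul, Complex.conj_ofReal, ← integral_conj,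
    ← integral_indicator (by exact measurableSet_lt measurable_const (continuous_coord 0).measurable),
    ← integral_const_mul, ← integral_const_mul, ← integral_const_mul]
  congr 1
  ext z
  by_cases hz : 0 < z 0
  swap
  · rw [indicator_of_notMem (by exact hz), bIntegrand, if_neg, mul_zero, mul_zero, mul_zero]
    rw [setFirst_zero, mul_right_comm, not_lt]
    exact mul_nonpos_of_nonneg_of_nonpos (mul_self_nonneg _) (not_lt.1 hz)
  rw [indicator_of_mem (by exact hz), bIntegrand, if_pos, bKernel]
  swap
  · rw [setFirst_zero, mul_right_comm]
    exact mul_pos (mul_self_pos.2 hy) hz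
  have h1 : setFirst (y 0 / (setFirst (y 0 * z 0) z : VR (d + 1)) 0) y -
      setFirst 1 (setFirst (y 0 * z 0) z) = setFirst ((z 0)⁻¹ - 1) (y - z) := by
    ext i
    refine Fin.cases ?_ (fun i => ?_) i
    · simp only [PiLp.sub_apply, setFirst_zero]
      field_simp
    · simp
  have h2 : ((|y 0| : ℝ) : ℂ) * ((|(setFirst (y 0 * z 0) z : VR (d + 1)) 0|⁻¹ : ℝ) : ℂ) =
      (((z 0)⁻¹ : ℝ) : ℂ) := by
    rw [← Complex.ofReal_mul, setFirst_zero, abs_mul, abs_of_pos hz, mul_inv,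
      mul_inv_cancel_left₀ (abs_ne_zero.2 hy)]
  rw [h1, map_mul, map_mul, Complex.conj_ofReal, ← integral_conj, ← h2]
  simp only [map_mul, Complex.conj_conj]
  have h3 : ∀ ζ : VR (d + 1), (starRingEnd ℂ) (Complex.exp (Complex.I *
      (inner ℝ (setFirst ((z 0)⁻¹ - 1) (y - z)) ζ : ℝ))) =
      wave (-setFirst ((z 0)⁻¹ - 1) (y - z)) ζ := fun ζ => conj_wave _ ζ
  simp only [h3]
  ring

/-- The substitution `y = (x₁σ₁, σ')`. -/
theorem integral_bIntegrand {x : VR (d + 1)} (hx : x 0 ≠ 0) :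
    ∫ y, bIntegrand a φ u x y = (∫ σ, if 0 < σ 0 then
      u (setFirst (x 0 * σ 0) σ) * bKernel a x σ else 0) * (starRingEnd ℂ) (φ x) := by
  rw [integral_eq_integral_dilation hx, ← integral_const_mul, ← integral_mul_const]
  congr 1
  ext σ
  have h0 : 0 < x 0 * (setFirst (x 0 * σ 0) σ : VR (d + 1)) 0 ↔ 0 < σ 0 := by
    rw [setFirst_zero, ← mul_assoc]
    exact mul_pos_iff_of_pos_left (mul_self_pos.2 hx)
  by_cases hσ : 0 < σ 0
  · rw [bIntegrand, if_pos (h0.2 hσ), if_pos hσ, setFirst_zero, mul_div_cancel_left₀ _ hx,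
      setFirst_setFirst, setFirst_self]
    have : ((|x 0| : ℝ) : ℂ) * ((|x 0|⁻¹ : ℝ) : ℂ) = 1 := by
      rw [← Complex.ofReal_mul, mul_inv_cancel₀ (abs_ne_zero.2 hx), Complex.ofReal_one]
    linear_combination (u (setFirst (x 0 * σ 0) σ) * bKernel a x σ * (starRingEnd ℂ) (φ x)) * this
  · rw [bIntegrand, if_neg (mt h0.1 hσ), if_neg hσ, mul_zero, zero_mul]

/-- A function that is continuous on a measurable set and vanishes off it is measurable. -/
theorem measurable_of_continuousOn {X : Type*} [TopologicalSpace X] [MeasurableSpace X]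
    [OpensMeasurableSpace X] {F : X → ℂ} {s : Set X} (hs : MeasurableSet s)
    (hF : ContinuousOn F s) (h0 : ∀ x ∉ s, F x = 0) : Measurable F := by
  classical
  have h1 : F = s.piecewise F fun _ => 0 := by
    ext x
    by_cases hx : x ∈ s
    · rw [piecewise_eq_of_mem _ _ _ hx]
    · rw [piecewise_eq_of_notMem _ _ _ hx, h0 x hx]
  rw [h1]
  exact hF.measurable_piecewise continuousOn_const hs

theorem IsTestFunction.measurable (hH : IsClosed H) (hu : IsTestFunction H u) : Measurable u := by
  obtain ⟨hs, K, -, hKH, h0⟩ := hu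
  exact measurable_of_continuousOn hH.measurableSet hs.continuousOn fun x hx =>
    h0 x fun h => hx (hKH h)

theorem IsTestFunction.exists_bound (hu : IsTestFunction H u) : ∃ C, 0 ≤ C ∧ ∀ x, ‖u x‖ ≤ C := by
  obtain ⟨hs, K, hK, hKH, h0⟩ := hu
  obtain ⟨C, hC⟩ := hK.exists_bound_of_continuousOn (hs.continuousOn.mono hKH)
  refine ⟨|C|, abs_nonneg _, fun x => ?_⟩
  by_cases hx : x ∈ K
  · exact (hC x hx).trans (le_abs_self _)
  · rw [h0 x hx, norm_zero]
    exact abs_nonneg _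

theorem IsTestFunction.integrable (hH : IsClosed H) (hu : IsTestFunction H u) :
    Integrable u := by
  obtain ⟨C, -, hC⟩ := hu.exists_bound
  have hm := hu.measurable hH
  obtain ⟨hs, K, hK, hKH, h0⟩ := hu
  refine (integrableOn_iff_integrable_of_support_subset (s := K) fun x hx => ?_).1 ?_
  · exact not_not.1 fun h => hx (h0 x h)
  · exact Measure.integrableOn_of_bounded hK.measure_lt_top.ne hm.aestronglyMeasurable
      (Eventually.of_forall hC)

/-- The symbol is only controlled on `H`; the factor `φ`, which vanishes off `H`, makes the kernel
measurable on the whole space. -/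
theorem measurable_conj_mul_bKernel (hH : IsClosed H)
    (ha : ContDiffOn ℝ ∞ (fun z : VR (d + 1) × VR (d + 1) => a z.1 z.2) (H ×ˢ univ))
    (hφ : IsTestFunction H φ) :
    Measurable fun z : VR (d + 1) × VR (d + 1) =>
      bKernel a z.1 z.2 * (starRingEnd ℂ) (φ z.1) := by
  have h1 : Measurable fun z : VR (d + 1) × VR (d + 1) => a z.1 z.2 * (starRingEnd ℂ) (φ z.1) := by
    refine measurable_of_continuousOn (s := H ×ˢ univ) (hH.prod isClosed_univ).measurableSet
      (ha.continuousOn.mul ?_) fun z hz => ?_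
    · exact (Complex.continuous_conj.comp_continuousOn hφ.1.continuousOn).comp
        continuous_fst.continuousOn fun z hz => hz.1
    · obtain ⟨-, K, -, hKH, h0⟩ := hφ
      rw [h0 z.1 fun h => hz ⟨hKH h, mem_univ _⟩, map_zero, mul_zero]
  have hset : Continuous fun x : VR (d + 1) => setFirst 1 x :=
    continuous_setFirst.comp (continuous_const.prodMk continuous_id)
  have h2 : Measurable fun w : (VR (d + 1) × VR (d + 1)) × VR (d + 1) =>
      wave (-(w.1.2 - setFirst 1 w.1.1)) w.2 * (a w.1.1 w.2 * (starRingEnd ℂ) (φ w.1.1)) := by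
    refine Measurable.mul ?_ (h1.comp ((measurable_fst.comp measurable_fst).prodMk measurable_snd))
    refine (continuous_wave.comp (Continuous.prodMk ?_ continuous_snd)).measurable
    exact ((continuous_snd.comp continuous_fst).sub
      (hset.comp (continuous_fst.comp continuous_fst))).neg
  have h3 := (h2.stronglyMeasurable.integral_prod_right' (ν := volume)).measurable.const_mul
    ((((2 * Real.pi) ^ (d + 1))⁻¹ : ℝ) : ℂ)
  convert h3 using 1
  ext z
  rw [bKernel, mul_assoc, ← integral_mul_const]
  simp only [mul_assoc]

theorem measurable_bIntegrand (hH : IsClosed H)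
    (ha : ContDiffOn ℝ ∞ (fun z : VR (d + 1) × VR (d + 1) => a z.1 z.2) (H ×ˢ univ))
    (hu : IsTestFunction H u) (hφ : IsTestFunction H φ) :
    Measurable fun z : VR (d + 1) × VR (d + 1) => bIntegrand a φ u z.1 z.2 := by
  have hc := (continuous_coord (n := d + 1) 0).measurable
  have hx0 : Measurable fun z : VR (d + 1) × VR (d + 1) => z.1 0 := hc.comp measurable_fst
  have hy0 : Measurable fun z : VR (d + 1) × VR (d + 1) => z.2 0 := hc.comp measurable_snd
  refine Measurable.ite (measurableSet_lt measurable_const (hx0.mul hy0)) ?_ measurable_const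
  have hσ : Measurable fun z : VR (d + 1) × VR (d + 1) => setFirst (z.2 0 / z.1 0) z.2 :=
    continuous_setFirst.measurable.comp ((hy0.div hx0).prodMk measurable_snd)
  have h1 := (measurable_conj_mul_bKernel hH ha hφ).comp (measurable_fst.prodMk hσ)
  have h2 := (((hu.measurable hH).comp measurable_snd).mul h1).mul
    (Complex.measurable_ofReal.comp (hx0.abs.inv))
  convert h2 using 1
  ext z
  simp only [Pi.mul_apply, Pi.inv_apply, Function.comp_apply]
  ring

/-- The kernels are bounded in `L¹` uniformly for `x` in the support of `φ`. -/
theorem integrable_bIntegrand (hH : IsClosed H) (ha : ∀ r, IsSymbol r H a)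
    (hu : IsTestFunction H u) (hφ : IsTestFunction H φ) :
    Integrable (fun z : VR (d + 1) × VR (d + 1) => bIntegrand a φ u z.1 z.2)
      (volume.prod volume) := by
  obtain ⟨C, hC0, hC⟩ := hu.exists_bound
  have hφi := hφ.integrable hH
  have hm := (measurable_bIntegrand hH (ha 0).1 hu hφ).aestronglyMeasurable
    (μ := volume.prod volume)
  have hmx : ∀ x, Measurable (bIntegrand a φ u x) := fun x =>
    (measurable_bIntegrand hH (ha 0).1 hu hφ).comp (measurable_const.prodMk measurable_id)
  obtain ⟨-, K, hK, hKH, h0⟩ := hφ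
  obtain ⟨M, hM⟩ := exists_integral_norm_bKernel_le ha hKH hK
  -- after the substitution `y = (x₁σ₁, σ')` the factor `|x₁|⁻¹` cancels
  have hkey : ∀ x : VR (d + 1), x 0 ≠ 0 → Integrable (bIntegrand a φ u x) ∧
      ∫ y, ‖bIntegrand a φ u x y‖ ≤ C * |M| * ‖φ x‖ := by
    intro x hx
    by_cases hxK : x ∈ K
    swap
    · have : bIntegrand a φ u x = fun _ => 0 := by
        ext y
        simp [bIntegrand, h0 x hxK]
      rw [this]
      simpa using mul_nonneg (mul_nonneg hC0 (abs_nonneg M)) (norm_nonneg (φ x))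
    obtain ⟨hk, hkM⟩ := hM x hxK
    have hle : ∀ σ : VR (d + 1), ‖bIntegrand a φ u x (setFirst (x 0 * σ 0) σ)‖ ≤
        |x 0|⁻¹ * (C * ‖bKernel a x σ‖ * ‖φ x‖) := by
      intro σ
      rw [bIntegrand]
      split_ifs
      · rw [setFirst_zero, mul_div_cancel_left₀ _ hx, setFirst_setFirst, setFirst_self, norm_mul,
          norm_mul, norm_mul, RCLike.norm_conj, Complex.norm_real, norm_inv, Real.norm_eq_abs,
          abs_abs, mul_comm]
        gcongr
        exact hC _
      · rw [norm_zero]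
        positivity
    have hint : Integrable fun σ => |x 0|⁻¹ * (C * ‖bKernel a x σ‖ * ‖φ x‖) :=
      ((hk.norm.const_mul C).mul_const _).const_mul _
    have hcd : Integrable fun σ => bIntegrand a φ u x (setFirst (x 0 * σ 0) σ) := by
      refine hint.mono' ?_ (Eventually.of_forall hle)
      have h1 : Continuous fun σ : VR (d + 1) => setFirst (x 0 * σ 0) σ :=
        continuous_setFirst.comp ((continuous_const.mul (continuous_coord 0)).prodMk continuous_id)
      exact ((hmx x).comp h1.measurable).aestronglyMeasurable
    refine ⟨(integrable_comp_dilation hx).1 hcd, ?_⟩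
    have h3 := integral_eq_integral_dilation hx fun y => ((‖bIntegrand a φ u x y‖ : ℝ) : ℂ)
    rw [integral_complex_ofReal, integral_complex_ofReal, ← Complex.ofReal_mul,
      Complex.ofReal_inj] at h3
    rw [h3]
    calc _ ≤ |x 0| * ∫ σ, |x 0|⁻¹ * (C * ‖bKernel a x σ‖ * ‖φ x‖) := by
          gcongr
          · exact hcd.norm
          · exact hle
      _ = C * (∫ σ, ‖bKernel a x σ‖) * ‖φ x‖ := by
          rw [integral_const_mul, integral_mul_const, integral_const_mul,
            mul_inv_cancel_left₀ (abs_ne_zero.2 hx)]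
      _ ≤ _ := by
          gcongr
          exact hkM.trans (le_abs_self M)
  refine (integrable_prod_iff hm).2 ⟨?_, ?_⟩
  · filter_upwards [ae_coord_zero_ne_zero] with x hx using (hkey x hx).1
  · refine (hφi.norm.const_mul (C * |M|)).mono' hm.norm.integral_prod_right' ?_
    filter_upwards [ae_coord_zero_ne_zero] with x hx
    rw [Real.norm_of_nonneg (integral_nonneg fun _ => norm_nonneg _)]
    exact (hkey x hx).2

/-- An operator which away from `{x₁ = 0}` is given by the kernel of a symbol of order `-∞` is the
totally characteristic operator with this symbol: the double integral of `bIntegrand` is the pairing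
of `B u` with `φ` in one order of integration, and of `u` with the adjoint in the other. -/
theorem isBOperator_of_kernel {ε : ℝ} {B : (VR (d + 1) → ℂ) → VR (d + 1) → ℂ}
    (ha : ∀ r, IsSymbol r (halfSpace ε) a)
    (hB : ∀ u, IsTestFunction (halfSpace ε) u → ∀ x ∈ halfSpace ε, x 0 ≠ 0 →
      B u x = ∫ σ, if 0 < σ 0 then u (setFirst (x 0 * σ 0) σ) * bKernel a x σ else 0) :
    IsBOperator ε a B := by
  intro u φ hu hφ
  have hH : IsClosed (halfSpace ε : Set (VR (d + 1))) :=
    isClosed_le continuous_const (continuous_const.mul (continuous_coord 0))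
  have hoff : ∀ {w : VR (d + 1) → ℂ}, IsTestFunction (halfSpace ε) w → ∀ x ∉ halfSpace ε,
      w x = 0 := by
    rintro w ⟨-, K, -, hKH, h0⟩ x hx
    exact h0 x fun h => hx (hKH h)
  rw [setIntegral_eq_integral_of_forall_compl_eq_zero fun x hx => by
      rw [hoff hφ x hx, map_zero, mul_zero],
    setIntegral_eq_integral_of_forall_compl_eq_zero fun y hy => by rw [hoff hu y hy, zero_mul]]
  calc _ = ∫ x, ∫ y, bIntegrand a φ u x y := by
        refine integral_congr_ae ?_
        filter_upwards [ae_coord_zero_ne_zero] with x hx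
        rw [integral_bIntegrand hx]
        by_cases hxH : x ∈ halfSpace ε
        · rw [hB u hu x hxH hx]
        · rw [hoff hφ x hxH, map_zero, mul_zero, mul_zero]
    _ = ∫ y, ∫ x, bIntegrand a φ u x y :=
        integral_integral_swap (f := bIntegrand a φ u) (integrable_bIntegrand hH ha hu hφ)
    _ = _ := by
        refine integral_congr_ae ?_
        filter_upwards [ae_coord_zero_ne_zero] with y hy
        rw [mul_conj_bAdjoint hy]

end BOperators

/-! ### The localized operators -/

section Extension

open Filter Topology

variable {O H K : Set (VR n)} {a : VR n → VR n → ℂ} {r : ℝ}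

/-- A symbol that vanishes for `x` outside a compact set extends by zero. -/
theorem IsSymbol.extend (ha : IsSymbol r (O ∩ H) a) (hO : IsOpen O) (hK : IsCompact K)
    (hKW : K ⊆ O ∩ H) (h0 : ∀ x ∉ K, ∀ ξ, a x ξ = 0) : IsSymbol r H a := by
  have hzero : ∀ x ∉ K, ∀ᶠ y in 𝓝 x, ∀ ξ, a y ξ = 0 := fun x hx => by
    filter_upwards [hK.isClosed.isOpen_compl.mem_nhds hx] with y hy using h0 y hy
  constructor
  · rintro ⟨x, ξ⟩ ⟨hx, -⟩
    by_cases hxK : x ∈ K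
    · refine (ha.1 (x, ξ) ⟨hKW hxK, mem_univ _⟩).mono_of_mem_nhdsWithin ?_
      have h1 : O ×ˢ univ ∈ 𝓝 (x, ξ) :=
        (hO.prod isOpen_univ).mem_nhds ⟨(hKW hxK).1, mem_univ _⟩
      filter_upwards [mem_nhdsWithin_of_mem_nhds h1, self_mem_nhdsWithin] with z hz hz'
      exact ⟨⟨hz.1, hz'.1⟩, mem_univ _⟩
    · refine ContDiffAt.contDiffWithinAt (contDiffAt_const (c := (0 : ℂ)).congr_of_eventuallyEq ?_)
      exact (continuous_fst.tendsto (x, ξ)).eventually ((hzero x hxK).mono fun y hy => hy) |>.mono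
        fun z hz => hz z.2
  · intro k j L _ hL
    obtain ⟨C, hC⟩ := ha.2 k j (L ∩ K) (inter_subset_right.trans hKW) (hL.inter_right hK.isClosed)
    refine ⟨|C|, fun x hx ξ => ?_⟩
    by_cases hxK : x ∈ K
    · have h1 := hC x ⟨hx, hxK⟩ ξ
      have h2 : ∀ η, iteratedFDerivWithin ℝ j (fun y => a y η) (O ∩ H) x =
          iteratedFDerivWithin ℝ j (fun y => a y η) H x := fun η => by
        rw [inter_comm, iteratedFDerivWithin_inter_open hO (hKW hxK).1]
      simp only [h2] at h1
      refine h1.trans ?_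
      gcongr
      exact le_abs_self C
    · have h2 : ∀ η, iteratedFDerivWithin ℝ j (fun y => a y η) H x = 0 := fun η =>
        iteratedFDerivWithin_eq_zero hK (fun y hy => h0 y hy η) hxK j
      simp only [h2]
      rw [show (fun _ : VR n => (0 : ContinuousMultilinearMap ℝ (fun _ : Fin j => VR n) ℂ)) = 0
        from rfl, iteratedFDeriv_zero, Pi.zero_apply, norm_zero]
      positivity

end Extension

section Cutoff

open Filter Topology

/-- The functions that cut off the half space `σ₁ > 0`. -/
def stepFun (k : ℕ) (s : ℝ) : ℝ := Real.smoothTransition ((k + 1) * s - 1)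

theorem contDiff_stepFun (k : ℕ) : ContDiff ℝ ∞ (stepFun k) :=
  Real.smoothTransition.contDiff.comp (by fun_prop)

theorem norm_stepFun_le (k : ℕ) (s : ℝ) : ‖(stepFun k s : ℂ)‖ ≤ 1 := by
  rw [Complex.norm_real, stepFun,
    Real.norm_of_nonneg (Real.smoothTransition.nonneg _)]
  exact Real.smoothTransition.le_one _

theorem stepFun_eq_zero {k : ℕ} {s : ℝ} (hs : (k + 1) * s ≤ 1) : stepFun k s = 0 :=
  Real.smoothTransition.zero_of_nonpos (by linarith)

theorem tendsto_stepFun_mul (s : ℝ) (z : ℂ) :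
    Tendsto (fun k : ℕ => (stepFun k s : ℂ) * z) atTop (𝓝 (if 0 < s then z else 0)) := by
  split_ifs with hs
  · refine tendsto_const_nhds.congr' ?_
    obtain ⟨N, hN⟩ := exists_nat_ge (2 / s)
    filter_upwards [eventually_ge_atTop N] with k hk
    have h1 : 2 / s ≤ k := hN.trans (by exact_mod_cast hk)
    rw [div_le_iff₀ hs] at h1
    rw [stepFun, Real.smoothTransition.one_of_one_le (by nlinarith), Complex.ofReal_one, one_mul]
  · refine tendsto_const_nhds.congr fun k => ?_
    have : (0 : ℝ) ≤ k := Nat.cast_nonneg k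
    rw [stepFun_eq_zero (by nlinarith), Complex.ofReal_zero, zero_mul]

variable {u : VR (d + 1) → ℂ} {ε : ℝ} {x : VR (d + 1)}

/-- The test function `u` is smooth on the half space, whose interior contains `(x₁σ₁, σ')` for `σ₁
> 0`; near the remaining points the step function vanishes. -/
theorem contDiff_stepFun_mul (hu : IsTestFunction (halfSpace ε) u) (hx : x ∈ halfSpace ε)
    (hε : ε ≠ 0) (hx0 : x 0 ≠ 0) (k : ℕ) :
    ContDiff ℝ ∞ fun σ : VR (d + 1) => (stepFun k (σ 0) : ℂ) * u (setFirst (x 0 * σ 0) σ) := by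
  rw [contDiff_iff_contDiffAt]
  intro σ
  by_cases hσ : 0 < σ 0
  · have h1 : ContDiffAt ℝ ∞ u (setFirst (x 0 * σ 0) σ) := by
      refine hu.1.contDiffAt ?_
      have hcont : Continuous fun x : VR (d + 1) => ε * x 0 :=
        continuous_const.mul (continuous_coord 0)
      have hpos : 0 < ε * x 0 := lt_of_le_of_ne hx (mul_ne_zero hε hx0).symm
      have hmem : setFirst (x 0 * σ 0) σ ∈ {y : VR (d + 1) | 0 < ε * y 0} := by
        rw [mem_ofPred_eq, setFirst_zero, ← mul_assoc]
        exact mul_pos hpos hσ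
      filter_upwards [(isOpen_lt continuous_const hcont).mem_nhds hmem] with y hy
      exact le_of_lt hy
    have h2 : ContDiff ℝ ∞ fun σ : VR (d + 1) => setFirst (x 0 * σ 0) σ := by
      simp only [← dilation_apply]
      exact (LinearMap.toContinuousLinearMap (dilation (x 0))).contDiff
    exact (Complex.ofRealCLM.contDiff.comp
      ((contDiff_stepFun k).comp (contDiff_coord 0))).contDiffAt.mul
      (h1.comp (f := fun σ : VR (d + 1) => setFirst (x 0 * σ 0) σ) σ h2.contDiffAt)
  · refine contDiffAt_const (c := (0 : ℂ)).congr_of_eventuallyEq ?_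
    have h1 : {τ : VR (d + 1) | (k + 1) * τ 0 < 1} ∈ 𝓝 σ := by
      refine (isOpen_lt (continuous_const.mul (continuous_coord 0)) continuous_const).mem_nhds ?_
      have : (0 : ℝ) ≤ k := Nat.cast_nonneg k
      change (k + 1) * σ 0 < 1
      nlinarith
    filter_upwards [h1] with τ hτ
    rw [stepFun_eq_zero (le_of_lt hτ), Complex.ofReal_zero, zero_mul]

theorem hasCompactSupport_stepFun_mul (hu : IsTestFunction (halfSpace ε) u) (hx0 : x 0 ≠ 0)
    (k : ℕ) : HasCompactSupport
      fun σ : VR (d + 1) => (stepFun k (σ 0) : ℂ) * u (setFirst (x 0 * σ 0) σ) := by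
  obtain ⟨-, K, hK, -, h0⟩ := hu
  have h1 : HasCompactSupport (u ∘ dilationHomeomorph hx0) :=
    (HasCompactSupport.intro hK h0).comp_homeomorph _
  have h2 : HasCompactSupport fun σ : VR (d + 1) => u (setFirst (x 0 * σ 0) σ) := by
    simp only [← dilation_apply]
    exact h1
  exact h2.mul_left

end Cutoff

namespace AdaptedChart

open Filter Topology

variable {GC : Subgroup (GL (Fin m) ℂ)} {ρ : GC →* GL (Fin (d + 1)) ℂ}
  {p : MvPolynomial (Fin (d + 1)) ℝ} {γ : AdaptedChart ρ p} [MeasurableSpace (G0 GC)]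
  [BorelSpace (G0 GC)] {μ : Measure (G0 GC)} {f : G0 GC → ℂ} {ε : ℝ}
  {T : (VR (d + 1) → ℂ) → VR (d + 1) → G0 GC → ℂ} {ψ : VR (d + 1) → ℂ}

/-- The kernel of an oscillatory integral, integrated against a test function, concentrates on
the orbit map. -/
theorem IsAmp.integral_mul_bKernel [μ.IsHaarMeasure] (hε : ε ≠ 0)
    (S : IsAdmissible ρ p μ f (halfSpace ε))
    (hT : γ.IsAmp f (halfSpace ε) T) (hψ : IsBddSmooth (halfSpace ε) ψ)
    {u : VR (d + 1) → ℂ} (hu : IsTestFunction (halfSpace ε) u) {x : VR (d + 1)}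
    (hx : x ∈ γ.tildeU ∩ halfSpace ε) (hx0 : x 0 ≠ 0) :
    (∫ σ, if 0 < σ 0 then u (setFirst (x 0 * σ 0) σ) * bKernel (γ.oscInt μ T ψ) x σ else 0) =
      ∫ g, T ψ x g * u (kappa p γ.l (γ.pt x g)) ∂μ := by
  have : SFinite μ := sFinite_haar S.algebraic
  have hsym := fun r => hT.isSymbol S hψ r
  have hh : Integrable (T ψ x) μ := by
    simpa [osc] using hT.integrable S hψ hx 0
  have hθ : Measurable fun g : G0 GC =>
      setFirst (character ρ p g.1⁻¹) (kappa p γ.l (γ.pt x g)) :=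
    (continuous_setFirst.comp ((continuous_character_inv S.rel).prodMk
      (continuous_kappa_pt S.rel γ x))).measurable
  -- up to the wave `e^{i(1, x')·ζ}`, the oscillatory integral is a superposition of waves with
  -- frequencies `(χ(g⁻¹), (g⁻¹v)_l)`
  have hwave : ∀ ζ, ∫ g, T ψ x g *
      wave (setFirst (character ρ p g.1⁻¹) (kappa p γ.l (γ.pt x g))) ζ ∂μ =
      wave (setFirst 1 x) ζ * γ.oscInt μ T ψ x ζ := by
    intro ζ
    rw [oscInt, ← integral_const_mul]
    congr 1
    ext g
    rw [show γ.osc x ζ g = wave (γ.phase x g) ζ from rfl, mul_left_comm, ← wave_add, phase,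
      add_sub_cancel]
  have hint : Integrable fun ζ => ∫ g, T ψ x g *
      wave (setFirst (character ρ p g.1⁻¹) (kappa p γ.l (γ.pt x g))) ζ ∂μ := by
    simp only [hwave]
    refine (integrable_symbol hsym hx).bdd_mul (c := 1) ?_
      (Eventually.of_forall fun ζ => (norm_wave _ _).le)
    exact (continuous_wave.comp (continuous_const.prodMk continuous_id)).aestronglyMeasurable
  have hker : ∀ F : VR (d + 1) → ℂ, ContDiff ℝ ∞ F → HasCompactSupport F →
      ∫ σ, F σ * bKernel (γ.oscInt μ T ψ) x σ = ∫ g, T ψ x g *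
        F (setFirst (character ρ p g.1⁻¹) (kappa p γ.l (γ.pt x g))) ∂μ := by
    intro F hF hFc
    have h1 := integral_mul_integral_superposition hh hθ hF hFc hint
    have h2 : ∀ σ, F σ * bKernel (γ.oscInt μ T ψ) x σ = (((2 * Real.pi) ^ (d + 1))⁻¹ : ℝ) *
        (F σ * ∫ ξ, wave (-σ) ξ * ∫ g, T ψ x g *
          wave (setFirst (character ρ p g.1⁻¹) (kappa p γ.l (γ.pt x g))) ξ ∂μ) := by
      intro σ
      rw [bKernel, mul_left_comm]
      congr 3
      ext ζ
      rw [hwave, ← mul_assoc, ← wave_add]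
      congr 2
      abel
    simp only [h2]
    rw [integral_const_mul, h1, ← mul_assoc, ← Complex.ofReal_mul, inv_mul_cancel₀ (by positivity),
      Complex.ofReal_one, one_mul]
  obtain ⟨C, hC0, hC⟩ := hu.exists_bound
  obtain ⟨M, hM⟩ := exists_integral_norm_bKernel_le hsym (singleton_subset_iff.2 hx)
    isCompact_singleton
  have hkint := (hM x rfl).1
  have hFsmooth := contDiff_stepFun_mul hu hx.2 hε hx0
  have hbound : ∀ (k : ℕ) (σ : VR (d + 1)),
      ‖(stepFun k (σ 0) : ℂ) * u (setFirst (x 0 * σ 0) σ)‖ ≤ C := fun k σ => by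
    rw [norm_mul]
    exact (mul_le_of_le_one_left (norm_nonneg _) (norm_stepFun_le k _)).trans (hC _)
  -- the step functions approximate the indicator function of `σ₁ > 0` in both integrals; in the
  -- second one `σ₁ = χ(g⁻¹)` is positive
  have hlim1 : Tendsto (fun k : ℕ => ∫ σ, ((stepFun k (σ 0) : ℂ) * u (setFirst (x 0 * σ 0) σ)) *
      bKernel (γ.oscInt μ T ψ) x σ) atTop (𝓝 (∫ σ, if 0 < σ 0 then
        u (setFirst (x 0 * σ 0) σ) * bKernel (γ.oscInt μ T ψ) x σ else 0)) := by
    refine tendsto_integral_of_dominated_convergence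
      (fun σ => C * ‖bKernel (γ.oscInt μ T ψ) x σ‖) (fun k => ?_) (hkint.norm.const_mul C)
      (fun k => Eventually.of_forall fun σ => ?_) (Eventually.of_forall fun σ => ?_)
    · exact (hFsmooth k).continuous.aestronglyMeasurable.mul hkint.aestronglyMeasurable
    · rw [norm_mul]
      exact mul_le_mul_of_nonneg_right (hbound k σ) (norm_nonneg _)
    · simp only [mul_assoc]
      exact tendsto_stepFun_mul _ _
  have hpt : ∀ g, setFirst (x 0 * character ρ p g.1⁻¹) (kappa p γ.l (γ.pt x g)) =
      kappa p γ.l (γ.pt x g) := fun g => by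
    rw [mul_comm, ← γ.kappa_pt_zero S.rel hx.1 g, setFirst_self]
  have hlim2 : Tendsto (fun k : ℕ => ∫ g, T ψ x g * ((stepFun k (character ρ p g.1⁻¹) : ℂ) *
      u (kappa p γ.l (γ.pt x g))) ∂μ) atTop
      (𝓝 (∫ g, T ψ x g * u (kappa p γ.l (γ.pt x g)) ∂μ)) := by
    refine tendsto_integral_of_dominated_convergence (fun g => C * ‖T ψ x g‖) (fun k => ?_)
      (hh.norm.const_mul C) (fun k => Eventually.of_forall fun g => ?_)
      (Eventually.of_forall fun g => ?_)
    · refine hh.aestronglyMeasurable.mul ?_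
      have h1 := (hFsmooth k).continuous.measurable.comp hθ
      refine Measurable.aestronglyMeasurable ?_
      convert h1 using 1
      ext g
      simp only [Function.comp_apply, setFirst_zero, setFirst_setFirst, hpt]
    · rw [norm_mul, mul_comm]
      have h1 := hbound k (setFirst (character ρ p g.1⁻¹) (kappa p γ.l (γ.pt x g)))
      rw [setFirst_zero, setFirst_setFirst, hpt] at h1
      exact mul_le_mul_of_nonneg_right h1 (norm_nonneg _)
    · have h1 := tendsto_stepFun_mul (character ρ p g.1⁻¹) (u (kappa p γ.l (γ.pt x g)))
      rw [if_pos (S.rel.character_inv_pos g)] at h1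
      exact h1.const_mul _
  refine tendsto_nhds_unique hlim1 (hlim2.congr fun k => ?_)
  rw [hker _ (hFsmooth k) (hasCompactSupport_stepFun_mul hu hx0 k)]
  simp only [setFirst_zero, setFirst_setFirst, hpt]

/-- The symbol of `v A_f w` is the oscillatory integral of the amplitude `v(x) f(g) c(g⁻¹v)
w(κ(g⁻¹v))`, extended by zero. -/
theorem isTotallyCharacteristicSmoothing_localOp [μ.IsHaarMeasure] (hε : ε ≠ 0)
    (S : IsAdmissible ρ p μ f (halfSpace ε)) :
    IsTotallyCharacteristicSmoothing ε (γ.tildeU ∩ halfSpace ε) (γ.localOp μ f) := by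
  refine ⟨isContinuousOperator_localOp S, fun v w hv hw => ?_⟩
  have hT : γ.IsAmp f (halfSpace ε) fun ψ x g => v x * γ.baseAmp f ψ x g :=
    IsAmp.coeff v hv.1 _ (γ.isAmp_baseAmp f _)
  have hψ : IsBddSmooth (halfSpace ε) w := hw.isBddSmooth γ.isOpen_tildeU S.side.uniqueDiffOn
  obtain ⟨-, K, hK, hKW, hv0⟩ := hv
  have hw0 : ∀ x ∉ γ.tildeU, w x = 0 := by
    obtain ⟨-, L, -, hLW, h0⟩ := hw
    exact fun x hx => h0 x fun h => hx (hLW h).1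
  have ha0 : ∀ x ∉ K, ∀ ζ, γ.oscInt μ (fun ψ x g => v x * γ.baseAmp f ψ x g) w x ζ = 0 := by
    intro x hx ζ
    simp [oscInt, hv0 x hx]
  have hsym := fun r => (hT.isSymbol (μ := μ) S hψ r).extend γ.isOpen_tildeU hK hKW ha0
  refine ⟨γ.oscInt μ (fun ψ x g => v x * γ.baseAmp f ψ x g) w, ⟨hsym, fun x hx ξ t ht => ?_⟩,
    isBOperator_of_kernel hsym fun u hu x hx hx0 => ?_⟩
  · by_cases hxK : x ∈ K
    · exact hT.isLacunary S hψ x (hKW hxK) ξ t ht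
    · simp [ha0 x hxK]
  · by_cases hxK : x ∈ K
    · rw [hT.integral_mul_bKernel hε S hψ hu (hKW hxK) hx0,
        γ.localOp_eq f μ (fun y hy => by rw [hw0 y hy, zero_mul]), ← integral_const_mul]
      simp only [baseAmp, mul_assoc]
    · rw [hv0 x hxK, zero_mul]
      simp [bKernel, ha0 x hxK]

end AdaptedChart

end PHV

end

theorem theorem6p1 {m d : ℕ} (GC : Subgroup (GL (Fin m) ℂ)) (ρ : GC →* GL (Fin (d + 1)) ℂ)
    (hPV : PHV.IsReductivePHV GC ρ)
    (hSC : PHV.IsIrreducibleHypersurface ℂ (PHV.singularSet ρ))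
    (p : MvPolynomial (Fin (d + 1)) ℝ)
    (hp : Irreducible (MvPolynomial.map (algebraMap ℝ ℂ) p))
    (hpS : PHV.singularSet ρ =
      {v | MvPolynomial.eval v (MvPolynomial.map (algebraMap ℝ ℂ) p) = 0})
    (hSR : PHV.IsIrreducibleHypersurface ℝ (PHV.realSingularSet ρ))
    (hframes : PHV.HasLocalFrames ρ p)
    [MeasurableSpace (PHV.G0 GC)] [BorelSpace (PHV.G0 GC)]
    (μ : MeasureTheory.Measure (PHV.G0 GC)) [μ.IsHaarMeasure] :
    -- `p` is a relative invariant with character `χ`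
    (∀ (g : PHV.realPoints GC) (v : PHV.VR (d + 1)),
      PHV.pfun p (PHV.act ρ g v) = PHV.character ρ p g * PHV.pfun p v) ∧
    -- the charts cover `V_ℝ - S_ℝ^sing`
    (∀ v ∈ PHV.regularDomain ρ, ∃ γ : PHV.AdaptedChart ρ p, v ∈ γ.U) ∧
    ∀ (γ : PHV.AdaptedChart ρ p) (f : PHV.G0 GC → ℂ), PHV.IsRapidlyDecreasing μ f →
      -- `a(x, ξ) = ã(x, x₁ξ₁, ξ')`, and `ã` is a lacunary symbol of order `-∞`
      (∀ x ∈ γ.tildeU, ∀ ξ : PHV.VR (d + 1),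
        γ.amplitude μ f x ξ = γ.symbol μ f x (PHV.setFirst (x 0 * ξ 0) ξ)) ∧
      PHV.IsLacunarySmoothingSymbol γ.tildeU (γ.symbol μ f) ∧
      -- in the chart, `π(f)` is the operator with amplitude `a`
      (∀ u : PHV.VR (d + 1) → ℂ, PHV.IsTestFunction γ.tildeU u → ∀ x ∈ γ.tildeU,
        MeasureTheory.Integrable (fun ξ : PHV.VR (d + 1) => ∫ y : PHV.VR (d + 1),
          Complex.exp (Complex.I * (inner ℝ (x - y) ξ : ℝ)) * γ.amplitude μ f x ξ * u y) ∧
        γ.localOp μ f u x = (((2 * Real.pi) ^ (d + 1))⁻¹ : ℝ) *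
          ∫ ξ : PHV.VR (d + 1), ∫ y : PHV.VR (d + 1),
            Complex.exp (Complex.I * (inner ℝ (x - y) ξ : ℝ)) * γ.amplitude μ f x ξ * u y) ∧
      -- it restricts to totally characteristic operators on both sides of the hypersurface
      ∀ ε : ℝ, ε = 1 ∨ ε = -1 →
        (∀ u : PHV.VR (d + 1) → ℂ, PHV.IsTestFunction γ.tildeU u → ∀ x ∈ γ.tildeUSide ε,
          γ.localOp μ f u x = γ.localOp μ f ((γ.tildeUSide ε).indicator u) x) ∧
        PHV.IsTotallyCharacteristicSmoothing ε (γ.tildeUSide ε) (γ.localOp μ f) := by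
  have hmap := PHV.pfun_act hPV.rational hp hpS
  have hrel : PHV.IsRelInvariant ρ p := ⟨hPV.rational, PHV.exists_pfun_ne_zero hp, hmap⟩
  obtain ⟨X, hX⟩ := PHV.exists_deriv_character_ne_zero hPV hp hpS
  rw [(hrel.hasDerivAt_character X).deriv] at hX
  refine ⟨hmap, fun v hv => PHV.exists_adaptedChart hframes hv, fun γ f hf => ?_⟩
  have S {H : Set (PHV.VR (d + 1))} (hH : PHV.IsSide H) :
      PHV.AdaptedChart.IsAdmissible ρ p μ f H := ⟨hPV.algebraic, hrel, ⟨X, hX⟩, hH, hf⟩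
  have hamp := γ.isAmp_baseAmp f univ
  have hsymbol : γ.symbol μ f = γ.oscInt μ (γ.baseAmp f) fun _ => 1 :=
    funext₂ fun x ξ => γ.symbol_eq_oscInt f μ x ξ
  refine ⟨fun x hx ξ => γ.amplitude_eq_symbol f μ hrel hx ξ, ⟨fun r => ?_, ?_⟩,
    fun u hu x hx => PHV.AdaptedChart.localOp_eq_oscillatory (S PHV.isSide_univ) hu hx,
    fun ε hε => ⟨fun u _ x hx => γ.localOp_indicator f μ hrel ε u hx, ?_⟩⟩
  · have h := hamp.isSymbol (μ := μ) (S PHV.isSide_univ) PHV.isBddSmooth_one r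
    rwa [inter_univ, ← hsymbol] at h
  · have h := hamp.isLacunary (μ := μ) (S PHV.isSide_univ) PHV.isBddSmooth_one
    rwa [inter_univ, ← hsymbol] at h
  · exact PHV.AdaptedChart.isTotallyCharacteristicSmoothing_localOp
      (by rcases hε with rfl | rfl <;> norm_num) (S (PHV.isSide_halfSpace hε))
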